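/- **Setting.** Let $0<s_0<1$, $0<\kappa_0\le\frac1{10}$, $c_0>0$, $K>1$, $K_1>1$ and $k_M\in\mathbb N$. Let $u,\theta$ be smooth real functions on $[0,1]$ such that $u'\ge c_0$ and $\theta\ge c_0$; $\operatorname{supp}u''$ and $\operatorname{supp}\theta'$ are contained in $[4\kappa_0,1-4\kappa_0]$ (extend $u''$ and $\theta'$ by zero, i.e. $u$ affinely and $\theta$ constantly near each end, to $\mathbb R$); for all integers $m\ge0$, $$\sup_{y\in\mathbb R}\Big|\frac{d^m\theta'}{dy^m}(y)\Big|+\sup_{y\in\mathbb R}\Big|\frac{d^mu''}{dy^m}(y)\Big|\le K^m(m!)^{1/s_0}(m+1)^{-2};$$ and, for every integer $k\neq0$, the operator $\mathcal R_{u,k}=u\,\mathrm{Id}-\varphi_1\tilde\Delta_k^{-1}$ on $L^2(0,1)$ has no eigenvalue $c\in\mathbb C$, neither outside the range of $u$ nor embedded in it. Here $\varphi_1=(u'/\theta)'$ and $\tilde\Delta_k\psi=(\psi'/\theta)'-\frac{k^2}{\theta}\psi$ with $\psi(0)=\psi(1)=0$. Let $\chi_2$ be a smooth real cut-off function with $\operatorname{supp}\chi_2\subset[\frac{\kappa_0}2,1-\frac{\kappa_0}2]$,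 $\chi_2=1$ on $[\kappa_0,1-\kappa_0]$ and $\sup|\chi_2^{(m)}|\le K_1^m(m!)^{2/(s_0+1)}(m+1)^{-2}$ for all $m\ge0$. For $k\ne0$ and $y'\in[0,1]$ let $\phi_1(\cdot,y',k)$ be the continuous solution on $[0,1]$ of $$\phi_1(y,y',k)=1+\int_{y'}^y\frac{k^2\theta(z')}{(u(z')-u(y'))^2}\int_{y'}^{z'}\frac{(u(z'')-u(y'))^2}{\theta(z'')}\phi_1(z'',y',k)\,dz''dz',$$ let $\phi(y,y',k)=(u(y)-u(y'))\phi_1(y,y',k)$ and $$e(y,y',k)=\phi(y,y',k)\int_0^y\frac{\theta(z)}{\phi(z,y',k)^2}dz\ \ (y<y'),\qquad e(y,y',k)=\phi(y,y',k)\int_1^y\frac{\theta(z)}{\phi(z,y',k)^2}dz\ \ (y>y').$$ Put $\rho(y')=(u(y')-u(0))(u(1)-u(y'))$, $J_2=-\rho\,\frac{\theta^2}{(u')^3}\varphi_1$, $$\begin{aligned}J_1(y',k)={}&-(u(1)-u(y'))\frac{\theta(0)}{u'(0)}-(u(y')-u(0))\frac{\theta(1)}{u'(1)}+\rho(y')\int_0^1\frac{\theta(z)}{(u(z)-u(y'))^2}\Big(\frac1{\phi_1(z,y',k)^2}-1\Big)dz\\&+\rho(y')\,\mathrm{p.v.}\!\int_0^1\frac{1}{u(z)-u(y')}\Big(\frac{\theta}{u'}\Big)'(z)\,dz,\end{aligned}$$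 $$b_1=\frac{J_1}{\sqrt{J_1^2+\pi^2J_2^2}},\qquad b_2=-\frac{\rho\,\theta/u'}{\sqrt{J_1^2+\pi^2J_2^2}}.$$ Let $B_j(v,k)=b_j(u^{-1}(v),k)$, $E(v,v',k)=e(u^{-1}(v),u^{-1}(v'),k)$, $\widetilde{\varphi_1}=\varphi_1\circ u^{-1}$, $\tilde\chi_2=\chi_2\circ u^{-1}$ (equal to $0$ outside $[u(0),u(1)]$). For $t\in\mathbb R$ and functions $g$ of $v$ define $$\mathbf D_{u,k}g(v)=B_1(v,k)g(v)+\widetilde{\varphi_1}(v)B_2(v,k)\,\mathrm{p.v.}\!\int_{u(0)}^{u(1)}E(v_1,v,k)\frac{g(v_1)e^{-i(v_1-v)tk}}{v_1-v}(u^{-1})'(v_1)\,dv_1,$$ $$\mathbf D^1_{u,k}g(v)=B_1(v,k)g(v)+B_2(v,k)\,\mathrm{p.v.}\!\int_{u(0)}^{u(1)}E(v_1,v,k)\frac{\widetilde{\varphi_1}(v_1)g(v_1)e^{-i(v_1-v)tk}}{v_1-v}(u^{-1})'(v)\,dv_1.$$ For a function $f(t,z,v)$ that, for each $t$, is Schwartz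 on $\mathbb T\times\mathbb R$ ($\mathbb T=\mathbb R/2\pi\mathbb Z$) write $\mathcal F_1f(t,k,v)=\frac1{2\pi}\int_{\mathbb T}f(t,z,v)e^{-izk}dz$, $\mathcal F_2g(\xi)=\int_{\mathbb R}g(v)e^{-iv\xi}dv$ and $\hat f_k(t,\cdot)=\mathcal F_2\mathcal F_1f(t,k,\cdot)$. **Statement.** There is $\lambda_{\mathcal D}>0$, depending only on $s_0,\kappa_0,c_0,K,K_1,k_M$, such that for all $u,\theta,\chi_2$ as above there are a function $\mathcal D^{com}(t,k,\xi,\xi_1)$ and a constant $C$, independent of $t,k,\xi,\xi_1$, with the following properties for all $t\in\mathbb R$, all integers $k$ with $0<|k|\le k_M$ and all $\xi,\xi_1\in\mathbb R$. For every $f$ as above (the same $\mathcal D^{com}$ serving all $f$), the function $\tilde\chi_2\mathbf D_{u,k}(\tilde\chi_2\mathcal F_1f)-\tilde\chi_2\mathbf D^1_{u,k}(\tilde\chi_2\mathcal F_1f)$ and the integrand on the right-hand side below are integrable, and $$\mathcal F_2\Big(\tilde\chi_2\mathbf D_{u,k}(\tilde\chi_2\mathcal F_1f)-\tilde\chi_2\mathbf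 D^1_{u,k}(\tilde\chi_2\mathcal F_1f)\Big)(\xi)=\int_{\mathbb R}\mathcal D^{com}(t,k,\xi,\xi_1)\hat f_k(t,\xi_1)\,d\xi_1;$$ moreover $$\big|\mathcal D^{com}(t,k,\xi,\xi_1)\big|\le C\min\left(\frac{e^{-\lambda_{\mathcal D}|\xi-\xi_1|^{s_0}}}{1+|\xi-kt|^2},\ \frac{e^{-\lambda_{\mathcal D}|\xi-\xi_1|^{s_0}}}{1+|\xi_1-kt|^2}\right).$$ -/

import Mathlib

open Set Filter MeasureTheory
open scoped Topology ContDiff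

noncomputable section

namespace ShearFlow

/-! ### The background shear flow `(u, θ)` -/

/-- `Δ̃_k ψ = w` on `(0,1)` with `ψ(0) = ψ(1) = 0`, where
`Δ̃_k ψ = (ψ' / θ)' - (k² / θ) ψ`, for `w ∈ L²(0,1)` and `ψ ∈ H²(0,1) ∩ H¹₀(0,1)`.
The function `p` is `ψ' / θ`; both first-order equations are written in integrated form. -/
def DistortedPoisson (θ : ℝ → ℝ) (k : ℤ) (w ψ : ℝ → ℂ) : Prop :=
  MemLp w 2 (volume.restrict (Icc (0 : ℝ) 1)) ∧
  ∃ p : ℝ → ℂ, ContinuousOn p (Icc (0 : ℝ) 1) ∧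
    (∀ y ∈ Icc (0 : ℝ) 1, ψ y = ∫ z in (0 : ℝ)..y, (θ z : ℂ) * p z) ∧
    (∀ y ∈ Icc (0 : ℝ) 1,
      p y = p 0 + ∫ z in (0 : ℝ)..y, (w z + ((k : ℂ) ^ 2 / (θ z : ℂ)) * ψ z)) ∧
    ψ 1 = 0

/-- `φ₁ = (u' / θ)'`. -/
def varphi1 (u θ : ℝ → ℝ) (y : ℝ) : ℝ := deriv (fun z => deriv u z / θ z) y

/-- `c` is an eigenvalue, on `L²(0,1)`, of the distorted Rayleigh operator
`R_{u,k} = u Id - (u'/θ)' Δ̃_k⁻¹`. The number `c` may lie in the range of `u`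
(embedded eigenvalue) or not. -/
def IsRayleighEigenvalue (u θ : ℝ → ℝ) (k : ℤ) (c : ℂ) : Prop :=
  ∃ w ψ : ℝ → ℂ, DistortedPoisson θ k w ψ ∧
    (¬ ∀ᵐ y ∂(volume.restrict (Icc (0 : ℝ) 1)), w y = 0) ∧
    ∀ᵐ y ∂(volume.restrict (Icc (0 : ℝ) 1)),
      (u y : ℂ) * w y - (varphi1 u θ y : ℂ) * ψ y = c * w y

/-- The standing assumptions on the background flow. The functions `u`, `θ` on `[0,1]` are
regarded as functions on `ℝ` through the extension under which `u''` and `θ'` vanish outside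
`[0,1]` (`u` affine and `θ` constant near each end). -/
structure Background (s₀ κ₀ c₀ K : ℝ) (u θ : ℝ → ℝ) : Prop where
  smooth_u : ContDiff ℝ ∞ u
  smooth_theta : ContDiff ℝ ∞ θ
  monotone : ∀ y ∈ Icc (0 : ℝ) 1, c₀ ≤ deriv u y
  positive : ∀ y ∈ Icc (0 : ℝ) 1, c₀ ≤ θ y
  supp_u : tsupport (deriv (deriv u)) ⊆ Icc (4 * κ₀) (1 - 4 * κ₀)
  supp_theta : tsupport (deriv θ) ⊆ Icc (4 * κ₀) (1 - 4 * κ₀)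
  stable : ∀ k : ℤ, k ≠ 0 → ∀ c : ℂ, ¬ IsRayleighEigenvalue u θ k c
  gevrey : ∀ (m : ℕ) (y y' : ℝ),
    |iteratedDeriv m (deriv θ) y| + |iteratedDeriv m (deriv (deriv u)) y'| ≤
      K ^ m * (m.factorial : ℝ) ^ (1 / s₀) / ((m : ℝ) + 1) ^ 2

/-- The cut-off `χ₂`. -/
structure IsCutoff (s₀ κ₀ K₁ : ℝ) (χ : ℝ → ℝ) : Prop where
  smooth : ContDiff ℝ ∞ χ
  supp : tsupport χ ⊆ Icc (κ₀ / 2) (1 - κ₀ / 2)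
  eq_one : ∀ y ∈ Icc κ₀ (1 - κ₀), χ y = 1
  gevrey : ∀ (m : ℕ) (y : ℝ),
    |iteratedDeriv m χ y| ≤
      K₁ ^ m * (m.factorial : ℝ) ^ (2 / (s₀ + 1)) / ((m : ℝ) + 1) ^ 2

/-! ### Homogeneous solutions and the coefficients of the wave operator -/

/-- Principal value of `∫_a^b f(x) dx` with a singularity at `c`. -/
def pvIntegral {E : Type*} [NormedAddCommGroup E] [NormedSpace ℝ E]
    (a b c : ℝ) (f : ℝ → E) : E :=
  limUnder (𝓝[>] (0 : ℝ)) (fun ε => ∫ x in {x : ℝ | x ∈ Icc a b ∧ ε ≤ |x - c|}, f x)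

/-- `f = φ₁(·, y', k)` is the continuous solution on `[0,1]` of
`f(y) = 1 + ∫_{y'}^y k² θ(z') / (u(z') - u(y'))² ∫_{y'}^{z'} (u(z'') - u(y'))² / θ(z'') f(z'')`. -/
def IsHomogeneousSolution (u θ : ℝ → ℝ) (k : ℤ) (y' : ℝ) (f : ℝ → ℝ) : Prop :=
  ContinuousOn f (Icc (0 : ℝ) 1) ∧
  ∀ y ∈ Icc (0 : ℝ) 1,
    f y = 1 + ∫ z in y'..y, (k : ℝ) ^ 2 * θ z / (u z - u y') ^ 2 *
      ∫ x in y'..z, (u x - u y') ^ 2 / θ x * f x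

/-- The homogeneous solution `φ₁(y, y', k)`. -/
def phi1 (u θ : ℝ → ℝ) (k : ℤ) (y y' : ℝ) : ℝ :=
  Classical.epsilon (IsHomogeneousSolution u θ k y') y

/-- `φ(y, y', k) = (u(y) - u(y')) φ₁(y, y', k)`. -/
def phi (u θ : ℝ → ℝ) (k : ℤ) (y y' : ℝ) : ℝ := (u y - u y') * phi1 u θ k y y'

/-- `e(y, y', k)`; the value on the diagonal plays no role. -/
def e (u θ : ℝ → ℝ) (k : ℤ) (y y' : ℝ) : ℝ :=
  if y < y' then phi u θ k y y' * ∫ z in (0 : ℝ)..y, θ z / phi u θ k z y' ^ 2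
  else phi u θ k y y' * ∫ z in (1 : ℝ)..y, θ z / phi u θ k z y' ^ 2

/-- `ρ(y') = (u(y') - u(0)) (u(1) - u(y'))`. -/
def rho (u : ℝ → ℝ) (y' : ℝ) : ℝ := (u y' - u 0) * (u 1 - u y')

def J1 (u θ : ℝ → ℝ) (k : ℤ) (y' : ℝ) : ℝ :=
  -(u 1 - u y') * (θ 0 / deriv u 0) - (u y' - u 0) * (θ 1 / deriv u 1)
  + rho u y' * (∫ z in (0 : ℝ)..1,
      θ z / (u z - u y') ^ 2 * (1 / phi1 u θ k z y' ^ 2 - 1))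
  + rho u y' * pvIntegral 0 1 y'
      (fun z => 1 / (u z - u y') * deriv (fun x => θ x / deriv u x) z)

def J2 (u θ : ℝ → ℝ) (y' : ℝ) : ℝ :=
  -(rho u y' * (θ y' ^ 2 / deriv u y' ^ 3) * varphi1 u θ y')

def b1 (u θ : ℝ → ℝ) (k : ℤ) (y' : ℝ) : ℝ :=
  J1 u θ k y' / √(J1 u θ k y' ^ 2 + Real.pi ^ 2 * J2 u θ y' ^ 2)

def b2 (u θ : ℝ → ℝ) (k : ℤ) (y' : ℝ) : ℝ :=
  -(rho u y' * (θ y' / deriv u y') /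
    √(J1 u θ k y' ^ 2 + Real.pi ^ 2 * J2 u θ y' ^ 2))

/-! ### The variable `v = u(y)` -/

/-- `u⁻¹`; a background `u` is a bijection of `ℝ`. -/
def uInv (u : ℝ → ℝ) : ℝ → ℝ := Function.invFun u

def B1 (u θ : ℝ → ℝ) (k : ℤ) (v : ℝ) : ℝ := b1 u θ k (uInv u v)

def B2 (u θ : ℝ → ℝ) (k : ℤ) (v : ℝ) : ℝ := b2 u θ k (uInv u v)

/-- `E(v, v', k)`, so that `E(u(y), u(y'), k) = e(y, y', k)`. -/
def E (u θ : ℝ → ℝ) (k : ℤ) (v v' : ℝ) : ℝ := e u θ k (uInv u v) (uInv u v')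

/-- `φ̃₁ = φ₁ ∘ u⁻¹`. -/
def tvarphi1 (u θ : ℝ → ℝ) (v : ℝ) : ℝ := varphi1 u θ (uInv u v)

/-- The wave operator `𝐃_{u,k}` at time `t`, applied to a function `g` of `v`. -/
def waveD (u θ : ℝ → ℝ) (k : ℤ) (t : ℝ) (g : ℝ → ℂ) (v : ℝ) : ℂ :=
  (B1 u θ k v : ℂ) * g v
  + (tvarphi1 u θ v : ℂ) * (B2 u θ k v : ℂ) *
    pvIntegral (u 0) (u 1) v (fun v₁ =>
      (E u θ k v₁ v : ℂ) *
        (g v₁ * Complex.exp (-Complex.I * (v₁ - v) * t * k) / ((v₁ : ℂ) - v)) *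
        ((deriv (uInv u) v₁ : ℝ) : ℂ))

/-- The operator `𝐃¹_{u,k}` at time `t`, applied to a function `g` of `v`. -/
def waveD1 (u θ : ℝ → ℝ) (k : ℤ) (t : ℝ) (g : ℝ → ℂ) (v : ℝ) : ℂ :=
  (B1 u θ k v : ℂ) * g v
  + (B2 u θ k v : ℂ) *
    pvIntegral (u 0) (u 1) v (fun v₁ =>
      (E u θ k v₁ v : ℂ) *
        ((tvarphi1 u θ v₁ : ℂ) * g v₁ *
          Complex.exp (-Complex.I * (v₁ - v) * t * k) / ((v₁ : ℂ) - v)) *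
        ((deriv (uInv u) v : ℝ) : ℂ))

/-! ### Functions on `𝕋 × ℝ` and Fourier transforms -/

/-- Schwartz functions of `(z, v) ∈ 𝕋 × ℝ`, with `𝕋 = ℝ / 2πℤ`. -/
structure IsSchwartz (f : ℝ → ℝ → ℂ) : Prop where
  smooth : ContDiff ℝ ∞ (fun x : ℝ × ℝ => f x.1 x.2)
  periodic : ∀ z v : ℝ, f (z + 2 * Real.pi) v = f z v
  decay : ∀ n m : ℕ, ∃ C : ℝ, ∀ x : ℝ × ℝ,
    |x.2| ^ n * ‖iteratedFDeriv ℝ m (fun x : ℝ × ℝ => f x.1 x.2) x‖ ≤ C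

/-- `F₁ f(k, v) = (1/2π) ∫_𝕋 f(z, v) e^{-izk} dz`. -/
def F1 (f : ℝ → ℝ → ℂ) (k : ℤ) (v : ℝ) : ℂ :=
  (1 / (2 * Real.pi) : ℂ) *
    ∫ z in (0 : ℝ)..(2 * Real.pi), f z v * Complex.exp (-Complex.I * z * k)

/-- `F₂ g(η) = ∫_ℝ g(v) e^{-ivη} dv`. -/
def F2 (g : ℝ → ℂ) (η : ℝ) : ℂ :=
  ∫ v : ℝ, g v * Complex.exp (-Complex.I * v * η)

/-- `f̂_k(η) = (1/2π) ∫_{𝕋×ℝ} f(z, v) e^{-izk-ivη} dz dv`. -/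
def fhat (f : ℝ → ℝ → ℂ) (k : ℤ) (η : ℝ) : ℂ := F2 (F1 f k) η

/-- `χ̃₂ 𝐃_{u,k}(χ̃₂ F₁f(t,k,·)) - χ̃₂ 𝐃¹_{u,k}(χ̃₂ F₁f(t,k,·))`, a function of `v`, where
`χ̃₂ = χ₂ ∘ u⁻¹` and `f = f(t, ·, ·)`. -/
def waveDiff (u θ χ : ℝ → ℝ) (k : ℤ) (t : ℝ) (f : ℝ → ℝ → ℂ) (v : ℝ) : ℂ :=
  (χ (uInv u v) : ℂ) * waveD u θ k t (fun w => (χ (uInv u w) : ℂ) * F1 f k w) v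
  - (χ (uInv u v) : ℂ) * waveD1 u θ k t (fun w => (χ (uInv u w) : ℂ) * F1 f k w) v

end ShearFlow

end

/-! Work in the variable v = u(y), where the flow enters through a = θ/u', b = 1/(θu'), q = (u⁻¹)'
and p = φ₁, all read as functions of v. In the difference of the two operators the B₁ terms cancel,
and the two principal values have the same singular part at v₁ = v. What is left is an ordinary
integral with kernel B₂(v) E(v₁,v) (p(v)q(v₁) - p(v₁)q(v))/(v₁ - v), times cut-offs (`pv_sub_pv`,
`waveDiff_eq`). With v₁ = v + Rs and R = u(1) - u(0), the operator becomes h ↦ R ∫ G(v)(s)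
e^{-iRkts} h(v + Rs) ds over s ∈ [-1,1], where G = `kernelC` takes values in C([-1,1]). Fourier
inversion and Fubini (`integral_fourierKernel`) give D^com(t,k,ξ,ξ₁) = (R/2π) ∫ e^{-iv(ξ-ξ₁)} ( ∫
G(v)(s) e^{iR(ξ₁-kt)s} ds ) dv. So decay in ξ - ξ₁ comes from Gevrey regularity of G in v at fixed
relative position s, and decay in ξ₁ - kt comes from regularity in s.

Regularity in v. In the coordinate s the homogeneous solution solves a Volterra equation on
C([-1,1]) whose coefficients are shifts of a and b. Its resolvent is an inverse in a Banach algebra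
of operators. For σ = 1/s₀ > 1 the Gevrey class of a given radius is closed under products, inverses
(`Gev.inverse`) and inverse square roots (`Gev.inv_sqrt`) without loss of radius. The rate of decay
therefore depends only on the radius of a, b, q, p and the cut-off, which is uniform
(`exists_radius`), while the constants may depend on the flow.

Regularity in s. The Green function is Φ times an explicit bracket: a twice differentiable part, a
multiple of s log|s| with coefficient proportional to a'(v), and a multiple of max(s,0) whose
coefficient is proportional to the jump of the coefficients on the two sides of v. Against functions
vanishing to second order at s = ±1, each of the three weights 1, s log|s| and max(s,0) has a
Fourier transform of size (1+β²)⁻¹ (`QuadWeight`), which is the quadratic decay in the theorem.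

Non-degeneracy. One has J₁ = ρ·jump and J₂ = ρ·a'(v), so B₂ is regular as long as jump and a' have
no common zero. At a common zero the Green function has neither logarithm nor kink, and it produces
an embedded eigenvalue u(y'), which is excluded (`jump_sq_add_pos`).

The weight at ξ₁ - kt is finally moved to ξ - kt at the price of half of the exponential
(`exists_le_min`). -/

noncomputable section
namespace ShearFlow

/-! ### Gevrey classes of vector-valued functions of one variable -/

/-- The weight `M ^ m * (m !) ^ σ / (m + 1) ^ 2`. -/
def gevreyWeight (σ M : ℝ) (m : ℕ) : ℝ := M ^ m * (m.factorial : ℝ) ^ σ / ((m : ℝ) + 1) ^ 2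

theorem gevreyWeight_pos {σ M : ℝ} (hM : 0 < M) (m : ℕ) : 0 < gevreyWeight σ M m := by
  unfold gevreyWeight
  have : (0 : ℝ) < m.factorial := by exact_mod_cast m.factorial_pos
  positivity

theorem gevreyWeight_zero (σ M : ℝ) : gevreyWeight σ M 0 = 1 := by
  simp [gevreyWeight]

/-- Since the binomial coefficient is m!/(i!(m-i)!), Leibniz's rule leaves the surplus choose^(1-σ).
It is at most 1 when σ ≥ 1, which makes the class an algebra, and small for 0 < i < m when σ > 1,
which makes it closed under inversion at fixed M. -/
theorem choose_mul_gevreyWeight (σ M : ℝ) {m i : ℕ} (hi : i ≤ m) :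
    (m.choose i : ℝ) * gevreyWeight σ M i * gevreyWeight σ M (m - i) =
      gevreyWeight σ M m * (m.choose i : ℝ) ^ (1 - σ) *
        (((m : ℝ) + 1) ^ 2 / (((i : ℝ) + 1) ^ 2 * (((m - i : ℕ) : ℝ) + 1) ^ 2)) := by
  have hc : (0 : ℝ) < m.choose i := by exact_mod_cast Nat.choose_pos hi
  have h1 : (0 : ℝ) < i.factorial := by exact_mod_cast i.factorial_pos
  have h2 : (0 : ℝ) < (m - i).factorial := by exact_mod_cast (m - i).factorial_pos
  have hm : (m.factorial : ℝ) = m.choose i * i.factorial * (m - i).factorial := by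
    exact_mod_cast (Nat.choose_mul_factorial_mul_factorial hi).symm
  have hM : M ^ m = M ^ i * M ^ (m - i) := by rw [← pow_add, Nat.add_sub_cancel' hi]
  unfold gevreyWeight
  rw [hm, hM, Real.mul_rpow (by positivity) h2.le, Real.mul_rpow hc.le h1.le,
    Real.rpow_sub hc, Real.rpow_one]
  have : (0 : ℝ) < (m.choose i : ℝ) ^ σ := by positivity
  field_simp

theorem sum_inv_sq_le (n : ℕ) : ∑ i ∈ Finset.range n, 1 / ((i : ℝ) + 1) ^ 2 ≤ 2 := by
  have key : ∀ n : ℕ, ∑ i ∈ Finset.range (n + 1), 1 / ((i : ℝ) + 1) ^ 2 ≤ 2 - 1 / ((n : ℝ) + 1) := by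
    intro n
    induction n with
    | zero => simp; norm_num
    | succ n ih =>
      rw [Finset.sum_range_succ]
      have hn : (0 : ℝ) ≤ n := by positivity
      have : 1 / (((n + 1 : ℕ) : ℝ) + 1) ^ 2 ≤ 1 / ((n : ℝ) + 1) - 1 / (((n + 1 : ℕ) : ℝ) + 1) := by
        push_cast
        rw [div_sub_div _ _ (by positivity) (by positivity), div_le_div_iff₀ (by positivity)
          (by positivity)]
        nlinarith
      linarith
  rcases n with _ | n
  · simp
  · refine (key n).trans ?_
    have : (0 : ℝ) ≤ 1 / ((n : ℝ) + 1) := by positivity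
    linarith

/-- With x = i+1 and y = m-i+1 one has m+1 ≤ x+y, hence (m+1)² ≤ 2x² + 2y², and each half sums to at
most 4. The denominators (m+1)² in the weight are there for this convolution bound. -/
theorem sum_weight_ratio_le (m : ℕ) :
    ∑ i ∈ Finset.range (m + 1),
      ((m : ℝ) + 1) ^ 2 / (((i : ℝ) + 1) ^ 2 * (((m - i : ℕ) : ℝ) + 1) ^ 2) ≤ 8 := by
  have h1 : ∀ i ∈ Finset.range (m + 1),
      ((m : ℝ) + 1) ^ 2 / (((i : ℝ) + 1) ^ 2 * (((m - i : ℕ) : ℝ) + 1) ^ 2) ≤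
        2 * (1 / ((i : ℝ) + 1) ^ 2) + 2 * (1 / (((m - i : ℕ) : ℝ) + 1) ^ 2) := by
    intro i hi
    have hi' : i ≤ m := Nat.lt_succ_iff.mp (Finset.mem_range.mp hi)
    have hm : (m : ℝ) = i + (m - i : ℕ) := by exact_mod_cast (Nat.add_sub_cancel' hi').symm
    rw [hm]
    generalize ((m - i : ℕ) : ℝ) = j at *
    set x := (i : ℝ) + 1 with hx
    have hi0 : (0 : ℝ) ≤ i := by positivity
    have hj : 0 ≤ j ∨ j < 0 := le_or_gt 0 j
    by_cases hj0 : j + 1 = 0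
    · simp [hj0]; positivity
    rw [show 2 * (1 / x ^ 2) + 2 * (1 / (j + 1) ^ 2) =
      (2 * (j + 1) ^ 2 + 2 * x ^ 2) / (x ^ 2 * (j + 1) ^ 2) by
        have hx0 : 0 < x := by positivity
        have hjp : (j + 1) ^ 2 ≠ 0 := pow_ne_zero _ hj0
        rw [mul_one_div, mul_one_div, div_add_div _ _ (by positivity) hjp]
        congr 1
        ring]
    have hx0 : 0 < x := by positivity
    have hjp : 0 < (j + 1) ^ 2 := by positivity
    gcongr
    have : (i : ℝ) + j + 1 = x + (j + 1) - 1 := by rw [hx]; ring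
    rw [this]
    rcases hj with hj | hj
    · nlinarith [sq_nonneg (x - (j + 1))]
    · nlinarith [sq_nonneg (x - (j + 1)), sq_nonneg (x + (j + 1) - 1), sq_nonneg (x + j)]
  refine (Finset.sum_le_sum h1).trans ?_
  rw [Finset.sum_add_distrib, ← Finset.mul_sum, ← Finset.mul_sum]
  have h2 := Finset.sum_range_reflect (fun i : ℕ => 1 / ((i : ℝ) + 1) ^ 2) (m + 1)
  have h3 : ∑ i ∈ Finset.range (m + 1), 1 / (((m - i : ℕ) : ℝ) + 1) ^ 2 ≤ 2 := by
    refine le_trans (le_of_eq ?_) (sum_inv_sq_le (m + 1))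
    rw [← h2]
    refine Finset.sum_congr rfl fun i _ => ?_
    simp
  linarith [sum_inv_sq_le (m + 1)]

theorem sum_choose_mul_gevreyWeight_le {σ M : ℝ} (hσ : 1 ≤ σ) (hM : 0 < M) (m : ℕ) :
    ∑ i ∈ Finset.range (m + 1), (m.choose i : ℝ) * gevreyWeight σ M i * gevreyWeight σ M (m - i) ≤
      8 * gevreyWeight σ M m := by
  have h : ∀ i ∈ Finset.range (m + 1),
      (m.choose i : ℝ) * gevreyWeight σ M i * gevreyWeight σ M (m - i) ≤ gevreyWeight σ M m *
        (((m : ℝ) + 1) ^ 2 / (((i : ℝ) + 1) ^ 2 * (((m - i : ℕ) : ℝ) + 1) ^ 2)) := by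
    intro i hi
    have hi' : i ≤ m := Nat.lt_succ_iff.mp (Finset.mem_range.mp hi)
    rw [choose_mul_gevreyWeight σ M hi']
    have hc : (1 : ℝ) ≤ m.choose i := by exact_mod_cast Nat.choose_pos hi'
    have := Real.rpow_le_one_of_one_le_of_nonpos hc (by linarith : 1 - σ ≤ 0)
    have h0 := gevreyWeight_pos (σ := σ) hM m
    gcongr
    nlinarith
  refine (Finset.sum_le_sum h).trans ?_
  rw [← Finset.mul_sum]
  nlinarith [sum_weight_ratio_le m, gevreyWeight_pos (σ := σ) hM m]

/-- For 0 < i < m the binomial coefficient is at least m, so the surplus choose^(1-σ) is at most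
m^(1-σ). For σ > 1 this tends to zero, the smallness that recursions for inverses need. -/
theorem sum_middle_choose_mul_gevreyWeight_le {σ M : ℝ} (hσ : 1 ≤ σ) (hM : 0 < M) (m : ℕ) :
    ∑ i ∈ Finset.Ico 1 m, (m.choose i : ℝ) * gevreyWeight σ M i * gevreyWeight σ M (m - i) ≤
      8 * (m : ℝ) ^ (1 - σ) * gevreyWeight σ M m := by
  have h : ∀ i ∈ Finset.Ico 1 m,
      (m.choose i : ℝ) * gevreyWeight σ M i * gevreyWeight σ M (m - i) ≤
        gevreyWeight σ M m * (m : ℝ) ^ (1 - σ) *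
        (((m : ℝ) + 1) ^ 2 / (((i : ℝ) + 1) ^ 2 * (((m - i : ℕ) : ℝ) + 1) ^ 2)) := by
    intro i hi
    obtain ⟨hi1, hi2⟩ := Finset.mem_Ico.mp hi
    rw [choose_mul_gevreyWeight σ M hi2.le]
    have hc : (m : ℝ) ≤ m.choose i := by
      have : m ≤ m.choose i := by
        obtain ⟨j, rfl⟩ : ∃ j, m = i + j := ⟨m - i, by omega⟩
        have hj : 1 ≤ j := by omega
        clear hi hi2
        have key : ∀ i j : ℕ, 1 ≤ i → 1 ≤ j → i + j ≤ (i + j).choose i := by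
          intro i j hi hj
          induction i, hi using Nat.le_induction with
          | base => simp
          | succ i hi ih =>
            have h1 : (i + 1 + j).choose (i + 1) = (i + j).choose i + (i + j).choose (i + 1) := by
              rw [show i + 1 + j = (i + j) + 1 by ring, Nat.choose_succ_succ]
            have h2 : 0 < (i + j).choose (i + 1) := Nat.choose_pos (by omega)
            omega
        exact key i j hi1 hj
      exact_mod_cast this
    have hm : (0 : ℝ) < m := by exact_mod_cast (by omega : 0 < m)
    have := Real.rpow_le_rpow_of_nonpos hm hc (by linarith : 1 - σ ≤ 0)
    have h0 := gevreyWeight_pos (σ := σ) hM m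
    gcongr
  refine (Finset.sum_le_sum h).trans ?_
  rw [← Finset.mul_sum]
  have hsub : ∑ i ∈ Finset.Ico 1 m,
      ((m : ℝ) + 1) ^ 2 / (((i : ℝ) + 1) ^ 2 * (((m - i : ℕ) : ℝ) + 1) ^ 2) ≤ 8 := by
    refine le_trans (Finset.sum_le_sum_of_subset_of_nonneg ?_ ?_) (sum_weight_ratio_le m)
    · intro i hi
      simp only [Finset.mem_Ico, Finset.mem_range] at *
      omega
    · intros; positivity
  have h0 : 0 ≤ gevreyWeight σ M m * (m : ℝ) ^ (1 - σ) := by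
    have := gevreyWeight_pos (σ := σ) hM m
    positivity
  nlinarith

/-- A recursive inequality with coefficients tending to zero has bounded solutions. -/
theorem exists_bound_of_recursion {ι : Type*} (x : ℕ → ι → ℝ) (p : ℝ) (ε : ℕ → ℝ)
    (hp : 0 ≤ p) (hε : Tendsto ε atTop (𝓝 0)) (hx0 : ∀ v, x 0 v ≤ p)
    (hrec : ∀ m, 1 ≤ m → ∀ v, ∀ c, 0 ≤ c → (∀ i < m, x i v ≤ c) → x m v ≤ p + ε m * c) :
    ∃ C, 0 ≤ C ∧ ∀ m v, x m v ≤ C := by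
  have h1 : ∀ m, ∃ C, p ≤ C ∧ ∀ i ≤ m, ∀ v, x i v ≤ C := by
    intro m
    induction m with
    | zero => exact ⟨p, le_rfl, fun i hi v => by rw [Nat.le_zero.mp hi]; exact hx0 v⟩
    | succ m ih =>
      obtain ⟨C, hC, h⟩ := ih
      refine ⟨max C (p + ε (m + 1) * C), le_max_of_le_left hC, fun i hi v => ?_⟩
      rcases Nat.lt_or_ge i (m + 1) with h' | h'
      · exact le_max_of_le_left (h i (by omega) v)
      · obtain rfl : i = m + 1 := by omega
        exact le_max_of_le_right
          (hrec _ (by omega) v C (hp.trans hC) fun j hj => h j (by omega) v)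
  -- Beyond `m0` the coefficient is at most 1/2. As `C` dominates `p` and the terms up to `m0`, the
  -- bound 2C reproduces itself: p + (1/2)·2C ≤ 2C.
  obtain ⟨m0, hm0⟩ := eventually_atTop.mp (hε.eventually (ge_mem_nhds (show (0 : ℝ) < 1 / 2 by norm_num)))
  obtain ⟨C, hC, h⟩ := h1 m0
  refine ⟨2 * C, by linarith, fun m v => ?_⟩
  induction m using Nat.strong_induction_on with
  | _ m ih =>
    rcases Nat.lt_or_ge m m0 with h' | h'
    · linarith [h m h'.le v]
    · rcases Nat.eq_zero_or_pos m with rfl | hm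
      · linarith [hx0 v]
      · have := hrec m hm v (2 * C) (by linarith) ih
        have h2 := hm0 m h'
        nlinarith

variable {V V' A : Type*} [NormedAddCommGroup V] [NormedSpace ℝ V] [NormedAddCommGroup V']
  [NormedSpace ℝ V'] [NormedRing A] [NormedAlgebra ℝ A]

/-- Smooth functions on `U` with `‖f⁽ᵐ⁾‖ ≤ C M ^ m (m !) ^ σ / (m + 1) ^ 2`. -/
structure Gev (σ M : ℝ) (U : Set ℝ) (f : ℝ → V) : Prop where
  smooth : ∀ v ∈ U, ContDiffAt ℝ ∞ f v
  bound : ∃ C, 0 ≤ C ∧ ∀ (m : ℕ), ∀ v ∈ U, ‖iteratedDeriv m f v‖ ≤ C * gevreyWeight σ M m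

theorem contDiffAt_nat {f : ℝ → V} {v : ℝ} (h : ContDiffAt ℝ ∞ f v) (m : ℕ) :
    ContDiffAt ℝ m f v := h.of_le (by exact_mod_cast le_top)

namespace Gev

variable {σ M : ℝ} {U : Set ℝ}

theorem mono_set {f : ℝ → V} (hf : Gev σ M U f) {U' : Set ℝ} (h : U' ⊆ U) : Gev σ M U' f :=
  ⟨fun v hv => hf.smooth v (h hv), by
    obtain ⟨C, h0, hC⟩ := hf.bound
    exact ⟨C, h0, fun m v hv => hC m v (h hv)⟩⟩

theorem const (hM : 0 < M) (c : V) : Gev σ M U (fun _ => c) :=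
  ⟨fun _ _ => contDiffAt_const, ‖c‖, norm_nonneg _, fun m v _ => by
    rw [iteratedDeriv_const]
    split_ifs with h
    · simp [h, gevreyWeight_zero]
    · simpa using mul_nonneg (norm_nonneg c) (gevreyWeight_pos hM m).le⟩

theorem add {f g : ℝ → V} (hf : Gev σ M U f) (hg : Gev σ M U g) :
    Gev σ M U (fun v => f v + g v) := by
  refine ⟨fun v hv => (hf.smooth v hv).add (hg.smooth v hv), ?_⟩
  obtain ⟨C, h0, hC⟩ := hf.bound
  obtain ⟨C', h0', hC'⟩ := hg.bound
  refine ⟨C + C', by positivity, fun m v hv => ?_⟩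
  rw [iteratedDeriv_fun_add (contDiffAt_nat (hf.smooth v hv) m) (contDiffAt_nat (hg.smooth v hv) m), add_mul]
  exact (norm_add_le _ _).trans (add_le_add (hC m v hv) (hC' m v hv))

theorem neg {f : ℝ → V} (hf : Gev σ M U f) : Gev σ M U (fun v => -f v) := by
  refine ⟨fun v hv => (hf.smooth v hv).neg, ?_⟩
  obtain ⟨C, h0, hC⟩ := hf.bound
  exact ⟨C, h0, fun m v hv => by simpa using hC m v hv⟩

theorem sub {f g : ℝ → V} (hf : Gev σ M U f) (hg : Gev σ M U g) :
    Gev σ M U (fun v => f v - g v) := by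
  simpa only [sub_eq_add_neg] using hf.add hg.neg

theorem mul (hσ : 1 ≤ σ) (hM : 0 < M) {f g : ℝ → A} (hf : Gev σ M U f) (hg : Gev σ M U g) :
    Gev σ M U (fun v => f v * g v) := by
  refine ⟨fun v hv => (hf.smooth v hv).mul (hg.smooth v hv), ?_⟩
  obtain ⟨C, h0, hC⟩ := hf.bound
  obtain ⟨C', h0', hC'⟩ := hg.bound
  refine ⟨C * C' * 8, by positivity, fun m v hv => ?_⟩
  rw [iteratedDeriv_fun_mul (contDiffAt_nat (hf.smooth v hv) m) (contDiffAt_nat (hg.smooth v hv) m)]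
  refine (norm_sum_le _ _).trans ?_
  have : ∀ i ∈ Finset.range (m + 1),
      ‖(m.choose i : A) * iteratedDeriv i f v * iteratedDeriv (m - i) g v‖ ≤
        C * C' * ((m.choose i : ℝ) * gevreyWeight σ M i * gevreyWeight σ M (m - i)) := by
    intro i _
    rw [mul_assoc, ← nsmul_eq_mul, ← Nat.cast_smul_eq_nsmul ℝ, norm_smul]
    have hW := (gevreyWeight_pos (σ := σ) hM i).le
    calc ‖(m.choose i : ℝ)‖ * ‖iteratedDeriv i f v * iteratedDeriv (m - i) g v‖
        ≤ (m.choose i : ℝ) * ((C * gevreyWeight σ M i) * (C' * gevreyWeight σ M (m - i))) := by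
          rw [Real.norm_natCast]
          gcongr
          exact (norm_mul_le _ _).trans (mul_le_mul (hC i v hv) (hC' _ v hv) (norm_nonneg _)
            (by positivity))
      _ = _ := by ring
  refine (Finset.sum_le_sum this).trans ?_
  rw [← Finset.mul_sum, mul_assoc (C * C')]
  exact mul_le_mul_of_nonneg_left (sum_choose_mul_gevreyWeight_le hσ hM m) (by positivity)

theorem iteratedDeriv_clm (L : V →L[ℝ] V') {f : ℝ → V} {v : ℝ} (hf : ContDiffAt ℝ ∞ f v)
    (m : ℕ) : iteratedDeriv m (fun x => L (f x)) v = L (iteratedDeriv m f v) := by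
  have := L.iteratedFDeriv_comp_left (contDiffAt_nat hf m) (le_refl (m : WithTop ℕ∞))
  simp only [iteratedDeriv]
  rw [show (fun x => L (f x)) = L ∘ f from rfl, this]
  rfl

theorem clm (L : V →L[ℝ] V') {f : ℝ → V} (hf : Gev σ M U f) :
    Gev σ M U (fun v => L (f v)) := by
  refine ⟨fun v hv => L.contDiff.contDiffAt.comp v (hf.smooth v hv), ?_⟩
  obtain ⟨C, h0, hC⟩ := hf.bound
  refine ⟨‖L‖ * C, by positivity, fun m v hv => ?_⟩
  rw [iteratedDeriv_clm L (hf.smooth v hv), mul_assoc]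
  exact (L.le_opNorm _).trans (by gcongr; exact hC m v hv)

theorem smul (hσ : 1 ≤ σ) (hM : 0 < M) {c : ℝ → ℝ} {f : ℝ → A} (hc : Gev σ M U c)
    (hf : Gev σ M U f) : Gev σ M U (fun v => c v • f v) := by
  have := (hc.clm ((ContinuousLinearMap.id ℝ ℝ).smulRight (1 : A))).mul hσ hM hf
  simpa using this

theorem congr {f g : ℝ → V} (hU : IsOpen U) (hf : Gev σ M U f) (h : ∀ v ∈ U, g v = f v) :
    Gev σ M U g := by
  have hev : ∀ v ∈ U, g =ᶠ[𝓝 v] f := fun v hv => by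
    filter_upwards [hU.mem_nhds hv] with x hx using h x hx
  refine ⟨fun v hv => (hf.smooth v hv).congr_of_eventuallyEq (hev v hv), ?_⟩
  obtain ⟨C, h0, hC⟩ := hf.bound
  exact ⟨C, h0, fun m v hv => by rw [(hev v hv).iteratedDeriv_eq m]; exact hC m v hv⟩

theorem continuousOn {f : ℝ → V} (hf : Gev σ M U f) : ContinuousOn f U :=
  fun v hv => (hf.smooth v hv).continuousAt.continuousWithinAt

/-- The recursion satisfied by the derivatives of an inverse or of an inverse square root
propagates Gevrey bounds, without loss in the radius. -/
theorem of_recursion (hσ : 1 < σ) (hM : 0 < M) {f : ℝ → V} {g : ℝ → V'} (hf : Gev σ M U f)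
    (hg : ∀ v ∈ U, ContDiffAt ℝ ∞ g v) {B : ℝ} (hB : ∀ v ∈ U, ‖g v‖ ≤ B)
    (hrec : ∀ m, 1 ≤ m → ∀ v ∈ U, ‖iteratedDeriv m g v‖ ≤ B * ∑ i ∈ Finset.Ico 1 (m + 1),
      (m.choose i : ℝ) * ‖iteratedDeriv i f v‖ * ‖iteratedDeriv (m - i) g v‖) :
    Gev σ M U g := by
  refine ⟨hg, ?_⟩
  rcases U.eq_empty_or_nonempty with rfl | ⟨v₀, hv₀⟩
  · exact ⟨0, le_rfl, by simp⟩
  obtain ⟨C, h0, hC⟩ := hf.bound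
  have hB0 : 0 ≤ B := (norm_nonneg _).trans (hB v₀ hv₀)
  obtain ⟨D, hD0, hD⟩ := exists_bound_of_recursion
    (fun m (v : U) => ‖iteratedDeriv m g v‖ / gevreyWeight σ M m) (B + B * (C * B))
    (fun m => B * C * (8 * (m : ℝ) ^ (1 - σ))) (by positivity) (by
      have : Tendsto (fun m : ℕ => (m : ℝ) ^ (-(σ - 1))) atTop (𝓝 0) :=
        (tendsto_rpow_neg_atTop (by linarith)).comp tendsto_natCast_atTop_atTop
      simpa [neg_sub] using (this.const_mul 8).const_mul (B * C)) (by
      intro v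
      simp only [iteratedDeriv_zero, gevreyWeight_zero, div_one]
      nlinarith [hB v v.2, mul_nonneg hB0 (mul_nonneg h0 hB0)]) (by
      intro m hm v c hc hi
      have hWm := gevreyWeight_pos (σ := σ) hM m
      rw [div_le_iff₀ hWm]
      refine (hrec m hm v v.2).trans ?_
      -- The top term i = m pairs f⁽ᵐ⁾ with g itself, which is bounded a priori, so it joins the
      -- constant part of the recursion. The remaining terms carry the vanishing factor m^(1-σ).
      rw [Finset.sum_Ico_succ_top hm]
      have h1 : ∑ i ∈ Finset.Ico 1 m,
          (m.choose i : ℝ) * ‖iteratedDeriv i f v‖ * ‖iteratedDeriv (m - i) g v‖ ≤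
          C * c * (8 * (m : ℝ) ^ (1 - σ) * gevreyWeight σ M m) := by
        have hmid := mul_le_mul_of_nonneg_left
          (sum_middle_choose_mul_gevreyWeight_le hσ.le hM m) (mul_nonneg h0 hc)
        rw [Finset.mul_sum] at hmid
        refine le_trans (Finset.sum_le_sum fun i hi' => ?_) hmid
        · obtain ⟨hi1, hi2⟩ := Finset.mem_Ico.mp hi'
          have hWi := gevreyWeight_pos (σ := σ) hM i
          have h3 := hi (m - i) (by omega)
          rw [div_le_iff₀ (gevreyWeight_pos hM _)] at h3
          calc (m.choose i : ℝ) * ‖iteratedDeriv i f v‖ * ‖iteratedDeriv (m - i) g v‖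
              ≤ (m.choose i : ℝ) * (C * gevreyWeight σ M i) * (c * gevreyWeight σ M (m - i)) := by
                gcongr
                exact hC i v v.2
            _ = _ := by ring
      have h2 : (m.choose m : ℝ) * ‖iteratedDeriv m f v‖ * ‖iteratedDeriv (m - m) g v‖ ≤
          C * gevreyWeight σ M m * B := by
        rw [Nat.choose_self, Nat.cast_one, one_mul, Nat.sub_self, iteratedDeriv_zero]
        have := hB v v.2
        have h4 := hC m v v.2
        gcongr
      calc _ ≤ B * (C * c * (8 * (m : ℝ) ^ (1 - σ) * gevreyWeight σ M m) +
            C * gevreyWeight σ M m * B) := by gcongr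
        _ ≤ _ := by nlinarith [mul_nonneg hB0 hWm.le])
  exact ⟨D, hD0, fun m v hv => (div_le_iff₀ (gevreyWeight_pos hM m)).mp (hD m ⟨v, hv⟩)⟩

/-- Leibniz's rule for the m-th derivative of f g = 1, multiplied from the left by g, isolates g⁽ᵐ⁾.
No commutativity is used, so the lemma applies to algebras of operators. -/
theorem norm_iteratedDeriv_inverse_le {f g : ℝ → A} {m : ℕ} (hm : 1 ≤ m) {v : ℝ}
    (hf : ContDiffAt ℝ ∞ f v) (hg : ContDiffAt ℝ ∞ g v) (hfg : ∀ᶠ x in 𝓝 v, f x * g x = 1)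
    (hgf : g v * f v = 1) : ‖iteratedDeriv m g v‖ ≤ ‖g v‖ * ∑ i ∈ Finset.Ico 1 (m + 1),
      (m.choose i : ℝ) * ‖iteratedDeriv i f v‖ * ‖iteratedDeriv (m - i) g v‖ := by
  have h1 : iteratedDeriv m (fun x => f x * g x) v = 0 := by
    have : (fun x => f x * g x) =ᶠ[𝓝 v] fun _ => (1 : A) := hfg
    rw [this.iteratedDeriv_eq, iteratedDeriv_const, if_neg (by omega)]
  rw [iteratedDeriv_fun_mul (contDiffAt_nat hf m) (contDiffAt_nat hg m),
    Finset.range_eq_Ico, Finset.sum_eq_sum_Ico_succ_bot (by omega)] at h1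
  simp only [Nat.choose_zero_right, Nat.cast_one, one_mul, iteratedDeriv_zero, Nat.sub_zero,
    zero_add] at h1
  have h2 : iteratedDeriv m g v = -(g v * ∑ i ∈ Finset.Ico 1 (m + 1),
      (m.choose i : A) * iteratedDeriv i f v * iteratedDeriv (m - i) g v) := by
    have := congrArg (fun x => g v * x) h1
    simp only [mul_add, ← mul_assoc, hgf, one_mul, mul_zero] at this
    exact eq_neg_of_add_eq_zero_left (by simpa [mul_assoc] using this)
  rw [h2, norm_neg]
  refine (norm_mul_le _ _).trans ?_
  refine mul_le_mul_of_nonneg_left ?_ (norm_nonneg _)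
  refine (norm_sum_le _ _).trans (Finset.sum_le_sum fun i _ => ?_)
  rw [mul_assoc, ← nsmul_eq_mul, ← Nat.cast_smul_eq_nsmul ℝ, norm_smul, Real.norm_natCast, mul_assoc]
  gcongr
  exact norm_mul_le _ _

theorem inverse [CompleteSpace A] (hσ : 1 < σ) (hM : 0 < M) (hU : IsOpen U) {f g : ℝ → A}
    (hf : Gev σ M U f) (hfg : ∀ v ∈ U, f v * g v = 1) (hgf : ∀ v ∈ U, g v * f v = 1)
    {B : ℝ} (hB : ∀ v ∈ U, ‖g v‖ ≤ B) : Gev σ M U g := by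
  have hg : ∀ v ∈ U, ContDiffAt ℝ ∞ g v := by
    intro v hv
    have h1 : g =ᶠ[𝓝 v] fun x => Ring.inverse (f x) := by
      filter_upwards [hU.mem_nhds hv] with x hx
      exact (Ring.inverse_unit ⟨f x, g x, hfg x hx, hgf x hx⟩).symm
    refine ContDiffAt.congr_of_eventuallyEq ?_ h1
    exact ContDiffAt.comp (g := Ring.inverse) v
      (contDiffAt_ringInverse ℝ (⟨f v, g v, hfg v hv, hgf v hv⟩ : Aˣ)) (hf.smooth v hv)
  refine hf.of_recursion hσ hM hg hB fun m hm v hv => ?_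
  refine (norm_iteratedDeriv_inverse_le hm (hf.smooth v hv) (hg v hv) ?_ (hgf v hv)).trans
    (mul_le_mul_of_nonneg_right (hB v hv) (Finset.sum_nonneg fun i _ => by positivity))
  filter_upwards [hU.mem_nhds hv] with x hx using hfg x hx

theorem inv (hσ : 1 < σ) (hM : 0 < M) (hU : IsOpen U) {f : ℝ → ℝ} (hf : Gev σ M U f) {d : ℝ}
    (hd : 0 < d) (h : ∀ v ∈ U, d ≤ |f v|) : Gev σ M U (fun v => (f v)⁻¹) := by
  have h0 : ∀ v ∈ U, f v ≠ 0 := fun v hv h' => by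
    have := h v hv
    rw [h', abs_zero] at this
    linarith
  refine hf.inverse hσ hM hU (fun v hv => mul_inv_cancel₀ (h0 v hv))
    (fun v hv => inv_mul_cancel₀ (h0 v hv)) (B := d⁻¹) fun v hv => ?_
  rw [norm_inv]
  exact inv_anti₀ hd (h v hv)

theorem inv_sqrt (hσ : 1 < σ) (hM : 0 < M) (hU : IsOpen U) {f : ℝ → ℝ} (hf : Gev σ M U f) {d : ℝ}
    (hd : 0 < d) (h : ∀ v ∈ U, d ≤ f v) : Gev σ M U (fun v => (√(f v))⁻¹) := by
  set g := fun v => (√(f v))⁻¹ with hgdef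
  have hfpos : ∀ v ∈ U, 0 < f v := fun v hv => hd.trans_le (h v hv)
  have hg : ∀ v ∈ U, ContDiffAt ℝ ∞ g v := fun v hv =>
    ((hf.smooth v hv).sqrt (hfpos v hv).ne').inv (Real.sqrt_pos.mpr (hfpos v hv)).ne'
  -- One entry of the maximum bounds g = f^(-1/2), the other the factor 1/f in front of the
  -- recursion.
  refine hf.of_recursion hσ hM hg (B := max (√d)⁻¹ d⁻¹) (fun v hv => ?_) ?_
  · refine le_max_of_le_left ?_
    rw [hgdef, Real.norm_eq_abs, abs_of_nonneg (by positivity)]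
    exact inv_anti₀ (Real.sqrt_pos.mpr hd) (Real.sqrt_le_sqrt (h v hv))
  intro m hm v hv
  obtain ⟨n, rfl⟩ : ∃ n, m = n + 1 := ⟨m - 1, by omega⟩
  -- The equation 2fg' + f'g = 0 is linear in g, whereas f g² = 1 would give a quadratic recursion.
  have hode : (fun x => 2 * (f x * deriv g x) + deriv f x * g x) =ᶠ[𝓝 v] fun _ => 0 := by
    filter_upwards [hU.mem_nhds hv] with x hx
    have hfd : HasDerivAt f (deriv f x) x :=
      ((hf.smooth x hx).differentiableAt (by simp)).hasDerivAt
    have hs := (hfd.sqrt (hfpos x hx).ne').inv (Real.sqrt_pos.mpr (hfpos x hx)).ne'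
    rw [show deriv g x = _ from hs.deriv]
    have h1 := Real.sq_sqrt (hfpos x hx).le
    have h2 := Real.sqrt_pos.mpr (hfpos x hx)
    simp only [hgdef]
    rw [h1]
    have h3 := hfpos x hx
    field_simp
    ring
  have hderiv : ∀ {F : ℝ → ℝ}, ContDiffAt ℝ ∞ F v → ContDiffAt ℝ n (deriv F) v := fun h =>
    h.derivWithin (by exact_mod_cast le_top)
  have h1 := hode.iteratedDeriv_eq n
  rw [iteratedDeriv_fun_add (contDiffAt_const.mul ((contDiffAt_nat (hf.smooth v hv) n).mul
    (hderiv (hg v hv)))) ((hderiv (hf.smooth v hv)).mul (contDiffAt_nat (hg v hv) n)),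
    iteratedDeriv_const_mul_field, iteratedDeriv_fun_mul (contDiffAt_nat (hf.smooth v hv) n)
    (hderiv (hg v hv)), iteratedDeriv_fun_mul (hderiv (hf.smooth v hv))
    (contDiffAt_nat (hg v hv) n), iteratedDeriv_const, ite_self,
    Finset.range_eq_Ico, Finset.sum_eq_sum_Ico_succ_bot (by omega)] at h1
  simp only [Nat.choose_zero_right, Nat.cast_one, one_mul, iteratedDeriv_zero, Nat.sub_zero,
    zero_add, ← iteratedDeriv_succ'] at h1
  have h2 : ∑ i ∈ Finset.Ico 1 (n + 1),
      (n.choose i : ℝ) * iteratedDeriv i f v * iteratedDeriv (n - i + 1) g v =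
      ∑ i ∈ Finset.Ico 1 (n + 1 + 1),
      (n.choose i : ℝ) * iteratedDeriv i f v * iteratedDeriv (n + 1 - i) g v := by
    rw [Finset.sum_Ico_succ_top (b := n + 1) (by omega), Nat.choose_succ_self, Nat.cast_zero, zero_mul, zero_mul,
      add_zero]
    refine Finset.sum_congr rfl fun i hi => ?_
    rw [Nat.sub_add_comm (by have := Finset.mem_Ico.mp hi; omega)]
  have h3 : ∑ i ∈ Finset.Ico 0 (n + 1),
      (n.choose i : ℝ) * iteratedDeriv (i + 1) f v * iteratedDeriv (n - i) g v =
      ∑ i ∈ Finset.Ico 1 (n + 1 + 1),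
      (n.choose (i - 1) : ℝ) * iteratedDeriv i f v * iteratedDeriv (n + 1 - i) g v := by
    rw [Finset.sum_Ico_add' (fun i => (n.choose (i - 1) : ℝ) * iteratedDeriv i f v *
      iteratedDeriv (n + 1 - i) g v) 0 (n + 1) 1 |>.symm]
    refine Finset.sum_congr rfl fun i _ => ?_
    simp
  rw [h2, h3] at h1
  have h4 : iteratedDeriv (n + 1) g v = -(f v)⁻¹ * ∑ i ∈ Finset.Ico 1 (n + 1 + 1),
      ((n.choose i : ℝ) + n.choose (i - 1) / 2) * (iteratedDeriv i f v *
        iteratedDeriv (n + 1 - i) g v) := by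
    have : ∑ i ∈ Finset.Ico 1 (n + 1 + 1), ((n.choose i : ℝ) + n.choose (i - 1) / 2) *
        (iteratedDeriv i f v * iteratedDeriv (n + 1 - i) g v) =
      ∑ i ∈ Finset.Ico 1 (n + 1 + 1),
      (n.choose i : ℝ) * iteratedDeriv i f v * iteratedDeriv (n + 1 - i) g v +
      2⁻¹ * ∑ i ∈ Finset.Ico 1 (n + 1 + 1),
      (n.choose (i - 1) : ℝ) * iteratedDeriv i f v * iteratedDeriv (n + 1 - i) g v := by
      rw [Finset.mul_sum, ← Finset.sum_add_distrib]
      refine Finset.sum_congr rfl fun i _ => ?_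
      ring
    rw [this]
    have hfv := (hfpos v hv).ne'
    field_simp
    linarith
  rw [h4, norm_mul, norm_neg, norm_inv, Real.norm_of_nonneg (hfpos v hv).le]
  refine mul_le_mul (le_max_of_le_right (inv_anti₀ hd (h v hv))) ?_ (norm_nonneg _) (by positivity)
  refine (norm_sum_le _ _).trans (Finset.sum_le_sum fun i hi => ?_)
  have hi1 := (Finset.mem_Ico.mp hi).1
  -- By Pascal's rule the coefficient C(n,i) + C(n,i-1)/2 is at most C(n+1,i), as `Gev.of_recursion`
  -- requires.
  have hch : (n + 1).choose i = n.choose (i - 1) + n.choose i := by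
    obtain ⟨j, rfl⟩ : ∃ j, i = j + 1 := ⟨i - 1, by omega⟩
    simp [Nat.choose_succ_succ]
  rw [norm_mul, norm_mul, hch, ← mul_assoc, Real.norm_of_nonneg (by positivity)]
  push_cast
  have : (0 : ℝ) ≤ n.choose (i - 1) := by positivity
  refine mul_le_mul_of_nonneg_right (mul_le_mul_of_nonneg_right ?_ (norm_nonneg _)) (norm_nonneg _)
  linarith

end Gev
end ShearFlow

end

/-! ### Gevrey bounds under differentiation, reciprocals and composition, with explicit radii -/

noncomputable section
namespace ShearFlow

variable {V V' A : Type*} [NormedAddCommGroup V] [NormedSpace ℝ V] [NormedAddCommGroup V']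
  [NormedSpace ℝ V'] [NormedRing A] [NormedAlgebra ℝ A]

theorem gevreyWeight_mono {σ M M' : ℝ} (hM : 0 < M) (h : M ≤ M') (m : ℕ) :
    gevreyWeight σ M m ≤ gevreyWeight σ M' m := by
  unfold gevreyWeight
  gcongr

theorem succ_le_two_pow (m : ℕ) : (m : ℝ) + 1 ≤ 2 ^ m := by
  exact_mod_cast Nat.lt_two_pow_self

theorem factorial_succ_rpow_le {σ : ℝ} (hσ : 0 ≤ σ) (m : ℕ) :
    ((m + 1).factorial : ℝ) ^ σ ≤ ((2 : ℝ) ^ σ) ^ m * (m.factorial : ℝ) ^ σ := by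
  have h0 : (0 : ℝ) ≤ m.factorial := by positivity
  rw [Nat.factorial_succ, Nat.cast_mul, Real.mul_rpow (by positivity) h0]
  gcongr
  rw [← Real.rpow_natCast, ← Real.rpow_mul (by norm_num), mul_comm σ, Real.rpow_mul (by norm_num),
    Real.rpow_natCast]
  refine Real.rpow_le_rpow (by positivity) ?_ hσ
  push_cast
  exact succ_le_two_pow m

theorem Gev.mono {σ M M' : ℝ} {U : Set ℝ} (hM : 0 < M) (h : M ≤ M') {f : ℝ → V}
    (hf : Gev σ M U f) : Gev σ M' U f := by
  obtain ⟨C, h0, hC⟩ := hf.bound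
  exact ⟨hf.smooth, C, h0, fun m v hv => (hC m v hv).trans
    (mul_le_mul_of_nonneg_left (gevreyWeight_mono hM h m) h0)⟩

/-- The extra factor (m+1)^σ of the shifted factorial is at most (2^σ)^m, so a derivative costs the
factor 2^σ in the radius. -/
theorem Gev.deriv {σ M : ℝ} (hσ : 0 ≤ σ) (hM : 0 < M) {U : Set ℝ} {f : ℝ → V}
    (hf : Gev σ M U f) : Gev σ (M * 2 ^ σ) U (deriv f) := by
  obtain ⟨C, h0, hC⟩ := hf.bound
  refine ⟨fun v hv => (hf.smooth v hv).derivWithin (by exact_mod_cast le_top), C * M, by positivity,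
    fun m v hv => ?_⟩
  rw [← iteratedDeriv_succ', mul_assoc]
  refine (hC (m + 1) v hv).trans (mul_le_mul_of_nonneg_left ?_ h0)
  unfold gevreyWeight
  calc M ^ (m + 1) * ((m + 1).factorial : ℝ) ^ σ / (((m + 1 : ℕ) : ℝ) + 1) ^ 2
      ≤ M ^ (m + 1) * (((2 : ℝ) ^ σ) ^ m * (m.factorial : ℝ) ^ σ) / ((m : ℝ) + 1) ^ 2 := by
        gcongr
        · exact factorial_succ_rpow_le hσ m
        · linarith
    _ = _ := by ring

theorem choose_mul_factorial_rpow_le {σ : ℝ} (hσ : 1 ≤ σ) {j n i : ℕ} (hij : i ≤ j) (hjn : j ≤ n) :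
    (j.choose i : ℝ) * ((i.factorial : ℝ) ^ σ * ((n - i).factorial : ℝ) ^ σ) ≤
      (n.factorial : ℝ) ^ σ := by
  have hn : (n.factorial : ℝ) = n.choose i * (i.factorial * (n - i).factorial) := by
    rw [← mul_assoc]
    exact_mod_cast (Nat.choose_mul_factorial_mul_factorial (hij.trans hjn)).symm
  rw [hn, Real.mul_rpow (by positivity) (by positivity), Real.mul_rpow (by positivity) (by positivity)]
  gcongr
  have h1 : (j.choose i : ℝ) ≤ n.choose i := by exact_mod_cast Nat.choose_le_choose i hjn
  have h2 : (1 : ℝ) ≤ n.choose i := by exact_mod_cast Nat.choose_pos (hij.trans hjn)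
  calc (j.choose i : ℝ) ≤ (n.choose i : ℝ) ^ (1 : ℝ) := by rwa [Real.rpow_one]
    _ ≤ _ := Real.rpow_le_rpow_of_exponent_le h2 hσ

theorem sum_half_pow_le (n : ℕ) : ∑ i ∈ Finset.range n, (1 / 2 : ℝ) ^ i ≤ 2 := by
  have := Summable.sum_le_tsum (Finset.range n) (fun i _ => by positivity) summable_geometric_two
  rwa [tsum_geometric_two] at this

/-- A bound on the derivatives of `1 / f` with constants that depend on `f` only through a lower
bound and the bounds on its derivatives of positive order. -/
theorem abs_iteratedDeriv_inv_le {σ K B : ℝ} (hσ : 1 ≤ σ) (hK : 0 < K) (hB : 0 < B) {f : ℝ → ℝ}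
    (hf : ContDiff ℝ ∞ f) (hpos : ∀ x, B⁻¹ ≤ f x)
    (hbd : ∀ i, 1 ≤ i → ∀ x, |iteratedDeriv i f x| ≤ K ^ i * (i.factorial : ℝ) ^ σ) (m : ℕ) (x : ℝ) :
    |iteratedDeriv m (fun x => (f x)⁻¹) x| ≤
      B * (2 * K * (1 + B)) ^ m * (m.factorial : ℝ) ^ σ := by
  have hf0 : ∀ x, 0 < f x := fun x => (inv_pos.mpr hB).trans_le (hpos x)
  have hg : ContDiff ℝ ∞ (fun x => (f x)⁻¹) := hf.inv fun x => (hf0 x).ne'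
  have hgB : ∀ x, |(f x)⁻¹| ≤ B := fun x => by
    rw [abs_inv, abs_of_pos (hf0 x)]
    exact inv_le_of_inv_le₀ hB (hpos x)
  -- The factor 2 turns the Leibniz sum into a geometric one, and 1+B leaves B/(1+B) ≤ 1, which
  -- closes the induction.
  set M := 2 * K * (1 + B) with hMdef
  have hM : 0 < M := by positivity
  induction m using Nat.strong_induction_on with
  | _ m ih =>
    rcases Nat.eq_zero_or_pos m with rfl | hm
    · simpa using hgB x
    have h1 := Gev.norm_iteratedDeriv_inverse_le hm hf.contDiffAt hg.contDiffAt
      (Eventually.of_forall fun x => mul_inv_cancel₀ (hf0 x).ne') (inv_mul_cancel₀ (hf0 x).ne')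
      (v := x)
    simp only [Real.norm_eq_abs] at h1
    refine h1.trans ?_
    have h2 : ∀ i ∈ Finset.Ico 1 (m + 1), (m.choose i : ℝ) * |iteratedDeriv i f x| *
        |iteratedDeriv (m - i) (fun x => (f x)⁻¹) x| ≤
        B * M ^ m * (m.factorial : ℝ) ^ σ * (1 / (2 * (1 + B)) * (1 / 2) ^ (i - 1)) := by
      intro i hi
      obtain ⟨hi1, hi2⟩ := Finset.mem_Ico.mp hi
      have hKM : K ^ i ≤ M ^ i * (1 / (2 * (1 + B)) * (1 / 2) ^ (i - 1)) := by
        obtain ⟨j, rfl⟩ : ∃ j, i = j + 1 := ⟨i - 1, by omega⟩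
        rw [Nat.add_sub_cancel, pow_succ, pow_succ, hMdef]
        have h3 : K ^ j ≤ (2 * K * (1 + B)) ^ j * (1 / 2) ^ j := by
          rw [← mul_pow]
          gcongr
          nlinarith
        calc K ^ j * K ≤ ((2 * K * (1 + B)) ^ j * (1 / 2) ^ j) * K := by gcongr
          _ = _ := by field_simp
      have hMs : M ^ m = M ^ i * M ^ (m - i) := by
        rw [← pow_add]; congr 1; omega
      calc (m.choose i : ℝ) * |iteratedDeriv i f x| *
        |iteratedDeriv (m - i) (fun x => (f x)⁻¹) x| ≤ (m.choose i : ℝ) *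
          (K ^ i * (i.factorial : ℝ) ^ σ) * (B * M ^ (m - i) * ((m - i).factorial : ℝ) ^ σ) := by
            gcongr
            · exact hbd i hi1 x
            · exact ih (m - i) (by omega)
        _ = B * M ^ (m - i) * K ^ i *
          ((m.choose i : ℝ) * ((i.factorial : ℝ) ^ σ * ((m - i).factorial : ℝ) ^ σ)) := by ring
        _ ≤ B * M ^ (m - i) * (M ^ i * (1 / (2 * (1 + B)) * (1 / 2) ^ (i - 1))) *
          (m.factorial : ℝ) ^ σ := by
            gcongr
            exact choose_mul_factorial_rpow_le hσ (by omega) le_rfl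
        _ = _ := by rw [hMs]; ring
    calc |(f x)⁻¹| * _ ≤ B * ∑ i ∈ Finset.Ico 1 (m + 1),
          B * M ^ m * (m.factorial : ℝ) ^ σ * (1 / (2 * (1 + B)) * (1 / 2) ^ (i - 1)) := by
          exact mul_le_mul (hgB x) (Finset.sum_le_sum h2)
            (Finset.sum_nonneg fun i _ => by positivity) hB.le
      _ = B * (B * M ^ m * (m.factorial : ℝ) ^ σ) * (1 / (2 * (1 + B))) *
          ∑ i ∈ Finset.range m, (1 / 2 : ℝ) ^ i := by
          rw [← Finset.mul_sum, ← Finset.mul_sum, Finset.sum_Ico_eq_sum_range]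
          simp only [Nat.add_sub_cancel, Nat.add_sub_cancel_left]
          ring
      _ ≤ B * (B * M ^ m * (m.factorial : ℝ) ^ σ) * (1 / (2 * (1 + B))) * 2 := by
          gcongr
          exact sum_half_pow_le m
      _ = (B * M ^ m * (m.factorial : ℝ) ^ σ) * (B / (1 + B)) := by field_simp
      _ ≤ _ := mul_le_of_le_one_right (by positivity) (by
          rw [div_le_one (by positivity)]; linarith)

/-- If `y' = g ∘ y`, Gevrey bounds on `f` and `g` carry over to `f ∘ y`. -/
theorem abs_iteratedDeriv_comp_flow_le {σ M B C : ℝ} (hσ : 1 ≤ σ) (hM : 0 < M) (hB : 0 < B)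
    (hC : 0 ≤ C) {f g y : ℝ → ℝ} (hf : ContDiff ℝ ∞ f) (hg : ContDiff ℝ ∞ g)
    (hy : ∀ v, HasDerivAt y (g (y v)) v)
    (hgb : ∀ i x, |iteratedDeriv i g x| ≤ B * (M / 2) ^ i * (i.factorial : ℝ) ^ σ)
    (hfb : ∀ i x, |iteratedDeriv i f x| ≤ C * M ^ i * (i.factorial : ℝ) ^ σ) :
    ContDiff ℝ ∞ (fun v => f (y v)) ∧ ∀ (m : ℕ) (v : ℝ),
      |iteratedDeriv m (fun v => f (y v)) v| ≤ C * (2 * B * M) ^ m * (m.factorial : ℝ) ^ σ := by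
  -- `D m` is (g d/dx)^m f. Because y' = g ∘ y, the m-th derivative of f ∘ y is `D m` ∘ y, and no
  -- formula for higher derivatives of a composition is needed.
  let D : ℕ → ℝ → ℝ := fun m => Nat.rec f (fun _ H x => g x * deriv H x) m
  have hD0 : D 0 = f := rfl
  have hDs : ∀ m, D (m + 1) = fun x => g x * deriv (D m) x := fun m => rfl
  have hDsm : ∀ m, ContDiff ℝ ∞ (D m) := by
    intro m
    induction m with
    | zero => exact hf
    | succ m ih =>
      rw [hDs]
      exact hg.mul (ContDiff.deriv' (ih.of_le (by exact_mod_cast le_top)))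
  have hder : ∀ m v, HasDerivAt (fun v => D m (y v)) (D (m + 1) (y v)) v := by
    intro m v
    have h1 : HasDerivAt (D m) (deriv (D m) (y v)) (y v) :=
      ((hDsm m).differentiable (by simp) _).hasDerivAt
    have := h1.comp v (hy v)
    refine this.congr_deriv ?_
    rw [hDs]
    exact mul_comm _ _
  have hit : ∀ m, iteratedDeriv m (fun v => f (y v)) = fun v => D m (y v) := by
    intro m
    induction m with
    | zero => simp [hD0]
    | succ m ih => rw [iteratedDeriv_succ, ih]; exact funext fun v => (hder m v).deriv
  -- All derivatives of `D m` are controlled at once, with the factorial of the total order m+j. The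
  -- radius M/2 assumed for g supplies the factors (1/2)^i that make the Leibniz sum at most 2.
  have hbound : ∀ m j x, |iteratedDeriv j (D m) x| ≤
      C * (2 * B * M) ^ m * M ^ j * ((m + j).factorial : ℝ) ^ σ := by
    intro m
    induction m with
    | zero => intro j x; simpa [hD0] using hfb j x
    | succ m ih =>
      intro j x
      have hdsm : ContDiff ℝ ∞ (deriv (D m)) :=
        ContDiff.deriv' ((hDsm m).of_le (by exact_mod_cast le_top))
      rw [hDs, iteratedDeriv_fun_mul (contDiffAt_nat hg.contDiffAt j)
        (contDiffAt_nat hdsm.contDiffAt j)]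
      refine (Finset.abs_sum_le_sum_abs _ _).trans ?_
      have h1 : ∀ i ∈ Finset.range (j + 1), |(j.choose i : ℝ) * iteratedDeriv i g x *
          iteratedDeriv (j - i) (deriv (D m)) x| ≤ C * (2 * B * M) ^ m * (B * M ^ (j + 1)) *
          ((m + 1 + j).factorial : ℝ) ^ σ * (1 / 2) ^ i := by
        intro i hi
        have hij : i ≤ j := Nat.lt_succ_iff.mp (Finset.mem_range.mp hi)
        rw [abs_mul, abs_mul, Nat.abs_cast, ← iteratedDeriv_succ']
        have h2 := choose_mul_factorial_rpow_le hσ hij (show j ≤ m + 1 + j by omega)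
        have h3 : m + 1 + j - i = m + (j - i + 1) := by omega
        rw [h3] at h2
        have hMs : M ^ (j + 1) = M ^ i * M ^ (j - i + 1) := by
          rw [← pow_add]; congr 1; omega
        calc (j.choose i : ℝ) * |iteratedDeriv i g x| * |iteratedDeriv (j - i + 1) (D m) x|
            ≤ (j.choose i : ℝ) * (B * (M / 2) ^ i * (i.factorial : ℝ) ^ σ) *
              (C * (2 * B * M) ^ m * M ^ (j - i + 1) * ((m + (j - i + 1)).factorial : ℝ) ^ σ) := by
              gcongr
              · exact hgb i x
              · exact ih _ x
          _ = C * (2 * B * M) ^ m * (B * M ^ (j + 1)) * (1 / 2) ^ i * ((j.choose i : ℝ) *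
              ((i.factorial : ℝ) ^ σ * ((m + (j - i + 1)).factorial : ℝ) ^ σ)) := by
              rw [hMs, div_pow, div_pow]; ring
          _ ≤ C * (2 * B * M) ^ m * (B * M ^ (j + 1)) * (1 / 2) ^ i *
              ((m + 1 + j).factorial : ℝ) ^ σ := by gcongr
          _ = _ := by ring
      refine (Finset.sum_le_sum h1).trans ?_
      rw [← Finset.mul_sum]
      calc _ ≤ C * (2 * B * M) ^ m * (B * M ^ (j + 1)) * ((m + 1 + j).factorial : ℝ) ^ σ * 2 := by
            gcongr
            exact sum_half_pow_le _
        _ = _ := by ring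
  refine ⟨contDiff_of_differentiable_iteratedDeriv fun m _ => ?_, fun m v => ?_⟩
  · rw [hit]
    exact fun v => (hder m v).differentiableAt
  · rw [hit]
    simpa using hbound m 0 (y v)

theorem gev_of_factorial_bound {σ N C : ℝ} (hN : 0 < N) (hC : 0 ≤ C) {f : ℝ → V}
    (hf : ContDiff ℝ ∞ f) (h : ∀ m v, ‖iteratedDeriv m f v‖ ≤ C * N ^ m * (m.factorial : ℝ) ^ σ) :
    Gev σ (4 * N) univ f := by
  refine ⟨fun v _ => hf.contDiffAt, C, hC, fun m v _ => (h m v).trans ?_⟩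
  rw [mul_assoc]
  refine mul_le_mul_of_nonneg_left ?_ hC
  unfold gevreyWeight
  rw [le_div_iff₀ (by positivity), mul_pow]
  have h1 : ((m : ℝ) + 1) ^ 2 ≤ 4 ^ m := by
    calc ((m : ℝ) + 1) ^ 2 ≤ (2 ^ m) ^ 2 := by gcongr; exact succ_le_two_pow m
      _ = 4 ^ m := by rw [← pow_mul, mul_comm, pow_mul]; norm_num
  calc N ^ m * (m.factorial : ℝ) ^ σ * ((m : ℝ) + 1) ^ 2
      ≤ N ^ m * (m.factorial : ℝ) ^ σ * 4 ^ m := by gcongr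
    _ = _ := by ring

theorem Gev.factorial_bound {σ M : ℝ} (hM : 0 < M) {f : ℝ → V} {U : Set ℝ} (hf : Gev σ M U f) :
    ∃ C, 0 ≤ C ∧ ∀ m, ∀ v ∈ U, ‖iteratedDeriv m f v‖ ≤ C * M ^ m * (m.factorial : ℝ) ^ σ := by
  obtain ⟨C, h0, hC⟩ := hf.bound
  refine ⟨C, h0, fun m v hv => (hC m v hv).trans ?_⟩
  rw [mul_assoc]
  refine mul_le_mul_of_nonneg_left (div_le_self (by positivity) ?_) h0
  have : (0 : ℝ) ≤ m := by positivity
  nlinarith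

end ShearFlow

end

noncomputable section
namespace ShearFlow

/-! ### The Banach algebra of continuous functions on `[-1, 1]` -/

/-- Continuous functions on `[-1, 1]`. -/
def SymmC : Type := C(Icc (-1 : ℝ) 1, ℝ)

namespace SymmC

instance : NormedCommRing SymmC := inferInstanceAs (NormedCommRing C(Icc (-1 : ℝ) 1, ℝ))
instance : NormedAlgebra ℝ SymmC := inferInstanceAs (NormedAlgebra ℝ C(Icc (-1 : ℝ) 1, ℝ))
instance : CompleteSpace SymmC := inferInstanceAs (CompleteSpace C(Icc (-1 : ℝ) 1, ℝ))

/-- The underlying continuous map. -/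
def toMap (g : SymmC) : C(Icc (-1 : ℝ) 1, ℝ) := g

/-- A continuous map as an element of `SymmC`. -/
def ofMap (g : C(Icc (-1 : ℝ) 1, ℝ)) : SymmC := g

end SymmC

/-- The value of `g : SymmC` at a real number, after clamping to `[-1, 1]`. -/
def ev (g : SymmC) (s : ℝ) : ℝ := g.toMap (projIcc (-1) 1 (by norm_num) s)

/-- The element of `SymmC` given by a function that is continuous on `[-1, 1]`. -/
def toC (f : ℝ → ℝ) : SymmC :=
  open Classical in
  if h : Continuous fun s : Icc (-1 : ℝ) 1 => f s then SymmC.ofMap ⟨_, h⟩ else 0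

theorem continuous_ev (g : SymmC) : Continuous (ev g) := g.toMap.continuous.comp continuous_projIcc

theorem ev_toC {f : ℝ → ℝ} (hf : ContinuousOn f (Icc (-1) 1)) {s : ℝ} (hs : s ∈ Icc (-1 : ℝ) 1) :
    ev (toC f) s = f s := by
  have h : Continuous fun s : Icc (-1 : ℝ) 1 => f s := continuousOn_iff_continuous_domRestrict.mp hf
  rw [ev, toC, dif_pos h, projIcc_of_mem _ hs]
  rfl

@[simp] theorem ev_add (f g : SymmC) (s : ℝ) : ev (f + g) s = ev f s + ev g s := rfl
@[simp] theorem ev_sub (f g : SymmC) (s : ℝ) : ev (f - g) s = ev f s - ev g s := rfl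
@[simp] theorem ev_neg (f : SymmC) (s : ℝ) : ev (-f) s = -ev f s := rfl
@[simp] theorem ev_mul (f g : SymmC) (s : ℝ) : ev (f * g) s = ev f s * ev g s := rfl
@[simp] theorem ev_smul (c : ℝ) (g : SymmC) (s : ℝ) : ev (c • g) s = c * ev g s := rfl
@[simp] theorem ev_one (s : ℝ) : ev 1 s = 1 := rfl
@[simp] theorem ev_zero (s : ℝ) : ev 0 s = 0 := rfl
@[simp] theorem ev_pow (g : SymmC) (n : ℕ) (s : ℝ) : ev (g ^ n) s = ev g s ^ n := rfl

theorem symmC_ext {f g : SymmC} (h : ∀ s ∈ Icc (-1 : ℝ) 1, ev f s = ev g s) : f = g := by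
  refine ContinuousMap.ext (f := f.toMap) (g := g.toMap) fun s => ?_
  have := h s s.2
  simpa [ev, projIcc_val] using this

theorem abs_ev_le (g : SymmC) (s : ℝ) : |ev g s| ≤ ‖g‖ := g.toMap.norm_coe_le_norm _

theorem symmC_norm_le {g : SymmC} {C : ℝ} (hC : 0 ≤ C) (h : ∀ s ∈ Icc (-1 : ℝ) 1, |ev g s| ≤ C) :
    ‖g‖ ≤ C := by
  refine (ContinuousMap.norm_le g.toMap hC).mpr fun s => ?_
  have := h s s.2
  simpa [ev, projIcc_val] using this

/-- Evaluation at a point as a continuous linear functional. -/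
def evL (s : ℝ) : SymmC →L[ℝ] ℝ :=
  LinearMap.mkContinuous
    { toFun := fun g => ev g s, map_add' := fun _ _ => rfl, map_smul' := fun _ _ => rfl } 1
    fun g => by rw [one_mul]; exact abs_ev_le g s

/-- The coordinate function. -/
def idC : SymmC := toC id

theorem ev_idC {s : ℝ} (hs : s ∈ Icc (-1 : ℝ) 1) : ev idC s = s := ev_toC continuousOn_id hs

theorem mul_mem_symm {r s : ℝ} (hr : r ∈ Icc (0 : ℝ) 1) (hs : s ∈ Icc (-1 : ℝ) 1) :
    r * s ∈ Icc (-1 : ℝ) 1 := by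
  obtain ⟨h1, h2⟩ := hr
  obtain ⟨h3, h4⟩ := hs
  constructor <;> nlinarith

theorem continuous_avg (j : ℕ) (g : SymmC) :
    Continuous fun s => ∫ r in (0 : ℝ)..1, r ^ j * ev g (r * s) := by
  refine intervalIntegral.continuous_parametric_intervalIntegral_of_continuous' ?_ _ _
  exact (continuous_snd.pow j).mul ((continuous_ev g).comp (continuous_snd.mul continuous_fst))

theorem avg_integrable (j : ℕ) (g : SymmC) (s : ℝ) :
    IntervalIntegrable (fun r => r ^ j * ev g (r * s)) volume 0 1 :=
  ((continuous_id.pow j).mul ((continuous_ev g).comp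
    (continuous_id.mul continuous_const))).intervalIntegrable _ _

theorem abs_avg_le {j p : ℕ} {D s : ℝ} {g : SymmC} (hs : s ∈ Icc (-1 : ℝ) 1)
    (h : ∀ x ∈ Icc (-1 : ℝ) 1, |ev g x| ≤ D * |x| ^ p) :
    |∫ r in (0 : ℝ)..1, r ^ j * ev g (r * s)| ≤ D * |s| ^ p / (p + j + 1) := by
  have h1 : |∫ r in (0 : ℝ)..1, r ^ j * ev g (r * s)| ≤
      ∫ r in (0 : ℝ)..1, D * |s| ^ p * r ^ (p + j) := by
    rw [← Real.norm_eq_abs]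
    refine intervalIntegral.norm_integral_le_of_norm_le zero_le_one ?_
      ((continuous_const.mul (continuous_id.pow _)).intervalIntegrable _ _)
    refine Eventually.of_forall fun r hr => ?_
    have hr0 : 0 ≤ r := hr.1.le
    have h2 := h (r * s) (mul_mem_symm ⟨hr0, hr.2⟩ hs)
    rw [Real.norm_eq_abs, abs_mul, abs_of_nonneg (pow_nonneg hr0 j)]
    rw [abs_mul, abs_of_nonneg hr0, mul_pow] at h2
    calc r ^ j * |ev g (r * s)| ≤ r ^ j * (D * (r ^ p * |s| ^ p)) := by gcongr
      _ = _ := by ring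
  refine h1.trans (le_of_eq ?_)
  rw [intervalIntegral.integral_const_mul, integral_pow]
  push_cast
  simp
  ring

/-- The averaging operator `(avg j g)(s) = ∫₀¹ r ^ j g(r s) dr`. -/
def avg (j : ℕ) : SymmC →L[ℝ] SymmC :=
  LinearMap.mkContinuous
    { toFun := fun g => toC fun s => ∫ r in (0 : ℝ)..1, r ^ j * ev g (r * s)
      map_add' := fun f g => symmC_ext fun s hs => by
        rw [ev_add, ev_toC (continuous_avg j _).continuousOn hs,
          ev_toC (continuous_avg j _).continuousOn hs, ev_toC (continuous_avg j _).continuousOn hs,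
          ← intervalIntegral.integral_add (avg_integrable j f s) (avg_integrable j g s)]
        simp only [ev_add, mul_add]
      map_smul' := fun c g => symmC_ext fun s hs => by
        rw [ev_toC (continuous_avg j _).continuousOn hs, RingHom.id_apply, ev_smul,
          ev_toC (continuous_avg j _).continuousOn hs, ← intervalIntegral.integral_const_mul]
        simp only [ev_smul, mul_left_comm] } 1
    fun g => by
      rw [one_mul]
      refine symmC_norm_le (norm_nonneg _) fun s hs => ?_
      simp only [LinearMap.coe_mk, AddHom.coe_mk]
      rw [ev_toC (continuous_avg j _).continuousOn hs]
      refine (abs_avg_le (p := 0) hs (D := ‖g‖) fun x _ => by simpa using abs_ev_le g x).trans ?_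
      rw [pow_zero, mul_one]
      exact div_le_self (norm_nonneg _) (by
        have : (0 : ℝ) ≤ j := by positivity
        push_cast; linarith)

theorem ev_avg (j : ℕ) (g : SymmC) {s : ℝ} (hs : s ∈ Icc (-1 : ℝ) 1) :
    ev (avg j g) s = ∫ r in (0 : ℝ)..1, r ^ j * ev g (r * s) :=
  ev_toC (continuous_avg j g).continuousOn hs

/-- The substitution x = rs shows that `avg j` is the primitive of x^j g divided by s^(j+1). It
performs the singular divisions of the problem as bounded operators on C([-1,1]). -/
theorem pow_mul_ev_avg (j : ℕ) (g : SymmC) {s : ℝ} (hs : s ∈ Icc (-1 : ℝ) 1) :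
    s ^ (j + 1) * ev (avg j g) s = ∫ x in (0 : ℝ)..s, x ^ j * ev g x := by
  have := intervalIntegral.smul_integral_comp_mul_right (fun x => x ^ j * ev g x) s (a := 0) (b := 1)
  rw [zero_mul, one_mul] at this
  rw [ev_avg j g hs, ← this, smul_eq_mul, pow_succ, mul_comm (s ^ j), mul_assoc,
    ← intervalIntegral.integral_const_mul]
  congr 1
  refine intervalIntegral.integral_congr fun r _ => ?_
  simp only [mul_pow]
  ring

theorem abs_ev_avg_le {j p : ℕ} {D s : ℝ} {g : SymmC} (hs : s ∈ Icc (-1 : ℝ) 1)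
    (h : ∀ x ∈ Icc (-1 : ℝ) 1, |ev g x| ≤ D * |x| ^ p) :
    |ev (avg j g) s| ≤ D * |s| ^ p / (p + j + 1) := by
  rw [ev_avg j g hs]; exact abs_avg_le hs h

theorem ev_avg_nonneg {j : ℕ} {s : ℝ} {g : SymmC} (hs : s ∈ Icc (-1 : ℝ) 1)
    (h : ∀ x ∈ Icc (-1 : ℝ) 1, 0 ≤ ev g x) : 0 ≤ ev (avg j g) s := by
  rw [ev_avg j g hs]
  refine intervalIntegral.integral_nonneg zero_le_one fun r hr => ?_
  exact mul_nonneg (pow_nonneg hr.1 _) (h _ (mul_mem_symm hr hs))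

/-! ### A Volterra equation -/

/-- The operator `g ↦ κ s² avg₁(α avg₂(β g))`. -/
def volterra (κ : ℝ) (α β : SymmC) : SymmC →L[ℝ] SymmC :=
  κ • (ContinuousLinearMap.mul ℝ SymmC (idC ^ 2) * avg 1 * ContinuousLinearMap.mul ℝ SymmC α *
    avg 2 * ContinuousLinearMap.mul ℝ SymmC β)

theorem volterra_apply (κ : ℝ) (α β g : SymmC) :
    volterra κ α β g = κ • (idC ^ 2 * avg 1 (α * avg 2 (β * g))) := rfl

/-- Each application raises the order of vanishing at s = 0 by two, and integrating the higher power
produces the factor 1/(n+1). Iteration yields 1/n!, so the Neumann series converges whatever the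
size of the coefficients. -/
theorem abs_ev_volterra_le {κ : ℝ} {α β g : SymmC} {D : ℝ} {n : ℕ}
    (h : ∀ x ∈ Icc (-1 : ℝ) 1, |ev g x| ≤ D * |x| ^ (2 * n)) {s : ℝ} (hs : s ∈ Icc (-1 : ℝ) 1) :
    |ev (volterra κ α β g) s| ≤ |κ| * ‖α‖ * ‖β‖ / (n + 1) * D * |s| ^ (2 * (n + 1)) := by
  have hD : ∀ x ∈ Icc (-1 : ℝ) 1, 0 ≤ D * |x| ^ (2 * n) := fun x hx => (abs_nonneg _).trans (h x hx)
  have h1 : ∀ x ∈ Icc (-1 : ℝ) 1, |ev (β * g) x| ≤ (‖β‖ * D) * |x| ^ (2 * n) := fun x hx => by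
    rw [ev_mul, abs_mul, mul_assoc]
    exact mul_le_mul (abs_ev_le β x) (h x hx) (abs_nonneg _) (norm_nonneg _)
  have h2 : ∀ x ∈ Icc (-1 : ℝ) 1, |ev (α * avg 2 (β * g)) x| ≤
      (‖α‖ * (‖β‖ * D)) * |x| ^ (2 * n) := fun x hx => by
    rw [ev_mul, abs_mul, mul_assoc]
    refine mul_le_mul (abs_ev_le α x) ((abs_ev_avg_le hx h1).trans ?_) (abs_nonneg _) (norm_nonneg _)
    refine div_le_self (by rw [mul_assoc]; exact mul_nonneg (norm_nonneg _) (hD x hx)) ?_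
    have : (0 : ℝ) ≤ (2 * n : ℕ) := by positivity
    push_cast at *; linarith
  have h3 := abs_ev_avg_le (j := 1) hs h2
  rw [volterra_apply, ev_smul, ev_mul, ev_pow, ev_idC hs, abs_mul, abs_mul, abs_pow]
  calc |κ| * (|s| ^ 2 * |ev (avg 1 (α * avg 2 (β * g))) s|)
      ≤ |κ| * (|s| ^ 2 * (‖α‖ * (‖β‖ * D) * |s| ^ (2 * n) / ((2 * n : ℕ) + (1 : ℕ) + 1))) := by gcongr
    _ ≤ |κ| * (|s| ^ 2 * (‖α‖ * (‖β‖ * D) * |s| ^ (2 * n) / (n + 1))) := by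
      have := hD s hs
      have h5 : 0 ≤ ‖α‖ * (‖β‖ * D) * |s| ^ (2 * n) := by
        rw [mul_assoc, mul_assoc]; positivity
      gcongr
      push_cast
      have : (0 : ℝ) ≤ n := by positivity
      linarith
    _ = _ := by ring

theorem abs_ev_volterra_pow_le (κ : ℝ) (α β g : SymmC) (n : ℕ) {s : ℝ} (hs : s ∈ Icc (-1 : ℝ) 1) :
    |ev ((volterra κ α β ^ n) g) s| ≤
      (|κ| * ‖α‖ * ‖β‖) ^ n / n.factorial * ‖g‖ * |s| ^ (2 * n) := by
  induction n generalizing s with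
  | zero => simpa using abs_ev_le g s
  | succ n ih =>
    rw [pow_succ', mul_apply_eq_comp]
    refine (abs_ev_volterra_le (fun x hx => ih hx) hs).trans (le_of_eq ?_)
    rw [Nat.factorial_succ]
    push_cast
    have : (n.factorial : ℝ) ≠ 0 := by exact_mod_cast n.factorial_ne_zero
    field_simp
    ring

theorem norm_volterra_pow_le (κ : ℝ) (α β : SymmC) (n : ℕ) :
    ‖volterra κ α β ^ n‖ ≤ (|κ| * ‖α‖ * ‖β‖) ^ n / n.factorial := by
  refine ContinuousLinearMap.opNorm_le_bound _ (by positivity) fun g => ?_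
  refine symmC_norm_le (by positivity) fun s hs => (abs_ev_volterra_pow_le κ α β g n hs).trans ?_
  refine mul_le_of_le_one_right (by positivity) (pow_le_one₀ (abs_nonneg _) ?_)
  exact abs_le.mpr hs

theorem summable_volterra_pow (κ : ℝ) (α β : SymmC) : Summable fun n => volterra κ α β ^ n :=
  Summable.of_norm_bounded (Real.summable_pow_div_factorial _) (norm_volterra_pow_le κ α β)

/-- The resolvent `(1 - volterra κ α β)⁻¹`. -/
def resolvent (κ : ℝ) (α β : SymmC) : SymmC →L[ℝ] SymmC := ∑' n, volterra κ α β ^ n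

theorem resolvent_mul (κ : ℝ) (α β : SymmC) : resolvent κ α β * (1 - volterra κ α β) = 1 :=
  (summable_volterra_pow κ α β).tsum_pow_mul_one_sub

theorem mul_resolvent (κ : ℝ) (α β : SymmC) : (1 - volterra κ α β) * resolvent κ α β = 1 :=
  (summable_volterra_pow κ α β).one_sub_mul_tsum_pow

theorem norm_resolvent_le (κ : ℝ) (α β : SymmC) :
    ‖resolvent κ α β‖ ≤ Real.exp (|κ| * ‖α‖ * ‖β‖) := by
  rw [Real.exp_eq_exp_ℝ, NormedSpace.exp_eq_tsum_div]
  exact tsum_of_norm_bounded (Real.summable_pow_div_factorial _).hasSum (norm_volterra_pow_le κ α β)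

/-- The solution of `Φ = 1 + volterra κ α β Φ`. -/
def volterraSol (κ : ℝ) (α β : SymmC) : SymmC := resolvent κ α β 1

theorem volterraSol_eq (κ : ℝ) (α β : SymmC) :
    volterraSol κ α β = 1 + κ • (idC ^ 2 * avg 1 (α * avg 2 (β * volterraSol κ α β))) := by
  have := congrArg (fun T : SymmC →L[ℝ] SymmC => T 1) (mul_resolvent κ α β)
  simp only [mul_apply_eq_comp, sub_apply,
    one_apply_eq_self] at this
  rw [← volterra_apply]
  exact sub_eq_iff_eq_add.mp this

theorem volterraSol_unique {κ : ℝ} {α β g : SymmC} (h : g = 1 + volterra κ α β g) :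
    g = volterraSol κ α β := by
  have := congrArg (fun T : SymmC →L[ℝ] SymmC => T g) (resolvent_mul κ α β)
  simp only [mul_apply_eq_comp, sub_apply,
    one_apply_eq_self] at this
  rw [← this, volterraSol]
  congr 1
  exact sub_eq_iff_eq_add.mpr h

/-- With nonnegative coefficients every term of the Neumann series is nonnegative, and the term n =
0 equals 1. -/
theorem one_le_ev_volterraSol {κ : ℝ} {α β : SymmC} (hκ : 0 ≤ κ)
    (hα : ∀ s ∈ Icc (-1 : ℝ) 1, 0 ≤ ev α s) (hβ : ∀ s ∈ Icc (-1 : ℝ) 1, 0 ≤ ev β s)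
    {s : ℝ} (hs : s ∈ Icc (-1 : ℝ) 1) : 1 ≤ ev (volterraSol κ α β) s := by
  have hpos : ∀ n : ℕ, ∀ x ∈ Icc (-1 : ℝ) 1, 0 ≤ ev ((volterra κ α β ^ n) 1) x := by
    intro n
    induction n with
    | zero => intro x _; simp
    | succ n ih =>
      intro x hx
      rw [pow_succ', mul_apply_eq_comp, volterra_apply, ev_smul, ev_mul, ev_pow]
      refine mul_nonneg hκ (mul_nonneg (sq_nonneg _) (ev_avg_nonneg hx fun y hy => ?_))
      rw [ev_mul]
      refine mul_nonneg (hα y hy) (ev_avg_nonneg hy fun z hz => ?_)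
      rw [ev_mul]
      exact mul_nonneg (hβ z hz) (ih z hz)
  let L : (SymmC →L[ℝ] SymmC) →L[ℝ] ℝ :=
    (evL s).comp (ContinuousLinearMap.apply ℝ SymmC (1 : SymmC))
  have hsum := (summable_volterra_pow κ α β).hasSum.mapL L
  have hL : ∀ T : SymmC →L[ℝ] SymmC, L T = ev (T 1) s := fun _ => rfl
  simp only [hL] at hsum
  have := le_hasSum hsum 0 fun n _ => hpos n s hs
  simpa [volterraSol, resolvent] using this

theorem Gev.volterra {σ M : ℝ} (hσ : 1 ≤ σ) (hM : 0 < M) {U : Set ℝ} {κ : ℝ → ℝ} {α β : ℝ → SymmC}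
    (hκ : Gev σ M U κ) (hα : Gev σ M U α) (hβ : Gev σ M U β) :
    Gev σ M U fun v => ShearFlow.volterra (κ v) (α v) (β v) := by
  unfold ShearFlow.volterra
  refine Gev.smul (A := SymmC →L[ℝ] SymmC) hσ hM hκ ?_
  refine Gev.mul (A := SymmC →L[ℝ] SymmC) hσ hM (Gev.mul (A := SymmC →L[ℝ] SymmC) hσ hM
    (Gev.mul (A := SymmC →L[ℝ] SymmC) hσ hM (Gev.const hM _) ?_) (Gev.const hM _)) ?_
  · exact hα.clm _
  · exact hβ.clm _

/-- The solution is the resolvent applied to 1, and the resolvent is the inverse of 1 - `volterra`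
in the algebra of bounded operators. `Gev.inverse` applies there, the exponential bound on the
resolvent being uniform on `U`. -/
theorem Gev.volterraSol {σ M : ℝ} (hσ : 1 < σ) (hM : 0 < M) {U : Set ℝ} (hU : IsOpen U)
    {κ : ℝ → ℝ} {α β : ℝ → SymmC} (hκ : Gev σ M U κ) (hα : Gev σ M U α) (hβ : Gev σ M U β) :
    Gev σ M U fun v => ShearFlow.volterraSol (κ v) (α v) (β v) := by
  have h1 : Gev σ M U fun v => 1 - ShearFlow.volterra (κ v) (α v) (β v) :=
    (Gev.const hM _).sub (Gev.volterra hσ.le hM hκ hα hβ)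
  obtain ⟨A, hA0, hA⟩ := hκ.bound
  obtain ⟨B, hB0, hB⟩ := hα.bound
  obtain ⟨D, hD0, hD⟩ := hβ.bound
  have h2 : Gev σ M U fun v => resolvent (κ v) (α v) (β v) := by
    refine h1.inverse hσ hM hU (fun v _ => mul_resolvent _ _ _) (fun v _ => resolvent_mul _ _ _)
      (B := Real.exp (A * B * D)) fun v hv => (norm_resolvent_le _ _ _).trans ?_
    have hA' := hA 0 v hv
    have hB' := hB 0 v hv
    have hD' := hD 0 v hv
    simp only [iteratedDeriv_zero, gevreyWeight_zero, mul_one, Real.norm_eq_abs] at hA' hB' hD'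
    gcongr
  exact h2.clm (ContinuousLinearMap.apply ℝ SymmC (1 : SymmC))

/-! ### Shifts -/

theorem abs_taylor_le {f f' f'' : ℝ → ℝ} (hf : ∀ x, HasDerivAt f (f' x) x)
    (hf' : ∀ x, HasDerivAt f' (f'' x) x) {B : ℝ} (hB : ∀ x, |f'' x| ≤ B) (x y : ℝ) :
    |f y - f x - (y - x) * f' x| ≤ B * (y - x) ^ 2 := by
  have h1 : ∀ z ∈ uIcc x y, ‖f' z - f' x‖ ≤ B * |y - x| := by
    intro z hz
    have := Convex.norm_image_sub_le_of_norm_hasDerivWithin_le (s := univ) (C := B)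
      (fun w _ => (hf' w).hasDerivWithinAt) (fun w _ => hB w) convex_univ (mem_univ x) (mem_univ z)
    refine this.trans ?_
    have hB0 : 0 ≤ B := (abs_nonneg _).trans (hB 0)
    rw [Real.norm_eq_abs]
    exact mul_le_mul_of_nonneg_left (abs_sub_left_of_mem_uIcc hz) hB0
  have h2 := Convex.norm_image_sub_le_of_norm_hasDerivWithin_le (f := fun z => f z - z * f' x)
    (s := uIcc x y) (C := B * |y - x|)
    (fun w _ => ((hf w).sub ((hasDerivAt_id w).mul_const (f' x))).hasDerivWithinAt)
    (fun w hw => by simpa using h1 w hw) (convex_uIcc x y) left_mem_uIcc right_mem_uIcc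
  rw [Real.norm_eq_abs, Real.norm_eq_abs, mul_assoc, ← sq, sq_abs] at h2
  refine le_trans (le_of_eq ?_) h2
  congr 1
  ring

/-- The element `s ↦ f(v + (τ₀ + τ₁ v) s)` of `SymmC`. -/
def shift (τ₀ τ₁ : ℝ) (f : ℝ → ℝ) (v : ℝ) : SymmC := toC fun s => f (v + (τ₀ + τ₁ * v) * s)

theorem ev_shift {τ₀ τ₁ v : ℝ} {f : ℝ → ℝ} (hf : Continuous f) {s : ℝ} (hs : s ∈ Icc (-1 : ℝ) 1) :
    ev (shift τ₀ τ₁ f v) s = f (v + (τ₀ + τ₁ * v) * s) :=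
  ev_toC (hf.comp (by fun_prop)).continuousOn hs

/-- Differentiability in v holds in the supremum norm over s: the Taylor remainder is uniform
because f'' is bounded and |1 + τ₁s| ≤ 2. -/
theorem hasDerivAt_shift {τ₀ τ₁ : ℝ} (hτ : |τ₁| ≤ 1) {f f' f'' : ℝ → ℝ}
    (hf : ∀ x, HasDerivAt f (f' x) x) (hf' : ∀ x, HasDerivAt f' (f'' x) x) {B : ℝ}
    (hB : ∀ x, |f'' x| ≤ B) (c : SymmC) (v : ℝ) :
    HasDerivAt (fun v => c * shift τ₀ τ₁ f v)
      (c * (toC (fun s => 1 + τ₁ * s) * shift τ₀ τ₁ f' v)) v := by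
  have hcf : Continuous f := continuous_iff_continuousAt.mpr fun x => (hf x).continuousAt
  have hcf' : Continuous f' := continuous_iff_continuousAt.mpr fun x => (hf' x).continuousAt
  refine HasDerivAt.const_mul c ?_
  have hB0 : 0 ≤ B := (abs_nonneg _).trans (hB 0)
  rw [hasDerivAt_iff_isLittleO]
  have hO : (fun v' => shift τ₀ τ₁ f v' - shift τ₀ τ₁ f v -
      (v' - v) • (toC (fun s => 1 + τ₁ * s) * shift τ₀ τ₁ f' v)) =O[𝓝 v]
      fun v' => (v' - v) ^ 2 := by
    refine Asymptotics.IsBigO.of_bound (4 * B) (Eventually.of_forall fun v' => ?_)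
    refine symmC_norm_le (by positivity) fun s hs => ?_
    rw [ev_sub, ev_sub, ev_smul, ev_mul, ev_shift hcf hs, ev_shift hcf hs, ev_shift hcf' hs,
      ev_toC (by fun_prop) hs]
    have := abs_taylor_le hf hf' hB (v + (τ₀ + τ₁ * v) * s) (v' + (τ₀ + τ₁ * v') * s)
    have hd : v' + (τ₀ + τ₁ * v') * s - (v + (τ₀ + τ₁ * v) * s) = (v' - v) * (1 + τ₁ * s) := by ring
    rw [hd] at this
    rw [← mul_assoc (v' - v)]
    refine this.trans ?_
    have h1 : (1 + τ₁ * s) ^ 2 ≤ 4 := by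
      have h2 : |τ₁ * s| ≤ 1 := by
        rw [abs_mul]; exact mul_le_one₀ hτ (abs_nonneg _) (abs_le.mpr hs)
      obtain ⟨h3, h4⟩ := abs_le.mp h2
      nlinarith
    rw [mul_pow, Real.norm_of_nonneg (sq_nonneg _)]
    calc B * ((v' - v) ^ 2 * (1 + τ₁ * s) ^ 2) ≤ B * ((v' - v) ^ 2 * 4) := by gcongr
      _ = _ := by ring
  refine hO.trans_isLittleO ?_
  have h : (fun v' : ℝ => (v' - v) * (v' - v)) =o[𝓝 v] fun v' => 1 * (v' - v) := by
    refine Asymptotics.IsLittleO.mul_isBigO ?_ (Asymptotics.isBigO_refl _ _)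
    rw [Asymptotics.isLittleO_one_iff]
    have : Tendsto (fun v' => v' - v) (𝓝 v) (𝓝 (v - v)) := tendsto_id.sub_const v
    rwa [sub_self] at this
  simpa [sq] using h

/-- The m-th derivative in v is (1 + τ₁s)^m f⁽ᵐ⁾ at the shifted point. The first factor is at most
2^m, whence the doubled radius, the same for all admissible τ₀ and τ₁. -/
theorem Gev.shift {σ M : ℝ} (hM : 0 < M) {f : ℝ → ℝ} (hf : Gev σ M univ f) {τ₀ τ₁ : ℝ}
    (hτ : |τ₁| ≤ 1) : Gev σ (2 * M) univ (shift τ₀ τ₁ f) := by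
  have hsm : ContDiff ℝ ∞ f := contDiff_iff_contDiffAt.mpr fun x => hf.smooth x (mem_univ x)
  obtain ⟨C, h0, hC⟩ := hf.bound
  have hd : ∀ m x, HasDerivAt (iteratedDeriv m f) (iteratedDeriv (m + 1) f x) x := fun m x => by
    rw [iteratedDeriv_succ]
    exact (hsm.differentiable_iteratedDeriv m (by exact_mod_cast ENat.natCast_lt_top m) x).hasDerivAt
  have hcont : ∀ m, Continuous (iteratedDeriv m f) := fun m =>
    continuous_iff_continuousAt.mpr fun x => (hd m x).continuousAt
  set c : SymmC := toC (fun s => 1 + τ₁ * s) with hc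
  have hS : ∀ m v, HasDerivAt (fun v => c ^ m * ShearFlow.shift τ₀ τ₁ (iteratedDeriv m f) v)
      (c ^ (m + 1) * ShearFlow.shift τ₀ τ₁ (iteratedDeriv (m + 1) f) v) v := fun m v => by
    have := hasDerivAt_shift (τ₀ := τ₀) hτ (hd m) (hd (m + 1))
      (B := C * gevreyWeight σ M (m + 1 + 1)) (fun x => hC _ x (mem_univ x)) (c ^ m) v
    rwa [← mul_assoc, ← pow_succ] at this
  have hit : ∀ m, iteratedDeriv m (ShearFlow.shift τ₀ τ₁ f) =
      fun v => c ^ m * ShearFlow.shift τ₀ τ₁ (iteratedDeriv m f) v := by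
    intro m
    induction m with
    | zero => simp
    | succ m ih => rw [iteratedDeriv_succ, ih]; exact funext fun v => (hS m v).deriv
  refine ⟨fun v _ => ?_, C, h0, fun m v _ => ?_⟩
  · refine ContDiff.contDiffAt (contDiff_of_differentiable_iteratedDeriv fun m _ => ?_)
    rw [hit]
    exact fun v => (hS m v).differentiableAt
  · have hW : gevreyWeight σ (2 * M) m = 2 ^ m * gevreyWeight σ M m := by
      unfold gevreyWeight; rw [mul_pow]; ring
    have hWp := gevreyWeight_pos (σ := σ) hM m
    rw [hit, hW]
    refine symmC_norm_le (by positivity) fun s hs => ?_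
    rw [ev_mul, ev_pow, hc, ev_toC (by fun_prop) hs, ev_shift (hcont m) hs, abs_mul, abs_pow]
    have h2 : |1 + τ₁ * s| ≤ 2 := by
      have h2 : |τ₁ * s| ≤ 1 := by
        rw [abs_mul]; exact mul_le_one₀ hτ (abs_nonneg _) (abs_le.mpr hs)
      rw [abs_le] at *
      constructor <;> linarith
    calc _ ≤ 2 ^ m * (C * gevreyWeight σ M m) := by
          gcongr
          exact hC m _ (mem_univ _)
      _ = _ := by ring

end ShearFlow

end

noncomputable section
namespace ShearFlow

/-! ### Oscillatory integrals on `[-1, 1]` -/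

/-- The oscillating exponential `e^{iβs}`. -/
def osc (β s : ℝ) : ℂ := Complex.exp (Complex.I * β * s)

theorem norm_osc (β s : ℝ) : ‖osc β s‖ = 1 := by
  rw [osc, show Complex.I * (β : ℂ) * s = ((β * s : ℝ) : ℂ) * Complex.I by push_cast; ring]
  exact Complex.norm_exp_ofReal_mul_I _

theorem continuous_osc (β : ℝ) : Continuous (osc β) := by unfold osc; fun_prop

theorem hasDerivAt_osc (β s : ℝ) : HasDerivAt (osc β) (Complex.I * β * osc β s) s := by
  have h1 : HasDerivAt (fun s : ℝ => Complex.I * (β : ℂ) * (s : ℂ)) (Complex.I * β * 1) s :=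
    (Complex.ofRealCLM.hasDerivAt (x := s)).const_mul _
  have := h1.cexp
  rw [mul_one, mul_comm (Complex.exp _)] at this
  exact this

/-- The point s = 0 is exempt from differentiability, so that integrands containing log|s| are
covered as long as they are continuous. -/
theorem osc_integral_by_parts {a b β : ℝ} (hab : a ≤ b) (hβ : β ≠ 0) {h h' : ℝ → ℝ}
    (hc : ContinuousOn h (Icc a b)) (hd : ∀ s ∈ Ioo a b, s ≠ 0 → HasDerivAt h (h' s) s)
    (hi : IntervalIntegrable h' volume a b) :
    ∫ s in a..b, (h s : ℂ) * osc β s = (Complex.I * β)⁻¹ *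
      ((h b : ℂ) * osc β b - (h a : ℂ) * osc β a - ∫ s in a..b, (h' s : ℂ) * osc β s) := by
  have hβ' : Complex.I * (β : ℂ) ≠ 0 := by simp [hβ]
  have hi' : IntervalIntegrable (fun s => (h' s : ℂ)) volume a b :=
    ⟨hi.1.ofReal, hi.2.ofReal⟩
  have hc' : ContinuousOn (fun s => (h s : ℂ)) (Icc a b) :=
    Complex.continuous_ofReal.comp_continuousOn hc
  have hint1 : IntervalIntegrable (fun s => (h' s : ℂ) * osc β s) volume a b :=
    hi'.mul_continuousOn (continuous_osc β).continuousOn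
  have hint2 : IntervalIntegrable (fun s => (h s : ℂ) * (Complex.I * β * osc β s)) volume a b := by
    refine ContinuousOn.intervalIntegrable ?_
    rw [uIcc_of_le hab]
    exact hc'.mul (continuous_const.mul (continuous_osc β)).continuousOn
  have := integral_eq_of_hasDerivAt_off_countable_of_le (fun s => (h s : ℂ) * osc β s)
    (fun s => (h' s : ℂ) * osc β s + (h s : ℂ) * (Complex.I * β * osc β s)) hab
    (countable_singleton (0 : ℝ)) (hc'.mul (continuous_osc β).continuousOn)
    (fun s hs => ((hd s hs.1 hs.2).ofReal_comp).mul (hasDerivAt_osc β s)) (hint1.add hint2)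
  rw [intervalIntegral.integral_add hint1 hint2] at this
  have h3 : ∫ s in a..b, (h s : ℂ) * (Complex.I * β * osc β s) =
      Complex.I * β * ∫ s in a..b, (h s : ℂ) * osc β s := by
    rw [← intervalIntegral.integral_const_mul]
    exact intervalIntegral.integral_congr fun s _ => by ring
  rw [h3] at this
  rw [eq_inv_mul_iff_mul_eq₀ hβ']
  linear_combination this

theorem norm_osc_integral_le {a b β : ℝ} (hab : a ≤ b) (hβ : β ≠ 0) {h h' : ℝ → ℝ}
    (hc : ContinuousOn h (Icc a b)) (hd : ∀ s ∈ Ioo a b, s ≠ 0 → HasDerivAt h (h' s) s)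
    (hi : IntervalIntegrable h' volume a b) {D : ℝ} (hD : ∫ s in a..b, |h' s| ≤ D) :
    ‖∫ s in a..b, (h s : ℂ) * osc β s‖ ≤ (|h b| + |h a| + D) / |β| := by
  rw [osc_integral_by_parts hab hβ hc hd hi, norm_mul, norm_inv, norm_mul, Complex.norm_I, one_mul,
    Complex.norm_real, Real.norm_eq_abs, inv_mul_eq_div]
  gcongr
  refine (norm_sub_le _ _).trans (add_le_add ((norm_sub_le _ _).trans ?_) ?_)
  · simp [norm_osc]
  · refine (intervalIntegral.norm_integral_le_integral_norm hab).trans (le_trans (le_of_eq ?_) hD)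
    exact intervalIntegral.integral_congr fun s _ => by simp [norm_osc]

/-- Split at δ = 1/|β|. On [0,δ] the integrand is at most |β|, giving 1; on [δ,1] one integration by
parts gives 2. -/
theorem abs_integral_sin_div_le {β : ℝ} (hβ : 1 ≤ |β|) :
    |∫ s in (0 : ℝ)..1, Real.sin (β * s) / s| ≤ 3 := by
  have hβ0 : β ≠ 0 := fun h => by simp [h] at hβ; linarith
  have hβp : 0 < |β| := by positivity
  set δ := |β|⁻¹ with hδ
  have hδ0 : 0 < δ := by positivity
  have hδ1 : δ ≤ 1 := inv_le_one_of_one_le₀ hβ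
  have hb : ∀ s : ℝ, |Real.sin (β * s) / s| ≤ |β| := by
    intro s
    rcases eq_or_ne s 0 with rfl | hs
    · simp
    · rw [abs_div, div_le_iff₀ (abs_pos.mpr hs), ← abs_mul]
      exact Real.abs_sin_le_abs
  have hint : ∀ a b : ℝ, IntervalIntegrable (fun s => Real.sin (β * s) / s) volume a b := by
    intro a b
    refine (intervalIntegrable_const (c := |β|)).mono_fun ?_ (Eventually.of_forall fun s => ?_)
    · exact Measurable.aestronglyMeasurable (by fun_prop)
    · show |Real.sin (β * s) / s| ≤ |(|β|)|
      rw [abs_abs]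
      exact hb s
  rw [← intervalIntegral.integral_add_adjacent_intervals (hint 0 δ) (hint δ 1)]
  have h1 : |∫ s in (0 : ℝ)..δ, Real.sin (β * s) / s| ≤ 1 := by
    have := intervalIntegral.norm_integral_le_of_norm_le_const (a := 0) (b := δ)
      (f := fun s => Real.sin (β * s) / s) (C := |β|) fun s _ => hb s
    rwa [sub_zero, abs_of_pos hδ0, hδ, mul_inv_cancel₀ hβp.ne', Real.norm_eq_abs] at this
  have h2 : |∫ s in δ..1, Real.sin (β * s) / s| ≤ 2 := by
    have hne : ∀ s ∈ Icc δ 1, s ≠ 0 := fun s hs => (hδ0.trans_le hs.1).ne'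
    have hci : ContinuousOn (fun s : ℝ => (s ^ 2)⁻¹) (uIcc δ 1) := by
      rw [uIcc_of_le hδ1]
      exact (continuous_pow 2).continuousOn.inv₀ fun s hs => pow_ne_zero _ (hne s hs)
    have hI : ∫ s in δ..1, |-(s ^ 2)⁻¹| = δ⁻¹ - 1 := by
      have := intervalIntegral.integral_eq_sub_of_hasDerivAt (a := δ) (b := 1)
        (f := fun s => -s⁻¹) (f' := fun s => (s ^ 2)⁻¹) (fun s hs => by
          rw [uIcc_of_le hδ1] at hs
          simpa using (hasDerivAt_inv (hne s hs)).fun_neg) hci.intervalIntegrable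
      rw [show δ⁻¹ - 1 = -(1 : ℝ)⁻¹ - -δ⁻¹ by rw [inv_one]; ring, ← this]
      refine intervalIntegral.integral_congr fun s _ => ?_
      simp only [abs_neg]
      exact abs_of_nonneg (by positivity)
    have h3 := norm_osc_integral_le hδ1 hβ0 (h := fun s => s⁻¹) (h' := fun s => -(s ^ 2)⁻¹)
      (continuousOn_id.inv₀ hne) (fun s hs _ => hasDerivAt_inv (hne s (Ioo_subset_Icc_self hs)))
      hci.intervalIntegrable.neg hI.le
    have h4 : (∫ s in δ..1, ((s⁻¹ : ℝ) : ℂ) * osc β s).im = ∫ s in δ..1, Real.sin (β * s) / s := by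
      have hII : IntervalIntegrable (fun s => ((s⁻¹ : ℝ) : ℂ) * osc β s) volume δ 1 := by
        refine ContinuousOn.intervalIntegrable ?_
        rw [uIcc_of_le hδ1]
        exact (Complex.continuous_ofReal.comp_continuousOn (continuousOn_id.inv₀ hne)).mul
          (continuous_osc β).continuousOn
      have := (Complex.imCLM.intervalIntegral_comp_comm hII)
      rw [← Complex.imCLM_apply, ← this]
      refine intervalIntegral.integral_congr fun s _ => ?_
      simp only [Complex.imCLM_apply, Complex.im_ofReal_mul, osc]
      rw [show Complex.I * (β : ℂ) * s = ((β * s : ℝ) : ℂ) * Complex.I by push_cast; ring,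
        Complex.exp_ofReal_mul_I_im]
      ring
    rw [← h4]
    refine (Complex.abs_im_le_norm _).trans (h3.trans (le_of_eq ?_))
    have : δ⁻¹ = |β| := by rw [hδ, inv_inv]
    rw [inv_one, abs_one, abs_of_pos (inv_pos.mpr hδ0), this]
    field_simp
    ring
  exact (abs_add_le _ _).trans (by linarith)

theorem intervalIntegrable_log_mul {f : ℝ → ℝ} {a b : ℝ} (hf : ContinuousOn f (uIcc a b)) :
    IntervalIntegrable (fun s => Real.log s * f s) volume a b :=
  intervalIntegral.intervalIntegrable_log'.mul_continuousOn hf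

theorem norm_osc_sub_one_le (β s : ℝ) : ‖osc β s - 1‖ ≤ |β| * |s| := by
  rw [osc, show Complex.I * (β : ℂ) * s = Complex.I * ((β * s : ℝ) : ℂ) by push_cast; ring]
  refine (Real.norm_exp_I_mul_ofReal_sub_one_le).trans ?_
  rw [Real.norm_eq_abs, abs_mul]

theorem continuousAt_log_mul_zero {V : Type*} [NormedAddCommGroup V] [NormedSpace ℝ V]
    {f : ℝ → V} {D : ℝ} (h : ∀ᶠ s in 𝓝 0, ‖f s‖ ≤ D * |s|) :
    ContinuousAt (fun s => Real.log s • f s) 0 := by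
  have h0 : Tendsto (fun s : ℝ => D * |s * Real.log s|) (𝓝 0) (𝓝 0) := by
    have h2 : Continuous fun s : ℝ => D * |s * Real.log s| :=
      continuous_const.mul Real.continuous_mul_log.abs
    have h3 := h2.tendsto 0
    rwa [zero_mul, abs_zero, mul_zero] at h3
  rw [ContinuousAt, Real.log_zero, zero_smul]
  refine squeeze_zero_norm' ?_ h0
  filter_upwards [h] with s hs
  rw [norm_smul, abs_mul, Real.norm_eq_abs]
  calc |Real.log s| * ‖f s‖ ≤ |Real.log s| * (D * |s|) := by gcongr
    _ = _ := by ring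

/-- Integrate by parts with the primitive (e^{iβs} - 1)/(iβ), which vanishes at 0 and tames the
logarithm. The remaining integral over s, combined with its reflection, becomes (2/β) ∫₀¹ sin(βs)/s
ds. -/
theorem norm_integral_log_osc_le {β : ℝ} (hβ : 1 ≤ |β|) :
    ‖∫ s in (-1 : ℝ)..1, (Real.log s : ℂ) * osc β s‖ ≤ 6 / |β| := by
  have hβ0 : β ≠ 0 := fun h => by simp [h] at hβ; linarith
  have hβ' : Complex.I * (β : ℂ) ≠ 0 := by simp [hβ0]
  set f : ℝ → ℂ := fun s => Real.log s • ((Complex.I * β)⁻¹ * (osc β s - 1)) with hf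
  set q : ℝ → ℂ := fun s => ((s : ℂ))⁻¹ * ((Complex.I * β)⁻¹ * (osc β s - 1)) with hq
  have hqb : ∀ s, ‖(Complex.I * (β : ℂ))⁻¹ * (osc β s - 1)‖ ≤ 1 * |s| := by
    intro s
    rw [norm_mul, norm_inv, norm_mul, Complex.norm_I, one_mul, Complex.norm_real, Real.norm_eq_abs,
      one_mul, inv_mul_le_iff₀ (by positivity)]
    exact norm_osc_sub_one_le β s
  have hqc : Measurable q := by
    have := (continuous_osc β).measurable
    fun_prop
  have hqi : ∀ a b : ℝ, IntervalIntegrable q volume a b := by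
    intro a b
    refine (intervalIntegrable_const (c := (1 : ℝ))).mono_fun hqc.aestronglyMeasurable
      (Eventually.of_forall fun s => ?_)
    rw [hq]
    simp only
    rw [norm_mul, norm_one, norm_inv, Complex.norm_real, Real.norm_eq_abs]
    rcases eq_or_ne s 0 with rfl | hs
    · simp
    · rw [inv_mul_le_iff₀ (by positivity)]
      simpa using hqb s
  have hlogi : IntervalIntegrable (fun s => (Real.log s : ℂ) * osc β s) volume (-1) 1 := by
    have h : IntervalIntegrable Real.log volume (-1) 1 := intervalIntegral.intervalIntegrable_log'
    exact IntervalIntegrable.mul_continuousOn ⟨h.1.ofReal, h.2.ofReal⟩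
      (continuous_osc β).continuousOn
  have hfc : Continuous f := by
    rw [continuous_iff_continuousAt]
    intro s
    rcases eq_or_ne s 0 with rfl | hs
    · exact continuousAt_log_mul_zero (Eventually.of_forall hqb)
    · exact (Real.continuousAt_log hs).smul
        (continuous_const.mul ((continuous_osc β).sub continuous_const)).continuousAt
  have hftc := integral_eq_of_hasDerivAt_off_countable_of_le f
    (fun s => (Real.log s : ℂ) * osc β s + q s) (show (-1 : ℝ) ≤ 1 by norm_num)
    (countable_singleton (0 : ℝ)) hfc.continuousOn (fun s hs => by
      have h1 := (Real.hasDerivAt_log hs.2).smul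
        (((hasDerivAt_osc β s).sub_const 1).const_mul ((Complex.I * (β : ℂ))⁻¹))
      refine h1.congr_deriv ?_
      rw [hq, inv_mul_cancel_left₀ hβ']
      simp [Complex.real_smul]) (hlogi.add (hqi _ _))
  rw [intervalIntegral.integral_add hlogi (hqi _ _)] at hftc
  -- The boundary terms vanish because `Real.log` is log|s|, hence zero at both s = 1 and s = -1.
  have hf1 : f 1 - f (-1) = 0 := by simp [hf]
  rw [hf1] at hftc
  rw [eq_neg_of_add_eq_zero_left hftc, norm_neg]
  have hsplit : ∫ s in (-1 : ℝ)..1, q s = ∫ s in (0 : ℝ)..1, (q s + q (-s)) := by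
    have hneg : ∫ s in (0 : ℝ)..1, q (-s) = ∫ s in (-1 : ℝ)..0, q s := by
      rw [intervalIntegral.integral_comp_neg, neg_zero]
    have hqi' : IntervalIntegrable (fun s => q (-s)) volume 0 1 := by
      have := (hqi 0 (-1)).comp_sub_left 0
      simpa using this
    rw [intervalIntegral.integral_add (hqi 0 1) hqi', hneg, add_comm,
      intervalIntegral.integral_add_adjacent_intervals (hqi _ _) (hqi _ _)]
  have hsin : ∀ s, q s + q (-s) = (2 * (β : ℂ)⁻¹) * ((Real.sin (β * s) / s : ℝ) : ℂ) := by
    intro s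
    rw [hq]
    have h1 : Complex.sin ((β : ℂ) * s) = (osc β (-s) - osc β s) * Complex.I / 2 := by
      rw [Complex.sin, osc, osc]
      congr 3
      · congr 1; push_cast; ring
      · congr 1; ring
    push_cast
    rw [h1, inv_neg, mul_inv, Complex.inv_I]
    ring
  rw [hsplit, intervalIntegral.integral_congr fun s _ => hsin s,
    intervalIntegral.integral_const_mul, intervalIntegral.integral_ofReal, norm_mul, norm_mul,
    norm_inv, Complex.norm_real, Complex.norm_real, Complex.norm_ofNat, Real.norm_eq_abs,
    Real.norm_eq_abs]
  calc 2 * |β|⁻¹ * |∫ s in (0 : ℝ)..1, Real.sin (β * s) / s| ≤ 2 * |β|⁻¹ * 3 := by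
        gcongr
        exact abs_integral_sin_div_le hβ
    _ = 6 / |β| := by ring

theorem integral_abs_le_of_le {a b D : ℝ} (hab : a ≤ b) {h k : ℝ → ℝ}
    (hi : IntervalIntegrable h volume a b) (hk : IntervalIntegrable k volume a b)
    (hb : ∀ s ∈ Icc a b, |h s| ≤ k s) (hD : ∫ s in a..b, k s = D) : ∫ s in a..b, |h s| ≤ D := by
  rw [← hD]
  exact intervalIntegral.integral_mono_on hab hi.abs hk hb

/-- A function on `[-1,1]` vanishing to second order at the end points, with two derivatives
bounded by `D`. -/
structure Bump (F F₁ F₂ : ℝ → ℝ) (D : ℝ) : Prop where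
  cont : ContinuousOn F (Icc (-1) 1)
  cont₁ : ContinuousOn F₁ (Icc (-1) 1)
  cont₂ : ContinuousOn F₂ (Icc (-1) 1)
  deriv : ∀ s ∈ Ioo (-1 : ℝ) 1, HasDerivAt F (F₁ s) s
  deriv₁ : ∀ s ∈ Ioo (-1 : ℝ) 1, HasDerivAt F₁ (F₂ s) s
  left : F (-1) = 0
  right : F 1 = 0
  left₁ : F₁ (-1) = 0
  right₁ : F₁ 1 = 0
  bound : ∀ s ∈ Icc (-1 : ℝ) 1, |F s| ≤ D
  bound₁ : ∀ s ∈ Icc (-1 : ℝ) 1, |F₁ s| ≤ D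
  bound₂ : ∀ s ∈ Icc (-1 : ℝ) 1, |F₂ s| ≤ D

namespace Bump

variable {F F₁ F₂ : ℝ → ℝ} {D β : ℝ}

theorem norm_integral_le (h : Bump F F₁ F₂ D) (hβ : 1 ≤ |β|) :
    ‖∫ s in (-1 : ℝ)..1, (F s : ℂ) * osc β s‖ ≤ 2 * D / |β| ^ 2 := by
  have hβ0 : β ≠ 0 := fun h => by simp [h] at hβ; linarith
  have h1 : (-1 : ℝ) ≤ 1 := by norm_num
  have hi₁ : IntervalIntegrable F₁ volume (-1) 1 :=
    ContinuousOn.intervalIntegrable (by rw [uIcc_of_le h1]; exact h.cont₁)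
  have hi₂ : IntervalIntegrable F₂ volume (-1) 1 :=
    ContinuousOn.intervalIntegrable (by rw [uIcc_of_le h1]; exact h.cont₂)
  rw [osc_integral_by_parts h1 hβ0 h.cont (fun s hs _ => h.deriv s hs) hi₁, h.left, h.right]
  have h2 := norm_osc_integral_le h1 hβ0 h.cont₁ (fun s hs _ => h.deriv₁ s hs) hi₂
    (integral_abs_le_of_le h1 hi₂ intervalIntegrable_const h.bound₂ (k := fun _ => D) rfl)
  rw [h.left₁, h.right₁, intervalIntegral.integral_const] at h2
  simp only [Complex.ofReal_zero, zero_mul, sub_zero, zero_sub, norm_mul, norm_neg, norm_inv,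
    Complex.norm_I, one_mul, Complex.norm_real, Real.norm_eq_abs]
  rw [abs_zero, zero_add, zero_add, smul_eq_mul] at h2
  calc |β|⁻¹ * _ ≤ |β|⁻¹ * ((1 - -1) * D / |β|) := by gcongr
    _ = _ := by field_simp; ring

/-- Only [0,1] contributes, with integrand sF. The factor s removes the boundary term at 0 in the
first integration by parts; the second one leaves F(0), so the decay is quadratic. -/
theorem norm_integral_pos_le (h : Bump F F₁ F₂ D) (hβ : 1 ≤ |β|) :
    ‖∫ s in (-1 : ℝ)..1, ((max s 0 * F s : ℝ) : ℂ) * osc β s‖ ≤ 4 * D / |β| ^ 2 := by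
  have hβ0 : β ≠ 0 := fun h => by simp [h] at hβ; linarith
  have hI : ∀ a b : ℝ, a ∈ Icc (-1 : ℝ) 1 → b ∈ Icc (-1 : ℝ) 1 →
      IntervalIntegrable (fun s => ((max s 0 * F s : ℝ) : ℂ) * osc β s) volume a b := by
    intro a b ha hb
    refine ContinuousOn.intervalIntegrable ?_
    refine (Complex.continuous_ofReal.comp_continuousOn ?_).mul (continuous_osc β).continuousOn
    refine (continuous_id.max continuous_const).continuousOn.mul (h.cont.mono ?_)
    exact uIcc_subset_Icc ha hb
  have hsub : Icc (0 : ℝ) 1 ⊆ Icc (-1) 1 := Icc_subset_Icc (by norm_num) le_rfl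
  have hsubo : Ioo (0 : ℝ) 1 ⊆ Ioo (-1) 1 := Ioo_subset_Ioo (by norm_num) le_rfl
  have h0 : (0 : ℝ) ≤ 1 := zero_le_one
  have hsplit : ∫ s in (-1 : ℝ)..1, ((max s 0 * F s : ℝ) : ℂ) * osc β s =
      ∫ s in (0 : ℝ)..1, ((s * F s : ℝ) : ℂ) * osc β s := by
    rw [← intervalIntegral.integral_add_adjacent_intervals (hI (-1) 0 (by simp) (by simp))
      (hI 0 1 (by simp) (by simp))]
    rw [show ∫ s in (-1 : ℝ)..0, ((max s 0 * F s : ℝ) : ℂ) * osc β s = 0 from ?_, zero_add]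
    · refine intervalIntegral.integral_congr fun s hs => ?_
      rw [uIcc_of_le h0] at hs
      simp only [max_eq_left hs.1]
    · rw [← intervalIntegral.integral_zero (a := -1) (b := 0) (E := ℂ)]
      refine intervalIntegral.integral_congr fun s hs => ?_
      rw [uIcc_of_le (by norm_num)] at hs
      simp [max_eq_right hs.2]
  have hc := h.cont.mono hsub
  have hc₁ := h.cont₁.mono hsub
  have hc₂ := h.cont₂.mono hsub
  have hi₁ : IntervalIntegrable (fun s => 1 * F s + s * F₁ s) volume 0 1 :=
    ContinuousOn.intervalIntegrable (by
      rw [uIcc_of_le h0]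
      exact (continuousOn_const.mul hc).add (continuousOn_id.mul hc₁))
  have hi₂ : IntervalIntegrable (fun s => 1 * F₁ s + (1 * F₁ s + s * F₂ s)) volume 0 1 :=
    ContinuousOn.intervalIntegrable (by
      rw [uIcc_of_le h0]
      exact (continuousOn_const.mul hc₁).add
        ((continuousOn_const.mul hc₁).add (continuousOn_id.mul hc₂)))
  rw [hsplit, osc_integral_by_parts h0 hβ0 (h := fun s => s * F s) (continuousOn_id.mul hc)
    (fun s hs _ => (hasDerivAt_id s).mul (h.deriv s (hsubo hs))) hi₁]
  have h2 := norm_osc_integral_le h0 hβ0 (h := fun s => 1 * F s + s * F₁ s) ((continuousOn_const.mul hc).add (continuousOn_id.mul hc₁))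
    (fun s hs _ => ((h.deriv s (hsubo hs)).const_mul 1).add
      ((hasDerivAt_id s).mul (h.deriv₁ s (hsubo hs)))) hi₂
    (integral_abs_le_of_le h0 hi₂ intervalIntegrable_const (k := fun _ => 3 * D) (fun s hs => by
      have h3 := abs_le.mp (h.bound₁ s (hsub hs))
      have h4 : |s * F₂ s| ≤ D := by
        rw [abs_mul, abs_of_nonneg hs.1]
        have := h.bound₂ s (hsub hs)
        nlinarith [hs.2, hs.1, abs_nonneg (F₂ s)]
      have h5 := abs_le.mp h4
      rw [abs_le]
      simp only [id]
      constructor <;> linarith) rfl)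
  rw [intervalIntegral.integral_const] at h2
  have hF0 := h.bound 0 (by simp)
  simp only [id, h.right, h.right₁, mul_zero, zero_mul, Complex.ofReal_zero, sub_zero, zero_sub,
    norm_mul, norm_neg, norm_inv, Complex.norm_I, one_mul, Complex.norm_real, Real.norm_eq_abs,
    add_zero, abs_zero, zero_add, smul_eq_mul] at h2 ⊢
  calc |β|⁻¹ * _ ≤ |β|⁻¹ * ((|F 0| + 3 * D) / |β|) := by gcongr
    _ ≤ |β|⁻¹ * ((D + 3 * D) / |β|) := by gcongr
    _ = _ := by field_simp; ring

theorem abs_sub_zero_le (h : Bump F F₁ F₂ D) {s : ℝ} (hs : s ∈ Ioo (-1 : ℝ) 1) :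
    |F s - F 0| ≤ D * |s| := by
  have := Convex.norm_image_sub_le_of_norm_hasDerivWithin_le (s := Ioo (-1 : ℝ) 1)
    (fun w hw => (h.deriv w hw).hasDerivWithinAt)
    (fun w hw => h.bound₁ w (Ioo_subset_Icc_self hw)) (convex_Ioo _ _)
    (show (0 : ℝ) ∈ Ioo (-1 : ℝ) 1 by simp) hs
  simpa using this

/-- One integration by parts leaves log|s|·F and terms of the same or better regularity. Writing F =
(F - F(0)) + F(0), the first part cancels the singularity and can be integrated by parts again,
while the second is `norm_integral_log_osc_le`. -/
theorem norm_integral_log_le (h : Bump F F₁ F₂ D) (hβ : 1 ≤ |β|) :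
    ‖∫ s in (-1 : ℝ)..1, ((s * Real.log s * F s : ℝ) : ℂ) * osc β s‖ ≤
      (14 + 3 * ∫ s in (-1 : ℝ)..1, |Real.log s|) * D / |β| ^ 2 := by
  have hβ0 : β ≠ 0 := fun h => by simp [h] at hβ; linarith
  have h1 : (-1 : ℝ) ≤ 1 := by norm_num
  have hD : 0 ≤ D := (abs_nonneg _).trans (h.bound 0 (by simp))
  set l := ∫ s in (-1 : ℝ)..1, |Real.log s| with hl
  have hlog : IntervalIntegrable Real.log volume (-1) 1 := intervalIntegral.intervalIntegrable_log'
  have hml : ContinuousOn (fun s => s * Real.log s) (Icc (-1) 1) :=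
    Real.continuous_mul_log.continuousOn
  have hmlb : ∀ s ∈ Icc (-1 : ℝ) 1, |s * Real.log s| ≤ 1 := by
    intro s hs
    rcases eq_or_ne s 0 with rfl | hs0
    · simp
    have h2 := Real.abs_log_mul_self_lt |s| (abs_pos.mpr hs0) (abs_le.mpr hs)
    rw [Real.log_abs, abs_mul, abs_abs, mul_comm, ← abs_mul] at h2
    exact h2.le
  have hci : ∀ {f : ℝ → ℝ}, ContinuousOn f (Icc (-1) 1) → IntervalIntegrable f volume (-1) 1 :=
    fun hf => ContinuousOn.intervalIntegrable (by rw [uIcc_of_le h1]; exact hf)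
  have hlci : ∀ {f : ℝ → ℝ}, ContinuousOn f (Icc (-1) 1) →
      IntervalIntegrable (fun s => Real.log s * f s) volume (-1) 1 :=
    fun hf => intervalIntegrable_log_mul (by rw [uIcc_of_le h1]; exact hf)
  have hosc : ∀ {f : ℝ → ℝ}, IntervalIntegrable f volume (-1) 1 →
      IntervalIntegrable (fun s => (f s : ℂ) * osc β s) volume (-1) 1 :=
    fun hf => IntervalIntegrable.mul_continuousOn ⟨hf.1.ofReal, hf.2.ofReal⟩
      (continuous_osc β).continuousOn
  have hdml : ∀ s : ℝ, s ≠ 0 → HasDerivAt (fun s => s * Real.log s) (Real.log s + 1) s :=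
    fun s hs => Real.hasDerivAt_mul_log hs
  -- the first integration by parts
  have hi₁ : IntervalIntegrable (fun s => (Real.log s + 1) * F s + s * Real.log s * F₁ s) volume
      (-1) 1 := by
    have : (fun s => (Real.log s + 1) * F s + s * Real.log s * F₁ s) =
        fun s => Real.log s * F s + F s + s * Real.log s * F₁ s := by ext s; ring
    rw [this]
    exact ((hlci h.cont).add (hci h.cont)).add (hci (hml.mul h.cont₁))
  rw [osc_integral_by_parts h1 hβ0 (h := fun s => s * Real.log s * F s) (hml.mul h.cont)
    (fun s hs hs0 => (hdml s hs0).mul (h.deriv s hs)) hi₁]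
  have hsplit : ∫ s in (-1 : ℝ)..1,
      (((Real.log s + 1) * F s + s * Real.log s * F₁ s : ℝ) : ℂ) * osc β s =
      (∫ s in (-1 : ℝ)..1, ((Real.log s * (F s - F 0) : ℝ) : ℂ) * osc β s) +
      F 0 * (∫ s in (-1 : ℝ)..1, (Real.log s : ℂ) * osc β s) +
      (∫ s in (-1 : ℝ)..1, (F s : ℂ) * osc β s) +
      ∫ s in (-1 : ℝ)..1, ((s * Real.log s * F₁ s : ℝ) : ℂ) * osc β s := by
    have ha := hosc (hlci (h.cont.sub continuousOn_const) : IntervalIntegrable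
      (fun s => Real.log s * (F s - F 0)) volume (-1) 1)
    have hb : IntervalIntegrable (fun s => (F 0 : ℂ) * ((Real.log s : ℂ) * osc β s)) volume (-1) 1 :=
      (hosc hlog).const_mul _
    have hc := hosc (hci h.cont)
    have hd : IntervalIntegrable (fun s => ((s * Real.log s * F₁ s : ℝ) : ℂ) * osc β s) volume
        (-1) 1 := hosc (hci (hml.mul h.cont₁))
    rw [← intervalIntegral.integral_const_mul, ← intervalIntegral.integral_add ha hb,
      ← intervalIntegral.integral_add (ha.add hb) hc,
      ← intervalIntegral.integral_add ((ha.add hb).add hc) hd]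
    refine intervalIntegral.integral_congr fun s _ => ?_
    push_cast
    ring
  have hA : ‖∫ s in (-1 : ℝ)..1, ((Real.log s * (F s - F 0) : ℝ) : ℂ) * osc β s‖ ≤
      (2 * D + D * l) / |β| := by
    have hi : IntervalIntegrable (fun s => s⁻¹ * (F s - F 0) + Real.log s * F₁ s) volume (-1) 1 := by
      refine IntervalIntegrable.add ?_ (hlci h.cont₁)
      refine (intervalIntegrable_const (c := D)).mono_fun ?_ ?_
      · refine AEStronglyMeasurable.mul measurable_inv.aestronglyMeasurable ?_
        rw [uIoc_of_le h1]
        exact ((h.cont.mono Ioc_subset_Icc_self).sub continuousOn_const).aestronglyMeasurable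
          measurableSet_Ioc
      · rw [uIoc_of_le h1, Measure.restrict_congr_set Ioo_ae_eq_Ioc.symm]
        refine (ae_restrict_iff' measurableSet_Ioo).mpr (Eventually.of_forall fun s hs => ?_)
        beta_reduce
        rw [Real.norm_of_nonneg hD, norm_mul, Real.norm_eq_abs, Real.norm_eq_abs, abs_inv]
        rcases eq_or_ne s 0 with rfl | hs0
        · simpa using hD
        · rw [inv_mul_le_iff₀ (abs_pos.mpr hs0), mul_comm]
          exact h.abs_sub_zero_le hs
    have hbd : ∫ s in (-1 : ℝ)..1, |s⁻¹ * (F s - F 0) + Real.log s * F₁ s| ≤ 2 * D + D * l := by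
      have hk : IntervalIntegrable (fun s => D + D * |Real.log s|) volume (-1) 1 :=
        intervalIntegrable_const.add (hlog.abs.const_mul D)
      have : ∫ s in (-1 : ℝ)..1, (D + D * |Real.log s|) = 2 * D + D * l := by
        rw [intervalIntegral.integral_add intervalIntegrable_const (hlog.abs.const_mul D),
          intervalIntegral.integral_const_mul, intervalIntegral.integral_const, smul_eq_mul]
        ring
      rw [← this]
      refine intervalIntegral.integral_mono_on_of_le_Ioo h1 hi.abs hk fun s hs => ?_
      refine (abs_add_le _ _).trans (add_le_add ?_ ?_)
      · rw [abs_mul, abs_inv]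
        rcases eq_or_ne s 0 with rfl | hs0
        · simpa using hD
        · rw [inv_mul_le_iff₀ (abs_pos.mpr hs0), mul_comm]
          exact h.abs_sub_zero_le hs
      · rw [abs_mul, mul_comm]
        gcongr
        exact h.bound₁ s (Ioo_subset_Icc_self hs)
    have hcont : ContinuousOn (fun s => Real.log s * (F s - F 0)) (Icc (-1) 1) := by
      intro s hs
      rcases eq_or_ne s 0 with rfl | hs0
      · refine ContinuousAt.continuousWithinAt ?_
        refine continuousAt_log_mul_zero (f := fun s => F s - F 0) (D := D) ?_
        filter_upwards [Ioo_mem_nhds (show (-1 : ℝ) < 0 by norm_num) (show (0 : ℝ) < 1 by norm_num)]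
          with s hs using h.abs_sub_zero_le hs
      · exact (Real.continuousAt_log hs0).continuousWithinAt.mul ((h.cont s hs).sub_const _)
    have := norm_osc_integral_le h1 hβ0 hcont (fun s hs hs0 =>
      (Real.hasDerivAt_log hs0).mul ((h.deriv s hs).sub_const (F 0))) hi hbd
    simpa using this
  have hB := norm_integral_log_osc_le hβ
  have hC : ‖∫ s in (-1 : ℝ)..1, (F s : ℂ) * osc β s‖ ≤ 2 * D / |β| := by
    have := norm_osc_integral_le h1 hβ0 h.cont (fun s hs _ => h.deriv s hs) (hci h.cont₁)
      (integral_abs_le_of_le h1 (hci h.cont₁) intervalIntegrable_const h.bound₁ (k := fun _ => D) rfl)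
    rw [h.left, h.right, abs_zero, zero_add, zero_add, intervalIntegral.integral_const,
      smul_eq_mul] at this
    refine this.trans (le_of_eq ?_)
    ring
  have hDD : ‖∫ s in (-1 : ℝ)..1, ((s * Real.log s * F₁ s : ℝ) : ℂ) * osc β s‖ ≤
      (4 * D + D * l) / |β| := by
    have hi : IntervalIntegrable (fun s => (Real.log s + 1) * F₁ s + s * Real.log s * F₂ s) volume
        (-1) 1 := by
      have : (fun s => (Real.log s + 1) * F₁ s + s * Real.log s * F₂ s) =
          fun s => Real.log s * F₁ s + F₁ s + s * Real.log s * F₂ s := by ext s; ring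
      rw [this]
      exact ((hlci h.cont₁).add (hci h.cont₁)).add (hci (hml.mul h.cont₂))
    have hk : IntervalIntegrable (fun s => 2 * D + D * |Real.log s|) volume (-1) 1 :=
      intervalIntegrable_const.add (hlog.abs.const_mul D)
    have hkv : ∫ s in (-1 : ℝ)..1, (2 * D + D * |Real.log s|) = 4 * D + D * l := by
      rw [intervalIntegral.integral_add intervalIntegrable_const (hlog.abs.const_mul D),
        intervalIntegral.integral_const,
        intervalIntegral.integral_const_mul D (fun s => |Real.log s|), smul_eq_mul]
      ring
    have := norm_osc_integral_le h1 hβ0 (h := fun s => s * Real.log s * F₁ s) (hml.mul h.cont₁) (fun s hs hs0 =>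
      (hdml s hs0).mul (h.deriv₁ s hs)) hi (integral_abs_le_of_le h1 hi hk (fun s hs => by
        rw [add_mul, one_mul]
        have h3 := h.bound₁ s hs
        have h4 := h.bound₂ s hs
        have h5 : |s * Real.log s * F₂ s| ≤ D := by
          rw [abs_mul]
          nlinarith [hmlb s hs, abs_nonneg (F₂ s), abs_nonneg (s * Real.log s)]
        have h6 : |Real.log s * F₁ s| ≤ D * |Real.log s| := by
          rw [abs_mul, mul_comm]; gcongr
        refine (abs_add_le _ _).trans ?_
        have := abs_add_le (Real.log s * F₁ s) (F₁ s)
        linarith) hkv)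
    rw [h.left₁, h.right₁, mul_zero, mul_zero, abs_zero, zero_add, zero_add] at this
    exact this
  rw [hsplit, h.left, h.right]
  simp only [mul_zero, zero_mul, Complex.ofReal_zero, sub_zero, zero_sub, norm_mul, norm_neg,
    norm_inv, Complex.norm_I, one_mul, Complex.norm_real, Real.norm_eq_abs]
  have hF0 := h.bound 0 (by simp)
  have hl0 : 0 ≤ l := intervalIntegral.integral_nonneg h1 fun s _ => abs_nonneg _
  have hβp : 0 < |β| := by positivity
  have htot : ‖(∫ s in (-1 : ℝ)..1, ((Real.log s * (F s - F 0) : ℝ) : ℂ) * osc β s) +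
      F 0 * (∫ s in (-1 : ℝ)..1, (Real.log s : ℂ) * osc β s) +
      (∫ s in (-1 : ℝ)..1, (F s : ℂ) * osc β s) +
      ∫ s in (-1 : ℝ)..1, ((s * Real.log s * F₁ s : ℝ) : ℂ) * osc β s‖ ≤
      (2 * D + D * l) / |β| + D * (6 / |β|) + 2 * D / |β| + (4 * D + D * l) / |β| := by
    refine (norm_add_le _ _).trans (add_le_add ((norm_add_le _ _).trans (add_le_add
      ((norm_add_le _ _).trans (add_le_add hA ?_)) hC)) hDD)
    rw [norm_mul, Complex.norm_real, Real.norm_eq_abs]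
    gcongr
  calc |β|⁻¹ * _ ≤ |β|⁻¹ * ((2 * D + D * l) / |β| + D * (6 / |β|) + 2 * D / |β| +
        (4 * D + D * l) / |β|) := by gcongr
    _ = (14 + 2 * l) * D / |β| ^ 2 := by field_simp; ring
    _ ≤ _ := by gcongr; linarith

end Bump

end ShearFlow

end

noncomputable section
namespace ShearFlow

/-! ### Oscillatory functionals on continuous functions -/

theorem intervalIntegrable_ev (g : SymmC) (a b : ℝ) : IntervalIntegrable (ev g) volume a b :=
  (continuous_ev g).intervalIntegrable a b

/-- The primitive vanishing at `-1`. -/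
def primC : SymmC →L[ℝ] SymmC :=
  (ContinuousLinearMap.mul ℝ SymmC idC).comp (avg 0) +
    ((evL (-1)).comp (avg 0)).smulRight (1 : SymmC)

theorem ev_primC (g : SymmC) {s : ℝ} (hs : s ∈ Icc (-1 : ℝ) 1) :
    ev (primC g) s = ∫ x in (-1 : ℝ)..s, ev g x := by
  have h : primC g = idC * avg 0 g + ev (avg 0 g) (-1) • 1 := rfl
  have h1 := pow_mul_ev_avg 0 g hs
  have h2 := pow_mul_ev_avg 0 g (s := -1) (by simp)
  simp only [pow_zero, one_mul, zero_add, pow_one] at h1 h2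
  rw [h, ev_add, ev_mul, ev_idC hs, ev_smul, ev_one, mul_one, h1,
    ← intervalIntegral.integral_add_adjacent_intervals (intervalIntegrable_ev g (-1) 0)
      (intervalIntegrable_ev g 0 s), intervalIntegral.integral_symm 0 (-1), ← h2]
  ring

theorem abs_ev_primC_le (g : SymmC) {s : ℝ} (hs : s ∈ Icc (-1 : ℝ) 1) :
    |ev (primC g) s| ≤ 2 * ‖g‖ := by
  rw [ev_primC g hs, ← Real.norm_eq_abs]
  refine (intervalIntegral.norm_integral_le_of_norm_le_const (C := ‖g‖)
    fun x _ => abs_ev_le g x).trans ?_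
  rw [mul_comm, abs_of_nonneg (by linarith [hs.1])]
  gcongr
  linarith [hs.2]

theorem norm_primC_le (g : SymmC) : ‖primC g‖ ≤ 2 * ‖g‖ :=
  symmC_norm_le (by positivity) fun _ hs => abs_ev_primC_le g hs

theorem hasDerivAt_ev_primC (g : SymmC) {s : ℝ} (hs : s ∈ Ioo (-1 : ℝ) 1) :
    HasDerivAt (ev (primC g)) (ev g s) s := by
  have h1 : HasDerivAt (fun s => ∫ x in (-1 : ℝ)..s, ev g x) (ev g s) s :=
    intervalIntegral.integral_hasDerivAt_right (intervalIntegrable_ev g _ _)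
      ((continuous_ev g).stronglyMeasurableAtFilter _ _) (continuous_ev g).continuousAt
  refine h1.congr_of_eventuallyEq ?_
  filter_upwards [Ioo_mem_nhds hs.1 hs.2] with x hx
  exact ev_primC g (Ioo_subset_Icc_self hx)

theorem eq_primC {F F₁ : SymmC}
    (hd : ∀ s ∈ Ioo (-1 : ℝ) 1, s ≠ 0 → HasDerivAt (ev F) (ev F₁ s) s) (h : ev F (-1) = 0) :
    F = primC F₁ := by
  refine symmC_ext fun s hs => ?_
  have := integral_eq_of_hasDerivAt_off_countable_of_le (ev F) (ev F₁) hs.1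
    (countable_singleton (0 : ℝ)) (continuous_ev F).continuousOn
    (fun x hx => hd x ⟨hx.1.1, hx.1.2.trans_le hs.2⟩ hx.2) (intervalIntegrable_ev F₁ _ _)
  rw [ev_primC F₁ hs, this, h, sub_zero]

theorem bump_primC {g : SymmC} (h₁ : ev (primC g) 1 = 0) (h : ev (primC (primC g)) 1 = 0) :
    Bump (ev (primC (primC g))) (ev (primC g)) (ev g) (4 * ‖g‖) where
  cont := (continuous_ev _).continuousOn
  cont₁ := (continuous_ev _).continuousOn
  cont₂ := (continuous_ev _).continuousOn
  deriv _ hs := hasDerivAt_ev_primC _ hs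
  deriv₁ _ hs := hasDerivAt_ev_primC _ hs
  left := by rw [ev_primC _ (by simp), intervalIntegral.integral_same]
  right := h
  left₁ := by rw [ev_primC _ (by simp), intervalIntegral.integral_same]
  right₁ := h₁
  bound s hs := by linarith [abs_ev_primC_le (primC g) hs, norm_primC_le g]
  bound₁ s hs := by linarith [abs_ev_primC_le g hs, norm_nonneg g]
  bound₂ s hs := by linarith [abs_ev_le g s, norm_nonneg g]

theorem intervalIntegrable_ev_osc (g : SymmC) (β : ℝ) :
    IntervalIntegrable (fun s => (ev g s : ℂ) * osc β s) volume (-1) 1 :=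
  ((Complex.continuous_ofReal.comp (continuous_ev g)).mul
    (continuous_osc β)).intervalIntegrable _ _

theorem norm_integral_ev_osc_le (g : SymmC) (β : ℝ) :
    ‖∫ s in (-1 : ℝ)..1, (ev g s : ℂ) * osc β s‖ ≤ 2 * ‖g‖ := by
  refine (intervalIntegral.norm_integral_le_of_norm_le_const (C := ‖g‖) fun s _ => ?_).trans ?_
  · rw [norm_mul, norm_osc, mul_one, Complex.norm_real]
    exact abs_ev_le g s
  · norm_num
    linarith

/-- The functional `g ↦ ∫_{-1}^1 g(s) e^{iβs} ds`. -/
def fourierC (β : ℝ) : SymmC →L[ℝ] ℂ :=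
  LinearMap.mkContinuous
    { toFun := fun g => ∫ s in (-1 : ℝ)..1, (ev g s : ℂ) * osc β s
      map_add' := fun f g => by
        rw [← intervalIntegral.integral_add (intervalIntegrable_ev_osc f β)
          (intervalIntegrable_ev_osc g β)]
        refine intervalIntegral.integral_congr fun s _ => ?_
        simp only [ev_add, Complex.ofReal_add, add_mul]
      map_smul' := fun c g => by
        rw [RingHom.id_apply, ← intervalIntegral.integral_smul]
        refine intervalIntegral.integral_congr fun s _ => ?_
        simp only [ev_smul, Complex.ofReal_mul, Complex.real_smul, mul_assoc] }
    2 fun g => norm_integral_ev_osc_le g β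

theorem fourierC_apply (β : ℝ) (g : SymmC) :
    fourierC β g = ∫ s in (-1 : ℝ)..1, (ev g s : ℂ) * osc β s := rfl

theorem norm_fourierC_le (β : ℝ) (g : SymmC) : ‖fourierC β g‖ ≤ 2 * ‖g‖ :=
  norm_integral_ev_osc_le g β

theorem continuous_fourierC {Y : Type*} [TopologicalSpace Y] {g : Y → SymmC} {β : Y → ℝ}
    (hg : Continuous g) (hβ : Continuous β) : Continuous fun y => fourierC (β y) (g y) := by
  have hosc : ∀ b₁ b₂ s : ℝ, ‖osc b₁ s - osc b₂ s‖ ≤ |b₁ - b₂| * |s| := by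
    intro b₁ b₂ s
    have : osc b₁ s - osc b₂ s = osc b₂ s * (osc (b₁ - b₂) s - 1) := by
      unfold osc
      rw [mul_sub, ← Complex.exp_add, mul_one]
      congr 2
      push_cast
      ring
    rw [this, norm_mul, norm_osc, one_mul]
    exact norm_osc_sub_one_le _ _
  have hb : ∀ (b₁ b₂ : ℝ) (f : SymmC), ‖fourierC b₁ f - fourierC b₂ f‖ ≤ 2 * ‖f‖ * |b₁ - b₂| := by
    intro b₁ b₂ f
    rw [fourierC_apply, fourierC_apply, ← intervalIntegral.integral_sub
      (intervalIntegrable_ev_osc f _) (intervalIntegrable_ev_osc f _)]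
    refine (intervalIntegral.norm_integral_le_of_norm_le_const (C := ‖f‖ * |b₁ - b₂|)
      fun s hs => ?_).trans ?_
    · rw [← mul_sub, norm_mul, Complex.norm_real]
      refine mul_le_mul (abs_ev_le f s) ((hosc _ _ _).trans ?_) (norm_nonneg _) (norm_nonneg _)
      refine mul_le_of_le_one_right (abs_nonneg _) (abs_le.mpr ?_)
      rw [uIoc_of_le (by norm_num)] at hs
      exact ⟨hs.1.le, hs.2⟩
    · norm_num
      linarith
  refine continuous_iff_continuousAt.mpr fun y => ?_
  have h1 : Tendsto (fun z => 2 * ‖g z - g y‖ + 2 * ‖g y‖ * |β z - β y|) (𝓝 y) (𝓝 0) := by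
    have : Continuous fun z => 2 * ‖g z - g y‖ + 2 * ‖g y‖ * |β z - β y| :=
      (continuous_const.mul (hg.sub continuous_const).norm).add
        (continuous_const.mul (hβ.sub continuous_const).abs)
    have h2 := this.tendsto y
    simpa using h2
  refine tendsto_iff_norm_sub_tendsto_zero.mpr (squeeze_zero (fun _ => norm_nonneg _)
    (fun z => ?_) h1)
  calc ‖fourierC (β z) (g z) - fourierC (β y) (g y)‖
      = ‖fourierC (β z) (g z - g y) + (fourierC (β z) (g y) - fourierC (β y) (g y))‖ := by
        rw [map_sub]; congr 1; ring
    _ ≤ _ := (norm_add_le _ _).trans (add_le_add (norm_fourierC_le _ _) (hb _ _ _))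

/-- A weight `w` such that the Fourier transform of `w F` decays quadratically for functions
`F` of class `C²` vanishing to second order at the end points. -/
def QuadWeight (w : SymmC) : Prop :=
  ∃ A, 0 ≤ A ∧ ∀ g : SymmC, ev (primC g) 1 = 0 → ev (primC (primC g)) 1 = 0 →
    ∀ β, ‖fourierC β (w * primC (primC g))‖ ≤ A * ‖g‖ / (1 + β ^ 2)

theorem quadWeight_of_le {w : SymmC} {A : ℝ} (hA : 0 ≤ A)
    (h : ∀ g : SymmC, ev (primC g) 1 = 0 → ev (primC (primC g)) 1 = 0 →
      ∀ β, 1 ≤ |β| → ‖fourierC β (w * primC (primC g))‖ ≤ A * ‖g‖ / |β| ^ 2) : QuadWeight w := by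
  refine ⟨2 * A + 16 * ‖w‖, by positivity, fun g h₁ h₂ β => ?_⟩
  rw [le_div_iff₀ (by positivity)]
  rcases le_total 1 |β| with hβ | hβ
  · have h3 := h g h₁ h₂ β hβ
    have hb : 0 < |β| ^ 2 := by positivity
    rw [le_div_iff₀ hb] at h3
    have h4 : 1 + β ^ 2 ≤ 2 * |β| ^ 2 := by rw [← sq_abs β]; nlinarith
    calc _ ≤ ‖fourierC β (w * primC (primC g))‖ * (2 * |β| ^ 2) := by gcongr
      _ ≤ 2 * (A * ‖g‖) := by linarith
      _ ≤ _ := by nlinarith [mul_nonneg (norm_nonneg w) (norm_nonneg g)]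
  · have h4 : 1 + β ^ 2 ≤ 2 := by rw [← sq_abs β]; nlinarith [abs_nonneg β]
    have h5 : ‖w * primC (primC g)‖ ≤ ‖w‖ * (4 * ‖g‖) :=
      (norm_mul_le _ _).trans (by gcongr; linarith [norm_primC_le g, norm_primC_le (primC g)])
    calc _ ≤ 2 * (‖w‖ * (4 * ‖g‖)) * 2 := by
          gcongr
          exact (norm_fourierC_le _ _).trans (by gcongr)
      _ ≤ _ := by nlinarith [mul_nonneg hA (norm_nonneg g)]

/-- The function `s log |s|`. -/
def logC : SymmC := toC fun s => s * Real.log s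

/-- The function `max s 0`. -/
def posC : SymmC := toC fun s => max s 0

theorem ev_logC {s : ℝ} (hs : s ∈ Icc (-1 : ℝ) 1) : ev logC s = s * Real.log s :=
  ev_toC Real.continuous_mul_log.continuousOn hs

theorem ev_posC {s : ℝ} (hs : s ∈ Icc (-1 : ℝ) 1) : ev posC s = max s 0 :=
  ev_toC (continuous_id.max continuous_const).continuousOn hs

theorem quadWeight_one : QuadWeight 1 :=
  quadWeight_of_le (A := 8) (by norm_num) fun g h₁ h₂ β hβ => by
    have := (bump_primC h₁ h₂).norm_integral_le hβ
    rw [one_mul, fourierC_apply]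
    convert this using 2
    ring

theorem fourierC_mul_eq {w : SymmC} {f : ℝ → ℝ} (hw : ∀ s ∈ Icc (-1 : ℝ) 1, ev w s = f s) (g : SymmC)
    (β : ℝ) : fourierC β (w * g) = ∫ s in (-1 : ℝ)..1, ((f s * ev g s : ℝ) : ℂ) * osc β s := by
  refine intervalIntegral.integral_congr fun s hs => ?_
  rw [uIcc_of_le (by norm_num)] at hs
  simp only [ev_mul, hw s hs]

theorem quadWeight_posC : QuadWeight posC :=
  quadWeight_of_le (A := 16) (by norm_num) fun g h₁ h₂ β hβ => by
    have := (bump_primC h₁ h₂).norm_integral_pos_le hβ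
    rw [fourierC_mul_eq fun s hs => ev_posC hs]
    convert this using 2
    ring

theorem quadWeight_logC : QuadWeight logC := by
  have hl : 0 ≤ ∫ s in (-1 : ℝ)..1, |Real.log s| :=
    intervalIntegral.integral_nonneg (by norm_num) fun s _ => abs_nonneg _
  refine quadWeight_of_le (A := (14 + 3 * ∫ s in (-1 : ℝ)..1, |Real.log s|) * 4) (by positivity)
    fun g h₁ h₂ β hβ => ?_
  have := (bump_primC h₁ h₂).norm_integral_log_le hβ
  rw [fourierC_mul_eq fun s hs => ev_logC hs]
  convert this using 2
  ring

/-! ### Gevrey families of functions of class `C²` -/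

/-- A Gevrey family of functions in `C([-1,1])` that are twice differentiable away from `0`, with
derivatives that extend continuously and form Gevrey families. -/
structure GevC2 (σ M : ℝ) (U : Set ℝ) (F F₁ F₂ : ℝ → SymmC) : Prop where
  gev : Gev σ M U F
  gev₁ : Gev σ M U F₁
  gev₂ : Gev σ M U F₂
  deriv : ∀ v ∈ U, ∀ s ∈ Ioo (-1 : ℝ) 1, s ≠ 0 → HasDerivAt (ev (F v)) (ev (F₁ v) s) s
  deriv₁ : ∀ v ∈ U, ∀ s ∈ Ioo (-1 : ℝ) 1, s ≠ 0 → HasDerivAt (ev (F₁ v)) (ev (F₂ v) s) s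

namespace GevC2

variable {σ M : ℝ} {U : Set ℝ} {F F₁ F₂ G G₁ G₂ : ℝ → SymmC}

theorem add (h : GevC2 σ M U F F₁ F₂) (h' : GevC2 σ M U G G₁ G₂) :
    GevC2 σ M U (fun v => F v + G v) (fun v => F₁ v + G₁ v) (fun v => F₂ v + G₂ v) where
  gev := h.gev.add h'.gev
  gev₁ := h.gev₁.add h'.gev₁
  gev₂ := h.gev₂.add h'.gev₂
  deriv v hv s hs hs0 := (h.deriv v hv s hs hs0).add (h'.deriv v hv s hs hs0)
  deriv₁ v hv s hs hs0 := (h.deriv₁ v hv s hs hs0).add (h'.deriv₁ v hv s hs hs0)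

theorem mul (hσ : 1 ≤ σ) (hM : 0 < M) (h : GevC2 σ M U F F₁ F₂) (h' : GevC2 σ M U G G₁ G₂) :
    GevC2 σ M U (fun v => F v * G v) (fun v => F₁ v * G v + F v * G₁ v)
      (fun v => (F₂ v * G v + F₁ v * G₁ v) + (F₁ v * G₁ v + F v * G₂ v)) where
  gev := h.gev.mul hσ hM h'.gev
  gev₁ := (h.gev₁.mul hσ hM h'.gev).add (h.gev.mul hσ hM h'.gev₁)
  gev₂ := ((h.gev₂.mul hσ hM h'.gev).add (h.gev₁.mul hσ hM h'.gev₁)).add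
    ((h.gev₁.mul hσ hM h'.gev₁).add (h.gev.mul hσ hM h'.gev₂))
  deriv v hv s hs hs0 := (h.deriv v hv s hs hs0).mul (h'.deriv v hv s hs hs0)
  deriv₁ v hv s hs hs0 :=
    ((h.deriv₁ v hv s hs hs0).mul (h'.deriv v hv s hs hs0)).add
      ((h.deriv v hv s hs hs0).mul (h'.deriv₁ v hv s hs hs0))

theorem smul (hσ : 1 ≤ σ) (hM : 0 < M) {c : ℝ → ℝ} (hc : Gev σ M U c)
    (h : GevC2 σ M U F F₁ F₂) :
    GevC2 σ M U (fun v => c v • F v) (fun v => c v • F₁ v) (fun v => c v • F₂ v) where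
  gev := hc.smul hσ hM h.gev
  gev₁ := hc.smul hσ hM h.gev₁
  gev₂ := hc.smul hσ hM h.gev₂
  deriv v hv s hs hs0 := (h.deriv v hv s hs hs0).const_mul (c v)
  deriv₁ v hv s hs hs0 := (h.deriv₁ v hv s hs hs0).const_mul (c v)

/-- The functions vanish to second order at the end points. -/
structure Vanish (U : Set ℝ) (F F₁ : ℝ → SymmC) : Prop where
  left : ∀ v ∈ U, ev (F v) (-1) = 0
  right : ∀ v ∈ U, ev (F v) 1 = 0
  left₁ : ∀ v ∈ U, ev (F₁ v) (-1) = 0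
  right₁ : ∀ v ∈ U, ev (F₁ v) 1 = 0

theorem Vanish.mul (h : Vanish U F F₁) (G G₁ : ℝ → SymmC) :
    Vanish U (fun v => F v * G v) (fun v => F₁ v * G v + F v * G₁ v) where
  left v hv := by simp [h.left v hv]
  right v hv := by simp [h.right v hv]
  left₁ v hv := by simp [h.left v hv, h.left₁ v hv]
  right₁ v hv := by simp [h.right v hv, h.right₁ v hv]

theorem Vanish.smul (h : Vanish U F F₁) (c : ℝ → ℝ) :
    Vanish U (fun v => c v • F v) (fun v => c v • F₁ v) where
  left v hv := by simp [h.left v hv]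
  right v hv := by simp [h.right v hv]
  left₁ v hv := by simp [h.left₁ v hv]
  right₁ v hv := by simp [h.right₁ v hv]

/-- F is the double primitive of F₂, so its weighted Fourier integral is a fixed continuous linear
functional of F₂(v). Derivatives in v pass through it, and the quadratic gain holds for all of them
with the Gevrey constant of F₂. -/
theorem exists_bound (hU : IsOpen U) (h : GevC2 σ M U F F₁ F₂) (h0 : Vanish U F F₁) {w : SymmC}
    (hw : QuadWeight w) :
    ∃ C, 0 ≤ C ∧ ∀ (β : ℝ) (m : ℕ), ∀ v ∈ U,
      ‖iteratedDeriv m (fun v => fourierC β (w * F v)) v‖ ≤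
        C * gevreyWeight σ M m / (1 + β ^ 2) := by
  obtain ⟨C, hC0, hC⟩ := h.gev₂.bound
  obtain ⟨A, hA0, hA⟩ := hw
  have hF₁ : ∀ v ∈ U, F₁ v = primC (F₂ v) := fun v hv =>
    eq_primC (h.deriv₁ v hv) (h0.left₁ v hv)
  have hF : ∀ v ∈ U, F v = primC (primC (F₂ v)) := fun v hv => by
    rw [← hF₁ v hv]
    exact eq_primC (h.deriv v hv) (h0.left v hv)
  -- The end conditions at s = 1 are linear in F₂ and hold on an open set, so every v-derivative of
  -- F₂ satisfies them too. This makes `QuadWeight` applicable to these derivatives.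
  have hzero : ∀ (Λ : SymmC →L[ℝ] ℝ), (∀ v ∈ U, Λ (F₂ v) = 0) → ∀ (m : ℕ), ∀ v ∈ U,
      Λ (iteratedDeriv m F₂ v) = 0 := by
    intro Λ hΛ m v hv
    rw [← Gev.iteratedDeriv_clm Λ (h.gev₂.smooth v hv) m]
    have : (fun x => Λ (F₂ x)) =ᶠ[𝓝 v] fun _ => 0 := by
      filter_upwards [hU.mem_nhds hv] with x hx using hΛ x hx
    rw [this.iteratedDeriv_eq, iteratedDeriv_const]
    simp
  refine ⟨A * C, by positivity, fun β m v hv => ?_⟩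
  have h1 : (fun v => fourierC β (w * F v)) =ᶠ[𝓝 v] fun v =>
      ((fourierC β).comp ((ContinuousLinearMap.mul ℝ SymmC w).comp (primC.comp primC))) (F₂ v) := by
    filter_upwards [hU.mem_nhds hv] with x hx
    rw [hF x hx]
    rfl
  rw [h1.iteratedDeriv_eq, Gev.iteratedDeriv_clm _ (h.gev₂.smooth v hv)]
  refine (hA _ ?_ ?_ β).trans ?_
  · refine hzero ((evL 1).comp primC) (fun x hx => ?_) m v hv
    have := h0.right₁ x hx
    rw [hF₁ x hx] at this
    exact this
  · refine hzero ((evL 1).comp (primC.comp primC)) (fun x hx => ?_) m v hv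
    have := h0.right x hx
    rw [hF x hx] at this
    exact this
  · rw [mul_assoc A C]
    gcongr
    exact hC m v hv

end GevC2

end ShearFlow

end

noncomputable section
namespace ShearFlow

/-! ### Fourier transforms -/


theorem F2_eq (g : ℝ → ℂ) (η : ℝ) : F2 g η = FourierTransform.fourier g (η / (2 * Real.pi)) := by
  rw [Real.fourier_real_eq_integral_exp_smul, F2]
  refine integral_congr_ae (Eventually.of_forall fun v => ?_)
  simp only [smul_eq_mul]
  rw [mul_comm]
  congr 2
  have : (Real.pi : ℂ) ≠ 0 := by exact_mod_cast Real.pi_ne_zero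
  push_cast
  field_simp

theorem pow_mul_norm_F2_le {g : ℝ → ℂ} {N : ℕ∞} (hg : ContDiff ℝ N g)
    (hi : ∀ n : ℕ, n ≤ N → Integrable (iteratedDeriv n g)) {m : ℕ} (hm : m ≤ N) (η : ℝ) :
    |η| ^ m * ‖F2 g η‖ ≤ ∫ v, ‖iteratedDeriv m g v‖ := by
  have h := congrFun (Real.fourier_iteratedDeriv hg hi hm) (η / (2 * Real.pi))
  rw [← F2_eq, ← F2_eq] at h
  have h2 : ‖F2 (iteratedDeriv m g) η‖ = |η| ^ m * ‖F2 g η‖ := by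
    have hpi : (Real.pi : ℂ) ≠ 0 := by exact_mod_cast Real.pi_ne_zero
    rw [h, norm_smul, norm_pow]
    congr 2
    rw [show 2 * (Real.pi : ℂ) * Complex.I * ((η / (2 * Real.pi) : ℝ) : ℂ) = Complex.I * (η : ℝ) by
      push_cast; field_simp]
    simp
  rw [← h2, F2]
  refine (norm_integral_le_integral_norm _).trans (le_of_eq ?_)
  congr 1
  ext v
  rw [norm_mul, show -Complex.I * (v : ℂ) * η = ((-(v * η) : ℝ) : ℂ) * Complex.I by push_cast; ring,
    Complex.norm_exp_ofReal_mul_I, mul_one]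

theorem F2_inversion {g : ℝ → ℂ} (hc : Continuous g) (hi : Integrable g)
    (hF : Integrable (F2 g)) (v : ℝ) :
    g v = (1 / (2 * Real.pi) : ℂ) * ∫ η : ℝ, F2 g η * Complex.exp (Complex.I * v * η) := by
  have hpi := Real.pi_pos
  have hF' : Integrable (FourierTransform.fourier g : ℝ → ℂ) := by
    have h1 := hF.comp_mul_right' (R := 2 * Real.pi) (by positivity)
    refine h1.congr (Eventually.of_forall fun w => ?_)
    simp only [F2_eq]
    rw [mul_div_cancel_right₀ _ (by positivity)]
  have h2 := congrFun (hc.fourierInv_fourier_eq hi hF') v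
  rw [← h2, Real.fourierInv_eq']
  have h3 := Measure.integral_comp_mul_right
    (fun η : ℝ => F2 g η * Complex.exp (Complex.I * v * η)) (2 * Real.pi)
  rw [abs_of_pos (by positivity)] at h3
  have h4 : ∫ η : ℝ, F2 g η * Complex.exp (Complex.I * v * η) = (2 * Real.pi) •
      ∫ x : ℝ, F2 g (x * (2 * Real.pi)) * Complex.exp (Complex.I * v * ((x * (2 * Real.pi) : ℝ) : ℂ)) := by
    rw [h3, smul_smul, mul_inv_cancel₀ (by positivity), one_smul]
  rw [h4, Complex.real_smul]
  have hpi' : (Real.pi : ℂ) ≠ 0 := by exact_mod_cast Real.pi_ne_zero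
  rw [← mul_assoc, show (1 / (2 * Real.pi) : ℂ) * ((2 * Real.pi : ℝ) : ℂ) = 1 by
    push_cast; field_simp, one_mul]
  refine integral_congr_ae (Eventually.of_forall fun w => ?_)
  simp only [F2_eq, smul_eq_mul]
  rw [mul_div_cancel_right₀ _ (by positivity), mul_comm]
  congr 2
  simp
  ring

/-- Polynomial bounds of every order imply stretched exponential decay. -/
theorem le_exp_of_pow_mul_le {s₀ M C N x : ℝ} (hs : 0 < s₀) (hM : 0 < M) (hC : 0 ≤ C) (hx : 0 ≤ x)
    (h : ∀ m : ℕ, x ^ m * N ≤ C * gevreyWeight (1 / s₀) M m) :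
    N ≤ C * Real.exp 1 * Real.exp (-((Real.exp 1 * M)⁻¹) ^ s₀ * x ^ s₀) := by
  set e₁ := Real.exp 1 with he
  have he0 : 0 < e₁ := Real.exp_pos 1
  have hr0 : (0 : ℝ) ≤ (e₁ * M)⁻¹ := by positivity
  rw [neg_mul, ← Real.mul_rpow hr0 hx]
  set y := ((e₁ * M)⁻¹ * x) ^ s₀ with hy
  have hy0 : 0 ≤ y := by positivity
  -- The nearly optimal order is m ≈ (x/(eM))^{s₀}: then M m^{1/s₀} ≤ x/e, and the bound of order m
  -- gives e^{-m}. Rounding down costs the factor e in the conclusion.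
  set m := ⌊y⌋₊ with hm
  have hmy : (m : ℝ) ≤ y := Nat.floor_le hy0
  have hym : y < m + 1 := Nat.lt_floor_add_one y
  have hexp : Real.exp (-(m : ℝ)) ≤ e₁ * Real.exp (-y) := by
    rw [he, ← Real.exp_add]
    exact Real.exp_le_exp.mpr (by linarith)
  have key : N ≤ C * Real.exp (-(m : ℝ)) := by
    rcases Nat.eq_zero_or_pos m with h0 | h0
    · have := h 0
      rw [gevreyWeight_zero] at this
      rw [h0]
      simpa using this
    have hm0 : (0 : ℝ) < m := by exact_mod_cast h0
    have hx0 : 0 < x := by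
      rcases hx.lt_or_eq with h1 | h1
      · exact h1
      · exfalso
        rw [hy, ← h1, mul_zero, Real.zero_rpow hs.ne'] at hmy
        linarith
    have h2 : (m : ℝ) ^ (1 / s₀) ≤ (e₁ * M)⁻¹ * x := by
      calc (m : ℝ) ^ (1 / s₀) ≤ y ^ (1 / s₀) := by gcongr
        _ = (e₁ * M)⁻¹ * x := by
          rw [hy, ← Real.rpow_mul (by positivity), mul_one_div_cancel hs.ne', Real.rpow_one]
    have h3 : gevreyWeight (1 / s₀) M m ≤ (M * (m : ℝ) ^ (1 / s₀)) ^ m := by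
      unfold gevreyWeight
      rw [mul_pow]
      refine (div_le_self (by positivity) ?_).trans ?_
      · have : (0 : ℝ) ≤ m := hm0.le
        nlinarith
      · gcongr
        rw [← Real.rpow_natCast ((m : ℝ) ^ (1 / s₀)), ← Real.rpow_mul hm0.le, mul_comm (1 / s₀),
          Real.rpow_mul hm0.le, Real.rpow_natCast]
        gcongr
        exact_mod_cast Nat.factorial_le_pow m
    have h4 : M * (m : ℝ) ^ (1 / s₀) ≤ e₁⁻¹ * x := by
      calc M * (m : ℝ) ^ (1 / s₀) ≤ M * ((e₁ * M)⁻¹ * x) := by gcongr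
        _ = _ := by field_simp
    have h5 : x ^ m * N ≤ x ^ m * (C * Real.exp (-(m : ℝ))) := by
      calc x ^ m * N ≤ C * (e₁⁻¹ * x) ^ m := (h m).trans (by gcongr; exact h3.trans (by gcongr))
        _ = _ := by
          rw [mul_pow, inv_pow, he, ← Real.exp_nat_mul, mul_one, ← Real.exp_neg]
          ring
    exact le_of_mul_le_mul_left h5 (by positivity)
  calc N ≤ _ := key
    _ ≤ C * (e₁ * Real.exp (-y)) := by gcongr
    _ = _ := by ring

theorem norm_F2_le_of_gevrey {s₀ M C A B : ℝ} (hs : 0 < s₀) (hM : 0 < M) (hC : 0 ≤ C) (hAB : A ≤ B)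
    {g : ℝ → ℂ} (hg : ContDiff ℝ ∞ g) (hsupp : ∀ v ∉ Icc A B, g v = 0)
    (hb : ∀ m v, ‖iteratedDeriv m g v‖ ≤ C * gevreyWeight (1 / s₀) M m) (η : ℝ) :
    ‖F2 g η‖ ≤ C * (B - A) * Real.exp 1 *
      Real.exp (-((Real.exp 1 * M)⁻¹) ^ s₀ * |η| ^ s₀) := by
  have hz : ∀ (m : ℕ), ∀ v ∉ Icc A B, iteratedDeriv m g v = 0 := by
    intro m v hv
    have : g =ᶠ[𝓝 v] fun _ => 0 := by
      filter_upwards [isClosed_Icc.isOpen_compl.mem_nhds hv] with x hx using hsupp x hx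
    rw [this.iteratedDeriv_eq, iteratedDeriv_const]
    simp
  have hcont : ∀ m : ℕ, Continuous (iteratedDeriv m g) := fun m =>
    hg.continuous_iteratedDeriv m (by exact_mod_cast le_top)
  have hint : ∀ m : ℕ, Integrable (iteratedDeriv m g) := fun m =>
    (hcont m).integrable_of_hasCompactSupport
      (HasCompactSupport.intro isCompact_Icc fun v hv => hz m v hv)
  refine le_exp_of_pow_mul_le hs hM (mul_nonneg hC (by linarith)) (abs_nonneg _) fun m => ?_
  refine (pow_mul_norm_F2_le (N := ⊤) hg (fun n _ => hint n) le_top η).trans ?_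
  rw [← setIntegral_eq_integral_of_forall_compl_eq_zero (s := Icc A B)
    fun v hv => by rw [hz m v hv, norm_zero]]
  have h1 := setIntegral_mono_on (hint m).norm.integrableOn
    (integrableOn_const (C := C * gevreyWeight (1 / s₀) M m) (by simp)) measurableSet_Icc
    (fun v (_ : v ∈ Icc A B) => hb m v)
  refine h1.trans (le_of_eq ?_)
  rw [setIntegral_const, Measure.real, Real.volume_Icc, ENNReal.toReal_ofReal (by linarith),
    smul_eq_mul]
  ring

/-! ### The partial Fourier transform of a Schwartz function -/

/-- Smooth functions on `ℝ × ℝ` all of whose derivatives decay rapidly in the second variable. -/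
structure Decays (g : ℝ × ℝ → ℂ) : Prop where
  smooth : ContDiff ℝ ∞ g
  decay : ∀ n m : ℕ, ∃ C : ℝ, ∀ x : ℝ × ℝ, |x.2| ^ n * ‖iteratedFDeriv ℝ m g x‖ ≤ C

/-- The partial derivative in the second variable. -/
def partialSnd (g : ℝ × ℝ → ℂ) (x : ℝ × ℝ) : ℂ := fderiv ℝ g x (0, 1)

namespace Decays

variable {g : ℝ × ℝ → ℂ}

theorem partialSnd (h : Decays g) : Decays (partialSnd g) := by
  have hs : ContDiff ℝ ∞ (fderiv ℝ g) := h.smooth.fderiv_right (by exact_mod_cast le_top)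
  set L : (ℝ × ℝ →L[ℝ] ℂ) →L[ℝ] ℂ := ContinuousLinearMap.apply ℝ ℂ ((0, 1) : ℝ × ℝ) with hL
  have heq : ShearFlow.partialSnd g = L ∘ fderiv ℝ g := rfl
  refine ⟨heq ▸ L.contDiff.comp hs, fun n m => ?_⟩
  obtain ⟨C, hC⟩ := h.decay n (m + 1)
  refine ⟨‖L‖ * C, fun x => ?_⟩
  have h1 : ‖iteratedFDeriv ℝ m (L ∘ fderiv ℝ g) x‖ ≤ ‖L‖ * ‖iteratedFDeriv ℝ m (fderiv ℝ g) x‖ :=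
    L.norm_iteratedFDeriv_comp_left hs.contDiffAt (by exact_mod_cast le_top)
  rw [norm_iteratedFDeriv_fderiv] at h1
  rw [heq]
  calc _ ≤ |x.2| ^ n * (‖L‖ * ‖iteratedFDeriv ℝ (m + 1) g x‖) := by gcongr
    _ = ‖L‖ * (|x.2| ^ n * ‖iteratedFDeriv ℝ (m + 1) g x‖) := by ring
    _ ≤ _ := by gcongr; exact hC x

theorem exists_bound (h : Decays g) : ∃ C, 0 ≤ C ∧ ∀ x : ℝ × ℝ, ‖g x‖ ≤ C * (1 + x.2 ^ 2)⁻¹ := by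
  obtain ⟨C₀, h0⟩ := h.decay 0 0
  obtain ⟨C₂, h2⟩ := h.decay 2 0
  simp only [norm_iteratedFDeriv_zero] at h0 h2
  have hC : ∀ x : ℝ × ℝ, ‖g x‖ * (1 + x.2 ^ 2) ≤ C₀ + C₂ := fun x => by
    have h3 := h0 x
    have h4 := h2 x
    rw [sq_abs] at h4
    linarith
  refine ⟨C₀ + C₂, le_trans (by positivity) (hC 0), fun x => ?_⟩
  rw [← div_eq_mul_inv, le_div_iff₀ (by positivity)]
  exact hC x

/-- The integral of `g` over one period against the `k`-th character. -/
def coeff (k : ℤ) (g : ℝ × ℝ → ℂ) (v : ℝ) : ℂ :=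
  ∫ z in (0 : ℝ)..(2 * Real.pi), g (z, v) * Complex.exp (-Complex.I * z * k)

theorem norm_character (k : ℤ) (z : ℝ) : ‖Complex.exp (-Complex.I * z * k)‖ = 1 := by
  rw [show -Complex.I * (z : ℂ) * k = ((-(z * k) : ℝ) : ℂ) * Complex.I by push_cast; ring,
    Complex.norm_exp_ofReal_mul_I]

theorem hasDerivAt_coeff (h : Decays g) (k : ℤ) (v : ℝ) :
    HasDerivAt (coeff k g) (coeff k (ShearFlow.partialSnd g) v) v := by
  obtain ⟨C, hC0, hC⟩ := h.partialSnd.exists_bound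
  have hc : Continuous g := h.smooth.continuous
  have hc' : Continuous (ShearFlow.partialSnd g) := h.partialSnd.smooth.continuous
  have hd : ∀ z w : ℝ, HasDerivAt (fun w => g (z, w)) (ShearFlow.partialSnd g (z, w)) w := by
    intro z w
    have h1 : HasFDerivAt g (fderiv ℝ g (z, w)) (z, w) :=
      (h.smooth.differentiable (by simp) _).hasFDerivAt
    exact h1.comp_hasDerivAt w ((hasDerivAt_const w z).prodMk (hasDerivAt_id w))
  refine (intervalIntegral.hasDerivAt_integral_of_dominated_loc_of_deriv_le
    (F := fun w z => g (z, w) * Complex.exp (-Complex.I * z * k))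
    (F' := fun w z => ShearFlow.partialSnd g (z, w) * Complex.exp (-Complex.I * z * k))
    (bound := fun _ => C) (s := univ) univ_mem ?_ ?_ ?_ ?_ intervalIntegrable_const ?_).2
  · exact Eventually.of_forall fun w => Continuous.aestronglyMeasurable (by fun_prop)
  · exact Continuous.intervalIntegrable (by fun_prop) _ _
  · exact Continuous.aestronglyMeasurable (by fun_prop)
  · refine Eventually.of_forall fun z _ w _ => ?_
    rw [norm_mul, norm_character, mul_one]
    refine (hC (z, w)).trans (mul_le_of_le_one_right hC0 (inv_le_one_of_one_le₀ ?_))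
    nlinarith
  · exact Eventually.of_forall fun z _ w _ => (hd z w).mul_const _

theorem integrable_coeff (h : Decays g) (k : ℤ) : Integrable (coeff k g) := by
  obtain ⟨C, hC0, hC⟩ := h.exists_bound
  have hcont : Continuous (coeff k g) :=
    continuous_iff_continuousAt.mpr fun v => (h.hasDerivAt_coeff k v).continuousAt
  refine (integrable_inv_one_add_sq.const_mul (C * (2 * Real.pi))).mono'
    hcont.aestronglyMeasurable (Eventually.of_forall fun v => ?_)
  refine (intervalIntegral.norm_integral_le_of_norm_le_const (C := C * (1 + v ^ 2)⁻¹)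
    fun z _ => ?_).trans (le_of_eq ?_)
  · rw [norm_mul, norm_character, mul_one]
    exact hC (z, v)
  · rw [sub_zero, abs_of_pos Real.two_pi_pos]
    ring

/-- The class `Decays` is stable under ∂_v, so each derivative of a Fourier coefficient is again
such a coefficient and inherits its integrability. -/
theorem iteratedDeriv_coeff (h : Decays g) (k : ℤ) (n : ℕ) :
    ∃ g', Decays g' ∧ iteratedDeriv n (coeff k g) = coeff k g' := by
  induction n with
  | zero => exact ⟨g, h, iteratedDeriv_zero⟩
  | succ n ih =>
    obtain ⟨g', h1, h2⟩ := ih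
    refine ⟨_, h1.partialSnd, ?_⟩
    rw [iteratedDeriv_succ, h2]
    ext v
    exact (h1.hasDerivAt_coeff k v).deriv

theorem integrable_F2_coeff (h : Decays g) (k : ℤ) : Integrable (F2 (coeff k g)) := by
  have hsm : ContDiff ℝ ((2 : ℕ∞) : WithTop ℕ∞) (coeff k g) := by
    refine contDiff_of_differentiable_iteratedDeriv fun m _ => ?_
    obtain ⟨g', h1, h2⟩ := h.iteratedDeriv_coeff k m
    rw [h2]
    exact fun v => (h1.hasDerivAt_coeff k v).differentiableAt
  have hi : ∀ n : ℕ, Integrable (iteratedDeriv n (coeff k g)) := fun n => by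
    obtain ⟨g', h1, h2⟩ := h.iteratedDeriv_coeff k n
    rw [h2]
    exact h1.integrable_coeff k
  have hcont : Continuous (F2 (coeff k g)) := by
    have h1 := (h.integrable_coeff k).aestronglyMeasurable
    refine continuous_of_dominated (bound := fun v => ‖coeff k g v‖) (fun η => ?_)
      (fun η => Eventually.of_forall fun v => ?_) (h.integrable_coeff k).norm
      (Eventually.of_forall fun v => by fun_prop)
    · exact h1.mul (Continuous.aestronglyMeasurable (by fun_prop))
    · rw [norm_mul, show -Complex.I * (v : ℂ) * η = ((-(v * η) : ℝ) : ℂ) * Complex.I by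
        push_cast; ring, Complex.norm_exp_ofReal_mul_I, mul_one]
  have h0 := fun η => pow_mul_norm_F2_le hsm (fun n _ => hi n) (m := 0) (by simp) η
  have h2 := fun η => pow_mul_norm_F2_le hsm (fun n _ => hi n) (m := 2) (by norm_num) η
  refine (integrable_inv_one_add_sq.const_mul ((∫ v, ‖iteratedDeriv 0 (coeff k g) v‖) +
    ∫ v, ‖iteratedDeriv 2 (coeff k g) v‖)).mono' hcont.aestronglyMeasurable
    (Eventually.of_forall fun η => ?_)
  · rw [← div_eq_mul_inv, le_div_iff₀ (by positivity)]
    have h3 := h0 η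
    have h4 := h2 η
    rw [sq_abs] at h4
    linarith

end Decays

theorem F1_eq (f : ℝ → ℝ → ℂ) (k : ℤ) :
    F1 f k = fun v => (1 / (2 * Real.pi) : ℂ) * Decays.coeff k (fun x => f x.1 x.2) v := rfl

theorem F2_const_mul (c : ℂ) (g : ℝ → ℂ) : F2 (fun v => c * g v) = fun η => c * F2 g η := by
  ext η
  rw [F2, F2, ← integral_const_mul]
  simp only [mul_assoc]

theorem IsSchwartz.continuous_F1 {f : ℝ → ℝ → ℂ} (hf : IsSchwartz f) (k : ℤ) :
    Continuous (F1 f k) := by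
  rw [F1_eq]
  exact continuous_const.mul (continuous_iff_continuousAt.mpr fun v =>
    (Decays.hasDerivAt_coeff ⟨hf.smooth, hf.decay⟩ k v).continuousAt)

theorem IsSchwartz.differentiable_F1 {f : ℝ → ℝ → ℂ} (hf : IsSchwartz f) (k : ℤ) :
    Differentiable ℝ (F1 f k) := by
  rw [F1_eq]
  exact fun v =>
    (Decays.hasDerivAt_coeff ⟨hf.smooth, hf.decay⟩ k v).differentiableAt.const_mul _

theorem IsSchwartz.integrable_F1 {f : ℝ → ℝ → ℂ} (hf : IsSchwartz f) (k : ℤ) :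
    Integrable (F1 f k) := by
  rw [F1_eq]
  exact (Decays.integrable_coeff ⟨hf.smooth, hf.decay⟩ k).const_mul _

theorem IsSchwartz.integrable_fhat {f : ℝ → ℝ → ℂ} (hf : IsSchwartz f) (k : ℤ) :
    Integrable (fhat f k) := by
  have : fhat f k = F2 (F1 f k) := rfl
  rw [this, F1_eq, F2_const_mul]
  exact (Decays.integrable_F2_coeff ⟨hf.smooth, hf.decay⟩ k).const_mul _

theorem IsSchwartz.F1_eq_integral_fhat {f : ℝ → ℝ → ℂ} (hf : IsSchwartz f) (k : ℤ) (v : ℝ) :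
    F1 f k v = (1 / (2 * Real.pi) : ℂ) *
      ∫ η : ℝ, fhat f k η * Complex.exp (Complex.I * v * η) :=
  F2_inversion (hf.continuous_F1 k) (hf.integrable_F1 k) (hf.integrable_fhat k) v

/-! ### Kernels of oscillatory operators -/

/-- The Fourier kernel of `h ↦ R ∫_{-1}^1 G(v)(s) e^{-iRbs} h(v + R s) ds`. -/
def fourierKernel (R b : ℝ) (G : ℝ → SymmC) (ξ ξ₁ : ℝ) : ℂ :=
  (R / (2 * Real.pi) : ℂ) * F2 (fun v => fourierC (R * (ξ₁ - b)) (G v)) (ξ - ξ₁)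

/-- Insert the inversion formula for h(v + Rs). The s-integral becomes `fourierC` at frequency R(η -
b), and the v-integral becomes `F2` at ξ - η. Fubini is legitimate because ‖G‖ and the transform of
h are integrable. -/
theorem integral_fourierKernel {R b A B : ℝ} {G : ℝ → SymmC} (hG : Continuous G)
    (hsupp : ∀ v ∉ Icc A B, G v = 0) {h : ℝ → ℂ} (hF : Integrable (F2 h))
    (hinv : ∀ v : ℝ, h v = (1 / (2 * Real.pi) : ℂ) * ∫ η : ℝ, F2 h η * Complex.exp (Complex.I * v * η))
    {W : ℝ → ℂ} (hW : ∀ v : ℝ, W v = R * ∫ s in (-1 : ℝ)..1,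
      (ev (G v) s : ℂ) * osc (-(R * b)) s * h (v + R * s)) :
    Integrable W ∧ ∀ ξ, Integrable (fun ξ₁ => fourierKernel R b G ξ ξ₁ * F2 h ξ₁) ∧
      F2 W ξ = ∫ ξ₁, fourierKernel R b G ξ ξ₁ * F2 h ξ₁ := by
  have hGi : Integrable fun v => ‖G v‖ :=
    (hG.integrable_of_hasCompactSupport (HasCompactSupport.intro isCompact_Icc hsupp)).norm
  have hpi : (Real.pi : ℂ) ≠ 0 := by exact_mod_cast Real.pi_ne_zero
  set c : ℂ := (R / (2 * Real.pi) : ℂ) with hc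
  set T : ℝ × ℝ → ℂ := fun x => fourierC (R * (x.2 - b)) (G x.1) with hT
  have hTc : Continuous T := continuous_fourierC (hG.comp continuous_fst) (by fun_prop)
  set Q : ℝ → ℝ × ℝ → ℂ := fun ξ x =>
    c * (Complex.exp (-Complex.I * x.1 * (ξ - x.2)) * T x) * F2 h x.2 with hQ
  have hexp : ∀ a b : ℝ, ‖Complex.exp (-Complex.I * a * b)‖ = 1 := fun a b => by
    rw [show -Complex.I * (a : ℂ) * b = ((-(a * b) : ℝ) : ℂ) * Complex.I by push_cast; ring,
      Complex.norm_exp_ofReal_mul_I]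
  have hQi : ∀ ξ, Integrable (Q ξ) (volume.prod volume) := by
    intro ξ
    refine ((hGi.mul_prod hF.norm).const_mul (2 * ‖c‖)).mono' ?_ (Eventually.of_forall fun x => ?_)
    · refine AEStronglyMeasurable.mul (Continuous.aestronglyMeasurable (by fun_prop)) ?_
      exact hF.aestronglyMeasurable.comp_snd
    · simp only [hQ, norm_mul]
      have h1 := hexp x.1 (ξ - x.2)
      push_cast at h1
      rw [h1, one_mul]
      calc ‖c‖ * ‖T x‖ * ‖F2 h x.2‖ ≤ ‖c‖ * (2 * ‖G x.1‖) * ‖F2 h x.2‖ := by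
            gcongr
            exact norm_fourierC_le _ _
        _ = _ := by ring
  have hWQ : ∀ ξ v : ℝ, W v * Complex.exp (-Complex.I * v * ξ) = ∫ ξ₁, Q ξ (v, ξ₁) := by
    intro ξ v
    have h1 : ∫ s in (-1 : ℝ)..1, (ev (G v) s : ℂ) * osc (-(R * b)) s * h (v + R * s) =
        ∫ s in (-1 : ℝ)..1, ∫ η : ℝ, (1 / (2 * Real.pi) : ℂ) *
          ((ev (G v) s : ℂ) * osc (R * (η - b)) s) * (F2 h η * Complex.exp (Complex.I * v * η)) := by
      refine intervalIntegral.integral_congr fun s _ => ?_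
      rw [hinv, ← mul_assoc, ← integral_const_mul]
      refine integral_congr_ae (Eventually.of_forall fun η => ?_)
      have : Complex.exp (Complex.I * ((v + R * s : ℝ) : ℂ) * η) * osc (-(R * b)) s =
          osc (R * (η - b)) s * Complex.exp (Complex.I * v * η) := by
        unfold osc
        rw [← Complex.exp_add, ← Complex.exp_add]
        congr 1
        push_cast
        ring
      simp only
      linear_combination (1 / (2 * Real.pi) : ℂ) * (ev (G v) s : ℂ) * F2 h η * this
    rw [hW, h1, intervalIntegral.integral_of_le (by norm_num), integral_integral_swap]
    · rw [← integral_const_mul, ← integral_mul_const]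
      refine integral_congr_ae (Eventually.of_forall fun η => ?_)
      simp only [hQ, hT, fourierC_apply]
      rw [intervalIntegral.integral_of_le (by norm_num : (-1 : ℝ) ≤ 1),
        integral_mul_const, integral_const_mul,
        show -Complex.I * (v : ℂ) * (ξ - η) = -Complex.I * v * ξ + Complex.I * v * η by ring,
        Complex.exp_add, hc]
      ring
    · have h2 : Integrable (fun _ : ℝ => ‖G v‖) (volume.restrict (Ioc (-1 : ℝ) 1)) :=
        integrableOn_const (by simp)
      refine ((h2.mul_prod hF.norm).const_mul ‖(1 / (2 * Real.pi) : ℂ)‖).mono' ?_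
        (Eventually.of_forall fun x => ?_)
      · have hev := continuous_ev (G v)
        have ho : Continuous fun x : ℝ × ℝ => osc (R * (x.2 - b)) x.1 := by unfold osc; fun_prop
        refine AEStronglyMeasurable.mul (Continuous.aestronglyMeasurable ?_)
          (AEStronglyMeasurable.mul ?_ (Continuous.aestronglyMeasurable (by fun_prop)))
        · exact continuous_const.mul
            ((Complex.continuous_ofReal.comp (hev.comp continuous_fst)).mul ho)
        · exact hF.aestronglyMeasurable.comp_snd
      · have h1 := hexp v (-x.2)
        rw [show -Complex.I * (v : ℂ) * ((-x.2 : ℝ) : ℂ) = Complex.I * v * x.2 by push_cast; ring] at h1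
        simp only [Function.uncurry, norm_mul, norm_osc, h1, mul_one, Complex.norm_real]
        rw [mul_assoc]
        gcongr
        exact abs_ev_le _ _
  have hker : ∀ ξ ξ₁ : ℝ, fourierKernel R b G ξ ξ₁ * F2 h ξ₁ = ∫ v, Q ξ (v, ξ₁) := by
    intro ξ ξ₁
    simp only [hQ, hT]
    rw [integral_mul_const, integral_const_mul, fourierKernel, F2]
    congr 3
    ext v
    push_cast
    ring
  refine ⟨?_, fun ξ => ⟨?_, ?_⟩⟩
  · have := (hQi 0).integral_prod_left
    refine this.congr (Eventually.of_forall fun v => ?_)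
    simp only
    rw [← hWQ 0 v]
    simp
  · refine (hQi ξ).integral_prod_right.congr (Eventually.of_forall fun ξ₁ => ?_)
    simp only
    rw [hker]
  · rw [F2]
    simp only [hWQ, hker]
    exact integral_integral_swap (f := fun v ξ₁ => Q ξ (v, ξ₁)) (hQi ξ)

end ShearFlow

end

noncomputable section
namespace ShearFlow

/-! ### Differentiating averages and shifts -/

theorem hasDerivAt_pow_mul_avg (j : ℕ) (g : SymmC) {s : ℝ} (hs : s ∈ Ioo (-1 : ℝ) 1) :
    HasDerivAt (fun s => s ^ (j + 1) * ev (avg j g) s) (s ^ j * ev g s) s := by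
  have hc : Continuous fun x => x ^ j * ev g x := (continuous_pow j).mul (continuous_ev g)
  have h1 : HasDerivAt (fun s => ∫ x in (0 : ℝ)..s, x ^ j * ev g x) (s ^ j * ev g s) s :=
    intervalIntegral.integral_hasDerivAt_right (hc.intervalIntegrable _ _)
      (hc.stronglyMeasurableAtFilter _ _) hc.continuousAt
  refine h1.congr_of_eventuallyEq ?_
  filter_upwards [Ioo_mem_nhds hs.1 hs.2] with x hx
  exact pow_mul_ev_avg j g (Ioo_subset_Icc_self hx)

/-- The Euler derivative of an average. -/
theorem hasDerivAt_ev_avg (j : ℕ) (g : SymmC) {s : ℝ} (hs : s ∈ Ioo (-1 : ℝ) 1) (hs0 : s ≠ 0) :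
    HasDerivAt (ev (avg j g)) (ev (g - ((j : ℝ) + 1) • avg j g) s / s) s := by
  have h1 := (hasDerivAt_pow_mul_avg j g hs).div (hasDerivAt_pow (j + 1) s) (pow_ne_zero _ hs0)
  have h2 : (ev (avg j g)) =ᶠ[𝓝 s] fun s => s ^ (j + 1) * ev (avg j g) s / s ^ (j + 1) := by
    filter_upwards [isOpen_ne.mem_nhds hs0] with x hx
    rw [mul_div_cancel_left₀ _ (pow_ne_zero _ hx)]
  refine (h1.congr_of_eventuallyEq h2).congr_deriv ?_
  rw [ev_sub, ev_smul]
  push_cast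
  field_simp
  ring

/-- Formally this is differentiation under the average, (avg_j g)' = avg_{j+1} g'. As g need not be
differentiable at 0, the formula is obtained by integrating the derivative of x^(j+1) g by parts and
comparing with the Euler derivative of the average. -/
theorem hasDerivAt_ev_avg_of_deriv (j : ℕ) {g g₁ : SymmC}
    (hg : ∀ s ∈ Ioo (-1 : ℝ) 1, s ≠ 0 → HasDerivAt (ev g) (ev g₁ s) s) {s : ℝ}
    (hs : s ∈ Ioo (-1 : ℝ) 1) (hs0 : s ≠ 0) :
    HasDerivAt (ev (avg j g)) (ev (avg (j + 1) g₁) s) s := by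
  convert hasDerivAt_ev_avg j g hs hs0 using 1
  rw [eq_div_iff hs0]
  have h0 : ∀ x ∈ uIcc 0 s, x ∈ Icc (-1 : ℝ) 1 := fun x hx =>
    uIcc_subset_Icc (show (0 : ℝ) ∈ Icc (-1 : ℝ) 1 by simp) (Ioo_subset_Icc_self hs) hx
  have h1 := pow_mul_ev_avg (j + 1) g₁ (Ioo_subset_Icc_self hs)
  have h2 := pow_mul_ev_avg j g (Ioo_subset_Icc_self hs)
  have hi₁ : Continuous fun x => x ^ (j + 1) * ev g₁ x := (continuous_pow _).mul (continuous_ev _)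
  have hi₂ : Continuous fun x => x ^ j * ev g x := (continuous_pow _).mul (continuous_ev _)
  have h3 : ∫ x in (0 : ℝ)..s, (((j : ℝ) + 1) * (x ^ j * ev g x) + x ^ (j + 1) * ev g₁ x) =
      s ^ (j + 1) * ev g s := by
    have := integral_eq_of_hasDerivAt_off_countable
      (fun x => x ^ (j + 1) * ev g x) (fun x => ((j : ℝ) + 1) * (x ^ j * ev g x) + x ^ (j + 1) * ev g₁ x)
      (a := 0) (b := s) (countable_singleton (0 : ℝ))
      ((continuous_pow _).mul (continuous_ev _)).continuousOn (fun x hx => ?_)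
      (((continuous_const.mul hi₂).add hi₁).intervalIntegrable _ _)
    · rw [this]; simp
    · have hx' : x ∈ Ioo (-1 : ℝ) 1 := by
        refine ⟨lt_of_le_of_lt ?_ hx.1.1, hx.1.2.trans_le ?_⟩
        · exact le_min (by norm_num) hs.1.le
        · exact max_le (by norm_num) hs.2.le
      refine ((hasDerivAt_pow (j + 1) x).mul (hg x hx' hx.2)).congr_deriv ?_
      push_cast
      simp
      ring
  have hi₃ : Continuous fun x => ((j : ℝ) + 1) * (x ^ j * ev g x) := continuous_const.mul hi₂
  rw [intervalIntegral.integral_add (hi₃.intervalIntegrable _ _) (hi₁.intervalIntegrable _ _), intervalIntegral.integral_const_mul, ← h1, ← h2] at h3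
  rw [ev_sub, ev_smul]
  have h4 : s ^ (j + 1) ≠ 0 := pow_ne_zero _ hs0
  have h5 : s ^ (j + 1) * (ev (avg (j + 1) g₁) s * s) =
      s ^ (j + 1) * (ev g s - ((j : ℝ) + 1) * ev (avg j g) s) := by
    rw [pow_succ] at h3 ⊢
    linear_combination h3
  exact mul_left_cancel₀ h4 h5

theorem hasDerivAt_ev_shift {τ₀ τ₁ v : ℝ} {f f' : ℝ → ℝ} (hf : ∀ x, HasDerivAt f (f' x) x)
    (hf' : Continuous f') {s : ℝ} (hs : s ∈ Ioo (-1 : ℝ) 1) :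
    HasDerivAt (ev (shift τ₀ τ₁ f v)) (ev ((τ₀ + τ₁ * v) • shift τ₀ τ₁ f' v) s) s := by
  have hc : Continuous f := continuous_iff_continuousAt.mpr fun x => (hf x).continuousAt
  have h1 : HasDerivAt (fun s => f (v + (τ₀ + τ₁ * v) * s))
      (f' (v + (τ₀ + τ₁ * v) * s) * ((τ₀ + τ₁ * v) * 1)) s :=
    (hf _).comp s (((hasDerivAt_id s).const_mul _).const_add v)
  rw [ev_smul, ev_shift hf' (Ioo_subset_Icc_self hs)]
  refine (h1.congr_of_eventuallyEq ?_).congr_deriv (by ring)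
  filter_upwards [Ioo_mem_nhds hs.1 hs.2] with x hx
  exact ev_shift hc (Ioo_subset_Icc_self hx)

theorem Gev.id_of_bounded {σ M A B : ℝ} (hM : 0 < M) {U : Set ℝ} (hU : U ⊆ Icc A B) :
    Gev σ M U fun v => v := by
  refine ⟨fun v _ => contDiffAt_id, |A| + |B| + (gevreyWeight σ M 1)⁻¹, ?_, fun m v hv => ?_⟩
  · have := gevreyWeight_pos (σ := σ) hM 1
    positivity
  have hw := gevreyWeight_pos (σ := σ) hM
  have hw1 := hw 1
  rcases m with _ | _ | m
  · rw [iteratedDeriv_zero, gevreyWeight_zero, mul_one, Real.norm_eq_abs, abs_le]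
    obtain ⟨h1, h2⟩ := hU hv
    have := inv_pos.mpr hw1
    constructor <;> linarith [neg_abs_le A, le_abs_self B, abs_nonneg A, abs_nonneg B]
  · rw [zero_add, iteratedDeriv_one, deriv_id'', norm_one, add_mul, inv_mul_cancel₀ hw1.ne']
    have : 0 ≤ (|A| + |B|) * gevreyWeight σ M 1 := by positivity
    linarith
  · rw [iteratedDeriv_succ', show _root_.deriv (fun v : ℝ => v) = fun _ => 1 from deriv_id'',
      iteratedDeriv_const, if_neg (by omega), norm_zero]
    have := hw (m + 1 + 1)
    positivity

/-- The pointwise inverse of a positive function. -/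
def invC (g : SymmC) : SymmC := toC fun s => (ev g s)⁻¹

theorem ev_invC {g : SymmC} (hg : ∀ s ∈ Icc (-1 : ℝ) 1, 1 ≤ ev g s) {s : ℝ} (hs : s ∈ Icc (-1 : ℝ) 1) :
    ev (invC g) s = (ev g s)⁻¹ :=
  ev_toC ((continuous_ev g).continuousOn.inv₀ fun x hx => (zero_lt_one.trans_le (hg x hx)).ne') hs

theorem Gev.invC {σ M : ℝ} (hσ : 1 < σ) (hM : 0 < M) {U : Set ℝ} (hU : IsOpen U) {F : ℝ → SymmC}
    (hF : Gev σ M U F) (h1 : ∀ v ∈ U, ∀ s ∈ Icc (-1 : ℝ) 1, 1 ≤ ev (F v) s) :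
    Gev σ M U fun v => ShearFlow.invC (F v) := by
  have h2 : ∀ v ∈ U, F v * ShearFlow.invC (F v) = 1 := fun v hv => symmC_ext fun s hs => by
    rw [ev_mul, ev_invC (h1 v hv) hs, ev_one,
      mul_inv_cancel₀ (zero_lt_one.trans_le (h1 v hv s hs)).ne']
  refine hF.inverse hσ hM hU h2 (fun v hv => by rw [mul_comm]; exact h2 v hv) (B := 1) fun v hv => ?_
  refine symmC_norm_le zero_le_one fun s hs => ?_
  have h3 := h1 v hv s hs
  rw [ev_invC (h1 v hv) hs, abs_inv, abs_of_pos (by linarith)]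
  exact inv_le_one_of_one_le₀ h3

/-! ### Gevrey families with an Euler derivative -/

/-- A Gevrey family of functions `F` whose Euler derivative `s ∂_s F` is a Gevrey family. -/
structure GevEuler (σ M : ℝ) (U : Set ℝ) (F F₁ : ℝ → SymmC) : Prop where
  gev : Gev σ M U F
  gev₁ : Gev σ M U F₁
  deriv : ∀ v ∈ U, ∀ s ∈ Ioo (-1 : ℝ) 1, s ≠ 0 → HasDerivAt (ev (F v)) (ev (F₁ v) s / s) s

namespace GevEuler

variable {σ M : ℝ} {U : Set ℝ} {F F₁ G G₁ : ℝ → SymmC}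

theorem add (h : GevEuler σ M U F F₁) (h' : GevEuler σ M U G G₁) :
    GevEuler σ M U (fun v => F v + G v) (fun v => F₁ v + G₁ v) where
  gev := h.gev.add h'.gev
  gev₁ := h.gev₁.add h'.gev₁
  deriv v hv s hs hs0 := by
    rw [ev_add, add_div]
    exact (h.deriv v hv s hs hs0).add (h'.deriv v hv s hs hs0)

theorem neg (h : GevEuler σ M U F F₁) : GevEuler σ M U (fun v => -F v) (fun v => -F₁ v) where
  gev := h.gev.neg
  gev₁ := h.gev₁.neg
  deriv v hv s hs hs0 := by
    rw [ev_neg, neg_div]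
    exact (h.deriv v hv s hs hs0).neg

theorem mul (hσ : 1 ≤ σ) (hM : 0 < M) (h : GevEuler σ M U F F₁) (h' : GevEuler σ M U G G₁) :
    GevEuler σ M U (fun v => F v * G v) (fun v => F₁ v * G v + F v * G₁ v) where
  gev := h.gev.mul hσ hM h'.gev
  gev₁ := (h.gev₁.mul hσ hM h'.gev).add (h.gev.mul hσ hM h'.gev₁)
  deriv v hv s hs hs0 :=
    ((h.deriv v hv s hs hs0).mul (h'.deriv v hv s hs hs0)).congr_deriv (by
      rw [ev_add, ev_mul, ev_mul]; ring)

theorem const_smul (hσ : 1 ≤ σ) (hM : 0 < M) (c : ℝ) (h : GevEuler σ M U F F₁) :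
    GevEuler σ M U (fun v => c • F v) (fun v => c • F₁ v) where
  gev := (Gev.const hM c).smul hσ hM h.gev
  gev₁ := (Gev.const hM c).smul hσ hM h.gev₁
  deriv v hv s hs hs0 := ((h.deriv v hv s hs hs0).const_mul c).congr_deriv (by rw [ev_smul]; ring)

theorem const (hM : 0 < M) (c : ℝ) :
    GevEuler σ M U (fun _ => c • (1 : SymmC)) (fun _ => 0) where
  gev := Gev.const hM _
  gev₁ := Gev.const hM _
  deriv _ _ s _ _ := by
    rw [ev_zero, zero_div]
    exact hasDerivAt_const s (c • (1 : ℝ))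

/-- An average of a merely continuous family already has a Euler derivative, since s∂_s undoes the
primitive. This is the source of regularity in s for families obtained from the Volterra solution,
about which only continuity is known at first. -/
theorem avg (hσ : 1 ≤ σ) (hM : 0 < M) (j : ℕ) (hF : Gev σ M U F) :
    GevEuler σ M U (fun v => ShearFlow.avg j (F v))
      (fun v => F v - ((j : ℝ) + 1) • ShearFlow.avg j (F v)) where
  gev := hF.clm _
  gev₁ := hF.sub ((Gev.const hM _).smul hσ hM (hF.clm _))
  deriv _ _ _ hs hs0 := hasDerivAt_ev_avg j _ hs hs0

theorem of_deriv (hσ : 1 ≤ σ) (hM : 0 < M) (hF : Gev σ M U F) (hF₁ : Gev σ M U F₁)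
    (hd : ∀ v ∈ U, ∀ s ∈ Ioo (-1 : ℝ) 1, s ≠ 0 → HasDerivAt (ev (F v)) (ev (F₁ v) s) s) :
    GevEuler σ M U F (fun v => idC * F₁ v) where
  gev := hF
  gev₁ := (Gev.const hM _).mul hσ hM hF₁
  deriv v hv s hs hs0 := by
    rw [ev_mul, ev_idC (Ioo_subset_Icc_self hs), mul_div_cancel_left₀ _ hs0]
    exact hd v hv s hs hs0

theorem invC (hσ : 1 < σ) (hM : 0 < M) (hU : IsOpen U) (h : GevEuler σ M U F F₁)
    (h1 : ∀ v ∈ U, ∀ s ∈ Icc (-1 : ℝ) 1, 1 ≤ ev (F v) s) :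
    GevEuler σ M U (fun v => ShearFlow.invC (F v))
      (fun v => -(F₁ v * (ShearFlow.invC (F v) * ShearFlow.invC (F v)))) where
  gev := h.gev.invC hσ hM hU h1
  gev₁ := (h.gev₁.mul hσ.le hM ((h.gev.invC hσ hM hU h1).mul hσ.le hM
    (h.gev.invC hσ hM hU h1))).neg
  deriv v hv s hs hs0 := by
    have h0 : ev (F v) s ≠ 0 := (zero_lt_one.trans_le (h1 v hv s (Ioo_subset_Icc_self hs))).ne'
    refine (((h.deriv v hv s hs hs0).inv h0).congr_of_eventuallyEq ?_).congr_deriv ?_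
    · filter_upwards [Ioo_mem_nhds hs.1 hs.2] with x hx
      exact ev_invC (h1 v hv) (Ioo_subset_Icc_self hx)
    · rw [ev_neg, ev_mul, ev_mul, ev_invC (h1 v hv) (Ioo_subset_Icc_self hs)]
      field_simp

/-- A second primitive gains two derivatives. -/
theorem gevC2_avg (hσ : 1 ≤ σ) (hM : 0 < M) (h : GevEuler σ M U F F₁) :
    GevC2 σ M U (fun v => idC ^ 2 * ShearFlow.avg 0 (F v))
      (fun v => idC * (ShearFlow.avg 0 (F v) + F v)) (fun v => (2 : ℝ) • F v + F₁ v) where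
  gev := (Gev.const hM _).mul hσ hM (h.gev.clm _)
  gev₁ := (Gev.const hM _).mul hσ hM ((h.gev.clm _).add h.gev)
  gev₂ := ((Gev.const hM (2 : ℝ)).smul hσ hM h.gev).add h.gev₁
  deriv v hv s hs hs0 := by
    have h1 := (hasDerivAt_id s).mul (hasDerivAt_pow_mul_avg 0 (F v) hs)
    refine (h1.congr_of_eventuallyEq ?_).congr_deriv ?_
    · filter_upwards [Ioo_mem_nhds hs.1 hs.2] with x hx
      rw [ev_mul, ev_pow, ev_idC (Ioo_subset_Icc_self hx)]
      simp only [Pi.mul_apply, id]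
      ring
    · rw [ev_mul, ev_idC (Ioo_subset_Icc_self hs), ev_add]
      simp only [id]
      ring
  deriv₁ v hv s hs hs0 := by
    have h1 := (hasDerivAt_pow_mul_avg 0 (F v) hs).add ((hasDerivAt_id s).mul (h.deriv v hv s hs hs0))
    refine (h1.congr_of_eventuallyEq ?_).congr_deriv ?_
    · filter_upwards [Ioo_mem_nhds hs.1 hs.2] with x hx
      rw [ev_mul, ev_idC (Ioo_subset_Icc_self hx), ev_add]
      simp only [Pi.mul_apply, Pi.add_apply, id]
      ring
    · rw [ev_add, ev_smul]
      simp only [id]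
      field_simp
      ring

end GevEuler

namespace GevC2

variable {σ M : ℝ} {U : Set ℝ} {F F₁ F₂ : ℝ → SymmC}

theorem avg (j : ℕ) (h : GevC2 σ M U F F₁ F₂) :
    GevC2 σ M U (fun v => ShearFlow.avg j (F v)) (fun v => ShearFlow.avg (j + 1) (F₁ v))
      (fun v => ShearFlow.avg (j + 2) (F₂ v)) where
  gev := h.gev.clm _
  gev₁ := h.gev₁.clm _
  gev₂ := h.gev₂.clm _
  deriv v hv _ hs hs0 := hasDerivAt_ev_avg_of_deriv j (h.deriv v hv) hs hs0
  deriv₁ v hv _ hs hs0 := hasDerivAt_ev_avg_of_deriv (j + 1) (h.deriv₁ v hv) hs hs0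

theorem shift {f : ℝ → ℝ} (hσ : 1 ≤ σ) (hM : 0 < M)
    (hf : ∀ n ≤ 2, Gev σ M univ (iteratedDeriv n f)) (hsm : ContDiff ℝ ∞ f) (R : ℝ) :
    GevC2 σ (2 * M) U (shift R 0 f) (fun v => R • ShearFlow.shift R 0 (iteratedDeriv 1 f) v)
      (fun v => R • R • ShearFlow.shift R 0 (iteratedDeriv 2 f) v) := by
  have h0 : |(0 : ℝ)| ≤ 1 := by simp
  have hM2 : 0 < 2 * M := by positivity
  have hg : ∀ n ≤ 2, Gev σ (2 * M) U (ShearFlow.shift R 0 (iteratedDeriv n f)) := fun n hn =>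
    (Gev.shift hM (hf n hn) h0).mono_set (subset_univ _)
  have hd : ∀ n x, HasDerivAt (iteratedDeriv n f) (iteratedDeriv (n + 1) f x) x := fun n x => by
    rw [iteratedDeriv_succ]
    exact (hsm.differentiable_iteratedDeriv n (by exact_mod_cast ENat.natCast_lt_top n) x).hasDerivAt
  have hc : ∀ n, Continuous (iteratedDeriv n f) := fun n =>
    hsm.continuous_iteratedDeriv n (by exact_mod_cast le_top)
  have hd0 := hd 0
  rw [iteratedDeriv_zero] at hd0
  have hg0 := hg 0 (by norm_num)
  rw [iteratedDeriv_zero] at hg0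
  have hR := Gev.const (σ := σ) (U := U) hM2 R
  refine ⟨hg0, hR.smul hσ hM2 (hg 1 (by norm_num)),
    hR.smul hσ hM2 (hR.smul hσ hM2 (hg 2 le_rfl)), fun v _ s hs _ => ?_, fun v _ s hs _ => ?_⟩
  · have := hasDerivAt_ev_shift (τ₀ := R) (τ₁ := 0) (v := v) hd0 (hc 1) hs
    rwa [zero_mul, add_zero] at this
  · have := (hasDerivAt_ev_shift (τ₀ := R) (τ₁ := 0) (v := v) (hd 1) (hc 2) hs).const_mul R
    rw [zero_mul, add_zero] at this
    exact this

end GevC2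

end ShearFlow

end

noncomputable section
namespace ShearFlow

/-! ### The Green function and the commutator kernel in local coordinates

In the variable `v = u(y)` the background enters through `a = (θ/u') ∘ u⁻¹`, `b = (1/(θu')) ∘ u⁻¹`,
`q = (u⁻¹)'` and `p = φ₁ ∘ u⁻¹`. Functions of `v₁` are written as functions of `s`, where
`v₁ = v + (τ₀ + τ₁ v) s`. -/

section Definitions

variable (κ τ₀ τ₁ u₀ u₁ : ℝ) (a b q p c : ℝ → ℝ) (v : ℝ)

/-- The homogeneous solution `Φ`. -/
def homSol : SymmC := volterraSol (κ * (τ₀ + τ₁ * v) ^ 2) (shift τ₀ τ₁ a v) (shift τ₀ τ₁ b v)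

/-- The average of `b Φ` against `s²`. -/
def homP : SymmC := avg 2 (shift τ₀ τ₁ b v * homSol κ τ₀ τ₁ a b v)

/-- The function `Z` such that `Φ = 1 + (v₁ - v)² Z`. -/
def homZ : SymmC := κ • avg 1 (shift τ₀ τ₁ a v * homP κ τ₀ τ₁ a b v)

/-- The function `a (Φ⁻² - 1) / (v₁ - v)²`. -/
def homN : SymmC :=
  -(shift τ₀ τ₁ a v * (homZ κ τ₀ τ₁ a b v * ((homSol κ τ₀ τ₁ a b v + (1 : ℝ) • 1) *
    (invC (homSol κ τ₀ τ₁ a b v) * invC (homSol κ τ₀ τ₁ a b v)))))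

/-- The difference quotient `(a'(v₁) - a'(v)) / (v₁ - v)`. -/
def diffQ (R : ℝ) : SymmC := avg 0 (shift R 0 (iteratedDeriv 2 a) v)

/-- The coefficient of the Green function to the left of `v`. -/
def coefL : ℝ :=
  -(a u₀ / (v - u₀)) + (v - u₀) * ev (avg 0 (homN κ (-u₀) 1 a b v)) (-1) +
    (u₁ - u₀) * ev (avg 0 (diffQ a v (u₁ - u₀))) (-1)

/-- The coefficient of the Green function to the right of `v`. -/
def coefR : ℝ :=
  a u₁ / (u₁ - v) - (u₁ - v) * ev (avg 0 (homN κ u₁ (-1) a b v)) 1 -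
    (u₁ - u₀) * ev (avg 0 (diffQ a v (u₁ - u₀))) 1

/-- The jump of the coefficients across `v`. -/
def jump : ℝ := coefL κ u₀ u₁ a b v - coefR κ u₀ u₁ a b v

/-- The regular part of the Green function divided by `Φ`. -/
def regPart : SymmC :=
  -shift (u₁ - u₀) 0 a v + ((u₁ - u₀) * coefL κ u₀ u₁ a b v) • idC +
    ((u₁ - u₀) ^ 2) • (idC ^ 2 * avg 0 (homN κ (u₁ - u₀) 0 a b v + diffQ a v (u₁ - u₀)))

/-- The Green function divided by `Φ`. -/
def bracketC : SymmC :=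
  regPart κ u₀ u₁ a b v + ((u₁ - u₀) * iteratedDeriv 1 a v) • logC -
    ((u₁ - u₀) * jump κ u₀ u₁ a b v) • posC

/-- The Green function `E(v₁, v)`. -/
def greenC : SymmC := homSol κ (u₁ - u₀) 0 a b v * bracketC κ u₀ u₁ a b v

/-- The coefficient `B₂`. -/
def normB : ℝ :=
  -(a v * (√(jump κ u₀ u₁ a b v ^ 2 + Real.pi ^ 2 * iteratedDeriv 1 a v ^ 2))⁻¹)

/-- The function `(p(v) q(v₁) - p(v₁) q(v)) / (v₁ - v)`. -/
def commC : SymmC :=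
  p v • avg 0 (shift (u₁ - u₀) 0 (iteratedDeriv 1 q) v) -
    q v • avg 0 (shift (u₁ - u₀) 0 (iteratedDeriv 1 p) v)

/-- The kernel of the commutator. -/
def kernelC : SymmC :=
  (c v * normB κ u₀ u₁ a b v) •
    (shift (u₁ - u₀) 0 c v * (commC u₀ u₁ q p v * greenC κ u₀ u₁ a b v))

end Definitions

/-- A function that is, together with its first three derivatives, of Gevrey class. -/
structure GevJet (σ M : ℝ) (f : ℝ → ℝ) : Prop where
  smooth : ContDiff ℝ ∞ f
  gev : ∀ n ≤ 3, Gev σ M univ (iteratedDeriv n f)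

namespace GevJet

variable {σ M : ℝ} {f : ℝ → ℝ}

theorem gev₀ (h : GevJet σ M f) : Gev σ M univ f := by
  simpa using h.gev 0 (by norm_num)

theorem continuous (h : GevJet σ M f) (n : ℕ) : Continuous (iteratedDeriv n f) :=
  h.smooth.continuous_iteratedDeriv n (by exact_mod_cast le_top)

theorem shift (h : GevJet σ M f) (hM : 0 < M) {n : ℕ} (hn : n ≤ 3) {τ₀ τ₁ : ℝ} (hτ : |τ₁| ≤ 1)
    (U : Set ℝ) : Gev σ (2 * M) U (shift τ₀ τ₁ (iteratedDeriv n f)) :=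
  (Gev.shift hM (h.gev n hn) hτ).mono_set (subset_univ _)

theorem shift₀ (h : GevJet σ M f) (hM : 0 < M) {τ₀ τ₁ : ℝ} (hτ : |τ₁| ≤ 1)
    (U : Set ℝ) : Gev σ (2 * M) U (ShearFlow.shift τ₀ τ₁ f) :=
  (Gev.shift hM h.gev₀ hτ).mono_set (subset_univ _)

theorem mono (h : GevJet σ M f) (hM : 0 < M) : GevJet σ (2 * M) f :=
  ⟨h.smooth, fun n hn => (h.gev n hn).mono hM (by linarith)⟩

end GevJet

theorem one_le_ev_homSol {κ τ₀ τ₁ : ℝ} (hκ : 0 ≤ κ) {a b : ℝ → ℝ} (ha : Continuous a)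
    (hb : Continuous b) (ha0 : ∀ x, 0 < a x) (hb0 : ∀ x, 0 < b x) (v : ℝ) {s : ℝ}
    (hs : s ∈ Icc (-1 : ℝ) 1) : 1 ≤ ev (homSol κ τ₀ τ₁ a b v) s :=
  one_le_ev_volterraSol (by positivity) (fun x hx => by rw [ev_shift ha hx]; exact (ha0 _).le)
    (fun x hx => by rw [ev_shift hb hx]; exact (hb0 _).le) hs

/-! ### Gevrey regularity in v of the ingredients of the Green function -/

section Gevrey

variable {σ M κ A B : ℝ} {U : Set ℝ} {a b : ℝ → ℝ}

theorem gev_affine (hσ : 1 ≤ σ) (hM : 0 < M) (hU : U ⊆ Icc A B) (τ₀ τ₁ : ℝ) :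
    Gev σ M U fun v => τ₀ + τ₁ * v :=
  (Gev.const hM τ₀).add ((Gev.const hM τ₁).mul hσ hM (Gev.id_of_bounded hM hU))

theorem gev_homSol (hσ : 1 < σ) (hM : 0 < M) (hU : IsOpen U) (hUb : U ⊆ Icc A B)
    (ha : GevJet σ M a) (hb : GevJet σ M b) {τ₀ τ₁ : ℝ} (hτ : |τ₁| ≤ 1) :
    Gev σ (2 * M) U (homSol κ τ₀ τ₁ a b) := by
  have hM2 : 0 < 2 * M := by positivity
  have h1 := gev_affine hσ.le hM2 hUb τ₀ τ₁
  refine Gev.volterraSol hσ hM2 hU ?_ (ha.shift₀ hM hτ U) (hb.shift₀ hM hτ U)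
  simp only [pow_two]
  exact (Gev.const hM2 κ).mul hσ.le hM2 (h1.mul hσ.le hM2 h1)

theorem gev_homP (hσ : 1 < σ) (hM : 0 < M) (hU : IsOpen U) (hUb : U ⊆ Icc A B)
    (ha : GevJet σ M a) (hb : GevJet σ M b) {τ₀ τ₁ : ℝ} (hτ : |τ₁| ≤ 1) :
    Gev σ (2 * M) U (homP κ τ₀ τ₁ a b) :=
  ((hb.shift₀ hM hτ U).mul hσ.le (by positivity) (gev_homSol hσ hM hU hUb ha hb hτ)).clm (avg 2)

theorem gev_homZ (hσ : 1 < σ) (hM : 0 < M) (hU : IsOpen U) (hUb : U ⊆ Icc A B)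
    (ha : GevJet σ M a) (hb : GevJet σ M b) {τ₀ τ₁ : ℝ} (hτ : |τ₁| ≤ 1) :
    Gev σ (2 * M) U (homZ κ τ₀ τ₁ a b) :=
  (((ha.shift₀ hM hτ U).mul hσ.le (by positivity) (gev_homP hσ hM hU hUb ha hb hτ)).clm
    (avg 1)).clm (κ • ContinuousLinearMap.id ℝ SymmC)

theorem gev_homN (hσ : 1 < σ) (hM : 0 < M) (hU : IsOpen U) (hUb : U ⊆ Icc A B) (hκ : 0 ≤ κ)
    (ha : GevJet σ M a) (hb : GevJet σ M b) (ha0 : ∀ x, 0 < a x) (hb0 : ∀ x, 0 < b x) {τ₀ τ₁ : ℝ}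
    (hτ : |τ₁| ≤ 1) : Gev σ (2 * M) U (homN κ τ₀ τ₁ a b) := by
  have hM2 : 0 < 2 * M := by positivity
  have h1 := gev_homSol (κ := κ) hσ hM hU hUb ha hb hτ (τ₀ := τ₀)
  have h2 := h1.invC hσ hM2 hU fun v _ s hs =>
    one_le_ev_homSol hκ ha.smooth.continuous hb.smooth.continuous ha0 hb0 v hs
  exact ((ha.shift₀ hM hτ U).mul hσ.le hM2 ((gev_homZ hσ hM hU hUb ha hb hτ).mul hσ.le hM2
    ((h1.add (Gev.const hM2 _)).mul hσ.le hM2 (h2.mul hσ.le hM2 h2)))).neg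

theorem gev_diffQ (hM : 0 < M) (ha : GevJet σ M a) (R : ℝ) :
    Gev σ (2 * M) U fun v => diffQ a v R :=
  (ha.shift hM (by norm_num) (by simp) U).clm (avg 0)

variable {u₀ u₁ d : ℝ}

/-- The coordinate of width v - u₀ puts u₀ at the fixed point s = -1. In the coordinate of width R
the limit of integration would move with v, and v-derivatives would fall on s, in which `homN` has
little regularity. Staying at distance d from the ends keeps 1/(v - u₀) Gevrey. -/
theorem gev_coefL (hσ : 1 < σ) (hM : 0 < M) (hd : 0 < d) (hκ : 0 ≤ κ)
    (ha : GevJet σ M a) (hb : GevJet σ M b) (ha0 : ∀ x, 0 < a x) (hb0 : ∀ x, 0 < b x) :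
    Gev σ (2 * M) (Ioo (u₀ + d) (u₁ - d)) (coefL κ u₀ u₁ a b) := by
  have hM2 : 0 < 2 * M := by positivity
  have hUb : Ioo (u₀ + d) (u₁ - d) ⊆ Icc (u₀ + d) (u₁ - d) := Ioo_subset_Icc_self
  have hid : Gev σ (2 * M) (Ioo (u₀ + d) (u₁ - d)) fun v => v - u₀ :=
    (Gev.id_of_bounded hM2 hUb).sub (Gev.const hM2 u₀)
  have h1 : Gev σ (2 * M) (Ioo (u₀ + d) (u₁ - d)) fun v => (v - u₀)⁻¹ :=
    hid.inv hσ hM2 isOpen_Ioo hd fun v hv => le_abs.mpr (Or.inl (by linarith [hv.1]))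
  refine Gev.add (Gev.add (Gev.neg ?_) ?_) ?_
  · simp only [div_eq_mul_inv]
    exact (Gev.const hM2 _).mul hσ.le hM2 h1
  · exact hid.mul hσ.le hM2 (((gev_homN hσ hM isOpen_Ioo hUb hκ ha hb ha0 hb0
      (by simp)).clm (avg 0)).clm (evL (-1)))
  · exact (Gev.const hM2 _).mul hσ.le hM2 (((gev_diffQ hM ha _).clm (avg 0)).clm (evL (-1)))

theorem gev_coefR (hσ : 1 < σ) (hM : 0 < M) (hd : 0 < d) (hκ : 0 ≤ κ)
    (ha : GevJet σ M a) (hb : GevJet σ M b) (ha0 : ∀ x, 0 < a x) (hb0 : ∀ x, 0 < b x) :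
    Gev σ (2 * M) (Ioo (u₀ + d) (u₁ - d)) (coefR κ u₀ u₁ a b) := by
  have hM2 : 0 < 2 * M := by positivity
  have hUb : Ioo (u₀ + d) (u₁ - d) ⊆ Icc (u₀ + d) (u₁ - d) := Ioo_subset_Icc_self
  have hid : Gev σ (2 * M) (Ioo (u₀ + d) (u₁ - d)) fun v => u₁ - v :=
    (Gev.const hM2 u₁).sub (Gev.id_of_bounded hM2 hUb)
  have h1 : Gev σ (2 * M) (Ioo (u₀ + d) (u₁ - d)) fun v => (u₁ - v)⁻¹ :=
    hid.inv hσ hM2 isOpen_Ioo hd fun v hv => le_abs.mpr (Or.inl (by linarith [hv.2]))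
  refine Gev.sub (Gev.sub ?_ ?_) ?_
  · simp only [div_eq_mul_inv]
    exact (Gev.const hM2 _).mul hσ.le hM2 h1
  · exact hid.mul hσ.le hM2 (((gev_homN hσ hM isOpen_Ioo hUb hκ ha hb ha0 hb0
      (by simp)).clm (avg 0)).clm (evL 1))
  · exact (Gev.const hM2 _).mul hσ.le hM2 (((gev_diffQ hM ha _).clm (avg 0)).clm (evL 1))

theorem gev_jump (hσ : 1 < σ) (hM : 0 < M) (hd : 0 < d) (hκ : 0 ≤ κ)
    (ha : GevJet σ M a) (hb : GevJet σ M b) (ha0 : ∀ x, 0 < a x) (hb0 : ∀ x, 0 < b x) :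
    Gev σ (2 * M) (Ioo (u₀ + d) (u₁ - d)) (jump κ u₀ u₁ a b) :=
  (gev_coefL hσ hM hd hκ ha hb ha0 hb0).sub (gev_coefR hσ hM hd hκ ha hb ha0 hb0)

/-- The homogeneous solution is twice differentiable. -/
theorem exists_gevC2_homSol (hσ : 1 < σ) (hM : 0 < M) (hU : IsOpen U) (hUb : U ⊆ Icc A B)
    (ha : GevJet σ M a) (hb : GevJet σ M b) (R : ℝ) :
    ∃ F₁ F₂, GevC2 σ (2 * M) U (homSol κ R 0 a b) F₁ F₂ := by
  have hM2 : 0 < 2 * M := by positivity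
  have hτ : |(0 : ℝ)| ≤ 1 := by simp
  have hα := ha.shift₀ (τ₀ := R) hM hτ U
  have hΦ := gev_homSol (κ := κ) (τ₀ := R) hσ hM hU hUb ha hb hτ
  have hαC := GevC2.shift (U := U) hσ.le hM (fun n hn => ha.gev n (by omega)) ha.smooth R
  have hαE : GevEuler σ (2 * M) U _ _ := GevEuler.of_deriv hσ.le hM2 hαC.gev hαC.gev₁ hαC.deriv
  have hP : GevEuler σ (2 * M) U (homP κ R 0 a b) _ :=
    GevEuler.avg hσ.le hM2 2 ((hb.shift₀ hM hτ U).mul hσ.le hM2 hΦ)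
  have hY := hαE.mul hσ.le hM2 hP
  have hid := Gev.const (σ := σ) (U := U) hM2 idC
  have hk := Gev.const (σ := σ) (U := U) hM2 (κ * R ^ 2)
  -- Bootstrap: Φ - 1 is κR² s² times the average `avg 1` of Y = aP, so its derivative is κR² sY.
  -- Since P is itself an average, Y has a Euler derivative, and the second derivative is κR² (Y +
  -- s∂_sY).
  have hΦeq : ∀ v, homSol κ R 0 a b v =
      1 + (κ * R ^ 2) • (idC ^ 2 * avg 1 (shift R 0 a v * homP κ R 0 a b v)) := by
    intro v
    have := volterraSol_eq (κ * (R + 0 * v) ^ 2) (shift R 0 a v) (shift R 0 b v)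
    rw [zero_mul, add_zero] at this
    unfold homP homSol
    rwa [zero_mul, add_zero]
  refine ⟨fun v => (κ * R ^ 2) • (idC * (shift R 0 a v * homP κ R 0 a b v)), _, hΦ,
    hk.smul hσ.le hM2 (hid.mul hσ.le hM2 hY.gev), hk.smul hσ.le hM2 (hY.gev.add hY.gev₁),
    fun v _ s hs _ => ?_, fun v hv s hs hs0 => ?_⟩
  · have h1 := ((hasDerivAt_pow_mul_avg 1 (shift R 0 a v * homP κ R 0 a b v) hs).const_mul
      (κ * R ^ 2)).const_add 1
    refine (h1.congr_of_eventuallyEq ?_).congr_deriv ?_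
    · filter_upwards [Ioo_mem_nhds hs.1 hs.2] with x hx
      conv_lhs => rw [hΦeq]
      rw [ev_add, ev_one, ev_smul, ev_mul, ev_pow, ev_idC (Ioo_subset_Icc_self hx)]
    · simp only [ev_smul, ev_mul, ev_idC (Ioo_subset_Icc_self hs), pow_one]
  · have h1 := ((hasDerivAt_id s).mul (hY.deriv v hv s hs hs0)).const_mul (κ * R ^ 2)
    refine (h1.congr_of_eventuallyEq ?_).congr_deriv ?_
    · filter_upwards [Ioo_mem_nhds hs.1 hs.2] with x hx
      rw [ev_smul, ev_mul, ev_idC (Ioo_subset_Icc_self hx)]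
      rfl
    · rw [ev_smul, ev_add]
      simp only [id]
      field_simp
      simp only [ev_add]

/-- The regular part of the Green function is twice differentiable. -/
theorem exists_gevC2_regPart (hσ : 1 < σ) (hM : 0 < M) (hd : 0 < d) (hκ : 0 ≤ κ)
    (ha : GevJet σ M a) (hb : GevJet σ M b) (ha0 : ∀ x, 0 < a x) (hb0 : ∀ x, 0 < b x) :
    ∃ F₁ F₂, GevC2 σ (2 * M) (Ioo (u₀ + d) (u₁ - d)) (regPart κ u₀ u₁ a b) F₁ F₂ := by
  have hM2 : 0 < 2 * M := by positivity
  have hτ : |(0 : ℝ)| ≤ 1 := by simp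
  set U := Ioo (u₀ + d) (u₁ - d) with hUdef
  have hU : IsOpen U := isOpen_Ioo
  have hUb : U ⊆ Icc (u₀ + d) (u₁ - d) := Ioo_subset_Icc_self
  set R := u₁ - u₀ with hR
  obtain ⟨Φ₁, Φ₂, hΦ⟩ := exists_gevC2_homSol (κ := κ) hσ hM hU hUb ha hb R
  have hαC := GevC2.shift (U := U) hσ.le hM (fun n hn => ha.gev n (by omega)) ha.smooth R
  have hαE : GevEuler σ (2 * M) U _ _ := GevEuler.of_deriv hσ.le hM2 hαC.gev hαC.gev₁ hαC.deriv
  have hΦE : GevEuler σ (2 * M) U _ _ := GevEuler.of_deriv hσ.le hM2 hΦ.gev hΦ.gev₁ hΦ.deriv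
  have hI := hΦE.invC hσ hM2 hU fun v _ s hs =>
    one_le_ev_homSol hκ ha.smooth.continuous hb.smooth.continuous ha0 hb0 v hs
  have hZ : GevEuler σ (2 * M) U (homZ κ R 0 a b) _ := GevEuler.const_smul hσ.le hM2 κ
    (GevEuler.avg hσ.le hM2 1 ((ha.shift₀ hM hτ U).mul hσ.le hM2
      (gev_homP (κ := κ) hσ hM hU hUb ha hb hτ)))
  have hN : GevEuler σ (2 * M) U (homN κ R 0 a b) _ := (hαE.mul hσ.le hM2 (hZ.mul hσ.le hM2
    ((hΦE.add (GevEuler.const hM2 1)).mul hσ.le hM2 (hI.mul hσ.le hM2 hI)))).neg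
  have hD : GevEuler σ (2 * M) U (fun v => diffQ a v R) _ :=
    GevEuler.avg hσ.le hM2 0 (ha.shift hM (n := 2) (by norm_num) hτ U)
  have hND := (hN.add hD).gevC2_avg hσ.le hM2
  have hidC : GevC2 σ (2 * M) U (fun _ => idC) (fun _ => 1) (fun _ => 0) := by
    refine ⟨Gev.const hM2 _, Gev.const hM2 _, Gev.const hM2 _, fun v _ s hs _ => ?_,
      fun v _ s hs _ => hasDerivAt_const s (1 : ℝ)⟩
    refine (hasDerivAt_id s).congr_of_eventuallyEq ?_
    filter_upwards [Ioo_mem_nhds hs.1 hs.2] with x hx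
    exact ev_idC (Ioo_subset_Icc_self hx)
  have hneg := GevC2.smul hσ.le hM2 (Gev.const hM2 (-1)) hαC
  have h3 := (hneg.add (GevC2.smul hσ.le hM2 ((Gev.const hM2 R).mul hσ.le hM2
    (gev_coefL (u₀ := u₀) (u₁ := u₁) hσ hM hd hκ ha hb ha0 hb0)) hidC)).add
    (GevC2.smul hσ.le hM2 (Gev.const hM2 (R ^ 2)) hND)
  have heq : regPart κ u₀ u₁ a b = fun v => ((-1 : ℝ) • shift R 0 a v +
      (R * coefL κ u₀ u₁ a b v) • idC) +
      (R ^ 2) • (idC ^ 2 * avg 0 (homN κ R 0 a b v + diffQ a v R)) := by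
    ext v
    rw [regPart, neg_one_smul]
  rw [heq]
  exact ⟨_, _, h3⟩

theorem exists_gevC2_avg_shift (hσ : 1 < σ) (hM : 0 < M) {f : ℝ → ℝ} (hf : GevJet σ M f) (R : ℝ) :
    ∃ F₁ F₂, GevC2 σ (2 * M) U (fun v => avg 0 (shift R 0 (iteratedDeriv 1 f) v)) F₁ F₂ := by
  have hsm : ContDiff ℝ ∞ (iteratedDeriv 1 f) := by
    rw [iteratedDeriv_one]
    exact (contDiff_infty_iff_deriv.mp hf.smooth).2
  exact ⟨_, _, GevC2.avg 0 (GevC2.shift hσ.le hM (fun n hn => by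
    rw [iteratedDeriv_one, ← iteratedDeriv_succ']; exact hf.gev (n + 1) (by omega)) hsm R)⟩

end Gevrey

/-! ### The commutator kernel -/

section Kernel

variable {σ M κ u₀ u₁ d d' δ : ℝ} {a b q p c : ℝ → ℝ}

theorem kernelC_eq_zero {v : ℝ} (hv : c v = 0) : kernelC κ u₀ u₁ a b q p c v = 0 := by
  rw [kernelC, hv, zero_mul, zero_smul]

theorem gev_normB (hσ : 1 < σ) (hM : 0 < M) (hd : 0 < d) (hκ : 0 ≤ κ)
    (ha : GevJet σ M a) (hb : GevJet σ M b) (ha0 : ∀ x, 0 < a x) (hb0 : ∀ x, 0 < b x) (hδ : 0 < δ)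
    (hj : ∀ v ∈ Ioo (u₀ + d) (u₁ - d),
      δ ≤ jump κ u₀ u₁ a b v ^ 2 + Real.pi ^ 2 * iteratedDeriv 1 a v ^ 2) :
    Gev σ (2 * M) (Ioo (u₀ + d) (u₁ - d)) (normB κ u₀ u₁ a b) := by
  have hM2 : 0 < 2 * M := by positivity
  have h1 := gev_jump (u₀ := u₀) (u₁ := u₁) hσ hM hd hκ ha hb ha0 hb0
  have h2 : Gev σ (2 * M) (Ioo (u₀ + d) (u₁ - d)) (iteratedDeriv 1 a) :=
    ((ha.mono hM).gev 1 (by norm_num)).mono_set (subset_univ _)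
  have h3 : Gev σ (2 * M) (Ioo (u₀ + d) (u₁ - d)) fun v =>
      jump κ u₀ u₁ a b v ^ 2 + Real.pi ^ 2 * iteratedDeriv 1 a v ^ 2 := by
    simp only [pow_two]
    exact (h1.mul hσ.le hM2 h1).add ((Gev.const hM2 _).mul hσ.le hM2 (h2.mul hσ.le hM2 h2))
  exact ((((ha.mono hM).gev₀).mono_set (subset_univ _)).mul hσ.le hM2
    (h3.inv_sqrt hσ hM2 isOpen_Ioo hδ hj)).neg

/-- For v in the inner interval, v ± R lies outside the support of c. The factor c(v + Rs) therefore
supplies the vanishing at s = ±1 for the whole kernel. -/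
theorem vanish_shift (hd : 0 < d) (hc : GevJet σ M c)
    (hsupp : ∀ v ∉ Icc (u₀ + d) (u₁ - d), c v = 0) :
    GevC2.Vanish (Ioo (u₀ + d) (u₁ - d)) (shift (u₁ - u₀) 0 c)
      (fun v => (u₁ - u₀) • shift (u₁ - u₀) 0 (iteratedDeriv 1 c) v) := by
  have h1 : ∀ v ∉ Icc (u₀ + d) (u₁ - d), iteratedDeriv 1 c v = 0 := by
    intro v hv
    have : c =ᶠ[𝓝 v] fun _ => 0 := by
      filter_upwards [isClosed_Icc.isOpen_compl.mem_nhds hv] with x hx using hsupp x hx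
    rw [this.iteratedDeriv_eq, iteratedDeriv_const]
    simp
  have hl : ∀ v ∈ Ioo (u₀ + d) (u₁ - d), v + (u₁ - u₀ + 0 * v) * -1 ∉ Icc (u₀ + d) (u₁ - d) :=
    fun v hv h => by linarith [h.1, hv.2]
  have hr : ∀ v ∈ Ioo (u₀ + d) (u₁ - d), v + (u₁ - u₀ + 0 * v) * 1 ∉ Icc (u₀ + d) (u₁ - d) :=
    fun v hv h => by linarith [h.2, hv.1]
  refine ⟨fun v hv => ?_, fun v hv => ?_, fun v hv => ?_, fun v hv => ?_⟩
  · rw [ev_shift hc.smooth.continuous (by simp), hsupp _ (hl v hv)]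
  · rw [ev_shift hc.smooth.continuous (by simp), hsupp _ (hr v hv)]
  · rw [ev_smul, ev_shift (hc.continuous 1) (by simp), h1 _ (hl v hv), mul_zero]
  · rw [ev_smul, ev_shift (hc.continuous 1) (by simp), h1 _ (hr v hv), mul_zero]

/-- The kernel of the commutator is Gevrey in `v`, and its Fourier transform in `s` decays
quadratically. -/
theorem exists_bound_kernelC (hσ : 1 < σ) (hM : 0 < M) (hd : 0 < d) (hdd : d < d')
    (hκ : 0 ≤ κ) (ha : GevJet σ M a) (hb : GevJet σ M b) (hq : GevJet σ M q) (hp : GevJet σ M p)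
    (hc : GevJet σ M c) (ha0 : ∀ x, 0 < a x) (hb0 : ∀ x, 0 < b x)
    (hsupp : ∀ v ∉ Icc (u₀ + d') (u₁ - d'), c v = 0) (hδ : 0 < δ)
    (hj : ∀ v ∈ Ioo (u₀ + d) (u₁ - d),
      δ ≤ jump κ u₀ u₁ a b v ^ 2 + Real.pi ^ 2 * iteratedDeriv 1 a v ^ 2) :
    Continuous (kernelC κ u₀ u₁ a b q p c) ∧
      (∀ β, ContDiff ℝ ∞ fun v => fourierC β (kernelC κ u₀ u₁ a b q p c v)) ∧
      ∃ C, 0 ≤ C ∧ ∀ (β : ℝ) (m : ℕ) (v : ℝ),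
        ‖iteratedDeriv m (fun v => fourierC β (kernelC κ u₀ u₁ a b q p c v)) v‖ ≤
          C * gevreyWeight σ (2 * M) m / (1 + β ^ 2) := by
  have hM2 : 0 < 2 * M := by positivity
  set U := Ioo (u₀ + d) (u₁ - d) with hUdef
  have hU : IsOpen U := isOpen_Ioo
  have hUb : U ⊆ Icc (u₀ + d) (u₁ - d) := Ioo_subset_Icc_self
  set R := u₁ - u₀ with hR
  have hsub : Icc (u₀ + d') (u₁ - d') ⊆ U := fun v hv => ⟨by linarith [hv.1], by linarith [hv.2]⟩
  have hsupp' : ∀ v ∉ Icc (u₀ + d) (u₁ - d), c v = 0 := fun v hv =>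
    hsupp v fun h => hv (hUb (hsub h))
  obtain ⟨Φ₁, Φ₂, hΦ⟩ := exists_gevC2_homSol (κ := κ) hσ hM hU hUb ha hb R
  obtain ⟨B₁, B₂, hB⟩ := exists_gevC2_regPart (u₀ := u₀) (u₁ := u₁) hσ hM hd hκ ha hb ha0 hb0
  obtain ⟨Q₁, Q₂, hQ⟩ := exists_gevC2_avg_shift (U := U) hσ hM hq R
  obtain ⟨P₁, P₂, hP⟩ := exists_gevC2_avg_shift (U := U) hσ hM hp R
  have hpU : Gev σ (2 * M) U p := (hp.mono hM).gev₀.mono_set (subset_univ _)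
  have hqU : Gev σ (2 * M) U q := (hq.mono hM).gev₀.mono_set (subset_univ _)
  have hcU : Gev σ (2 * M) U c := (hc.mono hM).gev₀.mono_set (subset_univ _)
  have haU : Gev σ (2 * M) U (iteratedDeriv 1 a) :=
    ((ha.mono hM).gev 1 (by norm_num)).mono_set (subset_univ _)
  have hjU : Gev σ (2 * M) U (jump κ u₀ u₁ a b) := gev_jump hσ hM hd hκ ha hb ha0 hb0
  have hnU : Gev σ (2 * M) U (normB κ u₀ u₁ a b) := gev_normB hσ hM hd hκ ha hb ha0 hb0 hδ hj
  have hcn := hcU.mul hσ.le hM2 hnU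
  have hH := (GevC2.smul hσ.le hM2 hpU hQ).add (GevC2.smul hσ.le hM2 (hqU.neg) hP)
  have hS := GevC2.shift (U := U) hσ.le hM (fun n hn => hc.gev n (by omega)) hc.smooth R
  have hV := vanish_shift hd hc hsupp'
  have hR1 := Gev.const (σ := σ) (U := U) hM2 R
  have hW := GevC2.mul hσ.le hM2 hH hΦ
  have hE₁ := GevC2.smul hσ.le hM2 hcn (GevC2.mul hσ.le hM2 hS (GevC2.mul hσ.le hM2 hW hB))
  have hE₂ := GevC2.smul hσ.le hM2 (hcn.mul hσ.le hM2 (hR1.mul hσ.le hM2 haU))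
    (GevC2.mul hσ.le hM2 hS hW)
  have hE₃ := GevC2.smul hσ.le hM2 (hcn.mul hσ.le hM2 (hR1.mul hσ.le hM2 hjU)).neg
    (GevC2.mul hσ.le hM2 hS hW)
  obtain ⟨C₁, hC₁, hb₁⟩ := hE₁.exists_bound hU ((hV.mul _ _).smul _) quadWeight_one
  obtain ⟨C₂, hC₂, hb₂⟩ := hE₂.exists_bound hU ((hV.mul _ _).smul _) quadWeight_logC
  obtain ⟨C₃, hC₃, hb₃⟩ := hE₃.exists_bound hU ((hV.mul _ _).smul _) quadWeight_posC
  -- The three singularity types are separated: each of the weights 1, s log|s| and max(s,0)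
  -- multiplies a `GevC2` family that vanishes to second order at the ends.
  have hsplit : ∀ v, kernelC κ u₀ u₁ a b q p c v = 1 * _ + logC * _ + posC * _ := fun v => by
    refine Eq.trans ?_ (congrArg₂ (· + ·) (congrArg₂ (· + ·)
      (congrArg (1 * ·) (rfl : (c v * normB κ u₀ u₁ a b v) • (shift R 0 c v *
        ((p v • avg 0 (shift R 0 (iteratedDeriv 1 q) v) + (-q v) • avg 0 (shift R 0 (iteratedDeriv 1 p) v))
          * homSol κ R 0 a b v * regPart κ u₀ u₁ a b v)) = _))
      (congrArg (logC * ·) (rfl : (c v * normB κ u₀ u₁ a b v * (R * iteratedDeriv 1 a v)) •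
        (shift R 0 c v * ((p v • avg 0 (shift R 0 (iteratedDeriv 1 q) v) +
          (-q v) • avg 0 (shift R 0 (iteratedDeriv 1 p) v)) * homSol κ R 0 a b v)) = _)))
      (congrArg (posC * ·) (rfl : (-(c v * normB κ u₀ u₁ a b v * (R * jump κ u₀ u₁ a b v))) •
        (shift R 0 c v * ((p v • avg 0 (shift R 0 (iteratedDeriv 1 q) v) +
          (-q v) • avg 0 (shift R 0 (iteratedDeriv 1 p) v)) * homSol κ R 0 a b v)) = _)))
    refine symmC_ext fun s _ => ?_
    simp only [kernelC, commC, greenC, bracketC, ev_add, ev_sub, ev_mul, ev_smul, ev_one, ← hR]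
    ring
  have hsm₁ := ((Gev.const hM2 (1 : SymmC)).mul hσ.le hM2 hE₁.gev)
  have hsm₂ := ((Gev.const hM2 logC).mul hσ.le hM2 hE₂.gev)
  have hsm₃ := ((Gev.const hM2 posC).mul hσ.le hM2 hE₃.gev)
  have hG : Gev σ (2 * M) U (kernelC κ u₀ u₁ a b q p c) :=
    Gev.congr hU ((hsm₁.add hsm₂).add hsm₃) fun v _ => hsplit v
  -- The support of c lies strictly inside `U` because d < d', so the kernel vanishes near every
  -- point outside `U` and bounds on `U` become global.
  have hzero : ∀ v ∉ U, kernelC κ u₀ u₁ a b q p c =ᶠ[𝓝 v] fun _ => 0 := fun v hv => by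
    filter_upwards [isClosed_Icc.isOpen_compl.mem_nhds fun h => hv (hsub h)] with x hx
    exact kernelC_eq_zero (hsupp x hx)
  have hsm : ∀ v, ContDiffAt ℝ ∞ (kernelC κ u₀ u₁ a b q p c) v := fun v => by
    by_cases hv : v ∈ U
    · exact hG.smooth v hv
    · exact contDiffAt_const.congr_of_eventuallyEq (hzero v hv)
  refine ⟨continuous_iff_continuousAt.mpr fun v => (hsm v).continuousAt, fun β =>
    contDiff_iff_contDiffAt.mpr fun v => (fourierC β).contDiff.contDiffAt.comp v (hsm v),
    C₁ + C₂ + C₃, by positivity, fun β m v => ?_⟩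
  have hw := gevreyWeight_pos (σ := σ) hM2 m
  by_cases hv : v ∈ U
  · have h1 := hb₁ β m v hv
    have h2 := hb₂ β m v hv
    have h3 := hb₃ β m v hv
    have hs₁ := (hsm₁.clm (fourierC β)).smooth v hv
    have hs₂ := (hsm₂.clm (fourierC β)).smooth v hv
    have hs₃ := (hsm₃.clm (fourierC β)).smooth v hv
    simp only [hsplit, map_add]
    rw [iteratedDeriv_fun_add (contDiffAt_nat (hs₁.add hs₂) m) (contDiffAt_nat hs₃ m),
      iteratedDeriv_fun_add (contDiffAt_nat hs₁ m) (contDiffAt_nat hs₂ m), add_mul, add_mul, add_div,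
      add_div]
    exact (norm_add_le _ _).trans (add_le_add ((norm_add_le _ _).trans (add_le_add h1 h2)) h3)
  · have h1 : (fun v => fourierC β (kernelC κ u₀ u₁ a b q p c v)) =ᶠ[𝓝 v] fun _ => 0 := by
      filter_upwards [hzero v hv] with x hx
      rw [hx, map_zero]
    rw [h1.iteratedDeriv_eq, iteratedDeriv_const]
    simp only [ite_self, norm_zero]
    positivity

end Kernel

end ShearFlow

end

noncomputable section
namespace ShearFlow

/-! ### The background in the variable `v = u(y)` -/

theorem eq_of_deriv_eq_zero_on {f : ℝ → ℝ} (hf : Differentiable ℝ f) {S : Set ℝ} (hS : Convex ℝ S)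
    (h : ∀ x ∈ S, deriv f x = 0) {x y : ℝ} (hx : x ∈ S) (hy : y ∈ S) : f x = f y := by
  have := hS.norm_image_sub_le_of_norm_deriv_le (f := f) (C := 0) (fun x _ => hf x)
    (fun x hx => by rw [h x hx, norm_zero]) hy hx
  rw [zero_mul] at this
  exact sub_eq_zero.mp (norm_le_zero_iff.mp this)

namespace Background

variable {s₀ κ₀ c₀ K : ℝ} {u θ : ℝ → ℝ}

theorem deriv_theta_eq_zero (h : Background s₀ κ₀ c₀ K u θ) {y : ℝ}
    (hy : y ∉ Icc (4 * κ₀) (1 - 4 * κ₀)) : deriv θ y = 0 :=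
  image_eq_zero_of_notMem_tsupport fun h' => hy (h.supp_theta h')

theorem deriv_deriv_u_eq_zero (h : Background s₀ κ₀ c₀ K u θ) {y : ℝ}
    (hy : y ∉ Icc (4 * κ₀) (1 - 4 * κ₀)) : deriv (deriv u) y = 0 :=
  image_eq_zero_of_notMem_tsupport fun h' => hy (h.supp_u h')

theorem smooth_deriv (h : Background s₀ κ₀ c₀ K u θ) : ContDiff ℝ ∞ (deriv u) :=
  (contDiff_infty_iff_deriv.mp h.smooth_u).2

theorem differentiable_u (h : Background s₀ κ₀ c₀ K u θ) : Differentiable ℝ u :=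
  h.smooth_u.differentiable (by simp)

theorem differentiable_deriv (h : Background s₀ κ₀ c₀ K u θ) : Differentiable ℝ (deriv u) :=
  h.smooth_deriv.differentiable (by simp)

theorem differentiable_theta (h : Background s₀ κ₀ c₀ K u θ) : Differentiable ℝ θ :=
  h.smooth_theta.differentiable (by simp)

theorem eq_left {f : ℝ → ℝ} (hκ : 0 < κ₀) (hf : Differentiable ℝ f)
    (h : ∀ y ∉ Icc (4 * κ₀) (1 - 4 * κ₀), deriv f y = 0) {y : ℝ} (hy : y < 4 * κ₀) : f y = f 0 :=
  eq_of_deriv_eq_zero_on hf (convex_Iio (4 * κ₀)) (fun x hx => h x fun h' => not_le.mpr hx h'.1) hy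
    (by simpa using hκ)

theorem eq_right {f : ℝ → ℝ} (hκ : 0 < κ₀) (hf : Differentiable ℝ f)
    (h : ∀ y ∉ Icc (4 * κ₀) (1 - 4 * κ₀), deriv f y = 0) {y : ℝ} (hy : 1 - 4 * κ₀ < y) : f y = f 1 :=
  eq_of_deriv_eq_zero_on hf (convex_Ioi (1 - 4 * κ₀)) (fun x hx => h x fun h' => not_le.mpr hx h'.2) hy
    (by simpa using hκ)

theorem le_of_flat {f : ℝ → ℝ} (hκ : 0 < κ₀) (hf : Differentiable ℝ f)
    (h : ∀ y ∉ Icc (4 * κ₀) (1 - 4 * κ₀), deriv f y = 0) {c : ℝ}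
    (hc : ∀ y ∈ Icc (0 : ℝ) 1, c ≤ f y) (y : ℝ) : c ≤ f y := by
  rcases lt_or_ge y 0 with h0 | h0
  · rw [eq_left hκ hf h (by linarith)]; exact hc 0 (by simp)
  rcases lt_or_ge 1 y with h1 | h1
  · rw [eq_right hκ hf h (by linarith)]; exact hc 1 (by simp)
  · exact hc y ⟨h0, h1⟩

/-- This bound may depend on the flow. It enters only the Gevrey constants and never the radius, so
the uniform rate of decay is unaffected. -/
theorem exists_abs_le {f : ℝ → ℝ} (hκ : 0 < κ₀) (hf : Differentiable ℝ f)
    (h : ∀ y ∉ Icc (4 * κ₀) (1 - 4 * κ₀), deriv f y = 0) : ∃ C, ∀ y, |f y| ≤ C := by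
  obtain ⟨C, hC⟩ := isCompact_Icc.exists_bound_of_continuousOn
    (hf.continuous.continuousOn (s := Icc (0 : ℝ) 1))
  refine ⟨C, fun y => ?_⟩
  rcases lt_or_ge y 0 with h0 | h0
  · rw [eq_left hκ hf h (by linarith)]; exact hC 0 (by simp)
  rcases lt_or_ge 1 y with h1 | h1
  · rw [eq_right hκ hf h (by linarith)]; exact hC 1 (by simp)
  · exact hC y ⟨h0, h1⟩

theorem le_deriv (h : Background s₀ κ₀ c₀ K u θ) (hκ : 0 < κ₀) (y : ℝ) : c₀ ≤ deriv u y :=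
  le_of_flat hκ h.differentiable_deriv (fun _ hy => h.deriv_deriv_u_eq_zero hy) h.monotone y

theorem le_theta (h : Background s₀ κ₀ c₀ K u θ) (hκ : 0 < κ₀) (y : ℝ) : c₀ ≤ θ y :=
  le_of_flat hκ h.differentiable_theta (fun _ hy => h.deriv_theta_eq_zero hy) h.positive y

theorem strictMono (h : Background s₀ κ₀ c₀ K u θ) (hκ : 0 < κ₀) (hc : 0 < c₀) : StrictMono u :=
  strictMono_of_deriv_pos fun y => hc.trans_le (h.le_deriv hκ y)

theorem mul_sub_le (h : Background s₀ κ₀ c₀ K u θ) (hκ : 0 < κ₀) {x y : ℝ} (hxy : x ≤ y) :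
    c₀ * (y - x) ≤ u y - u x :=
  mul_sub_le_image_sub_of_le_deriv h.differentiable_u (h.le_deriv hκ) hxy

theorem surjective (h : Background s₀ κ₀ c₀ K u θ) (hκ : 0 < κ₀) (hc : 0 < c₀) :
    Function.Surjective u := by
  refine h.differentiable_u.continuous.surjective ?_ ?_
  · refine tendsto_atTop_mono' atTop (f₁ := fun y => u 0 + c₀ * y) ?_ ?_
    · filter_upwards [eventually_ge_atTop 0] with y hy
      have := h.mul_sub_le hκ hy
      linarith
    · exact tendsto_atTop_add_const_left _ _ (tendsto_id.const_mul_atTop hc)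
  · refine tendsto_atBot_mono' atBot (f₁ := fun y => u 0 + c₀ * y) ?_ ?_
    · filter_upwards [eventually_le_atBot 0] with y hy
      have := h.mul_sub_le hκ hy
      linarith
    · exact tendsto_atBot_add_const_left _ _ (tendsto_id.const_mul_atBot hc)

theorem uInv_u (h : Background s₀ κ₀ c₀ K u θ) (hκ : 0 < κ₀) (hc : 0 < c₀) (y : ℝ) :
    uInv u (u y) = y :=
  Function.leftInverse_invFun (h.strictMono hκ hc).injective y

theorem u_uInv (h : Background s₀ κ₀ c₀ K u θ) (hκ : 0 < κ₀) (hc : 0 < c₀) (v : ℝ) :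
    u (uInv u v) = v :=
  Function.rightInverse_invFun (h.surjective hκ hc) v

theorem uInv_strictMono (h : Background s₀ κ₀ c₀ K u θ) (hκ : 0 < κ₀) (hc : 0 < c₀) :
    StrictMono (uInv u) := fun v w hvw => by
  rw [← (h.strictMono hκ hc).lt_iff_lt, h.u_uInv hκ hc, h.u_uInv hκ hc]
  exact hvw

theorem continuous_uInv (h : Background s₀ κ₀ c₀ K u θ) (hκ : 0 < κ₀) (hc : 0 < c₀) :
    Continuous (uInv u) :=
  (h.uInv_strictMono hκ hc).monotone.continuous_of_surjective fun y => ⟨u y, h.uInv_u hκ hc y⟩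

theorem hasDerivAt_uInv (h : Background s₀ κ₀ c₀ K u θ) (hκ : 0 < κ₀) (hc : 0 < c₀) (v : ℝ) :
    HasDerivAt (uInv u) ((deriv u (uInv u v))⁻¹) v :=
  HasDerivAt.of_local_left_inverse (h.continuous_uInv hκ hc).continuousAt
    (h.differentiable_u _).hasDerivAt (hc.trans_le (h.le_deriv hκ _)).ne'
    (Eventually.of_forall (h.u_uInv hκ hc))

end Background

/-- A function of `y` in the variable `v = u(y)`. -/
def pull (u f : ℝ → ℝ) (v : ℝ) : ℝ := f (uInv u v)

/-- `θ/u'` in the variable `v`. -/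
def aV (u θ : ℝ → ℝ) : ℝ → ℝ := pull u fun y => θ y * (deriv u y)⁻¹

/-- `1/(θu')` in the variable `v`. -/
def bV (u θ : ℝ → ℝ) : ℝ → ℝ := pull u fun y => (θ y)⁻¹ * (deriv u y)⁻¹

/-- `(u⁻¹)'`. -/
def qV (u : ℝ → ℝ) : ℝ → ℝ := pull u fun y => (deriv u y)⁻¹

/-- Lowering the order by one costs at most the factor 4, from (m+2)² ≤ 4(m+1)². Order zero needs
its own bound, which the hypotheses on derivatives do not contain. -/
theorem gev_of_gev_deriv {σ K : ℝ} (hK : 1 < K) (hσ : 0 ≤ σ) {f : ℝ → ℝ} (hf : ContDiff ℝ ∞ f) {C : ℝ}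
    (hC : ∀ y, |f y| ≤ C) (h : ∀ m y, |iteratedDeriv m (deriv f) y| ≤ gevreyWeight σ K m) :
    Gev σ K univ f := by
  have hC0 : 0 ≤ C := (abs_nonneg _).trans (hC 0)
  refine ⟨fun v _ => hf.contDiffAt, C + 4, by linarith, fun m v _ => ?_⟩
  rw [Real.norm_eq_abs]
  rcases m with _ | m
  · rw [iteratedDeriv_zero, gevreyWeight_zero]
    linarith [hC v]
  · rw [iteratedDeriv_succ']
    have hw := gevreyWeight_pos (σ := σ) (zero_lt_one.trans hK) (m + 1)
    have h1 : gevreyWeight σ K m ≤ 4 * gevreyWeight σ K (m + 1) := by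
      unfold gevreyWeight
      rw [← mul_div_assoc, div_le_div_iff₀ (by positivity) (by positivity)]
      have hm : (0 : ℝ) ≤ m := by positivity
      have e1 : K ^ m ≤ K ^ (m + 1) := pow_le_pow_right₀ hK.le (Nat.le_succ m)
      have e2 : (m.factorial : ℝ) ^ σ ≤ ((m + 1).factorial : ℝ) ^ σ := by
        gcongr
        omega
      have e3 : (((m + 1 : ℕ) : ℝ) + 1) ^ 2 ≤ 4 * ((m : ℝ) + 1) ^ 2 := by
        push_cast
        nlinarith
      calc K ^ m * (m.factorial : ℝ) ^ σ * (((m + 1 : ℕ) : ℝ) + 1) ^ 2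
          ≤ K ^ (m + 1) * ((m + 1).factorial : ℝ) ^ σ * (4 * ((m : ℝ) + 1) ^ 2) := by gcongr
        _ = _ := by ring
    nlinarith [h m v]

/-- Composition with `u⁻¹` preserves Gevrey regularity, with uniform constants. -/
theorem exists_radius_pull {s₀ κ₀ c₀ K M₀ : ℝ} (hs₀ : 0 < s₀) (hs₁ : s₀ < 1) (hκ : 0 < κ₀)
    (hc : 0 < c₀) (hK : 1 < K) (hM₀ : 0 < M₀) :
    ∃ N, 0 < N ∧ ∀ u θ, Background s₀ κ₀ c₀ K u θ → ∀ f, Gev (1 / s₀) M₀ univ f →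
      Gev (1 / s₀) N univ (pull u f) := by
  have hσ : 1 ≤ 1 / s₀ := by rw [le_div_iff₀ hs₀]; linarith
  set B := c₀⁻¹ with hB
  have hB0 : 0 < B := by positivity
  set M := M₀ + 2 * (2 * K * (1 + B)) with hM
  have hM0 : 0 < M := by positivity
  refine ⟨4 * (2 * B * M), by positivity, fun u θ h f hf => ?_⟩
  obtain ⟨C, hC0, hC⟩ := hf.factorial_bound hM₀
  have hsm : ContDiff ℝ ∞ f := contDiff_iff_contDiffAt.mpr fun x => hf.smooth x (mem_univ x)
  have hg : ContDiff ℝ ∞ fun y => (deriv u y)⁻¹ :=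
    h.smooth_deriv.inv fun y => (hc.trans_le (h.le_deriv hκ y)).ne'
  have hbd : ∀ i, 1 ≤ i → ∀ x, |iteratedDeriv i (deriv u) x| ≤ K ^ i * (i.factorial : ℝ) ^ (1 / s₀) := by
    intro i hi x
    obtain ⟨m, rfl⟩ := Nat.exists_eq_succ_of_ne_zero (Nat.one_le_iff_ne_zero.mp hi)
    rw [Nat.succ_eq_add_one, iteratedDeriv_succ']
    have h1 := h.gevrey m x x
    have h2 : |iteratedDeriv m (deriv (deriv u)) x| ≤
        K ^ m * (m.factorial : ℝ) ^ (1 / s₀) / ((m : ℝ) + 1) ^ 2 := by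
      linarith [abs_nonneg (iteratedDeriv m (deriv θ) x)]
    refine h2.trans ((div_le_self (by positivity) ?_).trans ?_)
    · have : (0 : ℝ) ≤ m := by positivity
      nlinarith
    · have e1 : K ^ m ≤ K ^ (m + 1) := pow_le_pow_right₀ hK.le (Nat.le_succ m)
      have e2 : (m.factorial : ℝ) ^ (1 / s₀) ≤ ((m + 1).factorial : ℝ) ^ (1 / s₀) := by
        gcongr
        omega
      gcongr
  have hgb : ∀ i x, |iteratedDeriv i (fun y => (deriv u y)⁻¹) x| ≤
      B * (M / 2) ^ i * (i.factorial : ℝ) ^ (1 / s₀) := fun i x => by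
    refine (abs_iteratedDeriv_inv_le hσ (by linarith) hB0 h.smooth_deriv
      (fun x => by rw [hB, inv_inv]; exact h.le_deriv hκ x) hbd i x).trans ?_
    gcongr
    rw [hM]
    linarith
  -- u⁻¹ solves y' = 1/u'(y), with right-hand side bounded by 1/c₀. No upper bound on u' is used, so
  -- the resulting radius depends only on s₀, c₀, K and M₀.
  have h3 := abs_iteratedDeriv_comp_flow_le hσ hM0 hB0 hC0 hsm hg (h.hasDerivAt_uInv hκ hc) hgb
    fun i x => (hC i x (mem_univ x)).trans (by
      gcongr
      rw [hM]
      have : 0 ≤ 2 * (2 * K * (1 + B)) := by positivity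
      linarith)
  exact gev_of_factorial_bound (by positivity) hC0 h3.1 h3.2

theorem Gev.jet {σ M : ℝ} (hσ : 0 ≤ σ) (hM : 0 < M) {f : ℝ → ℝ} (hf : Gev σ M univ f) :
    GevJet σ (M * 2 ^ σ * 2 ^ σ * 2 ^ σ) f := by
  have h2 : (1 : ℝ) ≤ 2 ^ σ := Real.one_le_rpow (by norm_num) hσ
  have hp : 0 < (2 : ℝ) ^ σ := by positivity
  have h1 := hf.deriv hσ hM
  have h3 := h1.deriv hσ (by positivity)
  have h4 := h3.deriv hσ (by positivity)
  refine ⟨contDiff_iff_contDiffAt.mpr fun x => hf.smooth x (mem_univ x), fun n hn => ?_⟩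
  have e1 : M ≤ M * 2 ^ σ := le_mul_of_one_le_right hM.le h2
  have e2 : M * 2 ^ σ ≤ M * 2 ^ σ * 2 ^ σ := le_mul_of_one_le_right (by positivity) h2
  have e3 : M * 2 ^ σ * 2 ^ σ ≤ M * 2 ^ σ * 2 ^ σ * 2 ^ σ := le_mul_of_one_le_right (by positivity) h2
  interval_cases n
  · rw [iteratedDeriv_zero]
    exact hf.mono hM (e1.trans (e2.trans e3))
  · rw [iteratedDeriv_one]
    exact h1.mono (by positivity) (e2.trans e3)
  · rw [iteratedDeriv_succ, iteratedDeriv_one]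
    exact h3.mono (by positivity) e3
  · rw [iteratedDeriv_succ, iteratedDeriv_succ, iteratedDeriv_one]
    exact h4

/-- The background and the cut-off are of Gevrey class in the variable `v`, with a uniform radius. -/
theorem exists_radius {s₀ κ₀ c₀ K K₁ : ℝ} (hs₀ : 0 < s₀) (hs₁ : s₀ < 1) (hκ : 0 < κ₀)
    (hc : 0 < c₀) (hK : 1 < K) (hK₁ : 1 < K₁) :
    ∃ M, 0 < M ∧ ∀ u θ χ, Background s₀ κ₀ c₀ K u θ → IsCutoff s₀ κ₀ K₁ χ →
      GevJet (1 / s₀) M (aV u θ) ∧ GevJet (1 / s₀) M (bV u θ) ∧ GevJet (1 / s₀) M (qV u) ∧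
      GevJet (1 / s₀) M (tvarphi1 u θ) ∧ GevJet (1 / s₀) M (pull u χ) := by
  have hσ : 1 < 1 / s₀ := by rw [lt_div_iff₀ hs₀]; linarith
  have hσ0 : 0 ≤ 1 / s₀ := by linarith
  have hK0 : 0 < K := by linarith
  have h2 : (1 : ℝ) ≤ 2 ^ (1 / s₀) := Real.one_le_rpow (by norm_num) hσ0
  set M₀ := K * 2 ^ (1 / s₀) + K₁ with hM₀
  have hM₀0 : 0 < M₀ := by positivity
  obtain ⟨N, hN, hpull⟩ := exists_radius_pull hs₀ hs₁ hκ hc hK hM₀0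
  refine ⟨N * 2 ^ (1 / s₀) * 2 ^ (1 / s₀) * 2 ^ (1 / s₀), by positivity, fun u θ χ h hχ => ?_⟩
  have hKM : K ≤ M₀ := by nlinarith
  have hKM' : K * 2 ^ (1 / s₀) ≤ M₀ := by linarith
  have hjet : ∀ f, Gev (1 / s₀) M₀ univ f →
      GevJet (1 / s₀) (N * 2 ^ (1 / s₀) * 2 ^ (1 / s₀) * 2 ^ (1 / s₀)) (pull u f) := fun f hf =>
    (hpull u θ h f hf).jet hσ0 hN
  obtain ⟨Cθ, hCθ⟩ := Background.exists_abs_le hκ h.differentiable_theta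
    (fun _ hy => h.deriv_theta_eq_zero hy)
  obtain ⟨Cu, hCu⟩ := Background.exists_abs_le hκ h.differentiable_deriv
    (fun _ hy => h.deriv_deriv_u_eq_zero hy)
  have hθ : Gev (1 / s₀) K univ θ := gev_of_gev_deriv hK hσ0 h.smooth_theta hCθ fun m y => by
    have := h.gevrey m y y
    unfold gevreyWeight
    linarith [abs_nonneg (iteratedDeriv m (deriv (deriv u)) y)]
  have hu : Gev (1 / s₀) K univ (deriv u) := gev_of_gev_deriv hK hσ0 h.smooth_deriv hCu fun m y => by
    have := h.gevrey m y y
    unfold gevreyWeight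
    linarith [abs_nonneg (iteratedDeriv m (deriv θ) y)]
  have hθi := hθ.inv hσ hK0 isOpen_univ hc fun v _ => (h.le_theta hκ v).trans (le_abs_self _)
  have hui := hu.inv hσ hK0 isOpen_univ hc fun v _ => (h.le_deriv hκ v).trans (le_abs_self _)
  have hφ : Gev (1 / s₀) (K * 2 ^ (1 / s₀)) univ (varphi1 u θ) := by
    have := (hu.mul hσ.le hK0 hθi).deriv hσ0 hK0
    exact this
  have hχ' : Gev (1 / s₀) K₁ univ χ := by
    refine ⟨fun v _ => hχ.smooth.contDiffAt, 1, zero_le_one, fun m v _ => ?_⟩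
    rw [one_mul, Real.norm_eq_abs]
    refine (hχ.gevrey m v).trans ?_
    unfold gevreyWeight
    have : (1 : ℝ) ≤ m.factorial := by exact_mod_cast m.factorial_pos
    -- Since s₀ ≤ 1, the cut-off belongs to a smaller Gevrey class than the flow.
    have h3 : 2 / (s₀ + 1) ≤ 1 / s₀ := by
      rw [div_le_div_iff₀ (by linarith) hs₀]
      linarith
    have h4 := Real.rpow_le_rpow_of_exponent_le this h3
    gcongr
  exact ⟨hjet _ ((hθ.mul hσ.le hK0 hui).mono hK0 hKM), hjet _ ((hθi.mul hσ.le hK0 hui).mono hK0 hKM),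
    hjet _ (hui.mono hK0 hKM), hjet _ (hφ.mono (by positivity) hKM'),
    hjet _ (hχ'.mono (by linarith) (by rw [hM₀]; nlinarith))⟩

end ShearFlow

end

noncomputable section
namespace ShearFlow

/-! ### Rescaling -/

/-- The function `s ↦ g (r s)`. -/
def scaleC (r : ℝ) (g : SymmC) : SymmC := toC fun s => ev g (r * s)

theorem ev_scaleC (r : ℝ) (g : SymmC) {s : ℝ} (hs : s ∈ Icc (-1 : ℝ) 1) :
    ev (scaleC r g) s = ev g (r * s) :=
  ev_toC ((continuous_ev g).comp (continuous_const.mul continuous_id)).continuousOn hs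

theorem avg_scaleC {r : ℝ} (hr : r ∈ Icc (0 : ℝ) 1) (j : ℕ) (g : SymmC) :
    avg j (scaleC r g) = scaleC r (avg j g) := by
  refine symmC_ext fun s hs => ?_
  rw [ev_scaleC r _ hs, ev_avg j _ hs, ev_avg j _ (mul_mem_symm hr hs)]
  refine intervalIntegral.integral_congr fun x hx => ?_
  rw [uIcc_of_le zero_le_one] at hx
  rw [ev_scaleC r _ (mul_mem_symm hx hs)]
  congr 2
  ring

theorem scaleC_mul (r : ℝ) (f g : SymmC) : scaleC r (f * g) = scaleC r f * scaleC r g :=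
  symmC_ext fun s hs => by
    rw [ev_mul, ev_scaleC r _ hs, ev_scaleC r _ hs, ev_scaleC r _ hs, ev_mul]

theorem shift_eq_scaleC {τ₀ τ₁ R r v : ℝ} (hr : r ∈ Icc (0 : ℝ) 1) (h : τ₀ + τ₁ * v = R * r) {f : ℝ → ℝ}
    (hf : Continuous f) : shift τ₀ τ₁ f v = scaleC r (shift R 0 f v) :=
  symmC_ext fun s hs => by
    rw [ev_scaleC r _ hs, ev_shift hf hs, ev_shift hf (mul_mem_symm hr hs), h]
    congr 1
    ring

section Rescale

variable {κ τ₀ τ₁ R r v : ℝ} {a b : ℝ → ℝ}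

theorem homSol_eq (κ τ₀ τ₁ : ℝ) (a b : ℝ → ℝ) (v : ℝ) :
    homSol κ τ₀ τ₁ a b v = 1 + (κ * (τ₀ + τ₁ * v) ^ 2) •
      (idC ^ 2 * avg 1 (shift τ₀ τ₁ a v * homP κ τ₀ τ₁ a b v)) :=
  volterraSol_eq _ _ _

/-- Dilating s by r multiplies s² by r², which is exactly the change of the factor κτ² in the
Volterra equation. Uniqueness identifies the solutions. This connects the coordinates used in
`coefL` and `coefR` with the one of width R. -/
theorem homSol_eq_scaleC (hr : r ∈ Icc (0 : ℝ) 1) (h : τ₀ + τ₁ * v = R * r) (ha : Continuous a)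
    (hb : Continuous b) : homSol κ τ₀ τ₁ a b v = scaleC r (homSol κ R 0 a b v) := by
  refine (volterraSol_unique ?_).symm
  rw [volterra_apply, shift_eq_scaleC hr h ha, shift_eq_scaleC hr h hb, ← scaleC_mul, avg_scaleC hr,
    ← scaleC_mul, avg_scaleC hr]
  refine symmC_ext fun s hs => ?_
  conv_lhs => rw [homSol_eq]
  simp only [ev_add, ev_smul, ev_mul, ev_pow, ev_one, ev_idC hs, ev_scaleC r _ hs,
    ev_idC (mul_mem_symm hr hs), h]
  unfold homP
  ring

theorem homN_eq_scaleC (hκ : 0 ≤ κ) (hr : r ∈ Icc (0 : ℝ) 1) (h : τ₀ + τ₁ * v = R * r)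
    (ha : Continuous a) (hb : Continuous b) (ha0 : ∀ x, 0 < a x) (hb0 : ∀ x, 0 < b x) :
    homN κ τ₀ τ₁ a b v = scaleC r (homN κ R 0 a b v) := by
  refine symmC_ext fun s hs => ?_
  have hrs := mul_mem_symm hr hs
  have h1 : homP κ τ₀ τ₁ a b v = scaleC r (homP κ R 0 a b v) := by
    unfold homP
    rw [homSol_eq_scaleC hr h ha hb, shift_eq_scaleC hr h hb, ← scaleC_mul, avg_scaleC hr]
  have h2 : ev (homZ κ τ₀ τ₁ a b v) s = ev (homZ κ R 0 a b v) (r * s) := by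
    unfold homZ
    rw [h1, shift_eq_scaleC hr h ha, ← scaleC_mul, avg_scaleC hr, ev_smul, ev_scaleC r _ hs, ev_smul]
  have h3 : ev (homSol κ τ₀ τ₁ a b v) s = ev (homSol κ R 0 a b v) (r * s) := by
    rw [homSol_eq_scaleC hr h ha hb, ev_scaleC r _ hs]
  have h4 : ev (shift τ₀ τ₁ a v) s = ev (shift R 0 a v) (r * s) := by
    rw [shift_eq_scaleC hr h ha, ev_scaleC r _ hs]
  rw [ev_scaleC r _ hs]
  unfold homN
  simp only [ev_neg, ev_mul, ev_add, h2, h3, h4, ev_smul, ev_one]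
  rw [ev_invC (fun x hx => one_le_ev_homSol hκ ha hb ha0 hb0 v hx) hs,
    ev_invC (fun x hx => one_le_ev_homSol hκ ha hb ha0 hb0 v hx) hrs, h3]

end Rescale

/-! ### The Green function -/

/-- Admissible coefficients of the Green function at the point `v`. -/
structure Admissible (κ u₀ u₁ : ℝ) (a b : ℝ → ℝ) (v : ℝ) : Prop where
  nonneg : 0 ≤ κ
  smooth : ContDiff ℝ ∞ a
  cont : Continuous b
  a_pos : ∀ x, 0 < a x
  b_pos : ∀ x, 0 < b x
  left : ∀ x ≤ u₀, iteratedDeriv 1 a x = 0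
  right : ∀ x, u₁ ≤ x → iteratedDeriv 1 a x = 0
  mem : v ∈ Ioo u₀ u₁

namespace Admissible

variable {κ u₀ u₁ v : ℝ} {a b : ℝ → ℝ}

theorem width_pos (h : Admissible κ u₀ u₁ a b v) : 0 < u₁ - u₀ := by
  linarith [h.mem.1, h.mem.2]

theorem ratioL_mem (h : Admissible κ u₀ u₁ a b v) : (v - u₀) / (u₁ - u₀) ∈ Ioo (0 : ℝ) 1 := by
  have := h.width_pos
  refine ⟨div_pos (by linarith [h.mem.1]) this, ?_⟩
  rw [div_lt_one this]
  linarith [h.mem.2]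

theorem ratioR_mem (h : Admissible κ u₀ u₁ a b v) : (u₁ - v) / (u₁ - u₀) ∈ Ioo (0 : ℝ) 1 := by
  have := h.width_pos
  refine ⟨div_pos (by linarith [h.mem.2]) this, ?_⟩
  rw [div_lt_one this]
  linarith [h.mem.1]

theorem hasDerivAt (h : Admissible κ u₀ u₁ a b v) (n : ℕ) (x : ℝ) :
    HasDerivAt (iteratedDeriv n a) (iteratedDeriv (n + 1) a x) x := by
  rw [iteratedDeriv_succ]
  exact (h.smooth.differentiable_iteratedDeriv n (by exact_mod_cast ENat.natCast_lt_top n)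
    x).hasDerivAt

theorem continuous (h : Admissible κ u₀ u₁ a b v) (n : ℕ) : Continuous (iteratedDeriv n a) :=
  h.smooth.continuous_iteratedDeriv n (by exact_mod_cast le_top)

theorem one_le (h : Admissible κ u₀ u₁ a b v) {s : ℝ} (hs : s ∈ Icc (-1 : ℝ) 1) (R : ℝ) :
    1 ≤ ev (homSol κ R 0 a b v) s :=
  one_le_ev_homSol h.nonneg h.smooth.continuous h.cont h.a_pos h.b_pos v hs

theorem ev_shift_a (h : Admissible κ u₀ u₁ a b v) {s : ℝ} (hs : s ∈ Icc (-1 : ℝ) 1) (R : ℝ) :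
    ev (shift R 0 a v) s = a (v + R * s) := by
  rw [ev_shift h.smooth.continuous hs, zero_mul, add_zero]

/-- From Φ = 1 + R²s²Z one gets Φ⁻² - 1 = -R²s² Z(Φ+1)Φ⁻², and the singular factor (v₁ - v)² divides
out. -/
theorem sq_mul_ev_homN (h : Admissible κ u₀ u₁ a b v) {s : ℝ} (hs : s ∈ Icc (-1 : ℝ) 1) (R : ℝ) :
    R ^ 2 * s ^ 2 * ev (homN κ R 0 a b v) s =
      a (v + R * s) * ((ev (homSol κ R 0 a b v) s)⁻¹ ^ 2 - 1) := by
  have h1 := congrArg (fun g => ev g s) (homSol_eq κ R 0 a b v)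
  have h0 : ev (homSol κ R 0 a b v) s ≠ 0 := (zero_lt_one.trans_le (h.one_le hs R)).ne'
  have h2 : ev (homZ κ R 0 a b v) s =
      κ * ev (avg 1 (shift R 0 a v * homP κ R 0 a b v)) s := rfl
  simp only [ev_add, ev_one, ev_smul, ev_mul, ev_pow, ev_idC hs, zero_mul, add_zero] at h1
  unfold homN
  simp only [ev_neg, ev_mul, ev_add, ev_smul, ev_one,
    ev_invC (fun x hx => h.one_le hx R) hs, h.ev_shift_a hs, h2]
  have h3 : κ * R ^ 2 * (s ^ 2 * ev (avg 1 (shift R 0 a v * homP κ R 0 a b v)) s) =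
    ev (homSol κ R 0 a b v) s - 1 := by linarith
  field_simp
  linear_combination (-(a (v + R * s) * (ev (homSol κ R 0 a b v) s + 1))) * h3

theorem mul_ev_diffQ (h : Admissible κ u₀ u₁ a b v) {s : ℝ} (hs : s ∈ Icc (-1 : ℝ) 1) (R : ℝ) :
    R * s * ev (diffQ a v R) s = iteratedDeriv 1 a (v + R * s) - iteratedDeriv 1 a v := by
  have h1 := pow_mul_ev_avg 0 (shift R 0 (iteratedDeriv 2 a) v) hs
  simp only [zero_add, pow_one, pow_zero, one_mul] at h1
  rw [mul_assoc, diffQ, h1, ← intervalIntegral.integral_const_mul]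
  have hd : ∀ x ∈ uIcc 0 s, HasDerivAt (fun x => iteratedDeriv 1 a (v + R * x))
      (R * iteratedDeriv 2 a (v + R * x)) x := fun x _ => by
    refine ((h.hasDerivAt 1 (v + R * x)).comp x
      (((hasDerivAt_id x).const_mul R).const_add v)).congr_deriv ?_
    ring
  have hc : Continuous fun x => R * iteratedDeriv 2 a (v + R * x) :=
    continuous_const.mul ((h.continuous 2).comp (by fun_prop))
  rw [show iteratedDeriv 1 a (v + R * s) - iteratedDeriv 1 a v =
    iteratedDeriv 1 a (v + R * s) - iteratedDeriv 1 a (v + R * 0) by rw [mul_zero, add_zero],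
    ← intervalIntegral.integral_eq_sub_of_hasDerivAt hd (hc.intervalIntegrable _ _)]
  refine intervalIntegral.integral_congr fun x hx => ?_
  have hx' : x ∈ Icc (-1 : ℝ) 1 := uIcc_subset_Icc (by simp) hs hx
  rw [ev_shift (h.continuous 2) hx', zero_mul, add_zero]

theorem ev_avg_mul (g : SymmC) {s : ℝ} (hs : s ∈ Icc (-1 : ℝ) 1) :
    s * ev (avg 0 g) s = ∫ x in (0 : ℝ)..s, ev g x := by
  have h1 := pow_mul_ev_avg 0 g hs
  simpa only [zero_add, pow_one, pow_zero, one_mul] using h1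

/-- By rescaling, all integrals are expressed in the single coordinate of width R, the form in which
the boundary condition at u₀ can be checked. -/
theorem coefL_eq (h : Admissible κ u₀ u₁ a b v) :
    coefL κ u₀ u₁ a b v = -(a u₀ / (v - u₀)) -
      (u₁ - u₀) * (∫ s in (0 : ℝ)..(-((v - u₀) / (u₁ - u₀))), ev (homN κ (u₁ - u₀) 0 a b v) s) -
      (u₁ - u₀) * ∫ s in (0 : ℝ)..(-1), ev (diffQ a v (u₁ - u₀)) s := by
  have hr := h.ratioL_mem
  have hr' : (v - u₀) / (u₁ - u₀) ∈ Icc (0 : ℝ) 1 := Ioo_subset_Icc_self hr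
  have hRr : (u₁ - u₀) * ((v - u₀) / (u₁ - u₀)) = v - u₀ := mul_div_cancel₀ _ h.width_pos.ne'
  have h1 : (-1 : ℝ) ∈ Icc (-1 : ℝ) 1 := by simp
  rw [coefL, homN_eq_scaleC h.nonneg hr' (R := u₁ - u₀) (by rw [hRr]; ring) h.smooth.continuous h.cont
    h.a_pos h.b_pos, avg_scaleC hr', ev_scaleC _ _ h1, ← ev_avg_mul _ h1,
    ← ev_avg_mul _ ⟨by linarith [hr.2], by linarith [hr.1]⟩, mul_neg_one]
  linear_combination (-(ev (avg 0 (homN κ (u₁ - u₀) 0 a b v)) (-((v - u₀) / (u₁ - u₀))))) * hRr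

theorem coefR_eq (h : Admissible κ u₀ u₁ a b v) :
    coefR κ u₀ u₁ a b v = a u₁ / (u₁ - v) -
      (u₁ - u₀) * (∫ s in (0 : ℝ)..((u₁ - v) / (u₁ - u₀)), ev (homN κ (u₁ - u₀) 0 a b v) s) -
      (u₁ - u₀) * ∫ s in (0 : ℝ)..1, ev (diffQ a v (u₁ - u₀)) s := by
  have hr := h.ratioR_mem
  have hr' : (u₁ - v) / (u₁ - u₀) ∈ Icc (0 : ℝ) 1 := Ioo_subset_Icc_self hr
  have hRr : (u₁ - u₀) * ((u₁ - v) / (u₁ - u₀)) = u₁ - v := mul_div_cancel₀ _ h.width_pos.ne'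
  have h1 : (1 : ℝ) ∈ Icc (-1 : ℝ) 1 := by simp
  rw [coefR, homN_eq_scaleC h.nonneg hr' (R := u₁ - u₀) (by rw [hRr]; ring) h.smooth.continuous h.cont
    h.a_pos h.b_pos, avg_scaleC hr', ev_scaleC _ _ h1, ← ev_avg_mul _ h1,
    ← ev_avg_mul _ ⟨by linarith [hr.1], by linarith [hr.2]⟩, mul_one]
  linear_combination (ev (avg 0 (homN κ (u₁ - u₀) 0 a b v)) ((u₁ - v) / (u₁ - u₀))) * hRr

/-- To the left of u₀ the extended a' vanishes, so the difference quotient reduces to -a'(v)/(Rs)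
and integrates to a logarithm. Integrating it up to s = -1 in `coefL` thus accounts for log((v -
u₀)/R). -/
theorem integral_diffQ_left (h : Admissible κ u₀ u₁ a b v) :
    (u₁ - u₀) * ∫ s in (-1 : ℝ)..(-((v - u₀) / (u₁ - u₀))), ev (diffQ a v (u₁ - u₀)) s =
      -(iteratedDeriv 1 a v * Real.log ((v - u₀) / (u₁ - u₀))) := by
  have hr := h.ratioL_mem
  have hRr : (u₁ - u₀) * ((v - u₀) / (u₁ - u₀)) = v - u₀ := mul_div_cancel₀ _ h.width_pos.ne'
  set r := (v - u₀) / (u₁ - u₀)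
  have hR := h.width_pos
  rw [← intervalIntegral.integral_const_mul]
  have h1 : ∫ s in (-1 : ℝ)..(-r), (u₁ - u₀) * ev (diffQ a v (u₁ - u₀)) s =
      ∫ s in (-1 : ℝ)..(-r), -iteratedDeriv 1 a v * s⁻¹ := by
    refine intervalIntegral.integral_congr fun s hs => ?_
    rw [uIcc_of_le (by linarith [hr.2])] at hs
    have hs0 : s ≠ 0 := by linarith [hs.2, hr.1]
    have h2 := h.mul_ev_diffQ (s := s) ⟨hs.1, by linarith [hs.2, hr.1]⟩ (u₁ - u₀)
    rw [h.left (v + (u₁ - u₀) * s) (by nlinarith [hs.2]), zero_sub] at h2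
    rw [eq_mul_inv_iff_mul_eq₀ hs0]
    linarith
  rw [h1, intervalIntegral.integral_const_mul, integral_inv_of_neg (by norm_num) (by linarith [hr.1])]
  rw [neg_div_neg_eq, div_one, neg_mul]

theorem integral_diffQ_right (h : Admissible κ u₀ u₁ a b v) :
    (u₁ - u₀) * ∫ s in ((u₁ - v) / (u₁ - u₀))..1, ev (diffQ a v (u₁ - u₀)) s =
      iteratedDeriv 1 a v * Real.log ((u₁ - v) / (u₁ - u₀)) := by
  have hr := h.ratioR_mem
  have hRr : (u₁ - u₀) * ((u₁ - v) / (u₁ - u₀)) = u₁ - v := mul_div_cancel₀ _ h.width_pos.ne'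
  set r := (u₁ - v) / (u₁ - u₀)
  have hR := h.width_pos
  rw [← intervalIntegral.integral_const_mul]
  have h1 : ∫ s in r..1, (u₁ - u₀) * ev (diffQ a v (u₁ - u₀)) s =
      ∫ s in r..1, -iteratedDeriv 1 a v * s⁻¹ := by
    refine intervalIntegral.integral_congr fun s hs => ?_
    rw [uIcc_of_le (by linarith [hr.2])] at hs
    have hs0 : s ≠ 0 := by linarith [hs.1, hr.1]
    have h2 := h.mul_ev_diffQ (s := s) ⟨by linarith [hs.1, hr.1], hs.2⟩ (u₁ - u₀)
    rw [h.right (v + (u₁ - u₀) * s) (by nlinarith [hs.1]), zero_sub] at h2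
    rw [eq_mul_inv_iff_mul_eq₀ hs0]
    linarith
  rw [h1, intervalIntegral.integral_const_mul, integral_inv_of_pos hr.1 (by norm_num)]
  rw [one_div, Real.log_inv]
  ring

theorem ev_bracketC_of_nonpos (h : Admissible κ u₀ u₁ a b v) {s : ℝ} (hs : s ∈ Icc (-1 : ℝ) 0) :
    ev (bracketC κ u₀ u₁ a b v) s = -a (v + (u₁ - u₀) * s) + (u₁ - u₀) * s *
      (iteratedDeriv 1 a v * Real.log s + coefL κ u₀ u₁ a b v + (u₁ - u₀) *
        ((∫ x in (0 : ℝ)..s, ev (homN κ (u₁ - u₀) 0 a b v) x) +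
          ∫ x in (0 : ℝ)..s, ev (diffQ a v (u₁ - u₀)) x)) := by
  have hs' : s ∈ Icc (-1 : ℝ) 1 := ⟨hs.1, hs.2.trans zero_le_one⟩
  rw [← ev_avg_mul _ hs', ← ev_avg_mul _ hs']
  simp only [bracketC, regPart, ev_add, ev_sub, ev_neg, ev_smul, ev_mul, ev_pow, ev_idC hs',
    ev_logC hs', ev_posC hs', h.ev_shift_a hs', max_eq_right hs.2, map_add]
  ring

theorem ev_bracketC_of_nonneg (h : Admissible κ u₀ u₁ a b v) {s : ℝ} (hs : s ∈ Icc (0 : ℝ) 1) :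
    ev (bracketC κ u₀ u₁ a b v) s = -a (v + (u₁ - u₀) * s) + (u₁ - u₀) * s *
      (iteratedDeriv 1 a v * Real.log s + coefR κ u₀ u₁ a b v + (u₁ - u₀) *
        ((∫ x in (0 : ℝ)..s, ev (homN κ (u₁ - u₀) 0 a b v) x) +
          ∫ x in (0 : ℝ)..s, ev (diffQ a v (u₁ - u₀)) x)) := by
  have hs' : s ∈ Icc (-1 : ℝ) 1 := ⟨by linarith [hs.1], hs.2⟩
  rw [← ev_avg_mul _ hs', ← ev_avg_mul _ hs']
  simp only [bracketC, regPart, ev_add, ev_sub, ev_neg, ev_smul, ev_mul, ev_pow, ev_idC hs',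
    ev_logC hs', ev_posC hs', h.ev_shift_a hs', max_eq_left hs.1, map_add, jump]
  ring

/-- This boundary condition at u₀ is what determines `coefL`: the logarithm at s = -(v - u₀)/R
cancels against the part of the difference-quotient integral beyond u₀. -/
theorem ev_bracketC_left (h : Admissible κ u₀ u₁ a b v) :
    ev (bracketC κ u₀ u₁ a b v) (-((v - u₀) / (u₁ - u₀))) = 0 := by
  have hr := h.ratioL_mem
  have hRr : (u₁ - u₀) * ((v - u₀) / (u₁ - u₀)) = v - u₀ := mul_div_cancel₀ _ h.width_pos.ne'
  have hv : v - u₀ ≠ 0 := by linarith [h.mem.1]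
  rw [h.ev_bracketC_of_nonpos ⟨by linarith [hr.2], by linarith [hr.1]⟩, h.coefL_eq, mul_neg, hRr,
    Real.log_neg_eq_log, show v + -(v - u₀) = u₀ by ring]
  have h1 := h.integral_diffQ_left
  rw [← intervalIntegral.integral_interval_sub_left] at h1
  · field_simp
    linear_combination (-(v - u₀)) * h1
  all_goals exact intervalIntegrable_ev _ _ _

theorem ev_bracketC_right (h : Admissible κ u₀ u₁ a b v) :
    ev (bracketC κ u₀ u₁ a b v) ((u₁ - v) / (u₁ - u₀)) = 0 := by
  have hr := h.ratioR_mem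
  have hRr : (u₁ - u₀) * ((u₁ - v) / (u₁ - u₀)) = u₁ - v := mul_div_cancel₀ _ h.width_pos.ne'
  have hv : u₁ - v ≠ 0 := by linarith [h.mem.2]
  rw [h.ev_bracketC_of_nonneg ⟨by linarith [hr.1], by linarith [hr.2]⟩, h.coefR_eq, hRr,
    show v + (u₁ - v) = u₁ by ring]
  have h1 := h.integral_diffQ_right
  have h2 := intervalIntegral.integral_add_adjacent_intervals
    (intervalIntegrable_ev (diffQ a v (u₁ - u₀)) 0 ((u₁ - v) / (u₁ - u₀)))
    (intervalIntegrable_ev (diffQ a v (u₁ - u₀)) ((u₁ - v) / (u₁ - u₀)) 1)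
  rw [← h2]
  field_simp
  linear_combination (-(u₁ - v)) * h1

theorem hasDerivAt_integral_ev (g : SymmC) (s : ℝ) :
    HasDerivAt (fun s => ∫ x in (0 : ℝ)..s, ev g x) (ev g s) s :=
  intervalIntegral.integral_hasDerivAt_right (intervalIntegrable_ev g _ _)
    ((continuous_ev g).stronglyMeasurableAtFilter _ _) (continuous_ev g).continuousAt

/-- The bracket divided by `s` is a primitive of `a / (s Φ)²`. -/
theorem hasDerivAt_bracketC_div (h : Admissible κ u₀ u₁ a b v) {s : ℝ} (hs : s ∈ Ioo (-1 : ℝ) 1)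
    (hs0 : s ≠ 0) :
    HasDerivAt (fun s => ev (bracketC κ u₀ u₁ a b v) s / s)
      (a (v + (u₁ - u₀) * s) / (s ^ 2 * ev (homSol κ (u₁ - u₀) 0 a b v) s ^ 2)) s := by
  have hs' := Ioo_subset_Icc_self hs
  have key : ∀ c : ℝ, HasDerivAt (fun s => (-a (v + (u₁ - u₀) * s) + (u₁ - u₀) * s *
      (iteratedDeriv 1 a v * Real.log s + c + (u₁ - u₀) *
        ((∫ x in (0 : ℝ)..s, ev (homN κ (u₁ - u₀) 0 a b v) x) +
          ∫ x in (0 : ℝ)..s, ev (diffQ a v (u₁ - u₀)) x))) / s)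
      (a (v + (u₁ - u₀) * s) / (s ^ 2 * ev (homSol κ (u₁ - u₀) 0 a b v) s ^ 2)) s := by
    intro c
    have hΦ : ev (homSol κ (u₁ - u₀) 0 a b v) s ≠ 0 := (zero_lt_one.trans_le (h.one_le hs' _)).ne'
    have hN := h.sq_mul_ev_homN hs' (u₁ - u₀)
    have hD := h.mul_ev_diffQ hs' (u₁ - u₀)
    have h1 : HasDerivAt (fun s => a (v + (u₁ - u₀) * s))
        (iteratedDeriv 1 a (v + (u₁ - u₀) * s) * ((u₁ - u₀) * 1)) s := by
      have := h.hasDerivAt 0 (v + (u₁ - u₀) * s)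
      rw [iteratedDeriv_zero, zero_add] at this
      exact this.comp s (((hasDerivAt_id s).const_mul (u₁ - u₀)).const_add v)
    have h2 := (((Real.hasDerivAt_log hs0).const_mul (iteratedDeriv 1 a v)).add_const c).add
      (((hasDerivAt_integral_ev (homN κ (u₁ - u₀) 0 a b v) s).add
        (hasDerivAt_integral_ev (diffQ a v (u₁ - u₀)) s)).const_mul (u₁ - u₀))
    have h3 := (h1.neg.add (((hasDerivAt_id s).const_mul (u₁ - u₀)).mul h2)).div (hasDerivAt_id s) hs0
    refine h3.congr_deriv ?_
    simp only [id, mul_one, Pi.add_apply, Pi.neg_apply, Pi.mul_apply]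
    rw [div_eq_div_iff (pow_ne_zero _ hs0) (by positivity)]
    have hN' : (u₁ - u₀) ^ 2 * s ^ 2 * ev (homN κ (u₁ - u₀) 0 a b v) s *
        ev (homSol κ (u₁ - u₀) 0 a b v) s ^ 2 =
        a (v + (u₁ - u₀) * s) * (1 - ev (homSol κ (u₁ - u₀) 0 a b v) s ^ 2) := by
      rw [hN]; field_simp
    field_simp
    linear_combination hN' +
      (u₁ - u₀) * s * ev (homSol κ (u₁ - u₀) 0 a b v) s ^ 2 * hD
  rcases lt_or_gt_of_ne hs0 with hneg | hpos
  · refine (key (coefL κ u₀ u₁ a b v)).congr_of_eventuallyEq ?_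
    filter_upwards [Ioo_mem_nhds hs.1 hneg] with x hx
    rw [h.ev_bracketC_of_nonpos (Ioo_subset_Icc_self hx)]
  · refine (key (coefR κ u₀ u₁ a b v)).congr_of_eventuallyEq ?_
    filter_upwards [Ioo_mem_nhds hpos hs.2] with x hx
    rw [h.ev_bracketC_of_nonneg (Ioo_subset_Icc_self hx)]

/-- In this form the jump resembles J₁/ρ: the integral of `homN` is the term with φ₁⁻² - 1, and the
difference quotient together with the logarithms is the principal value. -/
theorem jump_eq (h : Admissible κ u₀ u₁ a b v) :
    jump κ u₀ u₁ a b v = -(a u₀ / (v - u₀)) - a u₁ / (u₁ - v) +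
      (u₁ - u₀) * (∫ s in (-((v - u₀) / (u₁ - u₀)))..((u₁ - v) / (u₁ - u₀)),
        ev (homN κ (u₁ - u₀) 0 a b v) s) +
      ((u₁ - u₀) * (∫ s in (-((v - u₀) / (u₁ - u₀)))..((u₁ - v) / (u₁ - u₀)),
        ev (diffQ a v (u₁ - u₀)) s) + iteratedDeriv 1 a v *
        (Real.log ((u₁ - v) / (u₁ - u₀)) - Real.log ((v - u₀) / (u₁ - u₀)))) := by
  have h1 := h.integral_diffQ_left
  have h2 := h.integral_diffQ_right
  have hi := fun (g : SymmC) (x y : ℝ) => intervalIntegrable_ev g x y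
  have e := fun (g : SymmC) (x y : ℝ) =>
    (intervalIntegral.integral_interval_sub_left (hi g 0 y) (hi g 0 x)).symm
  rw [e] at h1 h2
  rw [jump, h.coefL_eq, h.coefR_eq, e _ (-((v - u₀) / (u₁ - u₀))), e _ (-((v - u₀) / (u₁ - u₀)))]
  linear_combination h1 + h2

end Admissible

end ShearFlow

end

noncomputable section
namespace ShearFlow

/-! ### Uniqueness for the integral equation -/

/-- Grönwall: the primitive of |d| starts from zero and its derivative is at most C times itself. -/
theorem eq_zero_of_abs_le_integral_right {d : ℝ → ℝ} (hd : Continuous d) {C c B : ℝ}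
    (h : ∀ y ∈ Icc c B, |d y| ≤ C * ∫ x in c..y, |d x|) {y : ℝ} (hy : y ∈ Icc c B) : d y = 0 := by
  have hda : Continuous fun x => |d x| := hd.abs
  have hder : ∀ y, HasDerivAt (fun y => ∫ x in c..y, |d x|) |d y| y := fun y =>
    intervalIntegral.integral_hasDerivAt_right (hda.intervalIntegrable _ _)
      (hda.stronglyMeasurableAtFilter _ _) hda.continuousAt
  have hz := eq_zero_of_abs_deriv_le_mul_abs_self_of_eq_zero_right (a := c) (b := B) (K := C)
    (f := fun y => ∫ x in c..y, |d x|) (f' := fun y => |d y|)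
    (fun y _ => (hder y).continuousAt.continuousWithinAt) (fun y _ => (hder y).hasDerivWithinAt)
    intervalIntegral.integral_same (fun y hy => by
      rw [Real.norm_eq_abs, abs_abs, Real.norm_eq_abs,
        abs_of_nonneg (intervalIntegral.integral_nonneg hy.1 fun x _ => abs_nonneg _)]
      exact h y ⟨hy.1, hy.2.le⟩) y hy
  have h1 := h y hy
  rw [show ∫ x in c..y, |d x| = 0 from hz, mul_zero] at h1
  exact abs_eq_zero.mp (le_antisymm h1 (abs_nonneg _))

theorem eq_zero_of_abs_le_integral {d : ℝ → ℝ} {A B c C : ℝ} (hAB : A ≤ B)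
    (hd : ContinuousOn d (Icc A B)) (hc : c ∈ Icc A B)
    (h : ∀ y ∈ Icc A B, |d y| ≤ C * |∫ x in c..y, abs (d x)|) {y : ℝ} (hy : y ∈ Icc A B) : d y = 0 := by
  set D : ℝ → ℝ := IccExtend hAB ((Icc A B).domRestrict d) with hD
  have hDc : Continuous D := (continuousOn_iff_continuous_domRestrict.mp hd).Icc_extend'
  have hDd : ∀ x ∈ Icc A B, D x = d x := fun x hx => by
    rw [hD, IccExtend_of_mem _ _ hx]; rfl
  have hint : ∀ y ∈ Icc A B, ∫ x in c..y, |d x| = ∫ x in c..y, |D x| := fun y hy =>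
    intervalIntegral.integral_congr fun x hx => by
      rw [hDd x (uIcc_subset_Icc hc hy hx)]
  rw [← hDd y hy]
  rcases le_total c y with hcy | hcy
  · refine eq_zero_of_abs_le_integral_right (C := C) hDc (c := c) (B := B) (fun z hz => ?_) ⟨hcy, hy.2⟩
    have hz' : z ∈ Icc A B := ⟨hc.1.trans hz.1, hz.2⟩
    have := h z hz'
    rwa [hint z hz', abs_of_nonneg (intervalIntegral.integral_nonneg hz.1 fun x _ => abs_nonneg _),
      ← hDd z hz'] at this
  · have := eq_zero_of_abs_le_integral_right (C := C) (d := fun x => D (-x)) (hDc.comp continuous_neg)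
      (c := -c) (B := -A) (fun z hz => ?_) (y := -y) ⟨by linarith, by linarith [hy.1]⟩
    · simpa using this
    · have hz' : -z ∈ Icc A B := ⟨by linarith [hz.2], by linarith [hz.1, hc.2]⟩
      have h1 := h (-z) hz'
      rw [hint _ hz', ← hDd _ hz'] at h1
      rw [intervalIntegral.integral_comp_neg (fun x => |D x|), neg_neg]
      rwa [intervalIntegral.integral_symm, abs_neg, abs_of_nonneg
        (intervalIntegral.integral_nonneg (by linarith [hz.1]) fun x _ => abs_nonneg _)] at h1

/-- The weight (u - u(y'))² increases away from y', so the inner integral is at most (u(z) -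
u(y'))²/c₀ times the integral of the absolute value. This cancels the singular quotient and leaves a
Grönwall inequality. Uniqueness is needed because `phi1` is a choice among solutions. -/
theorem IsHomogeneousSolution.eq {s₀ κ₀ c₀ K : ℝ} {u θ : ℝ → ℝ} (h : Background s₀ κ₀ c₀ K u θ)
    (hκ : 0 < κ₀) (hc : 0 < c₀) {k : ℤ} {y' : ℝ} (hy' : y' ∈ Icc (0 : ℝ) 1) {f g : ℝ → ℝ}
    (hf : IsHomogeneousSolution u θ k y' f) (hg : IsHomogeneousSolution u θ k y' g) {y : ℝ}
    (hy : y ∈ Icc (0 : ℝ) 1) : f y = g y := by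
  obtain ⟨T, hT⟩ := Background.exists_abs_le hκ h.differentiable_theta
    (fun _ hy => h.deriv_theta_eq_zero hy)
  have hT0 : 0 ≤ T := (abs_nonneg _).trans (hT 0)
  have hθ : ∀ x, 0 < θ x := fun x => hc.trans_le (h.le_theta hκ x)
  have hu := h.differentiable_u.continuous
  have hθc := h.differentiable_theta.continuous
  have hsub : ∀ z ∈ Icc (0 : ℝ) 1, uIcc y' z ⊆ Icc 0 1 := fun z hz => uIcc_subset_Icc hy' hz
  set d := fun y => f y - g y with hd
  have hdc : ContinuousOn d (Icc 0 1) := hf.1.sub hg.1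
  have hw : Continuous fun x => (u x - u y') ^ 2 / θ x :=
    ((hu.sub continuous_const).pow 2).div hθc fun x => (hθ x).ne'
  have hi : ∀ F : ℝ → ℝ, ContinuousOn F (Icc 0 1) → ∀ z ∈ Icc (0 : ℝ) 1,
      IntervalIntegrable (fun x => (u x - u y') ^ 2 / θ x * F x) volume y' z := fun F hF z hz =>
    (hw.continuousOn.mul (hF.mono (hsub z hz))).intervalIntegrable
  -- the inner integrals are controlled by the weight
  have hinner : ∀ F : ℝ → ℝ, ContinuousOn F (Icc 0 1) → ∀ z ∈ Icc (0 : ℝ) 1,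
      |∫ x in y'..z, (u x - u y') ^ 2 / θ x * F x| ≤
        (u z - u y') ^ 2 / c₀ * |∫ x in y'..z, abs (F x)| := by
    intro F hF z hz
    rw [← Real.norm_eq_abs]
    have hFi : IntervalIntegrable (fun x => (u z - u y') ^ 2 / c₀ * |F x|) volume y' z :=
      (continuousOn_const.mul (hF.mono (hsub z hz)).abs).intervalIntegrable
    refine (intervalIntegral.norm_integral_le_abs_of_norm_le (g := fun x => (u z - u y') ^ 2 / c₀ * |F x|)
      ?_ hFi).trans (le_of_eq ?_)
    · refine (ae_restrict_iff' measurableSet_uIoc).mpr (Eventually.of_forall fun x hx => ?_)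
      have hx' := uIoc_subset_uIcc hx
      rw [norm_mul, Real.norm_eq_abs, Real.norm_eq_abs, abs_of_nonneg
        (div_nonneg (sq_nonneg _) (hθ x).le)]
      have h1 : (u x - u y') ^ 2 ≤ (u z - u y') ^ 2 := by
        have hm := (h.strictMono hκ hc).monotone
        rw [sq_le_sq]
        rcases le_total y' z with h2 | h2
        · rw [uIcc_of_le h2] at hx'
          rw [abs_of_nonneg (sub_nonneg.mpr (hm hx'.1)), abs_of_nonneg (sub_nonneg.mpr (hm h2))]
          linarith [hm hx'.2]
        · rw [uIcc_of_ge h2] at hx'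
          rw [abs_of_nonpos (sub_nonpos.mpr (hm hx'.2)), abs_of_nonpos (sub_nonpos.mpr (hm h2))]
          linarith [hm hx'.1]
      have h2 := h.le_theta hκ x
      gcongr
    · rw [intervalIntegral.integral_const_mul, abs_mul, abs_of_nonneg (by positivity)]
  have hQ : ∀ F : ℝ → ℝ, ContinuousOn F (Icc 0 1) → ∀ y ∈ Icc (0 : ℝ) 1, ∀ z ∈ uIcc y' y,
      |(k : ℝ) ^ 2 * θ z / (u z - u y') ^ 2 * ∫ x in y'..z, (u x - u y') ^ 2 / θ x * F x| ≤
        (k : ℝ) ^ 2 * T / c₀ * |∫ x in y'..y, abs (F x)| := by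
    intro F hF y hy z hz
    have hz' := hsub y hy hz
    have h1 := hinner F hF z hz'
    have h2 : |∫ x in y'..z, abs (F x)| ≤ |∫ x in y'..y, abs (F x)| := by
      have hFi : ∀ w ∈ Icc (0 : ℝ) 1, IntervalIntegrable (fun x => |F x|) volume y' w := fun w hw =>
        ((hF.mono (hsub w hw)).abs).intervalIntegrable
      refine intervalIntegral.abs_integral_mono_interval (uIoc_subset_uIoc_of_uIcc_subset_uIcc (uIcc_subset_uIcc left_mem_uIcc hz))
        (Eventually.of_forall fun x => abs_nonneg _) (hFi y hy)
    -- On the diagonal the quotient is 0, by the convention for division by zero.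
    rcases eq_or_ne (u z - u y') 0 with h0 | h0
    · rw [h0]
      simp only [ne_eq, OfNat.ofNat_ne_zero, not_false_eq_true, zero_pow, div_zero, zero_mul, abs_zero]
      positivity
    · rw [abs_mul, abs_div, abs_mul, abs_of_nonneg (sq_nonneg (k : ℝ)), abs_of_nonneg
        (sq_nonneg (u z - u y'))]
      calc (k : ℝ) ^ 2 * |θ z| / (u z - u y') ^ 2 *
            |∫ x in y'..z, (u x - u y') ^ 2 / θ x * F x|
          ≤ (k : ℝ) ^ 2 * T / (u z - u y') ^ 2 * ((u z - u y') ^ 2 / c₀ * |∫ x in y'..y, abs (F x)|) := by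
            gcongr
            · exact hT z
            · exact h1.trans (by gcongr)
        _ = _ := by field_simp
  have hQi : ∀ F : ℝ → ℝ, ContinuousOn F (Icc 0 1) → ∀ y ∈ Icc (0 : ℝ) 1, IntervalIntegrable (fun z =>
      (k : ℝ) ^ 2 * θ z / (u z - u y') ^ 2 * ∫ x in y'..z, (u x - u y') ^ 2 / θ x * F x)
      volume y' y := by
    intro F hF y hy
    refine (intervalIntegrable_const (c := (k : ℝ) ^ 2 * T / c₀ * |∫ x in y'..y, abs (F x)|)).mono_fun
      ?_ ?_
    · refine AEStronglyMeasurable.mul (Measurable.aestronglyMeasurable ?_) ?_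
      · exact (measurable_const.mul hθc.measurable).div
          ((hu.measurable.sub_const _).pow_const 2)
      · refine ContinuousOn.aestronglyMeasurable (s := uIoc y' y) ?_ measurableSet_uIoc
        refine ContinuousOn.mono ?_ uIoc_subset_uIcc
        exact intervalIntegral.continuousOn_primitive_interval' (hi F hF y hy) left_mem_uIcc
    · refine (ae_restrict_iff' measurableSet_uIoc).mpr (Eventually.of_forall fun z hz => ?_)
      refine (hQ F hF y hy z (uIoc_subset_uIcc hz)).trans (le_abs_self _)
  have key : ∀ y ∈ Icc (0 : ℝ) 1, |d y| ≤ (k : ℝ) ^ 2 * T / c₀ * |∫ x in y'..y, abs (d x)| := by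
    intro y hy
    have h1 : d y = ∫ z in y'..y, (k : ℝ) ^ 2 * θ z / (u z - u y') ^ 2 *
        ∫ x in y'..z, (u x - u y') ^ 2 / θ x * d x := by
      rw [hd]
      simp only
      rw [hf.2 y hy, hg.2 y hy, add_sub_add_left_eq_sub,
        ← intervalIntegral.integral_sub (hQi f hf.1 y hy) (hQi g hg.1 y hy)]
      refine intervalIntegral.integral_congr fun z hz => ?_
      have hz' := hsub y hy hz
      rw [← mul_sub, ← intervalIntegral.integral_sub (hi f hf.1 z hz') (hi g hg.1 z hz')]
      congr 1
      refine intervalIntegral.integral_congr fun x _ => ?_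
      ring
    rw [h1, ← Real.norm_eq_abs]
    refine (intervalIntegral.norm_integral_le_of_norm_le_const fun z hz =>
      hQ d hdc y hy z (uIoc_subset_uIcc hz)).trans ?_
    refine mul_le_of_le_one_right (by positivity) (abs_le.mpr ?_)
    constructor <;> linarith [hy.1, hy.2, hy'.1, hy'.2]
  exact sub_eq_zero.mp (eq_zero_of_abs_le_integral zero_le_one hdc hy' key hy)

end ShearFlow

end

noncomputable section
namespace ShearFlow

/-! ### The homogeneous solution and the Green function in local coordinates -/

namespace Background

variable {s₀ κ₀ c₀ K : ℝ} {u θ : ℝ → ℝ} {k : ℤ} {y' y : ℝ}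

theorem deriv_pos (h : Background s₀ κ₀ c₀ K u θ) (hκ : 0 < κ₀) (hc : 0 < c₀) (y : ℝ) :
    0 < deriv u y := hc.trans_le (h.le_deriv hκ y)

theorem theta_pos (h : Background s₀ κ₀ c₀ K u θ) (hκ : 0 < κ₀) (hc : 0 < c₀) (y : ℝ) :
    0 < θ y := hc.trans_le (h.le_theta hκ y)

theorem deriv_uInv (h : Background s₀ κ₀ c₀ K u θ) (hκ : 0 < κ₀) (hc : 0 < c₀) (v : ℝ) :
    deriv (uInv u) v = qV u v := (h.hasDerivAt_uInv hκ hc v).deriv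

theorem contDiff_uInv (h : Background s₀ κ₀ c₀ K u θ) (hκ : 0 < κ₀) (hc : 0 < c₀) :
    ContDiff ℝ ∞ (uInv u) := by
  rw [contDiff_infty]
  intro n
  induction n with
  | zero => exact contDiff_zero.mpr (h.continuous_uInv hκ hc)
  | succ n ih =>
    push_cast
    rw [contDiff_succ_iff_deriv]
    refine ⟨fun v => (h.hasDerivAt_uInv hκ hc v).differentiableAt, by simp, ?_⟩
    rw [show deriv (uInv u) = fun v => (deriv u (uInv u v))⁻¹ from
      funext fun v => (h.hasDerivAt_uInv hκ hc v).deriv]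
    exact ((h.smooth_deriv.of_le (by exact_mod_cast le_top)).comp ih).inv
      fun v => (h.deriv_pos hκ hc _).ne'

theorem contDiff_aV (h : Background s₀ κ₀ c₀ K u θ) (hκ : 0 < κ₀) (hc : 0 < c₀) :
    ContDiff ℝ ∞ (aV u θ) :=
  (h.smooth_theta.mul (h.smooth_deriv.inv fun y => (h.deriv_pos hκ hc y).ne')).comp
    (h.contDiff_uInv hκ hc)

theorem varphi1_eq (h : Background s₀ κ₀ c₀ K u θ) (hκ : 0 < κ₀) (hc : 0 < c₀) (y : ℝ) :
    varphi1 u θ y = (deriv (deriv u) y * θ y - deriv u y * deriv θ y) / θ y ^ 2 :=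
  ((h.differentiable_deriv y).hasDerivAt.div (h.differentiable_theta y).hasDerivAt
    (h.theta_pos hκ hc y).ne').deriv

theorem deriv_ratio (h : Background s₀ κ₀ c₀ K u θ) (hκ : 0 < κ₀) (hc : 0 < c₀) (y : ℝ) :
    HasDerivAt (fun x => θ x / deriv u x) (-(varphi1 u θ y * θ y ^ 2 / deriv u y ^ 2)) y := by
  refine ((h.differentiable_theta y).hasDerivAt.div (h.differentiable_deriv y).hasDerivAt
    (h.deriv_pos hκ hc y).ne').congr_deriv ?_
  have h1 := (h.theta_pos hκ hc y).ne'
  rw [h.varphi1_eq hκ hc]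
  field_simp
  ring

theorem aV_u (h : Background s₀ κ₀ c₀ K u θ) (hκ : 0 < κ₀) (hc : 0 < c₀) (y : ℝ) :
    aV u θ (u y) = θ y / deriv u y := by
  rw [aV, pull, h.uInv_u hκ hc, div_eq_mul_inv]

theorem bV_u (h : Background s₀ κ₀ c₀ K u θ) (hκ : 0 < κ₀) (hc : 0 < c₀) (y : ℝ) :
    bV u θ (u y) = (θ y)⁻¹ * (deriv u y)⁻¹ := by
  rw [bV, pull, h.uInv_u hκ hc]

theorem deriv_aV (h : Background s₀ κ₀ c₀ K u θ) (hκ : 0 < κ₀) (hc : 0 < c₀) (v : ℝ) :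
    iteratedDeriv 1 (aV u θ) v =
      -(varphi1 u θ (uInv u v) * θ (uInv u v) ^ 2 / deriv u (uInv u v) ^ 3) := by
  rw [iteratedDeriv_one]
  have h1 := (h.deriv_ratio hκ hc (uInv u v)).comp v (h.hasDerivAt_uInv hκ hc v)
  have h2 : aV u θ = (fun x => θ x / deriv u x) ∘ uInv u := by
    funext v
    simp only [aV, pull, Function.comp, div_eq_mul_inv]
  rw [h2, h1.deriv]
  have := (h.deriv_pos hκ hc (uInv u v)).ne'
  field_simp

theorem varphi1_eq_zero (h : Background s₀ κ₀ c₀ K u θ) (hκ : 0 < κ₀) (hc : 0 < c₀)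
    (hy : y ∉ Icc (4 * κ₀) (1 - 4 * κ₀)) : varphi1 u θ y = 0 := by
  rw [h.varphi1_eq hκ hc, h.deriv_deriv_u_eq_zero hy, h.deriv_theta_eq_zero hy]
  simp

theorem admissible (h : Background s₀ κ₀ c₀ K u θ) (hκ : 0 < κ₀) (hc : 0 < c₀) (k : ℤ)
    (hy' : y' ∈ Ioo (0 : ℝ) 1) :
    Admissible ((k : ℝ) ^ 2) (u 0) (u 1) (aV u θ) (bV u θ) (u y') where
  nonneg := sq_nonneg _
  smooth := h.contDiff_aV hκ hc
  cont := ((h.smooth_theta.continuous.inv₀ fun y => (h.theta_pos hκ hc y).ne').mul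
    (h.smooth_deriv.continuous.inv₀ fun y => (h.deriv_pos hκ hc y).ne')).comp
    (h.continuous_uInv hκ hc)
  a_pos v := mul_pos (h.theta_pos hκ hc _) (inv_pos.mpr (h.deriv_pos hκ hc _))
  b_pos v := mul_pos (inv_pos.mpr (h.theta_pos hκ hc _)) (inv_pos.mpr (h.deriv_pos hκ hc _))
  left v hv := by
    have : uInv u v ≤ 0 := by
      rw [← h.uInv_u hκ hc 0]
      exact (h.uInv_strictMono hκ hc).monotone hv
    rw [h.deriv_aV hκ hc, h.varphi1_eq_zero hκ hc fun h' => by linarith [h'.1]]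
    simp
  right v hv := by
    have : 1 ≤ uInv u v := by
      rw [← h.uInv_u hκ hc 1]
      exact (h.uInv_strictMono hκ hc).monotone hv
    rw [h.deriv_aV hκ hc, h.varphi1_eq_zero hκ hc fun h' => by linarith [h'.2]]
    simp
  mem := ⟨h.strictMono hκ hc hy'.1, h.strictMono hκ hc hy'.2⟩

end Background

/-- The local coordinate of `y` relative to `y'`. -/
def loc (u : ℝ → ℝ) (y' y : ℝ) : ℝ := (u y - u y') / (u 1 - u 0)

namespace Background

variable {s₀ κ₀ c₀ K : ℝ} {u θ : ℝ → ℝ} {k : ℤ} {y' y : ℝ}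

theorem width_pos (h : Background s₀ κ₀ c₀ K u θ) (hκ : 0 < κ₀) (hc : 0 < c₀) : 0 < u 1 - u 0 :=
  sub_pos.mpr (h.strictMono hκ hc zero_lt_one)

theorem width_mul_loc (h : Background s₀ κ₀ c₀ K u θ) (hκ : 0 < κ₀) (hc : 0 < c₀) (y' y : ℝ) :
    (u 1 - u 0) * loc u y' y = u y - u y' :=
  mul_div_cancel₀ _ (h.width_pos hκ hc).ne'

theorem add_width_mul_loc (h : Background s₀ κ₀ c₀ K u θ) (hκ : 0 < κ₀) (hc : 0 < c₀) (y' y : ℝ) :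
    u y' + (u 1 - u 0) * loc u y' y = u y := by
  rw [h.width_mul_loc hκ hc]; ring

theorem hasDerivAt_loc (h : Background s₀ κ₀ c₀ K u θ) (y' y : ℝ) :
    HasDerivAt (loc u y') (deriv u y / (u 1 - u 0)) y :=
  ((h.differentiable_u y).hasDerivAt.sub_const _).div_const _

theorem continuous_loc (h : Background s₀ κ₀ c₀ K u θ) (y' : ℝ) : Continuous (loc u y') :=
  (h.differentiable_u.continuous.sub continuous_const).div_const _

theorem loc_strictMono (h : Background s₀ κ₀ c₀ K u θ) (hκ : 0 < κ₀) (hc : 0 < c₀) (y' : ℝ) :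
    StrictMono (loc u y') := fun x y hxy => by
  have := h.strictMono hκ hc hxy
  exact div_lt_div_of_pos_right (by linarith) (h.width_pos hκ hc)

theorem loc_self (u : ℝ → ℝ) (y : ℝ) : loc u y y = 0 := by rw [loc, sub_self, zero_div]

theorem loc_ne_zero (h : Background s₀ κ₀ c₀ K u θ) (hκ : 0 < κ₀) (hc : 0 < c₀) (hy : y ≠ y') :
    loc u y' y ≠ 0 := fun h0 => hy <| (h.loc_strictMono hκ hc y').injective <| by
  rw [h0, loc_self]

theorem loc_zero (u : ℝ → ℝ) (y' : ℝ) : loc u y' 0 = -((u y' - u 0) / (u 1 - u 0)) := by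
  rw [loc, ← neg_div, neg_sub]

theorem loc_mem (h : Background s₀ κ₀ c₀ K u θ) (hκ : 0 < κ₀) (hc : 0 < c₀)
    (hy' : y' ∈ Ioo (0 : ℝ) 1) (hy : y ∈ Icc (0 : ℝ) 1) : loc u y' y ∈ Ioo (-1 : ℝ) 1 := by
  have hR := h.width_pos hκ hc
  have h1 := h.strictMono hκ hc hy'.1
  have h2 := h.strictMono hκ hc hy'.2
  have h3 := (h.strictMono hκ hc).monotone hy.1
  have h4 := (h.strictMono hκ hc).monotone hy.2
  rw [loc, mem_Ioo, lt_div_iff₀ hR, div_lt_iff₀ hR]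
  constructor <;> linarith

theorem integral_comp_loc (h : Background s₀ κ₀ c₀ K u θ) {g : ℝ → ℝ} (hg : Continuous g)
    (y' x y : ℝ) : ∫ z in x..y, g (loc u y' z) * (deriv u z / (u 1 - u 0)) =
      ∫ s in loc u y' x..loc u y' y, g s :=
  intervalIntegral.integral_comp_mul_deriv (f := loc u y') (fun z _ => h.hasDerivAt_loc y' z)
    (h.smooth_deriv.continuous.div_const _).continuousOn hg

/-- Substituting the local coordinate, the inner integral is R³s³ times an `avg 2`. The quotient by
R²s² leaves one power of s for the outer `avg 1`, which reproduces the Volterra equation with κR² =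
k²R². -/
theorem isHomogeneousSolution (h : Background s₀ κ₀ c₀ K u θ) (hκ : 0 < κ₀) (hc : 0 < c₀) (k : ℤ)
    (hy' : y' ∈ Ioo (0 : ℝ) 1) : IsHomogeneousSolution u θ k y'
      fun y => ev (homSol ((k : ℝ) ^ 2) (u 1 - u 0) 0 (aV u θ) (bV u θ) (u y')) (loc u y' y) := by
  have hA := h.admissible hκ hc k hy'
  have hR := h.width_pos hκ hc
  have hyc : y' ∈ Icc (0 : ℝ) 1 := Ioo_subset_Icc_self hy'
  set R := u 1 - u 0 with hRdef
  set Φ := homSol ((k : ℝ) ^ 2) R 0 (aV u θ) (bV u θ) (u y') with hΦ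
  set P := homP ((k : ℝ) ^ 2) R 0 (aV u θ) (bV u θ) (u y') with hP
  have hloc : ∀ y ∈ Icc (0 : ℝ) 1, loc u y' y ∈ Icc (-1 : ℝ) 1 := fun y hy =>
    Ioo_subset_Icc_self (h.loc_mem hκ hc hy' hy)
  refine ⟨((continuous_ev Φ).comp (h.continuous_loc y')).continuousOn, fun y hy => ?_⟩
  have hinner : ∀ z ∈ Icc (0 : ℝ) 1, ∫ x in y'..z, (u x - u y') ^ 2 / θ x * ev Φ (loc u y' x) =
      R ^ 3 * (loc u y' z ^ 3 * ev P (loc u y' z)) := by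
    intro z hz
    have h1 : ∫ x in y'..z, (u x - u y') ^ 2 / θ x * ev Φ (loc u y' x) =
        ∫ x in y'..z, (fun s => R ^ 3 * (s ^ 2 * ev (shift R 0 (bV u θ) (u y') * Φ) s)) (loc u y' x) *
          (deriv u x / R) := by
      refine intervalIntegral.integral_congr fun x hx => ?_
      have hx' := hloc x (uIcc_subset_Icc hyc hz hx)
      have h2 := (h.deriv_pos hκ hc x).ne'
      have h3 := (h.theta_pos hκ hc x).ne'
      simp only
      rw [ev_mul, ev_shift hA.cont hx', zero_mul, add_zero, h.add_width_mul_loc hκ hc, h.bV_u hκ hc,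
        ← h.width_mul_loc hκ hc, ← hRdef]
      field_simp
    rw [h1, hRdef, h.integral_comp_loc (g := fun s => R ^ 3 * (s ^ 2 * _))
      (continuous_const.mul ((continuous_pow 2).mul (continuous_ev _))), loc_self,
      intervalIntegral.integral_const_mul, ← hRdef, hP, homP, ← hΦ,
      ← pow_mul_ev_avg 2 (shift R 0 (bV u θ) (u y') * Φ) (hloc z hz)]
  have houter : ∫ z in y'..y, (k : ℝ) ^ 2 * θ z / (u z - u y') ^ 2 *
      (∫ x in y'..z, (u x - u y') ^ 2 / θ x * ev Φ (loc u y' x)) =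
      ∫ z in y'..y, (fun s => (k : ℝ) ^ 2 * R ^ 2 * (s ^ 1 * ev (shift R 0 (aV u θ) (u y') * P) s))
        (loc u y' z) * (deriv u z / R) := by
    refine intervalIntegral.integral_congr fun z hz => ?_
    have hz' := uIcc_subset_Icc hyc hy hz
    have h2 := (h.deriv_pos hκ hc z).ne'
    simp only
    rw [hinner z hz', ev_mul, hA.ev_shift_a (hloc z hz'), h.add_width_mul_loc hκ hc, h.aV_u hκ hc,
      ← h.width_mul_loc hκ hc, ← hRdef]
    -- At z = y' both integrands are 0, the left one because its denominator vanishes.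
    rcases eq_or_ne (loc u y' z) 0 with h0 | h0
    · rw [h0]; simp
    · field_simp
  rw [houter, hRdef, h.integral_comp_loc (g := fun s => (k : ℝ) ^ 2 * R ^ 2 * (s ^ 1 * _))
    (continuous_const.mul ((continuous_pow 1).mul (continuous_ev _))), loc_self,
    intervalIntegral.integral_const_mul, ← hRdef, ← pow_mul_ev_avg 1 _ (hloc y hy)]
  conv_lhs => rw [hΦ, homSol_eq]
  simp only [ev_add, ev_one, ev_smul, ev_mul, ev_pow, ev_idC (hloc y hy), zero_mul, add_zero]
  rfl

theorem phi1_eq (h : Background s₀ κ₀ c₀ K u θ) (hκ : 0 < κ₀) (hc : 0 < c₀) (k : ℤ)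
    (hy' : y' ∈ Ioo (0 : ℝ) 1) (hy : y ∈ Icc (0 : ℝ) 1) : phi1 u θ k y y' =
      ev (homSol ((k : ℝ) ^ 2) (u 1 - u 0) 0 (aV u θ) (bV u θ) (u y')) (loc u y' y) :=
  IsHomogeneousSolution.eq h hκ hc (Ioo_subset_Icc_self hy')
    (Classical.epsilon_spec ⟨_, h.isHomogeneousSolution hκ hc k hy'⟩)
    (h.isHomogeneousSolution hκ hc k hy') hy

/-- In the local coordinate, bracket/s is up to the factor R⁻¹ the primitive of θ/φ² that vanishes
at the end point on the side of y. Multiplication by φ = RsΦ leaves Φ times the bracket. -/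
theorem e_eq (h : Background s₀ κ₀ c₀ K u θ) (hκ : 0 < κ₀) (hc : 0 < c₀) (k : ℤ)
    (hy' : y' ∈ Ioo (0 : ℝ) 1) (hy : y ∈ Icc (0 : ℝ) 1) (hne : y ≠ y') : e u θ k y y' =
      ev (greenC ((k : ℝ) ^ 2) (u 0) (u 1) (aV u θ) (bV u θ) (u y')) (loc u y' y) := by
  have hA := h.admissible hκ hc k hy'
  have hR := h.width_pos hκ hc
  set R := u 1 - u 0 with hRdef
  set Φ := homSol ((k : ℝ) ^ 2) R 0 (aV u θ) (bV u θ) (u y') with hΦ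
  set Q := bracketC ((k : ℝ) ^ 2) (u 0) (u 1) (aV u θ) (bV u θ) (u y') with hQ
  have hphi : ∀ z ∈ Icc (0 : ℝ) 1, phi u θ k z y' = R * loc u y' z * ev Φ (loc u y' z) :=
    fun z hz => by rw [phi, h.phi1_eq hκ hc k hy' hz, h.width_mul_loc hκ hc]
  have hΦ1 : ∀ z ∈ Icc (0 : ℝ) 1, ev Φ (loc u y' z) ≠ 0 := fun z hz =>
    (zero_lt_one.trans_le (hA.one_le (Ioo_subset_Icc_self (h.loc_mem hκ hc hy' hz)) R)).ne'
  have key : ∀ b ∈ Icc (0 : ℝ) 1, y' ∉ uIcc b y → ev Q (loc u y' b) = 0 →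
      ∫ z in b..y, θ z / phi u θ k z y' ^ 2 = R⁻¹ * (ev Q (loc u y' y) / loc u y' y) := by
    intro b hb hby hQb
    have hsub : uIcc b y ⊆ Icc 0 1 := uIcc_subset_Icc hb hy
    have hl0 : ∀ z ∈ uIcc b y, loc u y' z ≠ 0 := fun z hz =>
      h.loc_ne_zero hκ hc fun h' => hby (h' ▸ hz)
    have hd : ∀ z ∈ uIcc b y, HasDerivAt (fun z => R⁻¹ * (ev Q (loc u y' z) / loc u y' z))
        (θ z / (R * loc u y' z * ev Φ (loc u y' z)) ^ 2) z := fun z hz => by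
      have h1 := ((hA.hasDerivAt_bracketC_div (h.loc_mem hκ hc hy' (hsub hz)) (hl0 z hz)).comp z
        (h.hasDerivAt_loc y' z)).const_mul R⁻¹
      refine h1.congr_deriv ?_
      rw [h.add_width_mul_loc hκ hc, h.aV_u hκ hc, ← hRdef]
      have h2 := (h.deriv_pos hκ hc z).ne'
      have h3 := hΦ1 z (hsub hz)
      have h4 := hl0 z hz
      rw [← hΦ]
      field_simp
    have hcont : ContinuousOn (fun z => θ z / (R * loc u y' z * ev Φ (loc u y' z)) ^ 2) (uIcc b y) := by
      have hlc := h.continuous_loc y'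
      have hev := (continuous_ev Φ).comp hlc
      refine ContinuousOn.div h.smooth_theta.continuous.continuousOn
        (((continuous_const.mul hlc).mul hev).pow 2).continuousOn fun z hz =>
        pow_ne_zero _ (mul_ne_zero (mul_ne_zero hR.ne' (hl0 z hz)) (hΦ1 z (hsub hz)))
    rw [intervalIntegral.integral_congr (g := fun z =>
      θ z / (R * loc u y' z * ev Φ (loc u y' z)) ^ 2) fun z hz => by simp only [hphi z (hsub hz)],
      intervalIntegral.integral_eq_sub_of_hasDerivAt hd hcont.intervalIntegrable, hQb]
    simp
  have hl := h.loc_ne_zero hκ hc hne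
  have hG : ev (greenC ((k : ℝ) ^ 2) (u 0) (u 1) (aV u θ) (bV u θ) (u y')) (loc u y' y) =
      R * loc u y' y * ev Φ (loc u y' y) * (R⁻¹ * (ev Q (loc u y' y) / loc u y' y)) := by
    rw [greenC, ev_mul, ← hRdef, ← hΦ, ← hQ]
    field_simp
  rw [hG, e, hphi y hy]
  rcases lt_or_gt_of_ne hne with hlt | hgt
  · rw [if_pos hlt, key 0 (by simp) (fun h' => ?_) (by rw [loc_zero]; exact hA.ev_bracketC_left)]
    rw [uIcc_of_le hy.1] at h'
    linarith [h'.2]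
  · rw [if_neg hgt.not_gt, key 1 (by simp) (fun h' => ?_) hA.ev_bracketC_right]
    rw [uIcc_of_ge hy.2] at h'
    linarith [h'.1]

end Background

end ShearFlow

end

noncomputable section
namespace ShearFlow

/-! ### Principal values -/

theorem setOf_excised {A B c ε : ℝ} (hε : 0 < ε) (hA : A ≤ c - ε) (hB : c + ε ≤ B) :
    {x : ℝ | x ∈ Icc A B ∧ ε ≤ |x - c|} = Icc A (c - ε) ∪ Icc (c + ε) B := by
  ext x
  simp only [mem_ofPred_eq, mem_Icc, mem_union, le_abs]
  constructor
  · rintro ⟨⟨h1, h2⟩, h3 | h3⟩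
    · exact Or.inr ⟨by linarith, h2⟩
    · exact Or.inl ⟨h1, by linarith⟩
  · rintro (⟨h1, h2⟩ | ⟨h1, h2⟩)
    · exact ⟨⟨h1, by linarith⟩, Or.inr (by linarith)⟩
    · exact ⟨⟨by linarith, h2⟩, Or.inl (by linarith)⟩

/-- A principal value, for an integrand with an explicit non-integrable part. -/
theorem pvIntegral_eq {E : Type*} [NormedAddCommGroup E] [NormedSpace ℝ E] [CompleteSpace E]
    {A B c : ℝ} (hc : c ∈ Ioo A B) {f G : ℝ → E} {g L : ℝ → ℝ} {m : E}
    (hG : IntervalIntegrable G volume A B)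
    (hf : ∀ x ∈ Icc A B, x ≠ c → f x = G x + g x • m)
    (hL : ∀ x ∈ Icc A B, x ≠ c → HasDerivAt L (g x) x)
    (hg : ∀ x ∈ Icc A B, x ≠ c → ContinuousAt g x)
    (hlim : Tendsto (fun ε => L (c - ε) - L (c + ε)) (𝓝[>] 0) (𝓝 0)) :
    pvIntegral A B c f = (∫ x in A..B, G x) + (L B - L A) • m := by
  have hAB : A ≤ B := (hc.1.trans hc.2).le
  refine Tendsto.limUnder_eq ?_
  -- For small ε the excised interval splits into two pieces on which the fundamental theorem
  -- applies to `L`; only the symmetric difference L(c-ε) - L(c+ε) still depends on the singularity.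
  have hev : ∀ᶠ ε in 𝓝[>] (0 : ℝ), (∫ x in A..(c - ε), G x) + (∫ x in (c + ε)..B, G x) +
      ((L (c - ε) - L (c + ε)) + (L B - L A)) • m =
      ∫ x in {x : ℝ | x ∈ Icc A B ∧ ε ≤ |x - c|}, f x := by
    have h0 : 0 < min (c - A) (B - c) := lt_min (by linarith [hc.1]) (by linarith [hc.2])
    filter_upwards [Ioo_mem_nhdsGT h0] with ε hε
    have hε1 : A ≤ c - ε := by linarith [hε.2.trans_le (min_le_left _ _)]
    have hε2 : c + ε ≤ B := by linarith [hε.2.trans_le (min_le_right _ _)]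
    have hpiece : ∀ a b, A ≤ a → a ≤ b → b ≤ B → c ∉ Icc a b → IntegrableOn f (Icc a b) ∧
        ∫ x in Icc a b, f x = (∫ x in a..b, G x) + (L b - L a) • m := by
      intro a b ha hab hb hcab
      have hmem : ∀ x ∈ uIcc a b, x ∈ Icc A B ∧ x ≠ c := fun x hx => by
        rw [uIcc_of_le hab] at hx
        exact ⟨⟨ha.trans hx.1, hx.2.trans hb⟩, fun h => hcab (h ▸ hx)⟩
      have hgi : IntervalIntegrable g volume a b := ContinuousOn.intervalIntegrable fun x hx =>
        (hg x (hmem x hx).1 (hmem x hx).2).continuousWithinAt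
      have hGi : IntervalIntegrable G volume a b := hG.mono_set (by
        rw [uIcc_of_le hab, uIcc_of_le hAB]; exact Icc_subset_Icc ha hb)
      have hgm : IntervalIntegrable (fun x => g x • m) volume a b :=
        ⟨hgi.1.smul_const m, hgi.2.smul_const m⟩
      have hsum := hGi.add hgm
      have hcongr : EqOn (fun x => G x + g x • m) f (Icc a b) := fun x hx => by
        have := hmem x (by rwa [uIcc_of_le hab])
        exact (hf x this.1 this.2).symm
      refine ⟨IntegrableOn.congr_fun ((intervalIntegrable_iff_integrableOn_Icc_of_le hab).mp hsum)
        hcongr measurableSet_Icc, ?_⟩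
      rw [← setIntegral_congr_fun measurableSet_Icc hcongr, integral_Icc_eq_integral_Ioc,
        ← intervalIntegral.integral_of_le hab, intervalIntegral.integral_add hGi hgm,
        intervalIntegral.integral_smul_const,
        intervalIntegral.integral_eq_sub_of_hasDerivAt
          (fun x hx => hL x (hmem x hx).1 (hmem x hx).2) hgi]
    have h1 := hpiece A (c - ε) le_rfl hε1 (by linarith [hc.2, hε.1])
      fun h => by linarith [h.2, hε.1]
    have h2 := hpiece (c + ε) B (by linarith [hc.1, hε.1]) hε2 le_rfl
      fun h => by linarith [h.1, hε.1]
    rw [setOf_excised hε.1 hε1 hε2, setIntegral_union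
      (disjoint_left.mpr fun x hx hx' => by linarith [hx.2, hx'.1, hε.1]) measurableSet_Icc h1.1 h2.1,
      h1.2, h2.2]
    module
  refine Tendsto.congr' hev ?_
  have hcont : ContinuousOn (fun x => ∫ t in A..x, G t) (uIcc A B) :=
    intervalIntegral.continuousOn_primitive_interval' hG left_mem_uIcc
  have hcA : ContinuousAt (fun x => ∫ t in A..x, G t) c :=
    hcont.continuousAt (by rw [uIcc_of_le hAB]; exact Icc_mem_nhds hc.1 hc.2)
  have ht1 : Tendsto (fun ε : ℝ => c - ε) (𝓝[>] 0) (𝓝 c) := by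
    have : Tendsto (fun ε : ℝ => c - ε) (𝓝 0) (𝓝 (c - 0)) := tendsto_const_nhds.sub tendsto_id
    rw [sub_zero] at this
    exact this.mono_left nhdsWithin_le_nhds
  have ht2 : Tendsto (fun ε : ℝ => c + ε) (𝓝[>] 0) (𝓝 c) := by
    have : Tendsto (fun ε : ℝ => c + ε) (𝓝 0) (𝓝 (c + 0)) := tendsto_const_nhds.add tendsto_id
    rw [add_zero] at this
    exact this.mono_left nhdsWithin_le_nhds
  have hl1 := hcA.tendsto.comp ht1
  have hl2 := (tendsto_const_nhds (x := ∫ t in A..B, G t)).sub (hcA.tendsto.comp ht2)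
  have hl3 := ((hlim.add_const (L B - L A)).smul_const m)
  have := (hl1.add hl2).add hl3
  rw [add_sub_cancel, zero_add] at this
  refine this.congr' ?_
  have h0 : 0 < B - c := by linarith [hc.2]
  filter_upwards [Ioo_mem_nhdsGT h0] with ε hε
  have hmem : c + ε ∈ uIcc A B := by
    rw [uIcc_of_le hAB]; exact ⟨by linarith [hc.1, hε.1], by linarith [hε.2]⟩
  simp only [Function.comp]
  rw [intervalIntegral.integral_interval_sub_left hG
    (hG.mono_set (uIcc_subset_uIcc left_mem_uIcc hmem))]

/-! ### The coefficients of the wave operator -/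

namespace Background

variable {s₀ κ₀ c₀ K : ℝ} {u θ : ℝ → ℝ} {k : ℤ} {y' y : ℝ}

/-- The excision is symmetric in y, while the natural primitive is log|u(z) - u(y')|. The two
logarithms differ by that of a ratio of difference quotients, both of which tend to u'(y') ≠ 0. -/
theorem tendsto_log_sub (h : Background s₀ κ₀ c₀ K u θ) (hκ : 0 < κ₀) (hc : 0 < c₀) (y' : ℝ) :
    Tendsto (fun ε => Real.log (u (y' - ε) - u y') - Real.log (u (y' + ε) - u y')) (𝓝[>] 0) (𝓝 0) := by
  have hd := (h.deriv_pos hκ hc y').ne'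
  have hs := (hasDerivAt_iff_tendsto_slope.mp (h.differentiable_u y').hasDerivAt)
  have ht1 : Tendsto (fun ε : ℝ => y' - ε) (𝓝[>] 0) (𝓝[≠] y') := by
    refine tendsto_nhdsWithin_iff.mpr ⟨?_, ?_⟩
    · have : Tendsto (fun ε : ℝ => y' - ε) (𝓝 0) (𝓝 (y' - 0)) := tendsto_const_nhds.sub tendsto_id
      rw [sub_zero] at this
      exact this.mono_left nhdsWithin_le_nhds
    · filter_upwards [self_mem_nhdsWithin] with ε hε
      have : (0 : ℝ) < ε := hε
      simp [this.ne']
  have ht2 : Tendsto (fun ε : ℝ => y' + ε) (𝓝[>] 0) (𝓝[≠] y') := by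
    refine tendsto_nhdsWithin_iff.mpr ⟨?_, ?_⟩
    · have : Tendsto (fun ε : ℝ => y' + ε) (𝓝 0) (𝓝 (y' + 0)) := tendsto_const_nhds.add tendsto_id
      rw [add_zero] at this
      exact this.mono_left nhdsWithin_le_nhds
    · filter_upwards [self_mem_nhdsWithin] with ε hε
      have : (0 : ℝ) < ε := hε
      simp [this.ne']
  have h1 := ((hs.comp ht1).log hd).sub ((hs.comp ht2).log hd)
  rw [sub_self] at h1
  refine h1.congr' ?_
  filter_upwards [self_mem_nhdsWithin] with ε hε
  have hε' : (0 : ℝ) < ε := hε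
  have hm := h.strictMono hκ hc
  have h2 : u (y' - ε) - u y' ≠ 0 := (sub_neg.mpr (hm (by linarith))).ne
  have h3 : u (y' + ε) - u y' ≠ 0 := (sub_pos.mpr (hm (by linarith))).ne'
  simp only [Function.comp, slope_def_field, sub_sub_cancel_left, add_sub_cancel_left]
  rw [Real.log_div h2 (by simpa using hε'.ne'), Real.log_div h3 hε'.ne', Real.log_neg_eq_log]
  ring

/-- After division by ρ the boundary terms become -a(u₀)/(v-u₀) and -a(u₁)/(u₁-v). The principal
value splits into a regular difference-quotient integral and a'(v) times a difference of logarithms,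
matching `jump_eq`. -/
theorem J1_eq (h : Background s₀ κ₀ c₀ K u θ) (hκ : 0 < κ₀) (hc : 0 < c₀) (k : ℤ)
    (hy' : y' ∈ Ioo (0 : ℝ) 1) : J1 u θ k y' = rho u y' *
      jump ((k : ℝ) ^ 2) (u 0) (u 1) (aV u θ) (bV u θ) (u y') := by
  have hA := h.admissible hκ hc k hy'
  have hR := h.width_pos hκ hc
  rw [hA.jump_eq, ← loc_zero]
  change _ = _ * (_ + _ * (∫ s in _..loc u y' 1, _) + (_ * (∫ s in _..loc u y' 1, _) + _))
  set R := u 1 - u 0 with hRdef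
  set N := homN ((k : ℝ) ^ 2) R 0 (aV u θ) (bV u θ) (u y') with hN
  set D := diffQ (aV u θ) (u y') R with hD
  have hv0 : 0 < u y' - u 0 := sub_pos.mpr hA.mem.1
  have hv1 : 0 < u 1 - u y' := sub_pos.mpr hA.mem.2
  have hint : ∀ g : SymmC, ∫ z in (0 : ℝ)..1, deriv u z * ev g (loc u y' z) =
      R * ∫ s in loc u y' 0..loc u y' 1, ev g s := fun g => by
    rw [← intervalIntegral.integral_const_mul, ← h.integral_comp_loc (g := fun s => R * ev g s)
      (continuous_const.mul (continuous_ev g)), ← hRdef]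
    refine intervalIntegral.integral_congr fun z _ => ?_
    field_simp
  have hI1 : ∫ z in (0 : ℝ)..1, θ z / (u z - u y') ^ 2 * (1 / phi1 u θ k z y' ^ 2 - 1) =
      R * ∫ s in loc u y' 0..loc u y' 1, ev N s := by
    rw [← hint]
    refine intervalIntegral.integral_congr_ae ?_
    filter_upwards [compl_mem_ae_iff.mpr (measure_singleton y')] with z hz hz'
    rw [uIoc_of_le zero_le_one] at hz'
    have hz01 : z ∈ Icc (0 : ℝ) 1 := Ioc_subset_Icc_self hz'
    have hl := Ioo_subset_Icc_self (h.loc_mem hκ hc hy' hz01)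
    have hl0 := h.loc_ne_zero hκ hc hz
    have h1 := hA.sq_mul_ev_homN hl R
    have h2 := (h.deriv_pos hκ hc z).ne'
    rw [h.add_width_mul_loc hκ hc, h.aV_u hκ hc, ← hN] at h1
    have h3 : (θ z) * ((ev (homSol ((k : ℝ) ^ 2) R 0 (aV u θ) (bV u θ) (u y')) (loc u y' z))⁻¹ ^ 2 - 1) =
        R ^ 2 * loc u y' z ^ 2 * ev N (loc u y' z) * deriv u z := by
      rw [h1]; field_simp
    rw [h.phi1_eq hκ hc k hy' hz01, ← h.width_mul_loc hκ hc, one_div, ← inv_pow, div_mul_eq_mul_div,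
      ← hRdef, h3]
    field_simp
  have hI2 : pvIntegral 0 1 y' (fun z => 1 / (u z - u y') * deriv (fun x => θ x / deriv u x) z) =
      (∫ z in (0 : ℝ)..1, deriv u z * ev D (loc u y' z)) +
        (Real.log (u 1 - u y') - Real.log (u 0 - u y')) • iteratedDeriv 1 (aV u θ) (u y') := by
    have hsub : ∀ z, z ≠ y' → u z - u y' ≠ 0 := fun z hz =>
      sub_ne_zero.mpr ((h.strictMono hκ hc).injective.ne hz)
    refine pvIntegral_eq (L := fun z => Real.log (u z - u y'))
      (g := fun z => deriv u z / (u z - u y')) hy' ?_ ?_ ?_ ?_ (h.tendsto_log_sub hκ hc y')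
    · exact (h.smooth_deriv.continuous.mul
        ((continuous_ev D).comp (h.continuous_loc y'))).intervalIntegrable _ _
    · intro z hz hne
      have hl := Ioo_subset_Icc_self (h.loc_mem hκ hc hy' hz)
      have h1 := hA.mul_ev_diffQ hl R
      have h2 := (h.deriv_pos hκ hc z).ne'
      have h3 := hsub z hne
      rw [h.add_width_mul_loc hκ hc, h.width_mul_loc hκ hc, ← hD] at h1
      have h4 : deriv (fun x => θ x / deriv u x) z = deriv u z * iteratedDeriv 1 (aV u θ) (u z) := by
        rw [(h.deriv_ratio hκ hc z).deriv, h.deriv_aV hκ hc, h.uInv_u hκ hc]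
        field_simp
      rw [h4, smul_eq_mul]
      field_simp
      linear_combination -h1
    · intro z _ hne
      exact ((h.differentiable_u z).hasDerivAt.sub_const (u y')).log (hsub z hne)
    · intro z _ hne
      exact h.smooth_deriv.continuous.continuousAt.div
        (h.differentiable_u.continuous.continuousAt.sub continuousAt_const) (hsub z hne)
  rw [J1, hI1, hI2, hint, h.aV_u hκ hc, h.aV_u hκ hc, Real.log_div hv1.ne' hR.ne',
    Real.log_div hv0.ne' hR.ne', ← neg_sub (u y') (u 0), Real.log_neg_eq_log, smul_eq_mul, rho]
  field_simp
  ring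

theorem J2_eq (h : Background s₀ κ₀ c₀ K u θ) (hκ : 0 < κ₀) (hc : 0 < c₀) (y' : ℝ) :
    J2 u θ y' = rho u y' * iteratedDeriv 1 (aV u θ) (u y') := by
  rw [J2, h.deriv_aV hκ hc, h.uInv_u hκ hc]
  ring

/-- The factor ρ > 0 is common to numerator and denominator and cancels, which removes the
degeneration at the end points from the formula. -/
theorem B2_eq (h : Background s₀ κ₀ c₀ K u θ) (hκ : 0 < κ₀) (hc : 0 < c₀) (k : ℤ) {v : ℝ}
    (hv : v ∈ Ioo (u 0) (u 1)) :
    B2 u θ k v = normB ((k : ℝ) ^ 2) (u 0) (u 1) (aV u θ) (bV u θ) v := by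
  obtain ⟨y', rfl⟩ := h.surjective hκ hc v
  have hm := h.strictMono hκ hc
  have hy' : y' ∈ Ioo (0 : ℝ) 1 := ⟨hm.lt_iff_lt.mp hv.1, hm.lt_iff_lt.mp hv.2⟩
  have hρ : 0 < rho u y' := mul_pos (sub_pos.mpr hv.1) (sub_pos.mpr hv.2)
  rw [B2, h.uInv_u hκ hc, b2, h.J1_eq hκ hc k hy', h.J2_eq hκ hc, normB, h.aV_u hκ hc, mul_pow, mul_pow,
    mul_left_comm, ← mul_add, Real.sqrt_mul (sq_nonneg _), Real.sqrt_sq hρ.le,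
    mul_div_mul_left _ _ hρ.ne', div_eq_mul_inv]

end Background

end ShearFlow

end

noncomputable section
namespace ShearFlow

/-! ### Non-degeneracy: a degenerate point is an embedded eigenvalue -/

namespace Admissible

variable {κ u₀ u₁ v : ℝ} {a b : ℝ → ℝ}

theorem hasDerivAt_homSol (h : Admissible κ u₀ u₁ a b v) {R s : ℝ} (hs : s ∈ Ioo (-1 : ℝ) 1) :
    HasDerivAt (fun s => ev (homSol κ R 0 a b v) s)
      (κ * R ^ 2 * (s * (a (v + R * s) * ev (homP κ R 0 a b v) s))) s := by
  have h1 := ((hasDerivAt_pow_mul_avg 1 (shift R 0 a v * homP κ R 0 a b v) hs).const_mul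
    (κ * R ^ 2)).const_add 1
  refine (h1.congr_of_eventuallyEq ?_).congr_deriv ?_
  · filter_upwards [Ioo_mem_nhds hs.1 hs.2] with x hx
    conv_lhs => rw [homSol_eq]
    simp only [ev_add, ev_one, ev_smul, ev_mul, ev_pow, ev_idC (Ioo_subset_Icc_self hx), zero_mul,
      add_zero]
  · rw [ev_mul, h.ev_shift_a (Ioo_subset_Icc_self hs), pow_one]

/-- The derivative of `regPart`. -/
theorem hasDerivAt_regPart (h : Admissible κ u₀ u₁ a b v) (hd : iteratedDeriv 1 a v = 0) {s : ℝ}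
    (hs : s ∈ Ioo (-1 : ℝ) 1) :
    HasDerivAt (fun s => ev (regPart κ u₀ u₁ a b v) s)
      ((u₁ - u₀) * coefL κ u₀ u₁ a b v + (u₁ - u₀) ^ 2 * (s * ev (avg 0 (homN κ (u₁ - u₀) 0 a b v +
        diffQ a v (u₁ - u₀))) s) + (u₁ - u₀) ^ 2 * (s * ev (homN κ (u₁ - u₀) 0 a b v) s)) s := by
  set R := u₁ - u₀ with hR
  set F := homN κ R 0 a b v + diffQ a v R with hF
  have h0 := h.hasDerivAt 0 (v + R * s)
  rw [iteratedDeriv_zero, zero_add] at h0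
  have h1 : HasDerivAt (fun s => a (v + R * s)) (iteratedDeriv 1 a (v + R * s) * (R * 1)) s :=
    h0.comp s (((hasDerivAt_id s).const_mul R).const_add v)
  have h2 := (hasDerivAt_id s).mul (hasDerivAt_integral_ev F s)
  have h3 := (h1.neg.add ((hasDerivAt_id s).const_mul (R * coefL κ u₀ u₁ a b v))).add
    (h2.const_mul (R ^ 2))
  have hs' := Ioo_subset_Icc_self hs
  refine (h3.congr_of_eventuallyEq ?_).congr_deriv ?_
  · filter_upwards [Ioo_mem_nhds hs.1 hs.2] with x hx
    have hx' := Ioo_subset_Icc_self hx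
    simp only [regPart, ev_add, ev_neg, ev_smul, ev_mul, ev_pow, ev_idC hx', h.ev_shift_a hx', ← hR,
      Pi.add_apply, Pi.neg_apply, Pi.mul_apply, id, ← ev_avg_mul F hx']
    simp only [hF, map_add, ev_add]
    ring
  · have hD := h.mul_ev_diffQ hs' R
    rw [hd, sub_zero] at hD
    rw [← hD, ← ev_avg_mul F hs']
    simp only [hF, ev_add, map_add, id]
    ring

/-- When `jump` and `a'(v)` vanish, the bracket is `regPart`. -/
theorem bracketC_eq_regPart (hj : jump κ u₀ u₁ a b v = 0) (hd : iteratedDeriv 1 a v = 0) :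
    bracketC κ u₀ u₁ a b v = regPart κ u₀ u₁ a b v := by
  rw [bracketC, hj, hd]
  simp

/-- The momentum `ψ'/θ` of the Green function `ψ` at a degenerate point. -/
def mom (κ u₀ u₁ : ℝ) (a b : ℝ → ℝ) (v s : ℝ) : ℝ :=
  κ * (u₁ - u₀) * (s * (ev (homP κ (u₁ - u₀) 0 a b v) s * ev (regPart κ u₀ u₁ a b v) s)) +
    ev (homSol κ (u₁ - u₀) 0 a b v) s * (coefL κ u₀ u₁ a b v + (u₁ - u₀) *
      (s * ev (avg 0 (homN κ (u₁ - u₀) 0 a b v + diffQ a v (u₁ - u₀))) s) +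
      (u₁ - u₀) * (s * ev (homN κ (u₁ - u₀) 0 a b v) s)) / a (v + (u₁ - u₀) * s)

theorem continuous_mom (h : Admissible κ u₀ u₁ a b v) : Continuous (mom κ u₀ u₁ a b v) := by
  have h1 := h.smooth.continuous
  have h2 := fun g : SymmC => continuous_ev g
  unfold mom
  refine Continuous.add ?_ (Continuous.div ?_ (h1.comp (by fun_prop)) fun s => (h.a_pos _).ne')
  · exact continuous_const.mul (continuous_id.mul ((h2 _).mul (h2 _)))
  · exact (h2 _).mul ((continuous_const.add (continuous_const.mul (continuous_id.mul (h2 _)))).add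
      (continuous_const.mul (continuous_id.mul (h2 _))))

/-- With `jump` and a'(v) zero, the kink and the logarithm are absent, so the Green function is
differentiable across s = 0 and ψ'/θ extends continuously there. -/
theorem hasDerivAt_greenC (h : Admissible κ u₀ u₁ a b v) (hj : jump κ u₀ u₁ a b v = 0)
    (hd : iteratedDeriv 1 a v = 0) {s : ℝ} (hs : s ∈ Ioo (-1 : ℝ) 1) :
    HasDerivAt (fun s => ev (greenC κ u₀ u₁ a b v) s)
      ((u₁ - u₀) * a (v + (u₁ - u₀) * s) * mom κ u₀ u₁ a b v s) s := by
  have h1 := (h.hasDerivAt_homSol (R := u₁ - u₀) hs).mul (h.hasDerivAt_regPart hd hs)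
  simp only [greenC, bracketC_eq_regPart hj hd, ev_mul]
  refine h1.congr_deriv ?_
  have := (h.a_pos (v + (u₁ - u₀) * s)).ne'
  rw [mom]
  field_simp

/-- Away from s = 0 the momentum is rewritten through regPart/s, whose derivative is known
explicitly. Differentiating `mom` directly would require a derivative of `homN`. -/
theorem mom_eq (h : Admissible κ u₀ u₁ a b v) {s : ℝ}
    (hs : s ∈ Icc (-1 : ℝ) 1) (hs0 : s ≠ 0) : mom κ u₀ u₁ a b v s =
      κ * (u₁ - u₀) * ((s ^ (2 + 1) * ev (homP κ (u₁ - u₀) 0 a b v) s / s) *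
        (ev (regPart κ u₀ u₁ a b v) s / s)) +
      ev (homSol κ (u₁ - u₀) 0 a b v) s * (ev (regPart κ u₀ u₁ a b v) s / s) /
        (a (v + (u₁ - u₀) * s) * (u₁ - u₀)) +
      (ev (homSol κ (u₁ - u₀) 0 a b v) s)⁻¹ / ((u₁ - u₀) * s) := by
  have hR := h.width_pos.ne'
  have hN := h.sq_mul_ev_homN hs (u₁ - u₀)
  have hreg : ev (regPart κ u₀ u₁ a b v) s = -a (v + (u₁ - u₀) * s) +
      (u₁ - u₀) * coefL κ u₀ u₁ a b v * s + (u₁ - u₀) ^ 2 * (s ^ 2 *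
        ev (avg 0 (homN κ (u₁ - u₀) 0 a b v + diffQ a v (u₁ - u₀))) s) := by
    simp only [regPart, ev_add, ev_neg, ev_smul, ev_mul, ev_pow, ev_idC hs, h.ev_shift_a hs, map_add]
  have ha := (h.a_pos (v + (u₁ - u₀) * s)).ne'
  have hΦ := (zero_lt_one.trans_le (h.one_le hs (u₁ - u₀))).ne'
  rw [mom]
  set R := u₁ - u₀
  set I := ev (avg 0 (homN κ R 0 a b v + diffQ a v R)) s
  have hN' : R ^ 2 * s ^ 2 * ev (homN κ R 0 a b v) s * ev (homSol κ R 0 a b v) s ^ 2 =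
      a (v + R * s) * (1 - ev (homSol κ R 0 a b v) s ^ 2) := by
    rw [hN]; field_simp
  have key : ev (homSol κ R 0 a b v) s * (coefL κ u₀ u₁ a b v + R * (s * I) +
      R * (s * ev (homN κ R 0 a b v) s)) / a (v + R * s) =
      ev (homSol κ R 0 a b v) s * (ev (regPart κ u₀ u₁ a b v) s / s) / (a (v + R * s) * R) +
      (ev (homSol κ R 0 a b v) s)⁻¹ / (R * s) := by
    rw [hreg]
    field_simp
    linear_combination hN'
  rw [key]
  field_simp
  ring

theorem hasDerivAt_mom (h : Admissible κ u₀ u₁ a b v) (hj : jump κ u₀ u₁ a b v = 0)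
    (hd : iteratedDeriv 1 a v = 0) {s : ℝ} (hs : s ∈ Ioo (-1 : ℝ) 1) (hs0 : s ≠ 0) :
    HasDerivAt (mom κ u₀ u₁ a b v)
      ((u₁ - u₀) * ((κ * b (v + (u₁ - u₀) * s) -
        ev (diffQ a v (u₁ - u₀)) s / a (v + (u₁ - u₀) * s) ^ 2) *
          ev (greenC κ u₀ u₁ a b v) s)) s := by
  have hR := h.width_pos.ne'
  have hs' := Ioo_subset_Icc_self hs
  have hr := h.hasDerivAt_bracketC_div hs hs0
  have hΦd := h.hasDerivAt_homSol (R := u₁ - u₀) hs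
  have hΦ := (zero_lt_one.trans_le (h.one_le hs' (u₁ - u₀))).ne'
  have hPd := hasDerivAt_pow_mul_avg 2 (shift (u₁ - u₀) 0 b v * homSol κ (u₁ - u₀) 0 a b v) hs
  have hPe : ∀ x, ev (avg 2 (shift (u₁ - u₀) 0 b v * homSol κ (u₁ - u₀) 0 a b v)) x =
      ev (homP κ (u₁ - u₀) 0 a b v) x := fun x => rfl
  simp only [hPe] at hPd
  rw [bracketC_eq_regPart hj hd] at hr
  have hα : HasDerivAt (fun s => a (v + (u₁ - u₀) * s))
      (iteratedDeriv 1 a (v + (u₁ - u₀) * s) * ((u₁ - u₀) * 1)) s := by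
    have := h.hasDerivAt 0 (v + (u₁ - u₀) * s)
    rw [iteratedDeriv_zero, zero_add] at this
    exact this.comp s (((hasDerivAt_id s).const_mul (u₁ - u₀)).const_add v)
  have ha := (h.a_pos (v + (u₁ - u₀) * s)).ne'
  have h1 := ((((hPd.div (hasDerivAt_id s) hs0).mul hr).const_mul (κ * (u₁ - u₀))).add
    ((hΦd.mul hr).div (hα.mul_const (u₁ - u₀)) (mul_ne_zero ha hR))).add
    ((hΦd.inv hΦ).div ((hasDerivAt_id s).const_mul (u₁ - u₀)) (mul_ne_zero hR hs0))
  refine (h1.congr_of_eventuallyEq ?_).congr_deriv ?_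
  · filter_upwards [Ioo_mem_nhds hs.1 hs.2, isOpen_ne.mem_nhds hs0] with x hx hx0
    rw [h.mom_eq (Ioo_subset_Icc_self hx) hx0]
    rfl
  · have hD := h.mul_ev_diffQ hs' (u₁ - u₀)
    rw [hd, sub_zero] at hD
    rw [← hD, greenC, bracketC_eq_regPart hj hd, ev_mul, ev_mul, ev_shift h.cont hs', zero_mul, add_zero]
    simp only [id, Pi.mul_apply, Pi.div_apply, Pi.inv_apply]
    field_simp
    ring

end Admissible

namespace Background

variable {s₀ κ₀ c₀ K : ℝ} {u θ : ℝ → ℝ} {k : ℤ} {y' : ℝ}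

/-- If both terms vanish, ψ = E(·,v) satisfies the equation across y' and vanishes at 0 and 1. With
w = φ₁ψ/(u - u(y')), which is regular because φ₁ vanishes at y', this is an embedded eigenvalue
u(y') of the Rayleigh operator. It is non-trivial because ψ(y') ≠ 0. -/
theorem jump_sq_add_pos (h : Background s₀ κ₀ c₀ K u θ) (hκ : 0 < κ₀) (hc : 0 < c₀) (hk : k ≠ 0)
    (hy' : y' ∈ Ioo (0 : ℝ) 1) :
    0 < jump ((k : ℝ) ^ 2) (u 0) (u 1) (aV u θ) (bV u θ) (u y') ^ 2 +
      Real.pi ^ 2 * iteratedDeriv 1 (aV u θ) (u y') ^ 2 := by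
  by_contra hneg
  have hA := h.admissible hκ hc k hy'
  have hR := h.width_pos hκ hc
  set κ := (k : ℝ) ^ 2 with hκdef
  set a := aV u θ with ha
  set b := bV u θ with hb
  have hpi := Real.pi_pos
  have hj : jump κ (u 0) (u 1) a b (u y') = 0 := by
    have h1 : 0 ≤ Real.pi ^ 2 * iteratedDeriv 1 a (u y') ^ 2 := by positivity
    exact pow_eq_zero_iff (two_ne_zero) |>.mp (by nlinarith [sq_nonneg (jump κ (u 0) (u 1) a b (u y'))])
  have hd : iteratedDeriv 1 a (u y') = 0 := by
    rw [hj] at hneg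
    by_contra h0
    exact hneg (by positivity)
  -- the eigenfunction
  set ψ : ℝ → ℝ := fun y => ev (greenC κ (u 0) (u 1) a b (u y')) (loc u y' y) with hψ
  set p : ℝ → ℝ := fun y => Admissible.mom κ (u 0) (u 1) a b (u y') (loc u y' y) with hp
  -- This is φ₁ψ/(u - u(y')), written with the difference quotient of a' so that it is continuous at
  -- y'.
  set w : ℝ → ℝ := fun y =>
    -(deriv u y ^ 3 / θ y ^ 2 * ev (diffQ a (u y') (u 1 - u 0)) (loc u y' y) * ψ y) with hw
  have hlc := h.continuous_loc y'
  have huc := h.smooth_deriv.continuous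
  have hθc := h.smooth_theta.continuous
  have hθ0 := fun y => (h.theta_pos hκ hc y).ne'
  have hu0 := fun y => (h.deriv_pos hκ hc y).ne'
  have hψc : Continuous ψ := (continuous_ev _).comp hlc
  have hpc : Continuous p := hA.continuous_mom.comp hlc
  have hwc : Continuous w := ((((huc.pow 3).div (hθc.pow 2) fun y => pow_ne_zero _ (hθ0 y)).mul
    ((continuous_ev _).comp hlc)).mul hψc).neg
  have hrhs : Continuous fun y => w y + κ / θ y * ψ y :=
    hwc.add ((continuous_const.div hθc hθ0).mul hψc)
  have hψd : ∀ y ∈ Icc (0 : ℝ) 1, HasDerivAt ψ (θ y * p y) y := fun y hy => by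
    refine ((hA.hasDerivAt_greenC hj hd (h.loc_mem hκ hc hy' hy)).comp y
      (h.hasDerivAt_loc y' y)).congr_deriv ?_
    rw [h.add_width_mul_loc hκ hc, ha, h.aV_u hκ hc, ← ha]
    have := hu0 y
    simp only [hp]
    field_simp
  have hpd : ∀ y ∈ Icc (0 : ℝ) 1, y ≠ y' → HasDerivAt p (w y + κ / θ y * ψ y) y := fun y hy hne => by
    refine ((hA.hasDerivAt_mom hj hd (h.loc_mem hκ hc hy' hy) (h.loc_ne_zero hκ hc hne)).comp y
      (h.hasDerivAt_loc y' y)).congr_deriv ?_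
    rw [h.add_width_mul_loc hκ hc, ha, h.aV_u hκ hc, hb, h.bV_u hκ hc, ← ha, ← hb]
    have h1 := hu0 y
    have h2 := hθ0 y
    simp only [hw, hψ]
    field_simp
    ring
  have hψ0 : ψ 0 = 0 := by
    simp only [hψ]
    rw [greenC, ev_mul, loc_zero, hA.ev_bracketC_left, mul_zero]
  have hψ1 : ψ 1 = 0 := by
    simp only [hψ]
    rw [greenC, ev_mul, show loc u y' 1 = (u 1 - u y') / (u 1 - u 0) from rfl, hA.ev_bracketC_right,
      mul_zero]
  have hψy : ψ y' ≠ 0 := by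
    have h0 : (0 : ℝ) ∈ Icc (-1 : ℝ) 1 := by simp
    simp only [hψ]
    rw [greenC, ev_mul, loc_self, hA.ev_bracketC_of_nonneg (by simp)]
    refine mul_ne_zero (zero_lt_one.trans_le (hA.one_le h0 _)).ne' ?_
    simpa using (hA.a_pos _).ne'
  have hsub : ∀ y ∈ Icc (0 : ℝ) 1, uIcc 0 y ⊆ Icc (0 : ℝ) 1 := fun y hy =>
    uIcc_subset_Icc (by simp) hy
  have hψi : ∀ y ∈ Icc (0 : ℝ) 1, ψ y = ∫ z in (0 : ℝ)..y, θ z * p z := fun y hy => by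
    rw [intervalIntegral.integral_eq_sub_of_hasDerivAt (fun z hz => hψd z (hsub y hy hz))
      ((hθc.mul hpc).intervalIntegrable _ _), hψ0, sub_zero]
  have hpi' : ∀ y ∈ Icc (0 : ℝ) 1, p y = p 0 + ∫ z in (0 : ℝ)..y, (w z + κ / θ z * ψ z) :=
    fun y hy => by
    rw [integral_eq_of_hasDerivAt_off_countable p _ (countable_singleton y') hpc.continuousOn
      (fun z hz => hpd z (hsub y hy (Ioo_subset_Icc_self hz.1)) hz.2)
      (hrhs.intervalIntegrable _ _)]
    ring
  have heig : ∀ y ∈ Icc (0 : ℝ) 1, u y * w y - varphi1 u θ y * ψ y = u y' * w y := fun y hy => by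
    have h1 := hA.mul_ev_diffQ (Ioo_subset_Icc_self (h.loc_mem hκ hc hy' hy)) (u 1 - u 0)
    rw [hd, sub_zero, h.add_width_mul_loc hκ hc, h.width_mul_loc hκ hc, ha, h.deriv_aV hκ hc,
      h.uInv_u hκ hc, ← ha] at h1
    have h2 := hu0 y
    have h3 := hθ0 y
    simp only [hw]
    field_simp
    field_simp at h1
    linear_combination (-ψ y) * h1
  have hnot : ¬ ∀ᵐ y ∂(volume.restrict (Icc (0 : ℝ) 1)), (w y : ℂ) = 0 := by
    intro hw0
    have h1 : ∀ᵐ y ∂(volume.restrict (uIoc (0 : ℝ) 1)), w y = 0 := by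
      refine ae_restrict_of_ae_restrict_of_subset ?_ (hw0.mono fun y hy => by exact_mod_cast hy)
      rw [uIoc_of_le zero_le_one]
      exact Ioc_subset_Icc_self
    -- Energy identity: were w zero almost everywhere, integrating (pψ)' would force ∫ (k²ψ²/θ +
    -- θp²) = 0, against ψ(y') ≠ 0.
    have h2 := integral_eq_of_hasDerivAt_off_countable (fun y => p y * ψ y)
      (fun y => (w y + κ / θ y * ψ y) * ψ y + p y * (θ y * p y)) (a := 0) (b := 1)
      (countable_singleton y') (hpc.mul hψc).continuousOn (fun z hz => by
        have hz' := hsub 1 (by simp) (Ioo_subset_Icc_self hz.1)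
        exact (hpd z hz' hz.2).mul (hψd z hz'))
      (((hrhs.mul hψc).add (hpc.mul (hθc.mul hpc))).intervalIntegrable _ _)
    rw [hψ0, hψ1, mul_zero, mul_zero, sub_zero] at h2
    have hq : Continuous fun y => κ / θ y * ψ y ^ 2 + θ y * p y ^ 2 :=
      ((continuous_const.div hθc hθ0).mul (hψc.pow 2)).add (hθc.mul (hpc.pow 2))
    have h3 : ∫ y in (0 : ℝ)..1, (κ / θ y * ψ y ^ 2 + θ y * p y ^ 2) = 0 := by
      refine (intervalIntegral.integral_congr_ae_restrict ?_).trans h2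
      filter_upwards [h1] with y hy
      rw [hy]
      ring
    have hκ0 : 0 < κ := by
      have : (k : ℝ) ≠ 0 := by exact_mod_cast hk
      positivity
    refine (intervalIntegral.integral_pos zero_lt_one hq.continuousOn (fun y _ => ?_)
      ⟨y', Ioo_subset_Icc_self hy', ?_⟩).ne' h3
    · have := h.theta_pos hκ hc y
      positivity
    · have := h.theta_pos hκ hc y'
      have h4 : 0 < κ / θ y' * ψ y' ^ 2 := by positivity
      have h5 : 0 ≤ θ y' * p y' ^ 2 := by positivity
      linarith
  refine h.stable k hk (u y' : ℂ) ⟨fun y => (w y : ℂ), fun y => (ψ y : ℂ), ⟨?_, fun y => (p y : ℂ),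
    (Complex.continuous_ofReal.comp hpc).continuousOn, fun y hy => ?_, fun y hy => ?_, ?_⟩, hnot, ?_⟩
  · obtain ⟨C, hC⟩ := isCompact_Icc.exists_bound_of_continuousOn (hwc.continuousOn (s := Icc (0 : ℝ) 1))
    refine MemLp.of_bound (Complex.continuous_ofReal.comp hwc).aestronglyMeasurable C ?_
    filter_upwards [ae_restrict_mem measurableSet_Icc] with y hy
    rw [Complex.norm_real]
    exact hC y hy
  · beta_reduce
    rw [hψi y hy, ← intervalIntegral.integral_ofReal]
    simp only [Complex.ofReal_mul]
  · beta_reduce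
    rw [hpi' y hy, Complex.ofReal_add, ← intervalIntegral.integral_ofReal]
    simp only [Complex.ofReal_add, Complex.ofReal_mul, Complex.ofReal_div, hκdef, Complex.ofReal_pow,
      Complex.ofReal_intCast]
  · beta_reduce
    rw [hψ1, Complex.ofReal_zero]
  · filter_upwards [ae_restrict_mem measurableSet_Icc] with y hy
    exact_mod_cast heig y hy

/-- The normalizing denominator is bounded below away from the ends. -/
theorem exists_jump_sq_ge {σ M d : ℝ} (h : Background s₀ κ₀ c₀ K u θ) (hκ : 0 < κ₀) (hc : 0 < c₀)
    (hk : k ≠ 0) (hσ : 1 < σ) (hM : 0 < M) (ha : GevJet σ M (aV u θ)) (hb : GevJet σ M (bV u θ))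
    (hd : 0 < d) : ∃ δ, 0 < δ ∧ ∀ v ∈ Ioo (u 0 + d) (u 1 - d),
      δ ≤ jump ((k : ℝ) ^ 2) (u 0) (u 1) (aV u θ) (bV u θ) v ^ 2 +
        Real.pi ^ 2 * iteratedDeriv 1 (aV u θ) v ^ 2 := by
  have hA := h.admissible hκ hc k (y' := 1 / 2) ⟨by norm_num, by norm_num⟩
  have hm := h.strictMono hκ hc
  have hj := (gev_jump (κ := (k : ℝ) ^ 2) (u₀ := u 0) (u₁ := u 1) hσ hM (half_pos hd) (sq_nonneg _)
    ha hb hA.a_pos hA.b_pos).continuousOn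
  have hsub : Icc (u 0 + d) (u 1 - d) ⊆ Ioo (u 0 + d / 2) (u 1 - d / 2) := fun v hv =>
    ⟨by linarith [hv.1], by linarith [hv.2]⟩
  have hcont : ContinuousOn (fun v => jump ((k : ℝ) ^ 2) (u 0) (u 1) (aV u θ) (bV u θ) v ^ 2 +
      Real.pi ^ 2 * iteratedDeriv 1 (aV u θ) v ^ 2) (Icc (u 0 + d) (u 1 - d)) :=
    ((hj.mono hsub).pow 2).add
      (continuousOn_const.mul ((ha.continuous 1).continuousOn.pow 2))
  obtain ⟨δ, hδ, hδb⟩ := isCompact_Icc.exists_forall_le' hcont (a := 0) fun v hv => by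
    obtain ⟨y', rfl⟩ := h.surjective hκ hc v
    exact h.jump_sq_add_pos hκ hc hk
      ⟨hm.lt_iff_lt.mp (by linarith [hv.1]), hm.lt_iff_lt.mp (by linarith [hv.2])⟩
  exact ⟨δ, hδ, fun v hv => hδb v (Ioo_subset_Icc_self hv)⟩

end Background

end ShearFlow

end

noncomputable section
namespace ShearFlow

/-! ### The difference of the wave operators as an oscillatory integral -/

theorem intervalIntegrable_of_eq_off {E : Type*} [NormedAddCommGroup E] {f g : ℝ → E} {a b : ℝ}
    (hf : IntervalIntegrable f volume a b) (c : ℝ) (h : ∀ x ∈ uIoc a b, x ≠ c → f x = g x) :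
    IntervalIntegrable g volume a b := by
  refine hf.congr_ae ?_
  rw [EventuallyEq, ae_restrict_iff' measurableSet_uIoc]
  filter_upwards [compl_mem_ae_iff.mpr (measure_singleton c)] with x hx hx'
  exact h x hx' hx

theorem integral_congr_off {E : Type*} [NormedAddCommGroup E] [NormedSpace ℝ E] {f g : ℝ → E}
    {a b : ℝ} (c : ℝ) (h : ∀ x ∈ uIoc a b, x ≠ c → f x = g x) :
    ∫ x in a..b, f x = ∫ x in a..b, g x := by
  refine intervalIntegral.integral_congr_ae ?_
  filter_upwards [compl_mem_ae_iff.mpr (measure_singleton c)] with x hx hx'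
  exact h x hx' hx

/-- The difference quotients of `g` at `0` are integrable. -/
def SlopeInt (g : SymmC) : Prop :=
  IntervalIntegrable (fun s => (ev g s - ev g 0) / s) volume (-1) 1

namespace SlopeInt

variable {f g : SymmC}

theorem mem_of_uIoc {s : ℝ} (hs : s ∈ uIoc (-1 : ℝ) 1) : s ∈ Icc (-1 : ℝ) 1 := by
  rw [uIoc_of_le (by norm_num)] at hs
  exact Ioc_subset_Icc_self hs

theorem add (hf : SlopeInt f) (hg : SlopeInt g) : SlopeInt (f + g) := by
  have := IntervalIntegrable.add hf hg
  refine this.congr fun s _ => ?_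
  simp only [ev_add]
  ring

theorem mul (hf : SlopeInt f) (hg : SlopeInt g) : SlopeInt (f * g) := by
  have h1 := IntervalIntegrable.continuousOn_mul hg (continuous_ev f).continuousOn
  have h2 := (IntervalIntegrable.const_mul hf (ev g 0)).add h1
  refine h2.congr fun s _ => ?_
  simp only [ev_mul]
  ring

theorem const_smul (c : ℝ) (hf : SlopeInt f) : SlopeInt (c • f) := by
  refine (IntervalIntegrable.const_mul hf c).congr fun s _ => ?_
  simp only [ev_smul]
  ring

theorem neg (hf : SlopeInt f) : SlopeInt (-f) := by
  rw [← neg_one_smul ℝ f]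
  exact hf.const_smul _

theorem sub (hf : SlopeInt f) (hg : SlopeInt g) : SlopeInt (f - g) := by
  rw [sub_eq_add_neg]
  exact hf.add hg.neg

theorem of_eq_off {F : ℝ → ℝ} (hF : IntervalIntegrable F volume (-1) 1)
    (h : ∀ s ∈ Icc (-1 : ℝ) 1, s ≠ 0 → ev g s - ev g 0 = s * F s) : SlopeInt g :=
  intervalIntegrable_of_eq_off hF 0 fun s hs hs0 => by
    rw [h s (mem_of_uIoc hs) hs0, mul_div_cancel_left₀ _ hs0]

theorem one : SlopeInt 1 := of_eq_off (F := fun _ => 0) intervalIntegrable_const fun s _ _ => by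
  simp

theorem idC_mul (g : SymmC) : SlopeInt (idC * g) :=
  of_eq_off (intervalIntegrable_ev g _ _) fun s hs _ => by
    rw [ev_mul, ev_mul, ev_idC hs, ev_idC (by simp), zero_mul, sub_zero]

theorem idC_sq_mul (g : SymmC) : SlopeInt (idC ^ 2 * g) := by
  rw [pow_two idC, mul_assoc]
  exact idC_mul _

theorem logC : SlopeInt ShearFlow.logC :=
  of_eq_off (F := Real.log) intervalIntegral.intervalIntegrable_log' fun s hs _ => by
    rw [ev_logC hs, ev_logC (by simp), zero_mul, sub_zero]

theorem posC : SlopeInt ShearFlow.posC := by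
  refine IntervalIntegrable.trans (b := 0) ?_ ?_
  · refine (intervalIntegrable_const (c := (0 : ℝ))).congr fun s hs => ?_
    rw [uIoc_of_le (by norm_num)] at hs
    rw [ev_posC ⟨hs.1.le, by linarith [hs.2]⟩, ev_posC (by simp), max_eq_right hs.2]
    simp
  · refine (intervalIntegrable_const (c := (1 : ℝ))).congr fun s hs => ?_
    rw [uIoc_of_le (by norm_num)] at hs
    rw [ev_posC ⟨by linarith [hs.1], hs.2⟩, ev_posC (by simp), max_eq_left hs.1.le, max_self, sub_zero,
      div_self hs.1.ne']

theorem continuous_dslope {E : Type*} [NormedAddCommGroup E] [NormedSpace ℝ E] {H : ℝ → E}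
    (hH : Differentiable ℝ H) (v : ℝ) : Continuous (dslope H v) :=
  continuous_iff_continuousAt.mpr fun x => by
    rcases eq_or_ne x v with rfl | hne
    · exact continuousAt_dslope_same.mpr (hH x)
    · exact (continuousAt_dslope_of_ne hne).mpr (hH x).continuousAt

theorem shift {a : ℝ → ℝ} (ha : Differentiable ℝ a) (R v : ℝ) : SlopeInt (ShearFlow.shift R 0 a v) := by
  have hd : Differentiable ℝ fun s => a (v + R * s) := ha.comp (by fun_prop)
  refine of_eq_off ((continuous_dslope hd 0).intervalIntegrable _ _) fun s hs hs0 => ?_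
  rw [ev_shift ha.continuous hs, ev_shift ha.continuous (by simp), dslope_of_ne _ hs0, slope_def_field,
    zero_mul, add_zero, sub_zero, mul_div_cancel₀ _ hs0]

/-- The worst term of the bracket is s log|s|, whose difference quotient at 0 is log|s|, still
integrable. This makes the principal values below converge. -/
theorem greenC {κ u₀ u₁ v : ℝ} {a b : ℝ → ℝ} (h : Admissible κ u₀ u₁ a b v) :
    SlopeInt (ShearFlow.greenC κ u₀ u₁ a b v) := by
  have hΦ : SlopeInt (homSol κ (u₁ - u₀) 0 a b v) := by
    rw [homSol_eq]
    exact one.add ((idC_sq_mul _).const_smul _)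
  have hid : SlopeInt idC := by
    rw [← mul_one idC]
    exact idC_mul 1
  refine hΦ.mul (SlopeInt.sub (SlopeInt.add (SlopeInt.add (SlopeInt.add ?_ (hid.const_smul _)) ?_)
    (logC.const_smul _)) (posC.const_smul _))
  · exact (shift (h.smooth.differentiable (by simp)) _ _).neg
  · exact (idC_sq_mul _).const_smul _

/-- In the variable `x = v + R s`, after multiplication with a differentiable function. -/
theorem intervalIntegrable {g : SymmC} (hg : SlopeInt g) {R v A B : ℝ} (hR : 0 < R) (hA : v - R ≤ A)
    (hAB : A ≤ B) (hB : B ≤ v + R) {η : ℝ → ℂ} (hη : Differentiable ℝ η) :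
    IntervalIntegrable (fun x => (x - v)⁻¹ • ((ev g ((x - v) / R) : ℂ) * η x - (ev g 0 : ℂ) * η v))
      volume A B := by
  have h1 : IntervalIntegrable (fun x => (ev g ((x - v) / R) - ev g 0) / ((x - v) / R)) volume A B := by
    have h2 := ((IntervalIntegrable.comp_mul_right hg (c := R⁻¹)).comp_sub_right v)
    simp only [← div_eq_mul_inv, div_inv_eq_mul] at h2
    refine h2.mono_set ?_
    rw [uIcc_of_le hAB, uIcc_of_le (by linarith)]
    exact Icc_subset_Icc (by linarith) (by linarith)
  have h3 : IntervalIntegrable (fun x => (((ev g ((x - v) / R) - ev g 0) / ((x - v) / R) : ℝ) : ℂ))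
      volume A B := ⟨h1.1.ofReal, h1.2.ofReal⟩
  have h4 : Continuous fun x => (ev g ((x - v) / R) : ℂ) * dslope η v x :=
    (Complex.continuous_ofReal.comp ((continuous_ev g).comp (by fun_prop))).mul
      (continuous_dslope hη v)
  refine intervalIntegrable_of_eq_off ((h3.mul_const ((R : ℂ)⁻¹ * η v)).add
    (h4.intervalIntegrable A B)) v fun x _ hx => ?_
  have hx' : (x : ℂ) - v ≠ 0 := by exact_mod_cast sub_ne_zero.mpr hx
  have hR' : (R : ℂ) ≠ 0 := by exact_mod_cast hR.ne'
  rw [dslope_of_ne _ hx, slope_def_module, Complex.real_smul, Complex.real_smul]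
  push_cast
  field_simp
  ring

end SlopeInt

/-- Subtracting the constant m makes the integrand integrable; the principal value of 1/(x - v)
contributes only the logarithms coming from the asymmetric position of v. -/
theorem pvIntegral_inv_smul {A B v : ℝ} (hv : v ∈ Ioo A B) {f F : ℝ → ℂ} {m : ℂ}
    (hF : IntervalIntegrable (fun x => (x - v)⁻¹ • (F x - m)) volume A B)
    (hf : ∀ x ∈ Icc A B, x ≠ v → f x = (x - v)⁻¹ • F x) :
    pvIntegral A B v f = (∫ x in A..B, (x - v)⁻¹ • (F x - m)) +
      (Real.log (B - v) - Real.log (A - v)) • m := by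
  refine pvIntegral_eq (L := fun x => Real.log (x - v)) (g := fun x => (x - v)⁻¹) hv hF
    (fun x hx hne => ?_) (fun x _ hne => ?_) (fun x _ hne => ?_) ?_
  · rw [hf x hx hne]
    module
  · have := ((hasDerivAt_id x).sub_const v).log (sub_ne_zero.mpr hne)
    rwa [one_div] at this
  · exact (continuousAt_id.sub continuousAt_const).inv₀ (sub_ne_zero.mpr hne)
  · simp only [sub_sub_cancel_left, add_sub_cancel_left, Real.log_neg_eq_log, sub_self]
    exact tendsto_const_nhds

theorem mul_ev_avg_shift_deriv {f : ℝ → ℝ} (hf : ContDiff ℝ ∞ f) (R v : ℝ) {s : ℝ}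
    (hs : s ∈ Icc (-1 : ℝ) 1) :
    R * s * ev (avg 0 (shift R 0 (iteratedDeriv 1 f) v)) s = f (v + R * s) - f v := by
  have hd : Differentiable ℝ f := hf.differentiable (by simp)
  have hc1 : Continuous (iteratedDeriv 1 f) :=
    hf.continuous_iteratedDeriv 1 (by exact_mod_cast le_top)
  rw [mul_assoc, Admissible.ev_avg_mul _ hs, ← intervalIntegral.integral_const_mul]
  have hd : ∀ x ∈ uIcc 0 s, HasDerivAt (fun x => f (v + R * x)) (R * iteratedDeriv 1 f (v + R * x)) x :=
    fun x _ => by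
      rw [iteratedDeriv_one]
      refine ((hd (v + R * x)).hasDerivAt.comp x
        (((hasDerivAt_id x).const_mul R).const_add v)).congr_deriv ?_
      ring
  have hc : Continuous fun x => R * iteratedDeriv 1 f (v + R * x) :=
    continuous_const.mul (hc1.comp (by fun_prop))
  rw [show f (v + R * s) - f v = f (v + R * s) - f (v + R * 0) by rw [mul_zero, add_zero],
    ← intervalIntegral.integral_eq_sub_of_hasDerivAt hd (hc.intervalIntegrable _ _)]
  refine intervalIntegral.integral_congr fun x hx => ?_
  have hx' : x ∈ Icc (-1 : ℝ) 1 := uIcc_subset_Icc (by simp) hs hx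
  rw [ev_shift hc1 hx', zero_mul, add_zero]

theorem mul_ev_commC {u₀ u₁ : ℝ} {q p : ℝ → ℝ} (hq : ContDiff ℝ ∞ q) (hp : ContDiff ℝ ∞ p) (v : ℝ)
    {s : ℝ} (hs : s ∈ Icc (-1 : ℝ) 1) :
    (u₁ - u₀) * s * ev (commC u₀ u₁ q p v) s =
      p v * q (v + (u₁ - u₀) * s) - q v * p (v + (u₁ - u₀) * s) := by
  have h1 := mul_ev_avg_shift_deriv hq (u₁ - u₀) v hs
  have h2 := mul_ev_avg_shift_deriv hp (u₁ - u₀) v hs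
  simp only [commC, ev_sub, ev_smul]
  linear_combination p v * h1 - q v * h2

namespace Background

variable {s₀ κ₀ c₀ K : ℝ} {u θ χ : ℝ → ℝ} {k : ℤ}

theorem E_eq (h : Background s₀ κ₀ c₀ K u θ) (hκ : 0 < κ₀) (hc : 0 < c₀) (k : ℤ) {v x : ℝ}
    (hv : v ∈ Ioo (u 0) (u 1)) (hx : x ∈ Icc (u 0) (u 1)) (hne : x ≠ v) : E u θ k x v =
      ev (greenC ((k : ℝ) ^ 2) (u 0) (u 1) (aV u θ) (bV u θ) v) ((x - v) / (u 1 - u 0)) := by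
  obtain ⟨y', rfl⟩ := h.surjective hκ hc v
  obtain ⟨y, rfl⟩ := h.surjective hκ hc x
  have hm := h.strictMono hκ hc
  rw [E, h.uInv_u hκ hc, h.uInv_u hκ hc, h.e_eq hκ hc k
    ⟨hm.lt_iff_lt.mp hv.1, hm.lt_iff_lt.mp hv.2⟩ ⟨hm.le_iff_le.mp hx.1, hm.le_iff_le.mp hx.2⟩
    fun h' => hne (congrArg u h')]
  rfl

/-- Both principal values carry the singular value p(v)q(v)E(v,v)ζ(v), with E(v,v) read as `ev G 0`,
so their logarithmic terms cancel. The numerator p(v)q(x) - q(v)p(x) vanishes at x = v and turns the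
difference into a regular integral. -/
theorem pv_sub_pv (h : Background s₀ κ₀ c₀ K u θ) (hκ : 0 < κ₀) (hc : 0 < c₀) (k : ℤ)
    (hq : ContDiff ℝ ∞ (qV u)) (hp : ContDiff ℝ ∞ (tvarphi1 u θ)) {v : ℝ} (hv : v ∈ Ioo (u 0) (u 1))
    {g ζ : ℝ → ℂ} (hζ : Differentiable ℝ ζ) (t : ℝ)
    (hg : ∀ x : ℝ, g x * Complex.exp (-Complex.I * (x - v) * t * k) = ζ x) :
    (tvarphi1 u θ v : ℂ) * pvIntegral (u 0) (u 1) v (fun x => (E u θ k x v : ℂ) *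
        (g x * Complex.exp (-Complex.I * (x - v) * t * k) / ((x : ℂ) - v)) *
        ((deriv (uInv u) x : ℝ) : ℂ)) -
      pvIntegral (u 0) (u 1) v (fun x => (E u θ k x v : ℂ) *
        ((tvarphi1 u θ x : ℂ) * g x * Complex.exp (-Complex.I * (x - v) * t * k) / ((x : ℂ) - v)) *
        ((deriv (uInv u) v : ℝ) : ℂ)) =
      ∫ x in (u 0)..(u 1), (ev (commC (u 0) (u 1) (qV u) (tvarphi1 u θ) v *
        greenC ((k : ℝ) ^ 2) (u 0) (u 1) (aV u θ) (bV u θ) v) ((x - v) / (u 1 - u 0)) : ℂ) * ζ x := by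
  obtain ⟨y', rfl⟩ := h.surjective hκ hc v
  have hm := h.strictMono hκ hc
  have hA := h.admissible hκ hc k (y' := y') ⟨hm.lt_iff_lt.mp hv.1, hm.lt_iff_lt.mp hv.2⟩
  have hR := h.width_pos hκ hc
  set v := u y'
  set G := greenC ((k : ℝ) ^ 2) (u 0) (u 1) (aV u θ) (bV u θ) v with hG
  set R := u 1 - u 0 with hRdef
  set η₁ : ℝ → ℂ := fun x => (qV u x : ℂ) * ζ x with hη₁
  set η₂ : ℝ → ℂ := fun x => (qV u v : ℂ) * ((tvarphi1 u θ x : ℂ) * ζ x) with hη₂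
  have hcast : ∀ f : ℝ → ℝ, ContDiff ℝ ∞ f → Differentiable ℝ fun x => (f x : ℂ) := fun f hf x =>
    ((hf.differentiable (by simp) x).hasDerivAt.ofReal_comp).differentiableAt
  have hd₁ : Differentiable ℝ η₁ := (hcast _ hq).mul hζ
  have hd₂ : Differentiable ℝ η₂ := ((hcast _ hp).mul hζ).const_mul _
  have hint : ∀ η : ℝ → ℂ, Differentiable ℝ η → IntervalIntegrable (fun x => (x - v)⁻¹ •
      ((ev G ((x - v) / R) : ℂ) * η x - (ev G 0 : ℂ) * η v)) volume (u 0) (u 1) := fun η hη =>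
    (SlopeInt.greenC hA).intervalIntegrable hR (by linarith [hv.2]) (by linarith) (by linarith [hv.1]) hη
  have hx0 : ∀ x : ℝ, x ≠ v → (x : ℂ) - v ≠ 0 := fun x hx => by exact_mod_cast sub_ne_zero.mpr hx
  rw [pvIntegral_inv_smul hv (hint η₁ hd₁) fun x hx hne => ?_,
    pvIntegral_inv_smul hv (hint η₂ hd₂) fun x hx hne => ?_]
  · have e1 : (tvarphi1 u θ v : ℂ) * ((ev G 0 : ℂ) * η₁ v) = (ev G 0 : ℂ) * η₂ v := by
      simp only [hη₁, hη₂]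
      ring
    rw [mul_add, mul_smul_comm, e1, add_sub_add_right_eq_sub, ← intervalIntegral.integral_const_mul,
      ← intervalIntegral.integral_sub ((hint η₁ hd₁).const_mul _) (hint η₂ hd₂)]
    refine integral_congr_off v fun x hx hne => ?_
    rw [uIoc_of_le (by linarith)] at hx
    have hs : (x - v) / R ∈ Icc (-1 : ℝ) 1 := by
      rw [mem_Icc, le_div_iff₀ hR, div_le_iff₀ hR]
      constructor <;> linarith [hx.1, hx.2, hv.1, hv.2]
    have h1 := mul_ev_commC (u₀ := u 0) (u₁ := u 1) hq hp v hs
    rw [← hRdef, mul_div_cancel₀ _ hR.ne', add_sub_cancel] at h1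
    have h2 : ((x : ℂ) - v) * (ev (commC (u 0) (u 1) (qV u) (tvarphi1 u θ) v) ((x - v) / R) : ℂ) =
        tvarphi1 u θ v * qV u x - qV u v * tvarphi1 u θ x := by exact_mod_cast h1
    rw [mul_smul_comm, mul_sub, e1, ← smul_sub, Complex.real_smul, ev_mul]
    push_cast
    have h3 := hx0 x hne
    field_simp
    simp only [hη₁, hη₂]
    linear_combination (-(ev G ((x - v) / R) : ℂ) * ζ x) * h2
  · rw [h.E_eq hκ hc k hv hx hne, h.deriv_uInv hκ hc, ← hG, ← hRdef, Complex.real_smul,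
      mul_assoc (tvarphi1 u θ x : ℂ), hg x]
    push_cast
    simp only [hη₂]
    ring
  · rw [h.E_eq hκ hc k hv hx hne, h.deriv_uInv hκ hc, ← hG, ← hRdef, Complex.real_smul, hg x]
    push_cast
    simp only [hη₁]
    ring

end Background

end ShearFlow

end

/-! ### The commutator as an operator with kernel `kernelC`, and the bounds -/

noncomputable section
namespace ShearFlow

namespace Background

variable {s₀ κ₀ c₀ K : ℝ} {u θ χ : ℝ → ℝ} {k : ℤ}

/-- The difference of the wave operators is an oscillatory integral with kernel `kernelC`. -/
theorem waveDiff_eq (h : Background s₀ κ₀ c₀ K u θ) (hκ : 0 < κ₀) (hc : 0 < c₀) (k : ℤ)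
    (hq : ContDiff ℝ ∞ (qV u)) (hp : ContDiff ℝ ∞ (tvarphi1 u θ)) (hχ : ContDiff ℝ ∞ (pull u χ))
    {d : ℝ} (hd : 0 < d) (hsupp : ∀ v ∉ Icc (u 0 + d) (u 1 - d), pull u χ v = 0)
    {f : ℝ → ℝ → ℂ} (hf : IsSchwartz f) (t v : ℝ) :
    waveDiff u θ χ k t f v = (u 1 - u 0 : ℝ) * ∫ s in (-1 : ℝ)..1,
      (ev (kernelC ((k : ℝ) ^ 2) (u 0) (u 1) (aV u θ) (bV u θ) (qV u) (tvarphi1 u θ) (pull u χ) v) s : ℂ) *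
        osc (-((u 1 - u 0) * (k * t))) s * F1 f k (v + (u 1 - u 0) * s) := by
  have hR := h.width_pos hκ hc
  by_cases hcv : pull u χ v = 0
  · rw [waveDiff, show χ (uInv u v) = 0 from hcv, kernelC_eq_zero hcv]
    simp
  have hv' : v ∈ Icc (u 0 + d) (u 1 - d) := by
    by_contra h'
    exact hcv (hsupp v h')
  have hv : v ∈ Ioo (u 0) (u 1) := ⟨by linarith [hv'.1], by linarith [hv'.2]⟩
  set R := u 1 - u 0 with hRdef
  set ζ : ℝ → ℂ := fun x => (pull u χ x : ℂ) * F1 f k x *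
    Complex.exp (-Complex.I * (x - v) * t * k) with hζ
  have hosc : ∀ x : ℝ, HasDerivAt (fun x : ℝ => Complex.exp (-Complex.I * (x - v) * t * k))
      (Complex.exp (-Complex.I * (x - v) * t * k) * (-Complex.I * 1 * t * k)) x := fun x =>
    ((((Complex.ofRealCLM.hasDerivAt.sub_const (v : ℂ)).const_mul (-Complex.I)).mul_const
      (t : ℂ)).mul_const (k : ℂ)).cexp
  have hζd : Differentiable ℝ ζ := by
    refine Differentiable.mul (Differentiable.mul (fun x => ?_) (hf.differentiable_F1 k))
      fun x => (hosc x).differentiableAt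
    exact ((hχ.differentiable (by simp) x).hasDerivAt.ofReal_comp).differentiableAt
  have key := h.pv_sub_pv hκ hc k hq hp hv (g := fun x => (pull u χ x : ℂ) * F1 f k x) hζd t
    fun x => rfl
  set g : SymmC := commC (u 0) (u 1) (qV u) (tvarphi1 u θ) v *
    greenC ((k : ℝ) ^ 2) (u 0) (u 1) (aV u θ) (bV u θ) v with hg
  set nB := normB ((k : ℝ) ^ 2) (u 0) (u 1) (aV u θ) (bV u θ) v with hnB
  have h1 : waveDiff u θ χ k t f v = (pull u χ v : ℂ) * nB *
      ∫ x in (u 0)..(u 1), (ev g ((x - v) / R) : ℂ) * ζ x := by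
    rw [← key, waveDiff, waveD, waveD1, h.B2_eq hκ hc k hv, ← hnB]
    simp only [pull]
    ring
  have hsub : Function.support (fun x => (ev g ((x - v) / R) : ℂ) * ζ x) ⊆
      Icc (u 0 + d) (u 1 - d) := fun x hx => by
    by_contra h'
    exact hx (by simp [hζ, hsupp x h'])
  -- The cut-off inside ζ vanishes off the inner interval, so the domain may be replaced by [v-R,
  -- v+R], which corresponds to s ∈ [-1,1].
  have h2 : ∫ x in (u 0)..(u 1), (ev g ((x - v) / R) : ℂ) * ζ x =
      ∫ x in (v - R)..(v + R), (ev g ((x - v) / R) : ℂ) * ζ x := by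
    rw [intervalIntegral.integral_eq_integral_of_support_subset (hsub.trans fun x hx =>
        ⟨by linarith [hx.1], by linarith [hx.2]⟩),
      intervalIntegral.integral_eq_integral_of_support_subset (hsub.trans fun x hx =>
        ⟨by linarith [hx.1, hv.2], by linarith [hx.2, hv.1]⟩)]
  have h3 := intervalIntegral.integral_comp_add_mul (a := -1) (b := 1)
    (fun x => (ev g ((x - v) / R) : ℂ) * ζ x) hR.ne' v
  rw [mul_neg_one, mul_one, ← sub_eq_add_neg, ← h2] at h3
  rw [h1, show ∫ x in (u 0)..(u 1), (ev g ((x - v) / R) : ℂ) * ζ x =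
    (R : ℂ) * ∫ s in (-1 : ℝ)..1, (ev g ((v + R * s - v) / R) : ℂ) * ζ (v + R * s) by
      rw [h3, Complex.real_smul, Complex.ofReal_inv,
        mul_inv_cancel_left₀ (by exact_mod_cast hR.ne')], mul_left_comm,
    ← intervalIntegral.integral_const_mul]
  congr 1
  refine intervalIntegral.integral_congr fun s hs => ?_
  rw [uIcc_of_le (by norm_num)] at hs
  have e1 : (v + R * s - v) / R = s := by rw [add_sub_cancel_left, mul_div_cancel_left₀ _ hR.ne']
  have e2 : Complex.exp (-Complex.I * (((v + R * s : ℝ) : ℂ) - v) * t * k) =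
      osc (-(R * (k * t))) s := by
    rw [osc]
    congr 1
    push_cast
    ring
  simp only [hζ]
  rw [e1, e2, kernelC, ev_smul, ← hg, ← hnB, ← hRdef, ev_mul (shift R 0 (pull u χ) v) g,
    ev_shift hχ.continuous hs, zero_mul, add_zero]
  push_cast
  ring

/-- The cut-off vanishes near the ends of the range. -/
theorem pull_eq_zero {K₁ : ℝ} (h : Background s₀ κ₀ c₀ K u θ) (hκ : 0 < κ₀) (hc : 0 < c₀)
    (hχ : IsCutoff s₀ κ₀ K₁ χ) {v : ℝ}
    (hv : v ∉ Icc (u 0 + c₀ * κ₀ / 2) (u 1 - c₀ * κ₀ / 2)) : pull u χ v = 0 := by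
  obtain ⟨y, rfl⟩ := h.surjective hκ hc v
  rw [pull, h.uInv_u hκ hc]
  refine image_eq_zero_of_notMem_tsupport fun h' => hv ?_
  have hy := hχ.supp h'
  have h1 := h.mul_sub_le hκ (x := 0) (y := y) (by linarith [hy.1])
  have h2 := h.mul_sub_le hκ (x := y) (y := 1) (by linarith [hy.2])
  constructor <;> nlinarith [hy.1, hy.2]

end Background

/-! ### Bounds for the kernel -/

theorem inv_one_add_sq_le {R x : ℝ} (hR : 0 < R) :
    (1 + (R * x) ^ 2)⁻¹ ≤ (1 + (R⁻¹) ^ 2) / (1 + x ^ 2) := by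
  rw [inv_eq_one_div, div_le_div_iff₀ (by positivity) (by positivity)]
  have : R⁻¹ ^ 2 * (R * x) ^ 2 = x ^ 2 := by field_simp
  nlinarith [sq_nonneg (R * x), sq_nonneg R⁻¹]

theorem sq_le_rpow_exp {s₀ l : ℝ} (hs : 0 < s₀) (hl : 0 < l) :
    ∃ C, 0 ≤ C ∧ ∀ x : ℝ, (1 + x ^ 2) * Real.exp (-l * |x| ^ s₀) ≤ C := by
  have ht : Tendsto (fun z : ℝ => z ^ (2 / s₀) * Real.exp (-l * z)) atTop (𝓝 0) :=
    tendsto_rpow_mul_exp_neg_mul_atTop_nhds_zero _ _ hl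
  have hcont : ContinuousOn (fun z : ℝ => z ^ (2 / s₀) * Real.exp (-l * z)) (Ici 0) :=
    ((Real.continuous_rpow_const (by positivity)).mul (by fun_prop)).continuousOn
  obtain ⟨N, hN⟩ := eventually_atTop.mp (ht.eventually (ge_mem_nhds zero_lt_one))
  obtain ⟨C, hC⟩ := isCompact_Icc.exists_bound_of_continuousOn
    (hcont.mono (fun z hz => hz.1 : Icc (0 : ℝ) N ⊆ Ici 0))
  refine ⟨2 + |C|, by positivity, fun x => ?_⟩
  set z := |x| ^ s₀ with hz
  have hz0 : 0 ≤ z := by positivity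
  have hx : x ^ 2 = z ^ (2 / s₀) := by
    rw [hz, ← Real.rpow_mul (abs_nonneg x), mul_div_cancel₀ _ hs.ne', Real.rpow_two, sq_abs]
  have h1 : Real.exp (-l * z) ≤ 1 := Real.exp_le_one_iff.mpr (by nlinarith)
  have h2 : z ^ (2 / s₀) * Real.exp (-l * z) ≤ 1 + |C| := by
    rcases le_total z N with h | h
    · have := (le_abs_self _).trans (hC z ⟨hz0, h⟩)
      linarith [le_abs_self C]
    · linarith [hN z h, abs_nonneg C]
  rw [hx]
  linarith

theorem inv_one_add_sq_shift (x y : ℝ) :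
    (1 + y ^ 2)⁻¹ ≤ 2 * (1 + (x - y) ^ 2) / (1 + x ^ 2) := by
  rw [inv_eq_one_div, div_le_div_iff₀ (by positivity) (by positivity)]
  nlinarith [sq_nonneg (x - 2 * y), sq_nonneg ((x - y) * y), sq_nonneg (x - y), sq_nonneg y]

/-- For fixed ξ₁ the inner Fourier integral is a compactly supported Gevrey function of v whose
constant carries 1/(1+β²), with β = R(ξ₁ - b). Its transform at ξ - ξ₁ gives the stretched
exponential. -/
theorem norm_fourierKernel_le {s₀ M C A B R b : ℝ} (hs : 0 < s₀) (hM : 0 < M) (hC : 0 ≤ C)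
    (hAB : A ≤ B) (hR : 0 < R) {G : ℝ → SymmC} (hsupp : ∀ v ∉ Icc A B, G v = 0)
    (hG : ∀ β, ContDiff ℝ ∞ fun v => fourierC β (G v))
    (hb : ∀ (β : ℝ) (m : ℕ) (v : ℝ), ‖iteratedDeriv m (fun v => fourierC β (G v)) v‖ ≤
      C * gevreyWeight (1 / s₀) M m / (1 + β ^ 2)) (ξ ξ₁ : ℝ) :
    ‖fourierKernel R b G ξ ξ₁‖ ≤ R / (2 * Real.pi) * (C * (B - A) * Real.exp 1) * (1 + R⁻¹ ^ 2) *
      (Real.exp (-((Real.exp 1 * M)⁻¹) ^ s₀ * |ξ - ξ₁| ^ s₀) / (1 + |ξ₁ - b| ^ 2)) := by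
  have hp := Real.pi_pos
  set β := R * (ξ₁ - b) with hβ
  have h1 := norm_F2_le_of_gevrey (g := fun v => fourierC β (G v)) (C := C / (1 + β ^ 2)) hs hM
    (by positivity) hAB (hG β) (fun v hv => by simp [hsupp v hv])
    (fun m v => (hb β m v).trans_eq (by ring)) (ξ - ξ₁)
  have h2 : ‖(R / (2 * Real.pi) : ℂ)‖ = R / (2 * Real.pi) := by
    rw [show (R / (2 * Real.pi) : ℂ) = ((R / (2 * Real.pi) : ℝ) : ℂ) by push_cast; rfl,
      Complex.norm_real, Real.norm_of_nonneg (by positivity)]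
  have h3 := inv_one_add_sq_le (x := ξ₁ - b) hR
  rw [fourierKernel, norm_mul, h2, sq_abs]
  set X := Real.exp (-((Real.exp 1 * M)⁻¹) ^ s₀ * |ξ - ξ₁| ^ s₀)
  have hX : 0 ≤ X := (Real.exp_pos _).le
  have hBA : 0 ≤ B - A := sub_nonneg.mpr hAB
  calc R / (2 * Real.pi) * ‖F2 (fun v => fourierC β (G v)) (ξ - ξ₁)‖
      ≤ R / (2 * Real.pi) * (C / (1 + β ^ 2) * (B - A) * Real.exp 1 * X) := by gcongr
    _ = R / (2 * Real.pi) * (C * (B - A) * Real.exp 1) * X * (1 + (R * (ξ₁ - b)) ^ 2)⁻¹ := by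
        rw [← hβ]; ring
    _ ≤ R / (2 * Real.pi) * (C * (B - A) * Real.exp 1) * X *
          ((1 + R⁻¹ ^ 2) / (1 + (ξ₁ - b) ^ 2)) := by gcongr
    _ = _ := by ring

/-- Moving the weight from ξ₁ - b to ξ - b costs 2(1 + |ξ-ξ₁|²), which half of the stretched
exponential absorbs. The other half remains, whence the rate l/2. -/
theorem exists_le_min {s₀ l : ℝ} (hs : 0 < s₀) (hl : 0 < l) :
    ∃ C, 0 ≤ C ∧ ∀ ξ ξ₁ b : ℝ, Real.exp (-l * |ξ - ξ₁| ^ s₀) / (1 + |ξ₁ - b| ^ 2) ≤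
      C * min (Real.exp (-(l / 2) * |ξ - ξ₁| ^ s₀) / (1 + |ξ - b| ^ 2))
        (Real.exp (-(l / 2) * |ξ - ξ₁| ^ s₀) / (1 + |ξ₁ - b| ^ 2)) := by
  obtain ⟨C, hC, hb⟩ := sq_le_rpow_exp hs (half_pos hl)
  refine ⟨1 + 2 * C, by positivity, fun ξ ξ₁ b => ?_⟩
  simp only [sq_abs]
  set X := Real.exp (-(l / 2) * |ξ - ξ₁| ^ s₀) with hX
  have hX0 : 0 < X := Real.exp_pos _
  have hX1 : X ≤ 1 := Real.exp_le_one_iff.mpr (by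
    have : 0 ≤ |ξ - ξ₁| ^ s₀ := by positivity
    nlinarith)
  have hXX : Real.exp (-l * |ξ - ξ₁| ^ s₀) = X * X := by
    rw [hX, ← Real.exp_add]
    congr 1
    ring
  rw [hXX, mul_min_of_nonneg _ _ (by positivity)]
  refine le_min ?_ ?_
  · have h1 := inv_one_add_sq_shift (ξ - b) (ξ₁ - b)
    rw [sub_sub_sub_cancel_right] at h1
    have h2 := hb (ξ - ξ₁)
    calc X * X / (1 + (ξ₁ - b) ^ 2) = X * X * (1 + (ξ₁ - b) ^ 2)⁻¹ := div_eq_mul_inv _ _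
      _ ≤ X * X * (2 * (1 + (ξ - ξ₁) ^ 2) / (1 + (ξ - b) ^ 2)) := by gcongr
      _ = 2 * ((1 + (ξ - ξ₁) ^ 2) * X) * (X / (1 + (ξ - b) ^ 2)) := by ring
      _ ≤ (1 + 2 * C) * (X / (1 + (ξ - b) ^ 2)) := by
          gcongr
          linarith
  · rw [← mul_div_assoc]
    gcongr
    linarith

namespace Background

variable {s₀ κ₀ c₀ K K₁ : ℝ} {u θ χ : ℝ → ℝ}

theorem exists_bound_fourierKernel {M : ℝ} (h : Background s₀ κ₀ c₀ K u θ) (hs₀ : 0 < s₀)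
    (hs₁ : s₀ < 1) (hκ : 0 < κ₀) (hκ' : κ₀ ≤ 1 / 10) (hc : 0 < c₀) (hχ : IsCutoff s₀ κ₀ K₁ χ)
    (hM : 0 < M) (ha : GevJet (1 / s₀) M (aV u θ)) (hb : GevJet (1 / s₀) M (bV u θ))
    (hq : GevJet (1 / s₀) M (qV u)) (hp : GevJet (1 / s₀) M (tvarphi1 u θ))
    (hχM : GevJet (1 / s₀) M (pull u χ)) (k : ℤ) (hk : k ≠ 0) :
    Continuous (kernelC ((k : ℝ) ^ 2) (u 0) (u 1) (aV u θ) (bV u θ) (qV u) (tvarphi1 u θ) (pull u χ)) ∧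
    ∃ C, 0 ≤ C ∧ ∀ b ξ ξ₁ : ℝ, ‖fourierKernel (u 1 - u 0) b
      (kernelC ((k : ℝ) ^ 2) (u 0) (u 1) (aV u θ) (bV u θ) (qV u) (tvarphi1 u θ) (pull u χ)) ξ ξ₁‖ ≤
      C * (Real.exp (-((Real.exp 1 * (2 * M))⁻¹) ^ s₀ * |ξ - ξ₁| ^ s₀) / (1 + |ξ₁ - b| ^ 2)) := by
  have hσ : 1 < 1 / s₀ := by rw [lt_div_iff₀ hs₀]; linarith
  have hA := h.admissible hκ hc k (y' := 1 / 2) ⟨by norm_num, by norm_num⟩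
  have hR := h.width_pos hκ hc
  have hd : 0 < c₀ * κ₀ / 2 := by positivity
  -- The margin d/2 is smaller than the distance d of the cut-off from the ends, so the lower bound
  -- holds on a neighbourhood of its support.
  obtain ⟨δ, hδ, hj⟩ := h.exists_jump_sq_ge hκ hc hk hσ hM ha hb (half_pos hd)
  have hsupp : ∀ v ∉ Icc (u 0 + c₀ * κ₀ / 2) (u 1 - c₀ * κ₀ / 2), pull u χ v = 0 := fun v hv =>
    h.pull_eq_zero hκ hc hχ hv
  obtain ⟨hcont, hsm, C, hC, hbd⟩ := exists_bound_kernelC (κ := (k : ℝ) ^ 2) hσ hM (half_pos hd)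
    (half_lt_self hd) (sq_nonneg _) ha hb hq hp hχM hA.a_pos hA.b_pos hsupp hδ hj
  have hAB : u 0 + c₀ * κ₀ / 2 ≤ u 1 - c₀ * κ₀ / 2 := by
    have := h.mul_sub_le hκ zero_le_one
    nlinarith
  have hp0 := Real.pi_pos
  have hBA := sub_nonneg.mpr hAB
  exact ⟨hcont, _, by positivity, fun b ξ ξ₁ => norm_fourierKernel_le hs₀ (by positivity) hC hAB hR
    (fun v hv => kernelC_eq_zero (hsupp v hv)) hsm hbd ξ ξ₁⟩

end Background

end ShearFlow

end

/-! ### The kernel estimate -/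

theorem proposition4p9 (s₀ κ₀ c₀ K K₁ : ℝ) (hs₀ : 0 < s₀) (hs₀' : s₀ < 1)
    (hκ₀ : 0 < κ₀) (hκ₀' : κ₀ ≤ 1 / 10) (hc₀ : 0 < c₀) (hK : 1 < K) (hK₁ : 1 < K₁) (kM : ℕ) :
    ∃ lam : ℝ, 0 < lam ∧
      ∀ u θ χ₂ : ℝ → ℝ, ShearFlow.Background s₀ κ₀ c₀ K u θ →
        ShearFlow.IsCutoff s₀ κ₀ K₁ χ₂ →
        ∃ Dcom : ℝ → ℤ → ℝ → ℝ → ℂ,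
          (∀ (f : ℝ → ℝ → ℝ → ℂ), (∀ t : ℝ, ShearFlow.IsSchwartz (f t)) →
            ∀ (t : ℝ) (k : ℤ), 0 < |k| → |k| ≤ (kM : ℤ) →
              Integrable (ShearFlow.waveDiff u θ χ₂ k t (f t)) ∧
              ∀ ξ : ℝ,
                Integrable (fun ξ₁ : ℝ => Dcom t k ξ ξ₁ * ShearFlow.fhat (f t) k ξ₁) ∧
                ShearFlow.F2 (ShearFlow.waveDiff u θ χ₂ k t (f t)) ξ =
                  ∫ ξ₁ : ℝ, Dcom t k ξ ξ₁ * ShearFlow.fhat (f t) k ξ₁) ∧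
          ∃ C : ℝ, ∀ (t : ℝ) (k : ℤ), 0 < |k| → |k| ≤ (kM : ℤ) → ∀ ξ ξ₁ : ℝ,
            ‖Dcom t k ξ ξ₁‖ ≤ C * min
              (Real.exp (-lam * |ξ - ξ₁| ^ s₀) / (1 + |ξ - k * t| ^ 2))
              (Real.exp (-lam * |ξ - ξ₁| ^ s₀) / (1 + |ξ₁ - k * t| ^ 2)) := by
  obtain ⟨M, hM, hjet⟩ := ShearFlow.exists_radius hs₀ hs₀' hκ₀ hc₀ hK hK₁
  set l : ℝ := ((Real.exp 1 * (2 * M))⁻¹) ^ s₀ with hl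
  have hl0 : 0 < l := by positivity
  obtain ⟨C₁, hC₁, hmin⟩ := ShearFlow.exists_le_min hs₀ hl0
  -- The rate is fixed before the flow is chosen: l comes from the uniform radius 2M, where 2
  -- accounts for the shifts.
  refine ⟨l / 2, half_pos hl0, fun u θ χ₂ h hχ => ?_⟩
  obtain ⟨ha, hb, hq, hp, hχM⟩ := hjet u θ χ₂ h hχ
  have hker := h.exists_bound_fourierKernel hs₀ hs₀' hκ₀ hκ₀' hc₀ hχ hM ha hb hq hp hχM
  have hd : 0 < c₀ * κ₀ / 2 := by positivity
  have hsupp : ∀ v ∉ Icc (u 0 + c₀ * κ₀ / 2) (u 1 - c₀ * κ₀ / 2), ShearFlow.pull u χ₂ v = 0 :=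
    fun v hv => h.pull_eq_zero hκ₀ hc₀ hχ hv
  -- The constant depends on k. A dummy value at k = 0 makes it a nonnegative function on all
  -- integers, and summing it over |k| ≤ kM gives a common bound.
  have hC : ∀ k : ℤ, ∃ C, 0 ≤ C ∧ (k ≠ 0 → ∀ b ξ ξ₁ : ℝ, ‖ShearFlow.fourierKernel (u 1 - u 0) b
      (ShearFlow.kernelC ((k : ℝ) ^ 2) (u 0) (u 1) (ShearFlow.aV u θ) (ShearFlow.bV u θ)
        (ShearFlow.qV u) (ShearFlow.tvarphi1 u θ) (ShearFlow.pull u χ₂)) ξ ξ₁‖ ≤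
      C * (Real.exp (-l * |ξ - ξ₁| ^ s₀) / (1 + |ξ₁ - b| ^ 2))) := fun k => by
    by_cases hk : k = 0
    · exact ⟨0, le_rfl, fun h' => absurd hk h'⟩
    · obtain ⟨-, C, hC, hb⟩ := hker k hk
      exact ⟨C, hC, fun _ => hb⟩
  choose C hC hCb using hC
  refine ⟨fun t k ξ ξ₁ => ShearFlow.fourierKernel (u 1 - u 0) (k * t)
    (ShearFlow.kernelC ((k : ℝ) ^ 2) (u 0) (u 1) (ShearFlow.aV u θ) (ShearFlow.bV u θ)
      (ShearFlow.qV u) (ShearFlow.tvarphi1 u θ) (ShearFlow.pull u χ₂)) ξ ξ₁,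
    fun f hf t k hk _ => ?_, (∑ k ∈ Finset.Icc (-(kM : ℤ)) kM, C k) * C₁, fun t k hk hkM ξ ξ₁ => ?_⟩
  · exact ShearFlow.integral_fourierKernel (hker k (abs_pos.mp hk)).1
      (fun v hv => ShearFlow.kernelC_eq_zero (hsupp v hv)) ((hf t).integrable_fhat k)
      ((hf t).F1_eq_integral_fhat k)
      (h.waveDiff_eq hκ₀ hc₀ k hq.smooth hp.smooth hχM.smooth hd hsupp (hf t) t)
  · have hle : C k ≤ ∑ k ∈ Finset.Icc (-(kM : ℤ)) kM, C k :=
      Finset.single_le_sum (fun i _ => hC i) (Finset.mem_Icc.mpr (abs_le.mp hkM))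
    refine (hCb k (abs_pos.mp hk) (k * t) ξ ξ₁).trans ?_
    rw [mul_assoc]
    exact mul_le_mul hle (hmin ξ ξ₁ (k * t)) (by positivity) ((hC k).trans hle)
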